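/- **Problems.** Let $p\in\{1,2,\infty\}$ and let $\|\cdot\|$ be the $\ell_p$-norm. For $\mathbf x\in\mathbb Q^n$ let $\{\mathbf x\}\in(-1/2,1/2]^n$ be the coordinatewise fractional part. $\textsc{sap}(\alpha,\mathbf x)$ asks for $q_0\in\mathbb Z$ with $0<\|\{q_0\mathbf x\}\|\le\alpha\|\{q\mathbf x\}\|$ for all $q\in\mathbb Z$ with $\{q\mathbf x\}\ne 0$. $\textsc{gda}(\alpha,\mathbf x,N)$ asks for an integer $1\le q_0\le\alpha N$ with $\|\{q_0\mathbf x\}\|\le\alpha\|\{q\mathbf x\}\|$ for all integers $1\le q\le N$. For polynomials $f_1,f_2\in\mathbb Z[x]$ with maximum degree $d$, let $C(f_1,f_2)$ be the $2d\times 2d$ matrix whose $s$-th and $(d+s)$-th columns ($1\le s\le d$) contain the coefficients of $x^d,\dots,x^0$ of $f_1$ and $f_2$ respectively, in rows $s,\dots,s+d$, and $0$ elsewhere (the determinant of the empty matrix is $1$). For a matrix $W$, let $\check W_i$ be its top left $i\times i$ block. **Algorithm 3.** Input: $n\ge 2$, integers $a\ge b\ge 1$ (with $\alpha=a/b$), and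 $M\in M_n(\mathbb Z)$ with $\det M\neq0$ and $M_{n,1}=\max_{i,j}|M_{i,j}|$. 1. Let $\pi$ be the least prime not dividing $M_{n,1}\det M$. 2. Let $W=x\,\mathrm{adj}\,M+\pi\,\mathrm{Id}$. 3. For $i=2,\dots,n$: add $\pi$ to $W_{i,1}$, then add $\pi^{j}$ to $W_{i,i-1}$, where $j>0$ is minimal such that afterwards $\det C\big((\mathrm{adj}\,\check W_i)_{i,1},(\mathrm{adj}\,\check W_i)_{i,2}\big)\ne0$. 4. Let $c=\det C\big((\mathrm{adj}\,W)_{n,1},(\mathrm{adj}\,W)_{n,2}\big)$. If $|c|$ is a power of $\pi$, replace $c$ by $\pi+1$; otherwise divide $c$ by the largest power of $\pi$ dividing it. 5. Let $M'=W(c^{e})$ with $e=\lceil\log_{|c|}\big(a^2(2M_{n,1}n)^{3n}\big)\rceil$. 6. Find integers $b_1,b_2$ with $b_1(\mathrm{adj}\,M')_{n,1}+b_2(\mathrm{adj}\,M')_{n,2}=1$ and $|b_1|$ minimal, and let $\mathbf x=M'^{-1}(b_1,b_2,0,\dots,0)$. 7. Make one oracle call, $q_0=\textsc{sap}(\alpha,\mathbf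 x)$, or $q_0=\textsc{gda}(\alpha/n^{1/p},\mathbf x,N)$ with $N=n^{1/p}|\det M'|/(2\alpha)$. 8. Return $M'\{q_0\mathbf x\}$. **Theorem 2.** Let $m=\max(a^{1/n^3},M_{n,1})$. For either choice of the oracle, the reduction in Algorithm 3 requires $O(n^4\log (mn))$ arithmetic operations on integers of length $O(n^4\log (mn))$. Precisely: on a random access machine over the integers in which $+,-,\times$, integer quotient and remainder, sign tests, constants, memory accesses and the oracle call each cost one operation, there are a single program and an absolute constant $K$ such that, for all inputs as above and whatever integer $q_0$ the oracle replies, all steps of Algorithm 3 are well defined and the program makes exactly the oracle call of step 7 and halts with the output of step 8 after at most $Kn^4\log(mn)$ operations; every integer that it computes, and every integer occurring as a value of $\pi$, $c$, $c^e$, $b_1$, $b_2$, $\det M'$, as a coefficient of the final $W$, or as an entry of $M'$, has at most $Kn^4\log(mn)$ binary digits; and so does the reply $q_0$ if it is a valid answer to the $\textsc{gda}$ call, or a valid answer to the $\textsc{sap}$ call with $|q_0|\le|\det M'|$. (Rational vectors are given to the oracle by integer numerators and a positive common denominator, and $\alpha/n^{1/p}$ and $N$ by integer fractions to be divided or multiplied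 by $n^{1/p}$.) -/

import Mathlib

open Polynomial
open scoped ENNReal

namespace LatticeReduction

/-! ### The machine model: programs over integer registers and an integer memory -/

/-- The arithmetic operations on integers.  Comparisons are made by testing signs. -/
inductive ArithOp
  | add | sub | mul | div | mod

/-- The value of an arithmetic operation; `div` and `mod` are the quotient and the remainder
(in `[0, |y|)`) of integer division. -/
def ArithOp.eval : ArithOp → ℤ → ℤ → ℤ
  | .add, x, y => x + y
  | .sub, x, y => x - y
  | .mul, x, y => x * y
  | .div, x, y => x / y
  | .mod, x, y => x % y

/-- Programs.  Registers are named by natural numbers, memory cells are addressed by integers.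
A program is a finite object and mentions only finitely many registers. -/
inductive Program
  /-- `const d z`: put the integer constant `z` into register `d`. -/
  | const (d : ℕ) (z : ℤ)
  /-- `arith o d x y`: put the result of `o`, applied to registers `x` and `y`, into `d`. -/
  | arith (o : ArithOp) (d x y : ℕ)
  /-- `load d x`: read the memory cell whose address is in register `x` into register `d`. -/
  | load (d x : ℕ)
  /-- `store x y`: write register `y` to the memory cell whose address is in register `x`. -/
  | store (x y : ℕ)
  /-- `call d x y`: query the oracle with the block of memory cells that starts at the address
  in register `x` and whose length is in register `y`; put the reply into register `d`. -/
  | call (d x y : ℕ)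
  /-- sequential composition -/
  | seq (P Q : Program)
  /-- `ifPos x P Q`: run `P` if register `x` is positive, otherwise run `Q`. -/
  | ifPos (x : ℕ) (P Q : Program)
  /-- `whilePos x P`: run `P` as long as register `x` is positive. -/
  | whilePos (x : ℕ) (P : Program)

/-- The contents of the registers and of the memory. -/
structure State where
  reg : ℕ → ℤ
  mem : ℤ → ℤ

/-- Overwrite one register. -/
def State.setReg (s : State) (d : ℕ) (z : ℤ) : State :=
  { s with reg := Function.update s.reg d z }

/-- Overwrite one memory cell. -/
def State.setMem (s : State) (k z : ℤ) : State :=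
  { s with mem := Function.update s.mem k z }

/-- The block of `len` consecutive memory cells that starts at address `k`. -/
def State.block (s : State) (k len : ℤ) : List ℤ :=
  (List.range len.toNat).map fun i => s.mem (k + i)

/-- The length of an integer: the number of binary digits of its absolute value. -/
def bitLength (z : ℤ) : ℕ := z.natAbs.size

/-- `Exec O L P s T q s'`: with the oracle `O`, the program `P` started in the state `s` halts in
the state `s'` after exactly `T` operations, the list of the queries it made to the oracle is `q`,
and every integer that it computed has length at most `L`.  Every arithmetic operation, constant,
memory access, sign test and oracle call counts as one operation. -/
inductive Exec (O : List ℤ → ℤ) (L : ℕ) :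
    Program → State → ℕ → List (List ℤ) → State → Prop
  | const (d : ℕ) (z : ℤ) (s : State) (h : bitLength z ≤ L) :
      Exec O L (.const d z) s 1 [] (s.setReg d z)
  | arith (o : ArithOp) (d x y : ℕ) (s : State)
      (h : bitLength (o.eval (s.reg x) (s.reg y)) ≤ L) :
      Exec O L (.arith o d x y) s 1 [] (s.setReg d (o.eval (s.reg x) (s.reg y)))
  | load (d x : ℕ) (s : State) :
      Exec O L (.load d x) s 1 [] (s.setReg d (s.mem (s.reg x)))
  | store (x y : ℕ) (s : State) :
      Exec O L (.store x y) s 1 [] (s.setMem (s.reg x) (s.reg y))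
  | call (d x y : ℕ) (s : State) :
      Exec O L (.call d x y) s 1 [s.block (s.reg x) (s.reg y)]
        (s.setReg d (O (s.block (s.reg x) (s.reg y))))
  | seq {P Q : Program} {s s₁ s₂ : State} {T₁ T₂ : ℕ} {q₁ q₂ : List (List ℤ)}
      (h₁ : Exec O L P s T₁ q₁ s₁) (h₂ : Exec O L Q s₁ T₂ q₂ s₂) :
      Exec O L (.seq P Q) s (T₁ + T₂) (q₁ ++ q₂) s₂
  | ifTrue {x : ℕ} {P Q : Program} {s s₁ : State} {T : ℕ} {q : List (List ℤ)}
      (hx : 0 < s.reg x) (h : Exec O L P s T q s₁) :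
      Exec O L (.ifPos x P Q) s (T + 1) q s₁
  | ifFalse {x : ℕ} {P Q : Program} {s s₁ : State} {T : ℕ} {q : List (List ℤ)}
      (hx : ¬ 0 < s.reg x) (h : Exec O L Q s T q s₁) :
      Exec O L (.ifPos x P Q) s (T + 1) q s₁
  | whileDone {x : ℕ} {P : Program} {s : State} (hx : ¬ 0 < s.reg x) :
      Exec O L (.whilePos x P) s 1 [] s
  | whileStep {x : ℕ} {P : Program} {s s₁ s₂ : State} {T₁ T₂ : ℕ} {q₁ q₂ : List (List ℤ)}
      (hx : 0 < s.reg x) (h₁ : Exec O L P s T₁ q₁ s₁)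
      (h₂ : Exec O L (.whilePos x P) s₁ T₂ q₂ s₂) :
      Exec O L (.whilePos x P) s (T₁ + T₂ + 1) (q₁ ++ q₂) s₂

/-- The initial state: all registers are `0`, and the memory holds `n`, `a`, `b` followed by the
entries of `M`, row by row, and `0` elsewhere. -/
def initialState {n : ℕ} (a b : ℕ) (M : Matrix (Fin n) (Fin n) ℤ) : State where
  reg := fun _ => 0
  mem := fun k =>
    if k = 0 then (n : ℤ) else if k = 1 then (a : ℤ) else if k = 2 then (b : ℤ)
    else if h : 3 ≤ k ∧ (k - 3).toNat < n * n then
      M (finProdFinEquiv.symm ⟨(k - 3).toNat, h.2⟩).1 (finProdFinEquiv.symm ⟨(k - 3).toNat, h.2⟩).2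
    else 0

/-! ### Simultaneous approximation problems -/

/-- The coordinatewise fractional part with values in `(-1/2, 1/2]`. -/
def fracPart {n : ℕ} (x : Fin n → ℚ) : Fin n → ℚ := fun i => x i - ⌈x i - 1 / 2⌉

/-- The `ℓ_p`-norm of a rational vector. -/
noncomputable def lpNorm {n : ℕ} (p : ℝ≥0∞) (x : Fin n → ℚ) : ℝ :=
  ‖(WithLp.toLp p (fun i => (x i : ℝ)) : PiLp p fun _ : Fin n => ℝ)‖

/-- `q₀` is a valid output of the simultaneous approximation problem given by `α` and `x`. -/
def IsSapSolution {n : ℕ} (p : ℝ≥0∞) (α : ℝ) (x : Fin n → ℚ) (q₀ : ℤ) : Prop :=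
  0 < lpNorm p (fracPart ((q₀ : ℚ) • x)) ∧
    ∀ q : ℤ, 0 < lpNorm p (fracPart ((q : ℚ) • x)) →
      lpNorm p (fracPart ((q₀ : ℚ) • x)) ≤ α * lpNorm p (fracPart ((q : ℚ) • x))

/-- `q₀` is a valid output of the good Diophantine approximation problem given by `α`, `x`
and `N`. -/
def IsGdaSolution {n : ℕ} (p : ℝ≥0∞) (α : ℝ) (x : Fin n → ℚ) (N : ℝ) (q₀ : ℤ) : Prop :=
  (1 ≤ q₀ ∧ (q₀ : ℝ) ≤ α * N) ∧
    ∀ q : ℤ, 1 ≤ q → (q : ℝ) ≤ N →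
      lpNorm p (fracPart ((q₀ : ℚ) • x)) ≤ α * lpNorm p (fracPart ((q : ℚ) • x))

/-- The list of integers `w` presents the input `(α, x)` to a `SAP` oracle: it consists of the
numerator and denominator of `α`, a common denominator for `x`, and the numerators of `x`. -/
def EncodesSap {n : ℕ} (w : List ℤ) (α : ℝ) (x : Fin n → ℚ) : Prop :=
  ∃ (s t d : ℤ) (y : Fin n → ℤ), w = s :: t :: d :: List.ofFn y ∧ 0 < t ∧ 0 < d ∧
    α = s / t ∧ ∀ i, x i = y i / d

/-- The number `n ^ (1 / p)`, which is `1` for `p = ∞`. -/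
noncomputable def dimFactor (n : ℕ) (p : ℝ≥0∞) : ℝ := (n : ℝ) ^ (p⁻¹).toReal

/-- The list of integers `w` presents the input `(α, x, N)` to a `GDA` oracle for the `ℓ_p`-norm.
The possibly irrational parameters `α = (s / t) / n ^ (1 / p)` and `N = n ^ (1 / p) * (u / v)` are
given by the integers `s, t, u, v`; then follow a common denominator and the numerators of `x`. -/
def EncodesGda {n : ℕ} (p : ℝ≥0∞) (w : List ℤ) (α : ℝ) (x : Fin n → ℚ) (N : ℝ) : Prop :=
  ∃ (s t u v d : ℤ) (y : Fin n → ℤ), w = s :: t :: u :: v :: d :: List.ofFn y ∧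
    0 < t ∧ 0 < v ∧ 0 < d ∧ α = (s / t) / dimFactor n p ∧ N = dimFactor n p * (u / v) ∧
    ∀ i, x i = y i / d

/-- The two problems to which short vector problems are reduced. -/
inductive Target
  | sap | gda

/-! ### The reduction -/

/-- The matrix `C(f₁, f₂)` of coefficients: with `d` the maximum of the two degrees, its first `d`
columns are the shifts of the coefficient vector of `f₁` (leading coefficient on top), and its
last `d` columns are those of `f₂`. -/
noncomputable def coeffMatrix (f₁ f₂ : ℤ[X]) :
    Matrix (Fin (2 * max f₁.natDegree f₂.natDegree))
      (Fin (2 * max f₁.natDegree f₂.natDegree)) ℤ :=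
  let d := max f₁.natDegree f₂.natDegree
  Matrix.of fun r s =>
    if s.val < d then
      if s.val ≤ r.val ∧ r.val ≤ d + s.val then f₁.coeff (d + s.val - r.val) else 0
    else
      if s.val - d ≤ r.val ∧ r.val ≤ s.val then f₂.coeff (s.val - r.val) else 0

/-- With `Wᵢ` the top left square block of `W` that ends in row `i` (rows are numbered from `0`),
the determinant of `C` at the first two entries in the last row of `adj Wᵢ`. -/
noncomputable def testDet {n : ℕ} (W : Matrix (Fin n) (Fin n) ℤ[X]) (i : Fin n) : ℤ :=
  let B : Matrix (Fin (i.val + 1)) (Fin (i.val + 1)) ℤ[X] :=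
    W.submatrix (Fin.castLE i.isLt) (Fin.castLE i.isLt)
  (coeffMatrix (B.adjugate (Fin.last i.val) 0) (B.adjugate (Fin.last i.val) 1)).det

/-- The first row or column. -/
def fst {n : ℕ} (hn : 2 ≤ n) : Fin n := ⟨0, by omega⟩

/-- The second row or column. -/
def snd {n : ℕ} (hn : 2 ≤ n) : Fin n := ⟨1, by omega⟩

/-- The last row or column. -/
def lst {n : ℕ} (hn : 2 ≤ n) : Fin n := ⟨n - 1, by omega⟩

/-- The body of the loop for row `i ≥ 1` (numbered from `0`): add `p` to the first entry of
row `i`, and add `p ^ j` to the entry of row `i` to the left of the diagonal. -/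
noncomputable def loopStep {n : ℕ} (hn : 2 ≤ n) (p j : ℕ) (i : Fin n)
    (W : Matrix (Fin n) (Fin n) ℤ[X]) : Matrix (Fin n) (Fin n) ℤ[X] :=
  W + Matrix.single i (fst hn) (p : ℤ[X]) +
    Matrix.single i ⟨i.val - 1, by omega⟩ ((p : ℤ[X]) ^ j)

/-- The matrix with linear polynomial entries after rows `1, …, k` (numbered from `0`) have been
processed with the exponents `J 1, …, J k`.  It starts as `x adj M + p Id`. -/
noncomputable def loopMatrix {n : ℕ} (hn : 2 ≤ n) (M : Matrix (Fin n) (Fin n) ℤ) (p : ℕ)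
    (J : ℕ → ℕ) : ℕ → Matrix (Fin n) (Fin n) ℤ[X]
  | 0 => (X : ℤ[X]) • M.adjugate.map (Polynomial.C : ℤ →+* ℤ[X]) +
      (p : ℤ[X]) • (1 : Matrix (Fin n) (Fin n) ℤ[X])
  | k + 1 =>
    if h : k + 1 < n then loopStep hn p (J (k + 1)) ⟨k + 1, h⟩ (loopMatrix hn M p J k)
    else loopMatrix hn M p J k

/-- The number `c / p ^ j` with `j` maximal, or `p + 1` if `|c| = p ^ j`. -/
def coprimePart (p : ℕ) (c : ℤ) : ℤ :=
  if c.natAbs = p ^ padicValInt p c then (p : ℤ) + 1 else c / (p : ℤ) ^ padicValInt p c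

/-- The integer `c` at the end of the loop: the determinant for the whole matrix `W`, made coprime
to `p`. -/
noncomputable def cValue {n : ℕ} (hn : 2 ≤ n) (p : ℕ) (W : Matrix (Fin n) (Fin n) ℤ[X]) : ℤ :=
  coprimePart p (testDet W (lst hn))

/-- The exponent `⌈log_{|c|} (a² (2 M_{n,1} n)^{3n})⌉`. -/
noncomputable def substExponent {n : ℕ} (hn : 2 ≤ n) (a : ℕ) (M : Matrix (Fin n) (Fin n) ℤ)
    (c : ℤ) : ℕ :=
  ⌈Real.logb |(c : ℝ)| ((a : ℝ) ^ 2 * (2 * (M (lst hn) (fst hn) : ℝ) * n) ^ (3 * n))⌉₊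

/-- The integer matrix obtained from `W` by substituting a power of `c` for the variable. -/
noncomputable def substMatrix {n : ℕ} (hn : 2 ≤ n) (a : ℕ) (M : Matrix (Fin n) (Fin n) ℤ)
    (c : ℤ) (W : Matrix (Fin n) (Fin n) ℤ[X]) : Matrix (Fin n) (Fin n) ℤ :=
  W.map (Polynomial.eval (c ^ substExponent hn a M c))

/-- An execution of the reduction up to the oracle call, on the input `a`, `b`, `M`
(with `α = a / b`). -/
structure Execution {n : ℕ} (hn : 2 ≤ n) (a b : ℕ) (M : Matrix (Fin n) (Fin n) ℤ) where
  /-- the least prime that does not divide `M_{n,1} det M` -/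
  p : ℕ
  p_spec : IsLeast {q : ℕ | q.Prime ∧ ¬ (q : ℤ) ∣ M (lst hn) (fst hn) * M.det} p
  /-- the minimal positive exponents found in the loop (rows are numbered from `0`) -/
  J : ℕ → ℕ
  J_spec : ∀ k (h : k + 1 < n),
    IsLeast {j : ℕ | 0 < j ∧ testDet (loopStep hn p j ⟨k + 1, h⟩ (loopMatrix hn M p J k))
      ⟨k + 1, h⟩ ≠ 0} (J (k + 1))
  /-- the matrix with linear polynomial entries at the end of the loop -/
  W : Matrix (Fin n) (Fin n) ℤ[X]
  W_spec : W = loopMatrix hn M p J (n - 1)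
  /-- the integer matrix after the substitution for the variable -/
  M' : Matrix (Fin n) (Fin n) ℤ
  M'_spec : M' = substMatrix hn a M (cValue hn p W) W
  M'_det : M'.det ≠ 0
  /-- Bézout coefficients with `|b₁|` minimal -/
  b₁ : ℤ
  b₂ : ℤ
  b_spec : b₁ * M'.adjugate (lst hn) (fst hn) + b₂ * M'.adjugate (lst hn) (snd hn) = 1
  b_min : ∀ b₁' b₂' : ℤ,
    b₁' * M'.adjugate (lst hn) (fst hn) + b₂' * M'.adjugate (lst hn) (snd hn) = 1 → |b₁| ≤ |b₁'|

namespace Execution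

variable {n : ℕ} {hn : 2 ≤ n} {a b : ℕ} {M : Matrix (Fin n) (Fin n) ℤ}

/-- The integer vector `(b₁, b₂, 0, …, 0)`. -/
def bVec (E : Execution hn a b M) : Fin n → ℤ :=
  fun i => if i = fst hn then E.b₁ else if i = snd hn then E.b₂ else 0

/-- The rational vector `x = M'⁻¹ (b₁, b₂, 0, …, 0)`. -/
noncomputable def x (E : Execution hn a b M) : Fin n → ℚ :=
  (E.M'.map (Int.cast : ℤ → ℚ))⁻¹.mulVec fun i => (E.bVec i : ℚ)

/-- The gap `α / n ^ (1 / p)` of the call to `GDA`. -/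
noncomputable def gdaGap (_E : Execution hn a b M) (p : ℝ≥0∞) : ℝ := (a / b : ℝ) / dimFactor n p

/-- The bound `N = n ^ (1 / p) |det M'| / (2 α)` of the call to `GDA`. -/
noncomputable def gdaBound (E : Execution hn a b M) (p : ℝ≥0∞) : ℝ :=
  dimFactor n p * |(E.M'.det : ℝ)| / (2 * (a / b : ℝ))

/-- The list `w` presents the oracle call `SAP(α, x)` or `GDA(α / n ^ (1 / p), x, N)`. -/
def IsQuery (E : Execution hn a b M) (p : ℝ≥0∞) (w : List ℤ) : Target → Prop
  | .sap => EncodesSap w (a / b : ℝ) E.x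
  | .gda => EncodesGda p w (E.gdaGap p) E.x (E.gdaBound p)

/-- The integer `q₀` is a valid reply to the oracle call; for `SAP`, whose valid outputs are
determined modulo `det M'`, it is moreover at most `|det M'|` in magnitude. -/
def IsReply (E : Execution hn a b M) (p : ℝ≥0∞) (q₀ : ℤ) : Target → Prop
  | .sap => IsSapSolution p (a / b : ℝ) E.x q₀ ∧ |q₀| ≤ |E.M'.det|
  | .gda => IsGdaSolution p (E.gdaGap p) E.x (E.gdaBound p) q₀

/-- The vector `M' {q₀ x}` that is returned when the reply of the oracle is `q₀`. -/
noncomputable def output (E : Execution hn a b M) (q₀ : ℤ) : Fin n → ℚ :=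
  (E.M'.map (Int.cast : ℤ → ℚ)).mulVec (fracPart ((q₀ : ℚ) • E.x))

/-- The integers that the reduction's variables hold or are composed of have length at most `L`. -/
def IntegersBounded (E : Execution hn a b M) (L : ℕ) : Prop :=
  bitLength E.p ≤ L ∧ (∀ i j k, bitLength ((E.W i j).coeff k) ≤ L) ∧
    bitLength (testDet E.W (lst hn)) ≤ L ∧ bitLength (cValue hn E.p E.W) ≤ L ∧
    bitLength (cValue hn E.p E.W ^ substExponent hn a M (cValue hn E.p E.W)) ≤ L ∧
    (∀ i j, bitLength (E.M' i j) ≤ L) ∧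
    bitLength E.b₁ ≤ L ∧ bitLength E.b₂ ≤ L ∧ bitLength E.M'.det ≤ L

end Execution

end LatticeReduction

/-!
The program of the reduction is written down explicitly, as a term of `Program`, and its number of
operations and the sizes of its integers are estimated along the way.

The point of the theorem is that `O(n ^ 4 log (m n))` operations suffice although the algorithm
tests `O(n)` exponents in each of `n` rows, and each test needs cofactors and the resultant of
matrices of size about `n` with polynomial entries. Integers of length `O(n ^ 4 log (m n))` make up
for this. A polynomial is kept as its value at a large integer `x`, from which it can be read off in
balanced digits, and a whole row of a matrix is kept as one integer in a still larger base `Z`.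
Fraction-free elimination on packed rows (`elim_step`, based on the identity of Sylvester and
Bareiss) then takes `O(k ^ 2)` operations for the determinant of a `k × k` matrix. A cofactor is the
determinant of the matrix with one row replaced by a unit vector, and, up to the order of rows and
columns, `coeffMatrix f₁ f₂` is a Sylvester matrix, so its determinant is a resultant of `f₁` and
`f₂`. So each test takes `O(n ^ 2)` operations, the adjugate and the loop together `O(n ^ 4)`.

The steps of the algorithm are well defined for the following reasons.
* The least prime `P` that does not divide `M_{n,1} det M` is at most logarithmic in this number, by
  Chebyshev's bound for the product of the primes below `P`. It is found by trial: a proper prime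
  power `q` is recognized by the fact that `q` divides the square of the product of `M_{n,1} det M`
  and the prime powers met before, and there are so few of them that this product remains small.
* In the loop, each new summand in row `i` for which the resultant vanishes belongs to a complex
  root of a fixed nonzero polynomial of degree `O(i)`, and different summands belong to different
  roots (`exists_res_ne_zero`). Hence one of the first `O(n)` powers of `P` is good.
* Modulo `P`, the matrix `M'` is a multiple of `adj M` by a unit. Hence neither `det M'` nor the
  first of the two last cofactors of `M'` is divisible by `P`. A prime that divides both cofactors
  is therefore different from `P`, and it divides the resultant; so it divides `c` and the point of
  evaluation, and then the value of the second cofactor at `0`. But this value is, up to sign, a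
  product of powers of `P` (`LoopData.isCoprime`). Euclid's algorithm gives Bézout coefficients, and
  `|b₁|` is made minimal by reduction modulo the second cofactor.

After the call, the reply is reduced modulo `det M'`, on which alone the output depends, so the
output is computed with small integers whatever the oracle replies. All coefficients and values are
bounded by the `ℓ₁`-norm of polynomials, which is submultiplicative; `Budget` collects the resulting
inequalities between the scales `β`, `x`, `Z` and the bound `B` for all integers, `exists_budget`
provides such scales, and `cost_bounds` turns them into the bounds `K n ^ 4 log (m n)`.
-/

namespace LatticeReduction

/-! ### Structured programs -/

/-- Arithmetic expressions over registers and memory cells. -/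
inductive Expr
  | const (z : ℤ)
  | reg (r : ℕ)
  | op (o : ArithOp) (e f : Expr)
  | load (e : Expr)

namespace Expr

instance : Add Expr := ⟨op .add⟩
instance : Sub Expr := ⟨op .sub⟩
instance : Mul Expr := ⟨op .mul⟩
instance : Div Expr := ⟨op .div⟩
instance : Mod Expr := ⟨op .mod⟩

/-- The value of an expression. -/
def eval (s : State) : Expr → ℤ
  | const z => z
  | reg r => s.reg r
  | op o e f => o.eval (e.eval s) (f.eval s)
  | load e => s.mem (e.eval s)

@[simp] theorem eval_const (s : State) (z : ℤ) : (const z).eval s = z := rfl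
@[simp] theorem eval_reg (s : State) (r : ℕ) : (reg r).eval s = s.reg r := rfl
@[simp] theorem eval_load (s : State) (e : Expr) : (load e).eval s = s.mem (e.eval s) := rfl
@[simp] theorem eval_add (s : State) (e f : Expr) : (e + f).eval s = e.eval s + f.eval s := rfl
@[simp] theorem eval_sub (s : State) (e f : Expr) : (e - f).eval s = e.eval s - f.eval s := rfl
@[simp] theorem eval_mul (s : State) (e f : Expr) : (e * f).eval s = e.eval s * f.eval s := rfl
@[simp] theorem eval_div (s : State) (e f : Expr) : (e / f).eval s = e.eval s / f.eval s := rfl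
@[simp] theorem eval_mod (s : State) (e f : Expr) : (e % f).eval s = e.eval s % f.eval s := rfl

/-- Code that puts the value of an expression into register `d`, with registers `t, t + 1, …` for
intermediate results. -/
def compile : Expr → ℕ → ℕ → Program
  | const z, d, _ => .const d z
  | reg r, d, t => .seq (.const t 0) (.arith .add d r t)
  | op o e f, d, t =>
      .seq (e.compile t (t + 1)) (.seq (f.compile (t + 1) (t + 2)) (.arith o d t (t + 1)))
  | load e, d, t => .seq (e.compile t (t + 1)) (.load d t)

/-- The number of operations for the evaluation of an expression. -/
def cost : Expr → ℕ
  | const _ => 1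
  | reg _ => 2
  | op _ e f => e.cost + (f.cost + 1)
  | load e => e.cost + 1

/-- An exponent `k` such that the value is at most `B ^ k` in magnitude if the constants, the
registers and the memory cells are at most `B`. -/
def deg : Expr → ℕ
  | const _ => 1
  | reg _ => 1
  | op .add e f => max e.deg f.deg + 1
  | op .sub e f => max e.deg f.deg + 1
  | op .mul e f => e.deg + f.deg
  | op .div e _ => e.deg
  | op .mod e f => max e.deg f.deg
  | load _ => 1

/-- The maximum of `Expr.deg` over the subexpressions. -/
def peak : Expr → ℕ
  | const _ => 1
  | reg _ => 1
  | op o e f => max ((op o e f).deg) (max e.peak f.peak)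
  | load e => max 1 e.peak

/-- The expression mentions only registers below `100` and constants of at most `10 ^ 6`. -/
def small : Expr → Bool
  | const z => decide (z.natAbs ≤ 10 ^ 6)
  | reg r => decide (r < 100)
  | op _ e f => e.small && f.small
  | load e => e.small

/-- The syntactic conditions under which an expression is evaluated at bounded cost. -/
def Ok (e : Expr) : Prop := e.small = true ∧ e.cost ≤ 60 ∧ e.peak ≤ 8

instance (e : Expr) : Decidable e.Ok := by unfold Ok; infer_instance

end Expr

/-- The states agree on the memory and on the registers that are not used for intermediate
results. -/
def Agree (s σ : State) : Prop := s.mem = σ.mem ∧ ∀ r < 100, s.reg r = σ.reg r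

/-- All memory cells and registers, up to those for intermediate results, are at most `B`. -/
def Bounded (B : ℕ) (σ : State) : Prop :=
  (∀ r < 100, |σ.reg r| ≤ B) ∧ ∀ k, |σ.mem k| ≤ B

@[simp] theorem reg_setReg (s : State) (d r : ℕ) (z : ℤ) :
    (s.setReg d z).reg r = if r = d then z else s.reg r := by
  simp [State.setReg, Function.update_apply]

@[simp] theorem mem_setReg (s : State) (d : ℕ) (z : ℤ) : (s.setReg d z).mem = s.mem := rfl

@[simp] theorem mem_setMem (s : State) (k l z : ℤ) :
    (s.setMem k z).mem l = if l = k then z else s.mem l := by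
  simp [State.setMem, Function.update_apply]

@[simp] theorem reg_setMem (s : State) (k z : ℤ) : (s.setMem k z).reg = s.reg := rfl

theorem bitLength_le_of_abs_le {z : ℤ} {N : ℕ} (h : |z| ≤ N) : bitLength z ≤ N.size :=
  Nat.size_le_size (by rw [Int.abs_eq_natAbs] at h; exact_mod_cast h)

theorem ArithOp.abs_eval_le {B : ℤ} (hB : 2 ≤ B) {x y : ℤ} {i j : ℕ} (hx : |x| ≤ B ^ i)
    (hy : |y| ≤ B ^ j) : ∀ o : ArithOp, |o.eval x y| ≤ B ^ (match o with
      | .add => max i j + 1 | .sub => max i j + 1 | .mul => i + j | .div => i | .mod => max i j) := by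
  have h1 : (1 : ℤ) ≤ B := by linarith
  have hi : B ^ i ≤ B ^ max i j := pow_le_pow_right₀ h1 (le_max_left _ _)
  have hj : B ^ j ≤ B ^ max i j := pow_le_pow_right₀ h1 (le_max_right _ _)
  have hp : 0 < B ^ max i j := by positivity
  rintro (_ | _ | _ | _ | _) <;> simp only [eval]
  · rw [pow_succ]; have := abs_add_le x y; nlinarith
  · rw [pow_succ]; have := abs_sub x y; nlinarith
  · rw [abs_mul, pow_add]; gcongr
  · refine le_trans ?_ hx
    have := Int.natAbs_ediv_le_natAbs x y
    rw [Int.abs_eq_natAbs, Int.abs_eq_natAbs]; exact_mod_cast this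
  · rcases eq_or_ne y 0 with rfl | h0
    · simpa using hx.trans hi
    · rw [abs_of_nonneg (Int.emod_nonneg x h0)]
      exact (Int.emod_lt_abs x h0).le.trans (hy.trans hj)

theorem Expr.abs_eval_le {B : ℕ} (hB : 10 ^ 6 ≤ B) {s : State} (hs : Bounded B s) :
    ∀ e : Expr, e.small = true → |e.eval s| ≤ (B : ℤ) ^ e.deg := by
  have hB2 : (2 : ℤ) ≤ B := by exact_mod_cast le_trans (by norm_num) hB
  intro e
  induction e with
  | const z =>
    intro h
    simp only [small, decide_eq_true_eq] at h
    simp only [eval, deg, pow_one, Int.abs_eq_natAbs]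
    exact_mod_cast h.trans hB
  | reg r => intro h; simpa [eval, deg] using hs.1 r (by simpa [small] using h)
  | load e _ => intro h; simpa [eval, deg] using hs.2 _
  | op o e f he hf =>
    intro h
    simp only [small, Bool.and_eq_true] at h
    have := ArithOp.abs_eval_le hB2 (he h.1) (hf h.2) o
    cases o <;> simpa [eval, deg] using this

theorem Expr.deg_le_peak (e : Expr) : e.deg ≤ e.peak := by
  cases e <;> simp [deg, peak]

section

variable {O : List ℤ → ℤ} {B : ℕ}

theorem Expr.exec_compile (hB : 10 ^ 6 ≤ B) {σ : State} (hσ : Bounded B σ) :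
    ∀ (e : Expr) (d t : ℕ) (s : State), 100 ≤ t → e.small = true → e.peak ≤ 8 → Agree s σ →
      ∃ s', Exec O (B ^ 8).size (e.compile d t) s e.cost [] s' ∧ s'.mem = s.mem ∧
        s'.reg d = e.eval σ ∧ ∀ r, r < t → r ≠ d → s'.reg r = s.reg r := by
  have hbound : ∀ e : Expr, e.small = true → e.peak ≤ 8 → bitLength (e.eval σ) ≤ (B ^ 8).size := by
    intro e h1 h2
    apply bitLength_le_of_abs_le
    refine (e.abs_eval_le hB hσ h1).trans ?_
    push_cast
    exact pow_le_pow_right₀ (by exact_mod_cast le_trans (by norm_num) hB) (e.deg_le_peak.trans h2)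
  intro e
  induction e with
  | const z =>
    intro d t s _ h1 h2 _
    exact ⟨_, .const d z s (hbound _ h1 h2), rfl, by simp [eval],
      fun r _ hr => by simp [hr]⟩
  | reg r =>
    intro d t s ht h1 h2 hs
    have hr : r < 100 := by simpa [small] using h1
    have key : (s.setReg t 0).reg r + (s.setReg t 0).reg t = (reg r).eval σ := by
      simp [eval, show r ≠ t by omega, hs.2 r hr]
    refine ⟨_, .seq (.const t 0 s (by simp [bitLength])) (.arith .add d r t _ ?_), ?_, ?_, ?_⟩
    · rw [ArithOp.eval, key]; exact hbound _ h1 h2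
    · simp
    · rw [reg_setReg, if_pos rfl, ArithOp.eval, key]
    · intro r' h h'; simp [h', h.ne]
  | load e ih =>
    intro d t s ht h1 h2 hs
    simp only [small] at h1
    have hp : e.peak ≤ 8 := by simp [peak] at h2; omega
    obtain ⟨s', hx, hm, hv, hr⟩ := ih t (t + 1) s (by omega) h1 hp hs
    refine ⟨_, .seq hx (.load d t s'), ?_, ?_, ?_⟩
    · simp [hm]
    · simp [hv, hm, hs.1]
    · intro r h h'; simp [h', hr r (by omega) h.ne]
  | op o e f ihe ihf =>
    intro d t s ht h1 h2 hs
    have h1' := h1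
    simp only [small, Bool.and_eq_true] at h1
    have hp : e.peak ≤ 8 ∧ f.peak ≤ 8 := by simp [peak] at h2; omega
    obtain ⟨s₁, hx₁, hm₁, hv₁, hr₁⟩ := ihe t (t + 1) s (by omega) h1.1 hp.1 hs
    have hs₁ : Agree s₁ σ :=
      ⟨hm₁.trans hs.1, fun r hr => (hr₁ r (by omega) (by omega)).trans (hs.2 r hr)⟩
    obtain ⟨s₂, hx₂, hm₂, hv₂, hr₂⟩ := ihf (t + 1) (t + 2) s₁ (by omega) h1.2 hp.2 hs₁
    have key : o.eval (s₂.reg t) (s₂.reg (t + 1)) = (op o e f).eval σ := by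
      rw [hv₂, hr₂ t (by omega) (by omega), hv₁]; rfl
    refine ⟨_, .seq hx₁ (.seq hx₂ (.arith o d t (t + 1) s₂ ?_)), ?_, ?_, ?_⟩
    · rw [key]; exact hbound _ h1' h2
    · simp [hm₂, hm₁]
    · rw [reg_setReg, if_pos rfl, key]
    · intro r h h'
      simp [h', hr₂ r (by omega) (by omega), hr₁ r (by omega) h.ne]

/-- From a bounded state, the program halts after at most `T` operations without a call to the
oracle, in a bounded state that satisfies `Q`. -/
def Run (O : List ℤ → ℤ) (B : ℕ) (P : Program) (σ : State) (T : ℕ) (Q : State → Prop) : Prop :=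
  Bounded B σ → ∀ s, Agree s σ → ∃ T' ≤ T, ∃ s' σ', Exec O (B ^ 8).size P s T' [] s' ∧
    Agree s' σ' ∧ Bounded B σ' ∧ Q σ'

theorem Run.mono {P : Program} {σ : State} {T T' : ℕ} {Q Q' : State → Prop}
    (h : Run O B P σ T Q) (hT : T ≤ T') (hQ : ∀ σ', Q σ' → Q' σ') : Run O B P σ T' Q' := by
  intro hσ s hs
  obtain ⟨T₁, hT₁, s', σ', hx, ha, hb, hq⟩ := h hσ s hs
  exact ⟨T₁, hT₁.trans hT, s', σ', hx, ha, hb, hQ _ hq⟩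

theorem Run.of_bounded {P : Program} {σ : State} {T : ℕ} {Q : State → Prop}
    (h : Bounded B σ → Run O B P σ T Q) : Run O B P σ T Q := fun hσ => h hσ hσ

theorem Run.seq {P P' : Program} {σ : State} {T T' : ℕ} {Q : State → Prop}
    (h : Run O B P σ T fun σ' => Run O B P' σ' T' Q) : Run O B (.seq P P') σ (T + T') Q := by
  intro hσ s hs
  obtain ⟨T₁, hT₁, s₁, σ₁, hx₁, ha₁, hb₁, hq₁⟩ := h hσ s hs
  obtain ⟨T₂, hT₂, s₂, σ₂, hx₂, ha₂, hb₂, hq₂⟩ := hq₁ hb₁ s₁ ha₁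
  exact ⟨T₁ + T₂, by omega, s₂, σ₂, .seq hx₁ hx₂, ha₂, hb₂, hq₂⟩

/-- Assignment of a value to a register. -/
def set (v : ℕ) (e : Expr) : Program := e.compile v 100

/-- Assignment of a value to a memory cell. -/
def put (e f : Expr) : Program :=
  .seq (e.compile 100 101) (.seq (f.compile 101 102) (.store 100 101))

/-- Case distinction by the sign of an expression. -/
def ifE (e : Expr) (P P' : Program) : Program :=
  .seq (e.compile 100 101) (.ifPos 100 P P')

/-- Repetition as long as an expression is positive. -/
def whileE (e : Expr) (P : Program) : Program :=
  .seq (e.compile 100 101) (.whilePos 100 (.seq P (e.compile 100 101)))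

/-- Repetition with register `v` running from `lo` up to `hi - 1`. -/
def forE (v : ℕ) (lo hi : Expr) (P : Program) : Program :=
  .seq (set v lo) (whileE (hi - .reg v) (.seq P (set v (.reg v + .const 1))))

/-- The program that does nothing of interest. -/
def skip : Program := .const 100 0

theorem Run.skip {σ : State} {Q : State → Prop} (hQ : Q σ) :
    Run O B skip σ 1 Q := by
  intro hσ s hs
  exact ⟨1, le_rfl, _, σ, .const _ _ _ (by simp [bitLength]),
    ⟨hs.1, fun r hr => by simp [hr.ne, hs.2 r hr]⟩, hσ, hQ⟩

theorem Run.set (hB : 10 ^ 6 ≤ B) {v : ℕ} {e : Expr} {σ : State} {Q : State → Prop}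
    (he : v < 100 ∧ e.Ok) (hv : |e.eval σ| ≤ B) (hQ : Q (σ.setReg v (e.eval σ))) :
    Run O B (set v e) σ 60 Q := by
  intro hσ s hs
  obtain ⟨s', hx, hm, hv', hr⟩ := e.exec_compile (O := O) hB hσ v 100 s le_rfl he.2.1 he.2.2.2 hs
  refine ⟨_, he.2.2.1, s', σ.setReg v (e.eval σ), hx, ⟨by simp [hm, hs.1], fun r h => ?_⟩, ⟨fun r h => ?_, hσ.2⟩, hQ⟩
  · by_cases h' : r = v
    · subst h'; simp [hv']
    · simp [h', hr r h h', hs.2 r h]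
  · by_cases h' : r = v
    · simpa [h'] using hv
    · simpa [h'] using hσ.1 r h

theorem Run.put (hB : 10 ^ 6 ≤ B) {e f : Expr} {σ : State} {Q : State → Prop}
    (he : e.Ok ∧ f.Ok) (hv : |f.eval σ| ≤ B) (hQ : Q (σ.setMem (e.eval σ) (f.eval σ))) :
    Run O B (put e f) σ 121 Q := by
  intro hσ s hs
  obtain ⟨s₁, hx, hm, hv', hr⟩ := e.exec_compile (O := O) hB hσ 100 101 s (by omega) he.1.1 he.1.2.2 hs
  have hs₁ : Agree s₁ σ :=
    ⟨hm.trans hs.1, fun r h => (hr r (by omega) (by omega)).trans (hs.2 r h)⟩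
  obtain ⟨s₂, hx₂, hm₂, hv₂, hr₂⟩ :=
    f.exec_compile (O := O) hB hσ 101 102 s₁ (by omega) he.2.1 he.2.2.2 hs₁
  refine ⟨_, ?_, _, σ.setMem (e.eval σ) (f.eval σ), .seq hx (.seq hx₂ (.store 100 101 s₂)), ⟨?_, fun r h => ?_⟩,
    ⟨hσ.1, fun k => ?_⟩, hQ⟩
  · have := he.1.2.1; have := he.2.2.1; omega
  · funext k
    simp [hv₂, hr₂ 100 (by omega) (by omega), hv', hm₂, hm, hs.1]
  · simp [hr₂ r (by omega) (by omega), hs₁.2 r h]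
  · by_cases h : k = e.eval σ
    · simpa [h] using hv
    · simpa [h] using hσ.2 k

theorem Run.ifE (hB : 10 ^ 6 ≤ B) {e : Expr} {P P' : Program} {σ : State} {T : ℕ}
    {Q : State → Prop} (he : e.Ok) (h : 0 < e.eval σ → Run O B P σ T Q)
    (h' : e.eval σ ≤ 0 → Run O B P' σ T Q) : Run O B (ifE e P P') σ (T + 61) Q := by
  intro hσ s hs
  obtain ⟨s₁, hx, hm, hv, hr⟩ := e.exec_compile (O := O) hB hσ 100 101 s (by omega) he.1 he.2.2 hs
  have hs₁ : Agree s₁ σ :=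
    ⟨hm.trans hs.1, fun r h => (hr r (by omega) (by omega)).trans (hs.2 r h)⟩
  have hc := he.2.1
  by_cases h0 : 0 < e.eval σ
  · obtain ⟨T', hT', s', σ', hx', ha, hb, hq⟩ := h h0 hσ s₁ hs₁
    exact ⟨e.cost + (T' + 1), by omega, s', σ', .seq hx (.ifTrue (by rwa [hv]) hx'), ha, hb, hq⟩
  · obtain ⟨T', hT', s', σ', hx', ha, hb, hq⟩ := h' (not_lt.1 h0) hσ s₁ hs₁
    exact ⟨e.cost + (T' + 1), by omega, s', σ', .seq hx (.ifFalse (by rwa [hv]) hx'), ha, hb, hq⟩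

/-- The rule for loops: `I k` holds after `k` rounds, and there are at most `N` rounds. -/
theorem Run.whileE (hB : 10 ^ 6 ≤ B) {e : Expr} {P : Program} {σ : State} {Q : State → Prop}
    (he : e.Ok) (N T : ℕ) (I : ℕ → State → Prop) (h0 : I 0 σ)
    (hstep : ∀ k σ', I k σ' → 0 < e.eval σ' → k < N ∧ Run O B P σ' T (I (k + 1)))
    (hQ : ∀ k σ', I k σ' → e.eval σ' ≤ 0 → Q σ') :
    Run O B (whileE e P) σ (N * (T + 61) + 61) Q := by
  have hc := he.2.1
  have main : ∀ (j k : ℕ) (s σ' : State), j + k = N → I k σ' → Bounded B σ' → Agree s σ' →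
      s.reg 100 = e.eval σ' → ∃ T' ≤ j * (T + 61) + 1, ∃ s' σ'',
        Exec O (B ^ 8).size (.whilePos 100 (.seq P (e.compile 100 101))) s T' [] s' ∧
        Agree s' σ'' ∧ Bounded B σ'' ∧ Q σ'' := by
    intro j
    induction j with
    | zero =>
      intro k s σ' hk hI hb ha hr
      have hle : e.eval σ' ≤ 0 := by
        by_contra hpos
        have := (hstep k σ' hI (not_le.1 hpos)).1
        omega
      exact ⟨1, by omega, s, σ', .whileDone (by rw [hr]; omega), ha, hb, hQ k σ' hI hle⟩
    | succ j ih =>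
      intro k s σ' hk hI hb ha hr
      by_cases hpos : 0 < e.eval σ'
      · obtain ⟨T₁, hT₁, s₁, σ₁, hx₁, ha₁, hb₁, hI₁⟩ := (hstep k σ' hI hpos).2 hb s ha
        obtain ⟨s₂, hx₂, hm₂, hv₂, hr₂⟩ :=
          e.exec_compile (O := O) hB hb₁ 100 101 s₁ (by omega) he.1 he.2.2 ha₁
        have ha₂ : Agree s₂ σ₁ :=
          ⟨hm₂.trans ha₁.1, fun r h => (hr₂ r (by omega) (by omega)).trans (ha₁.2 r h)⟩
        obtain ⟨T₂, hT₂, s', σ'', hx', ha', hb', hq'⟩ := ih (k + 1) s₂ σ₁ (by omega) hI₁ hb₁ ha₂ hv₂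
        refine ⟨T₁ + e.cost + T₂ + 1, ?_, s', σ'',
          .whileStep (by rw [hr]; exact hpos) (.seq hx₁ hx₂) hx', ha', hb', hq'⟩
        rw [Nat.succ_mul]; omega
      · exact ⟨1, by omega, s, σ', .whileDone (by rw [hr]; exact hpos), ha, hb,
          hQ k σ' hI (not_lt.1 hpos)⟩
  intro hσ s hs
  obtain ⟨s₁, hx, hm, hv, hr⟩ := e.exec_compile (O := O) hB hσ 100 101 s (by omega) he.1 he.2.2 hs
  have hs₁ : Agree s₁ σ :=
    ⟨hm.trans hs.1, fun r h => (hr r (by omega) (by omega)).trans (hs.2 r h)⟩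
  obtain ⟨T', hT', s', σ', hx', ha, hb, hq⟩ := main N 0 s₁ σ (by omega) h0 hσ hs₁ hv
  exact ⟨e.cost + T', by omega, s', σ', .seq hx hx', ha, hb, hq⟩

/-- The rule for counting loops with `N` rounds: before round `k` the counter is `l + k`. -/
theorem Run.forE (hB : 10 ^ 6 ≤ B) {v : ℕ} {lo hi : Expr} {P : Program} {σ : State}
    {Q : State → Prop} (he : v < 100 ∧ lo.Ok ∧ (hi - .reg v).Ok) (l : ℤ) (N T : ℕ)
    (I : ℕ → State → Prop) (hl : lo.eval σ = l) (hlB : |l| ≤ B) (hNB : |l + N| ≤ B)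
    (h0 : I 0 (σ.setReg v l)) (hv : ∀ k σ', I k σ' → σ'.reg v = l + k ∧ hi.eval σ' = l + N)
    (hstep : ∀ k σ', k < N → I k σ' → Run O B P σ' T
      fun σ'' => σ''.reg v = l + k ∧ I (k + 1) (σ''.setReg v (l + k + 1)))
    (hQ : ∀ σ', I N σ' → Q σ') :
    Run O B (forE v lo hi P) σ (N * (T + 121) + 121) Q := by
  have h1 : (Expr.reg v + .const 1).Ok := by
    have := he.1
    simp only [Expr.Ok, Expr.small, Expr.cost, Expr.peak, Expr.deg, HAdd.hAdd, Add.add,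
      Bool.and_eq_true, decide_eq_true_eq]
    refine ⟨⟨this, by norm_num⟩, by decide, by decide⟩
  have : Run O B (LatticeReduction.forE v lo hi P) σ (60 + (N * ((T + 60) + 61) + 61)) Q := by
    refine .seq (.set hB ⟨he.1, he.2.1⟩ (by rw [hl]; exact hlB) ?_)
    rw [hl]
    refine .whileE hB he.2.2 N (T + 60) (fun k σ' => k ≤ N ∧ I k σ') ⟨by omega, h0⟩ ?_ ?_
    · rintro k σ' ⟨_, hI⟩ hpos
      obtain ⟨hr, hh⟩ := hv k σ' hI
      have hk : k < N := by
        rw [Expr.eval_sub, Expr.eval_reg, hr, hh] at hpos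
        omega
      refine ⟨hk, .seq ((hstep k σ' hk hI).mono le_rfl ?_)⟩
      rintro σ'' ⟨hr'', hI''⟩
      refine .set hB ⟨he.1, h1⟩ ?_ ⟨by omega, ?_⟩
      · rw [Expr.eval_add, Expr.eval_reg, Expr.eval_const, hr'']
        rw [abs_le] at hlB hNB ⊢
        constructor <;> omega
      · rw [Expr.eval_add, Expr.eval_reg, Expr.eval_const, hr'']; exact hI''
    · rintro k σ' ⟨hk, hI⟩ hle
      obtain ⟨hr, hh⟩ := hv k σ' hI
      have : k = N := by
        rw [Expr.eval_sub, Expr.eval_reg, hr, hh] at hle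
        omega
      subst this
      exact hQ _ hI
  refine this.mono ?_ fun _ h => h
  have e1 : T + 60 + 61 = T + 121 := by ring
  rw [e1]; omega

end

/-! ### Fraction-free elimination -/

/-- The indices `0, …, c - 1`, followed by `f 0, f 1, …`. -/
def extIdx (c : ℕ) (f : ℕ → ℕ) (x : ℕ) : ℕ := if x < c then x else f (x - c)

/-- The submatrix of `A` with the first `c` rows and columns, bordered by `r` further rows, given
by `f`, and columns, given by `g`. -/
def bordered (A : ℕ → ℕ → ℤ) (c r : ℕ) (f g : ℕ → ℕ) : Matrix (Fin (c + r)) (Fin (c + r)) ℤ :=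
  Matrix.of fun x y => A (extIdx c f x) (extIdx c g y)

/-- The leading principal minor of size `c`. -/
def lead (A : ℕ → ℕ → ℤ) (c : ℕ) : ℤ := (Matrix.of fun x y : Fin c => A x y).det

/-- The minor of the first `c` rows and row `i` and of the first `c` columns and column `j`. -/
def minor (A : ℕ → ℕ → ℤ) (c i j : ℕ) : ℤ := (bordered A c 1 (fun _ => i) fun _ => j).det

/-- A Schur complement determinant: bordering a nonsingular leading block multiplies its
determinant by the determinant of a matrix `s` that does not depend on the bordering. -/
theorem exists_schur (A : ℕ → ℕ → ℤ) (c : ℕ) (h : lead A c ≠ 0) :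
    ∃ s : ℕ → ℕ → ℚ, ∀ (r : ℕ) (f g : ℕ → ℕ), ((bordered A c r f g).det : ℚ) =
      lead A c * (Matrix.of fun x y : Fin r => s (f x) (g y)).det := by
  set L : Matrix (Fin c) (Fin c) ℚ := Matrix.of fun x y => (A x y : ℚ) with hL
  have hdet : L.det = (lead A c : ℚ) := by
    rw [lead, Int.cast_det]; rfl
  have : Invertible L := Matrix.invertibleOfIsUnitDet L (by
    rw [hdet]; exact isUnit_iff_ne_zero.2 (by exact_mod_cast h))
  refine ⟨fun i j => A i j - ∑ x : Fin c, (∑ y : Fin c, (A i y : ℚ) * (⅟L) y x) * A x j, fun r f g => ?_⟩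
  rw [← hdet, Int.cast_det,
    ← Matrix.det_submatrix_equiv_self finSumFinEquiv ((bordered A c r f g).map _)]
  rw [← show Matrix.fromBlocks L (Matrix.of fun (x : Fin c) (y : Fin r) => (A x (g y) : ℚ))
    (Matrix.of fun (x : Fin r) (y : Fin c) => (A (f x) y : ℚ))
    (Matrix.of fun x y : Fin r => (A (f x) (g y) : ℚ)) =
      ((bordered A c r f g).map (Int.cast : ℤ → ℚ)).submatrix finSumFinEquiv finSumFinEquiv from ?_,
    Matrix.det_fromBlocks₁₁]
  · rfl
  · ext (x | x) (y | y) <;> simp [bordered, extIdx, hL]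

theorem minor_zero (A : ℕ → ℕ → ℤ) (i j : ℕ) : minor A 0 i j = A i j := by
  simp [minor, bordered, extIdx]

theorem minor_self (A : ℕ → ℕ → ℤ) (c : ℕ) : minor A c c c = lead A (c + 1) := by
  unfold minor lead bordered
  congr 1
  ext x y
  have h : ∀ x : Fin (c + 1), extIdx c (fun _ => c) x = x := fun x => by
    unfold extIdx; grind
  simp only [Matrix.of_apply, h]

/-- The identity of Sylvester and Bareiss. -/
theorem lead_mul_minor_succ (A : ℕ → ℕ → ℤ) (c i j : ℕ) (h : lead A c ≠ 0) :
    lead A c * minor A (c + 1) i j =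
      minor A c c c * minor A c i j - minor A c i c * minor A c c j := by
  obtain ⟨s, hs⟩ := exists_schur A c h
  have h1 : ∀ i j, (minor A c i j : ℚ) = lead A c * s i j := fun i j => by
    rw [minor, hs]; simp
  have h2 : (minor A (c + 1) i j : ℚ) = lead A c * (s c c * s i j - s c j * s i c) := by
    have : minor A (c + 1) i j =
        (bordered A c 2 (fun t => if t = 0 then c else i) fun t => if t = 0 then c else j).det := by
      have h : ∀ (k : ℕ) (x : Fin (c + 2)),
          extIdx (c + 1) (fun _ => k) x = extIdx c (fun t => if t = 0 then c else k) x := by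
        intro k x; unfold extIdx; grind
      unfold minor bordered
      congr 1
      ext x y
      simp only [Matrix.of_apply, h]
    rw [this, hs, Matrix.det_fin_two]; simp
  have : (lead A c * minor A (c + 1) i j : ℚ) =
      minor A c c c * minor A c i j - minor A c i c * minor A c c j := by
    simp only [h1, h2]; ring
  exact_mod_cast this

theorem lead_eq_zero (A : ℕ → ℕ → ℤ) {c k : ℕ} (h : lead A c ≠ 0) (hc : c < k)
    (h0 : ∀ i, c ≤ i → i < k → minor A c i c = 0) : lead A k = 0 := by
  obtain ⟨s, hs⟩ := exists_schur A c h
  have hlead : (lead A c : ℚ) ≠ 0 := by exact_mod_cast h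
  have h1 : ∀ i, c ≤ i → i < k → s i c = 0 := fun i hi hi' => by
    have := hs 1 (fun _ => i) fun _ => c
    rw [← minor, h0 i hi hi'] at this
    simpa [hlead] using this.symm
  obtain ⟨r, rfl⟩ := Nat.exists_eq_add_of_lt hc
  have h2 : lead A (c + (r + 1)) = (bordered A c (r + 1) (c + ·) (c + ·)).det := by
    unfold lead bordered
    congr 1
    ext x y
    have h : ∀ x : ℕ, extIdx c (c + ·) x = x := fun x => by
      unfold extIdx; grind
    simp only [Matrix.of_apply, h]
  have h3 : (lead A (c + (r + 1)) : ℚ) = 0 := by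
    rw [h2, hs, Matrix.det_eq_zero_of_column_eq_zero 0, mul_zero]
    intro i
    simpa using h1 (c + i) (by omega) (by omega)
  exact_mod_cast h3

/-- Rows `c` and `i` are exchanged, and one of them is negated. -/
def swapNeg (A : ℕ → ℕ → ℤ) (c i : ℕ) : ℕ → ℕ → ℤ :=
  fun x y => if x = c then A i y else if x = i then -A c y else A x y

theorem lead_swapNeg (A : ℕ → ℕ → ℤ) {c i k : ℕ} (hc : c < i) (hi : i < k) :
    lead (swapNeg A c i) k = lead A k := by
  let M : Matrix (Fin k) (Fin k) ℤ := Matrix.of fun x y => A x y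
  let v : Fin k → ℤ := fun x => if x = ⟨i, hi⟩ then -1 else 1
  let e : Equiv.Perm (Fin k) := Equiv.swap ⟨c, hc.trans hi⟩ ⟨i, hi⟩
  have h : (Matrix.of fun x y : Fin k => swapNeg A c i x y) =
      Matrix.of fun x y => v x * (M.submatrix e id) x y := by
    ext x y
    simp only [Matrix.of_apply, swapNeg, v, M, e, Matrix.submatrix_apply, id]
    by_cases h1 : x = ⟨c, hc.trans hi⟩
    · subst h1; simp [hc.ne]
    · by_cases h2 : x = ⟨i, hi⟩
      · subst h2; simp [hc.ne']
      · have h1' : x.val ≠ c := fun h => h1 (Fin.ext h)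
        have h2' : x.val ≠ i := fun h => h2 (Fin.ext h)
        rw [Equiv.swap_apply_of_ne_of_ne h1 h2]
        simp [h1', h2', h2]
  rw [lead, h, Matrix.det_mul_column, Matrix.det_permute, Equiv.Perm.sign_swap]
  · simp [v, lead, M]
  · simp [Fin.ext_iff, hc.ne]

theorem minor_eq_mul {A A' : ℕ → ℕ → ℤ} {c i i' : ℕ} (u : ℤ) (h : ∀ x < c, A' x = A x)
    (hi : ∀ y, A' i' y = u * A i y) (j : ℕ) : minor A' c i' j = u * minor A c i j := by
  unfold minor
  rw [Matrix.det_succ_row _ (Fin.last c), Matrix.det_succ_row _ (Fin.last c), Finset.mul_sum]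
  refine Finset.sum_congr rfl fun y _ => ?_
  have h1 : (bordered A' c 1 (fun _ => i') fun _ => j).submatrix (Fin.last c).succAbove y.succAbove
      = (bordered A c 1 (fun _ => i) fun _ => j).submatrix (Fin.last c).succAbove y.succAbove := by
    ext x y
    simp [bordered, extIdx, h x x.2]
  have h2 : bordered A' c 1 (fun _ => i') (fun _ => j) (Fin.last c) y =
      u * bordered A c 1 (fun _ => i) (fun _ => j) (Fin.last c) y := by
    simp [bordered, extIdx, hi]
  rw [h1, h2]; ring

theorem minor_swapNeg (A : ℕ → ℕ → ℤ) {c i : ℕ} (hc : c < i) (x j : ℕ) :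
    minor (swapNeg A c i) c x j =
      if x = c then minor A c i j else if x = i then -minor A c c j else minor A c x j := by
  have h : ∀ x < c, swapNeg A c i x = A x := fun x hx => by
    funext y; simp [swapNeg, hx.ne, (hx.trans hc).ne]
  split_ifs with h1 h2
  · rw [← one_mul (minor A c i j)]
    exact minor_eq_mul 1 h (by simp [swapNeg, h1]) j
  · rw [neg_eq_neg_one_mul]
    exact minor_eq_mul _ h (by simp [swapNeg, h2, hc.ne']) j
  · rw [← one_mul (minor A c x j)]
    exact minor_eq_mul 1 h (by simp [swapNeg, h1, h2]) j

theorem lead_swapNeg_of_le (A : ℕ → ℕ → ℤ) {c i : ℕ} (hc : c < i) :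
    lead (swapNeg A c i) c = lead A c := by
  unfold lead
  congr 1
  ext x y
  simp [swapNeg, x.2.ne, (x.2.trans hc).ne]

theorem abs_det_le {r k : ℕ} (hr : r ≤ k) {b : ℤ} (hb : 1 ≤ b) (M : Matrix (Fin r) (Fin r) ℤ)
    (hM : ∀ i j, |M i j| ≤ b) : |M.det| ≤ (k * b) ^ k := by
  have h := Matrix.det_le (A := M) (abv := AbsoluteValue.abs) (x := b) hM
  rw [Fintype.card_fin, nsmul_eq_mul] at h
  refine le_trans h ?_
  rcases Nat.eq_zero_or_pos k with rfl | hk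
  · obtain rfl : r = 0 := by omega
    simp
  have h1 : (r.factorial : ℤ) ≤ (k : ℤ) ^ r := by
    exact_mod_cast (Nat.factorial_le_pow r).trans (Nat.pow_le_pow_left hr r)
  have hk' : (1 : ℤ) ≤ k * b := by nlinarith [show (1 : ℤ) ≤ k by exact_mod_cast hk]
  calc (r.factorial : ℤ) * b ^ r ≤ (k : ℤ) ^ r * b ^ r := by gcongr
    _ = (k * b) ^ r := by rw [mul_pow]
    _ ≤ (k * b) ^ k := pow_le_pow_right₀ hk' hr

/-! ### Packed rows -/

/-- The integer with the balanced digits `f 0, …, f (N - 1)` in base `Z`. -/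
def pack (Z : ℤ) (N : ℕ) (f : ℕ → ℤ) : ℤ := ∑ j ∈ Finset.range N, f j * Z ^ j

theorem pack_succ (Z : ℤ) (N : ℕ) (f : ℕ → ℤ) :
    pack Z (N + 1) f = f 0 + Z * pack Z N fun j => f (j + 1) := by
  rw [pack, Finset.sum_range_succ', pack, Finset.mul_sum, add_comm]
  simp only [pow_zero, mul_one, pow_succ]
  congr 1
  exact Finset.sum_congr rfl fun j _ => by ring

theorem pack_zero (Z : ℤ) (f : ℕ → ℤ) : pack Z 0 f = 0 := by simp [pack]

theorem pack_congr {Z : ℤ} {N : ℕ} {f g : ℕ → ℤ} (h : ∀ j < N, f j = g j) :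
    pack Z N f = pack Z N g :=
  Finset.sum_congr rfl fun j hj => by rw [h j (Finset.mem_range.1 hj)]

theorem two_mul_abs_pack_lt {Z : ℤ} (hZ : 1 ≤ Z) {N : ℕ} {f : ℕ → ℤ}
    (h : ∀ j < N, 2 * |f j| < Z) : 2 * |pack Z N f| < Z ^ N := by
  induction N generalizing f with
  | zero => simp [pack_zero]
  | succ N ih =>
    rw [pack_succ]
    have h1 := ih (f := fun j => f (j + 1)) fun j hj => h (j + 1) (by omega)
    have h2 := h 0 (by omega)
    have h3 := abs_add_le (f 0) (Z * pack Z N fun j => f (j + 1))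
    rw [abs_mul, abs_of_pos (by omega : 0 < Z)] at h3
    rw [pow_succ]
    nlinarith

theorem div_of_two_mul_abs_lt {Z a t : ℤ} (h : 2 * |a| < Z) : (a + Z * t + Z / 2) / Z = t := by
  have h1 := le_abs_self a
  have h2 := neg_abs_le a
  rw [show a + Z * t + Z / 2 = (a + Z / 2) + Z * t by ring,
    Int.add_mul_ediv_left _ _ (by omega : Z ≠ 0),
    Int.ediv_eq_zero_of_lt (by omega) (by omega), zero_add]

theorem mod_eq_zero_iff_of_two_mul_abs_lt {Z a t : ℤ} (h : 2 * |a| < Z) :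
    (a + Z * t) % Z = 0 ↔ a = 0 := by
  constructor
  · intro h0
    have h1 : Z ∣ a := by
      have := Int.dvd_of_emod_eq_zero h0
      exact (Int.dvd_add_left (Dvd.intro t rfl)).1 this
    by_contra h2
    have := Int.le_of_dvd (abs_pos.2 h2) ((dvd_abs _ _).2 h1)
    have := abs_nonneg a
    omega
  · rintro rfl; simp

/-- The situation after `c` rounds of fraction-free elimination for a `k × k` matrix `A₀`: up to
row operations that do not change the determinant, row `i` consists of the minors of the leading
block of size `c` bordered by row `i`, packed in base `Z`, and `q` is the minor of this block.
Once the pivot vanishes, all remaining numbers are `0`. -/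
def ElimState (Z : ℤ) (k N : ℕ) (b : ℤ) (A₀ : ℕ → ℕ → ℤ) (c : ℕ) (q : ℤ) (w : ℕ → ℤ) : Prop :=
  (∃ A : ℕ → ℕ → ℤ, lead A k = lead A₀ k ∧ (∀ i < k, ∀ j, |A i j| ≤ b) ∧ lead A c = q ∧ q ≠ 0 ∧
    ∀ i, c ≤ i → i < k → w i = pack Z (N - c) fun j => minor A c i (c + j)) ∨
  (lead A₀ k = 0 ∧ q = 0 ∧ 0 < c ∧ ∀ i, c ≤ i → i < k → w i = 0)

section

variable {Z b q : ℤ} {k N c : ℕ} {A A₀ : ℕ → ℕ → ℤ} {w w' : ℕ → ℤ}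

theorem ElimState.init (hA : ∀ i < k, ∀ j, |A₀ i j| ≤ b) (hw : ∀ i < k, w i = pack Z N (A₀ i)) :
    ElimState Z k N b A₀ 0 1 w :=
  .inl ⟨A₀, rfl, hA, by simp [lead], one_ne_zero, fun i _ hi => by
    rw [hw i hi]; exact pack_congr fun j _ => by simp [minor_zero]⟩

theorem ElimState.eq_lead (h : ElimState Z k N b A₀ k q w) : q = lead A₀ k := by
  rcases h with ⟨A, h1, -, h3, -⟩ | ⟨h1, h2, -⟩
  · rw [← h3, h1]
  · rw [h1, h2]

theorem ElimState.swap (h : ElimState Z k N b A₀ c q w) {i : ℕ} (hc : c < i) (hi : i < k)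
    (h1 : w' c = w i) (h2 : w' i = -w c) (h3 : ∀ x, x ≠ c → x ≠ i → w' x = w x) :
    ElimState Z k N b A₀ c q w' := by
  rcases h with ⟨A, e1, e2, e3, e4, e5⟩ | ⟨e1, e2, e3, e4⟩
  · refine .inl ⟨swapNeg A c i, by rw [lead_swapNeg A hc hi, e1], fun x hx y => ?_,
      by rw [lead_swapNeg_of_le A hc, e3], e4, fun x hx hx' => ?_⟩
    · unfold swapNeg
      split_ifs
      · exact e2 i hi y
      · rw [abs_neg]; exact e2 c (by omega) y
      · exact e2 x hx y
    · simp only [minor_swapNeg A hc]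
      by_cases hxc : x = c
      · subst hxc; simp [h1, e5 i hc.le hi]
      · by_cases hxi : x = i
        · subst hxi
          simp only [if_neg hxc, if_true, h2, e5 c le_rfl (hc.trans hi)]
          simp [pack]
        · simp [hxc, hxi, h3 x hxc hxi, e5 x hx hx']
  · refine .inr ⟨e1, e2, e3, fun x hx hx' => ?_⟩
    by_cases hxc : x = c
    · rw [hxc, h1, e4 i hc.le hi]
    · by_cases hxi : x = i
      · rw [hxi, h2, e4 c le_rfl (hc.trans hi), neg_zero]
      · rw [h3 x hxc hxi, e4 x hx hx']

theorem two_mul_abs_minor_lt (hb : 1 ≤ b) (hZ : 2 * (k * b) ^ k < Z)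
    (hA : ∀ i < k, ∀ j, |A i j| ≤ b) {c i : ℕ} (hc : c < k) (hi : i < k) (j : ℕ) :
    2 * |minor A c i j| < Z := by
  refine lt_of_le_of_lt ?_ hZ
  have := abs_det_le (r := c + 1) (k := k) (by omega) hb
    (bordered A c 1 (fun _ => i) fun _ => j) fun x y => by
      simp only [bordered, extIdx, Matrix.of_apply]
      apply hA
      split_ifs <;> omega
  rw [minor]; omega

/-- The lowest digit and the remaining digits of a row. -/
theorem ElimState.digits (hb : 1 ≤ b) (hZ : 2 * (k * b) ^ k < Z) (hk : k ≤ N)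
    (hA : ∀ i < k, ∀ j, |A i j| ≤ b) (hc : c < k) {i : ℕ} (hi : i < k) {t : ℤ}
    (ht : t = pack Z (N - c) fun j => minor A c i (c + j)) :
    (t + Z / 2) / Z = pack Z (N - (c + 1)) (fun j => minor A c i (c + 1 + j)) ∧
    t - Z * ((t + Z / 2) / Z) = minor A c i c ∧ (t % Z = 0 ↔ minor A c i c = 0) := by
  have h2 := two_mul_abs_minor_lt hb hZ hA hc hi c
  have h1 : t = minor A c i c +
      Z * pack Z (N - (c + 1)) (fun j => minor A c i (c + 1 + j)) := by
    rw [ht, show N - c = N - (c + 1) + 1 by omega, pack_succ]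
    simp only [add_zero, add_assoc, add_comm 1]
  have h3 : (t + Z / 2) / Z = pack Z (N - (c + 1)) (fun j => minor A c i (c + 1 + j)) := by
    rw [h1]; exact div_of_two_mul_abs_lt h2
  refine ⟨h3, by rw [h3, h1]; ring, ?_⟩
  rw [h1]; exact mod_eq_zero_iff_of_two_mul_abs_lt h2

theorem one_le_of_digit_bound (hb : 1 ≤ b) (hZ : 2 * (k * b) ^ k < Z) : 1 ≤ Z := by
  have : 0 ≤ ((k : ℤ) * b) ^ k := by positivity
  omega

theorem ElimState.abs_le (hb : 1 ≤ b) (hZ : 2 * (k * b) ^ k < Z) (hk : k ≤ N)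
    (h : ElimState Z k N b A₀ c q w) {i : ℕ} (hc : c < k) (hi : c ≤ i) (hi' : i < k) :
    |w i| ≤ Z ^ N ∧ |(w i + Z / 2) / Z| ≤ Z ^ N ∧ |w i - Z * ((w i + Z / 2) / Z)| ≤ Z := by
  have hZ1 := one_le_of_digit_bound hb hZ
  rcases h with ⟨A, e1, e2, e3, e4, e5⟩ | ⟨e1, e2, e3, e4⟩
  · obtain ⟨h1, h2, -⟩ := ElimState.digits hb hZ hk e2 hc hi' (e5 i hi hi')
    have hm := fun c (hc : c < k) j => two_mul_abs_minor_lt hb hZ e2 hc hi' j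
    have hpow : ∀ M ≤ N, Z ^ M ≤ Z ^ N := fun M hM => pow_le_pow_right₀ hZ1 hM
    refine ⟨?_, ?_, ?_⟩
    · rw [e5 i hi hi']
      have := two_mul_abs_pack_lt hZ1 (N := N - c) fun j _ => hm c hc (c + j)
      have := hpow (N - c) (by omega)
      have := abs_nonneg (pack Z (N - c) fun j => minor A c i (c + j))
      omega
    · rw [h1]
      have := two_mul_abs_pack_lt hZ1 (N := N - (c + 1)) fun j _ => hm c hc (c + 1 + j)
      have := hpow (N - (c + 1)) (by omega)
      have := abs_nonneg (pack Z (N - (c + 1)) fun j => minor A c i (c + 1 + j))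
      omega
    · rw [h2]
      have := hm c hc c
      omega
  · rw [e4 i hi hi', zero_add, Int.ediv_eq_zero_of_lt (by omega) (by omega)]
    simp
    exact ⟨by positivity, by omega⟩

/-- One round of the elimination. -/
theorem ElimState.step (hb : 1 ≤ b) (hZ : 2 * (k * b) ^ k < Z) (hk : k ≤ N)
    (h : ElimState Z k N b A₀ c q w) (hc : c < k)
    (hp : w c % Z ≠ 0 ∨ ∀ i, c ≤ i → i < k → w i % Z = 0) {R D : ℕ → ℤ}
    (hR : ∀ i, R i = (w i + Z / 2) / Z) (hD : ∀ i, D i = w i - Z * R i)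
    (hw : ∀ i, c < i → i < k → w' i = (D c * R i - D i * R c) / q) :
    ElimState Z k N b A₀ (c + 1) (D c) w' := by
  have hZ1 := one_le_of_digit_bound hb hZ
  have hzero : ∀ i, w i = 0 → R i = 0 ∧ D i = 0 := fun i h0 => by
    have : R i = 0 := by
      rw [hR, h0, zero_add, Int.ediv_eq_zero_of_lt (by omega) (by omega)]
    exact ⟨this, by rw [hD, h0, this]; ring⟩
  rcases h with ⟨A, e1, e2, e3, e4, e5⟩ | ⟨e1, e2, e3, e4⟩
  · have hdig := fun i hi hi' => ElimState.digits hb hZ hk e2 hc hi' (e5 i hi hi')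
    have hD' : ∀ i, c ≤ i → i < k → D i = minor A c i c := fun i hi hi' => by
      rw [hD, hR]; exact (hdig i hi hi').2.1
    have hlead : lead A c ≠ 0 := by rwa [e3]
    have hDc : D c = lead A (c + 1) := by rw [hD' c le_rfl hc, minor_self]
    by_cases h0 : D c = 0
    · have hall : ∀ i, c ≤ i → i < k → minor A c i c = 0 := by
        rcases hp with hp | hp
        · exact absurd ((hdig c le_rfl hc).2.2.2 (by rw [← hD' c le_rfl hc, h0])) hp
        · exact fun i hi hi' => (hdig i hi hi').2.2.1 (hp i hi hi')
      refine .inr ⟨by rw [← e1]; exact lead_eq_zero A hlead hc hall, h0, by omega, ?_⟩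
      intro i hi hi'
      rw [hw i hi hi', h0, hD' i (by omega) hi', hall i (by omega) hi']
      simp
    · refine .inl ⟨A, e1, e2, hDc.symm, h0, fun i hi hi' => ?_⟩
      have hkey : D c * R i - D i * R c =
          q * pack Z (N - (c + 1)) fun j => minor A (c + 1) i (c + 1 + j) := by
        rw [hR, hR, (hdig i (by omega) hi').1, (hdig c le_rfl hc).1, hD' c le_rfl hc,
          hD' i (by omega) hi', pack, pack, pack, Finset.mul_sum, Finset.mul_sum, Finset.mul_sum,
          ← Finset.sum_sub_distrib]
        refine Finset.sum_congr rfl fun j _ => ?_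
        rw [← mul_assoc q, ← e3, lead_mul_minor_succ A c i (c + 1 + j) hlead]
        ring
      rw [hw i hi hi', hkey, Int.mul_ediv_cancel_left _ e4]
  · refine .inr ⟨e1, (hzero c (e4 c le_rfl hc)).2, by omega, fun i hi hi' => ?_⟩
    rw [hw i hi hi', e2, Int.ediv_zero]

end

/-! ### The determinant program -/

/-- The workspace consists of the memory cells with negative addresses. -/
def work (e : Expr) : Expr := .const (-1) - e

@[simp] theorem eval_work (s : State) (e : Expr) : (work e).eval s = -1 - e.eval s := rfl

/-- The integer that remains when the lowest balanced digit of `e` in base `f` is removed. -/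
def digitTail (e f : Expr) : Expr := (e + f / .const 2) / f

@[simp] theorem eval_digitTail (s : State) (e f : Expr) :
    (digitTail e f).eval s = (e.eval s + f.eval s / 2) / f.eval s := rfl

/-- The search for a row with a nonzero pivot; it is exchanged with the row in register `61`. -/
def pivotProg : Program :=
  forE 62 (.reg 61 + .const 1) (.reg 50) <|
    ifE (.const 1 - .load (work (.reg 61)) % .reg 5)
      (.seq (set 65 (.load (work (.reg 61)))) <|
        .seq (put (work (.reg 61)) (.load (work (.reg 62)))) <|
        put (work (.reg 62)) (.const 0 - .reg 65))
      skip

/-- The elimination in the rows below the one in register `61`. -/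
def reduceProg : Program :=
  forE 62 (.reg 61 + .const 1) (.reg 50) <|
    .seq (set 67 (digitTail (.load (work (.reg 62))) (.reg 5))) <|
    .seq (set 66 (.load (work (.reg 62)) - .reg 5 * .reg 67)) <|
    put (work (.reg 62)) ((.reg 63 * .reg 67 - .reg 66 * .reg 64) / .reg 60)

/-- Fraction-free elimination for the matrix whose rows, packed with base in register `5`, are
in the workspace; its size is in register `50`. The determinant ends up in register `60`. -/
def detProg : Program :=
  .seq (set 60 (.const 1)) <|
  forE 61 (.const 0) (.reg 50) <|
  .seq pivotProg <|
  .seq (set 64 (digitTail (.load (work (.reg 61))) (.reg 5))) <|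
  .seq (set 63 (.load (work (.reg 61)) - .reg 5 * .reg 64)) <|
  .seq reduceProg <|
  set 60 (.reg 63)

/-- The registers below `b` and the memory cells with nonnegative addresses are unchanged. -/
def Frame (b : ℕ) (σ σ' : State) : Prop :=
  (∀ r < b, σ'.reg r = σ.reg r) ∧ ∀ k, 0 ≤ k → σ'.mem k = σ.mem k

theorem Frame.refl (b : ℕ) (σ : State) : Frame b σ σ := ⟨fun _ _ => rfl, fun _ _ => rfl⟩

theorem Frame.trans {b : ℕ} {σ σ' σ'' : State} (h : Frame b σ σ') (h' : Frame b σ' σ'') :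
    Frame b σ σ'' :=
  ⟨fun r hr => (h'.1 r hr).trans (h.1 r hr), fun k hk => (h'.2 k hk).trans (h.2 k hk)⟩

theorem Frame.mono {b b' : ℕ} {σ σ' : State} (h : Frame b σ σ') (hb : b' ≤ b) : Frame b' σ σ' :=
  ⟨fun r hr => h.1 r (by omega), h.2⟩

theorem Frame.set {b d : ℕ} {σ σ' : State} {z : ℤ} (h : Frame b σ σ') (hd : b ≤ d) :
    Frame b σ (σ'.setReg d z) :=
  ⟨fun r hr => by simp [show r ≠ d by omega, h.1 r hr], h.2⟩

theorem Frame.put {b : ℕ} {k z : ℤ} {σ σ' : State} (h : Frame b σ σ') (hk : k < 0) :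
    Frame b σ (σ'.setMem k z) :=
  ⟨h.1, fun l hl => by simp [show l ≠ k by omega, h.2 l hl]⟩

theorem run_pivotProg {O : List ℤ → ℤ} {B : ℕ} (hB : 10 ^ 6 ≤ B) {σ : State} {Z b : ℤ}
    {c l N : ℕ} {A₀ : ℕ → ℕ → ℤ} (h5 : σ.reg 5 = Z) (h50 : σ.reg 50 = (c + 1 + l : ℕ))
    (h61 : σ.reg 61 = c) (hb : 1 ≤ b) (hZ : 2 * ((c + 1 + l : ℕ) * b) ^ (c + 1 + l) < Z)
    (hk : c + 1 + l ≤ N) (hBZ : Z ^ N ≤ B)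
    (hE : ElimState Z (c + 1 + l) N b A₀ c (σ.reg 60) fun i => σ.mem (-1 - (i : ℕ))) :
    Run O B pivotProg σ (l * 484 + 121) fun σ' =>
      Frame 60 σ σ' ∧ σ'.reg 61 = c ∧ σ'.reg 60 = σ.reg 60 ∧
      ElimState Z (c + 1 + l) N b A₀ c (σ.reg 60) (fun i => σ'.mem (-1 - (i : ℕ))) ∧
      (σ'.mem (-1 - (c : ℕ)) % Z ≠ 0 ∨
        ∀ i, c ≤ i → i < c + 1 + l → σ'.mem (-1 - (i : ℕ)) % Z = 0) := by
  apply Run.of_bounded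
  intro hσ
  have hZ1 := one_le_of_digit_bound hb hZ
  have hkB : ((c + 1 + l : ℕ) : ℤ) ≤ B := by
    have := (le_abs_self _).trans (hσ.1 50 (by norm_num)); rwa [h50] at this
  push_cast at hkB
  refine .forE hB (by decide) (c + 1) l (60 + (121 + 121) + 61)
    (fun t σ' => t ≤ l ∧ Frame 60 σ σ' ∧ σ'.reg 61 = c ∧ σ'.reg 62 = c + 1 + t ∧
      σ'.reg 60 = σ.reg 60 ∧
      ElimState Z (c + 1 + l) N b A₀ c (σ.reg 60) (fun i => σ'.mem (-1 - (i : ℕ))) ∧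
      (σ'.mem (-1 - (c : ℕ)) % Z ≠ 0 ∨
        ∀ i, c ≤ i → i < c + 1 + t → σ'.mem (-1 - (i : ℕ)) % Z = 0))
    (by simp [h61]) (by rw [abs_le]; omega) (by rw [abs_le]; omega) ?_ ?_ ?_ ?_
  · refine ⟨by omega, (Frame.refl _ _).set (by norm_num), by simp [h61], by simp, by simp,
      by simpa using hE, ?_⟩
    by_cases h0 : σ.mem (-1 - (c : ℕ)) % Z = 0
    · right
      intro i hi hi'
      obtain rfl : i = c := by omega
      simpa using h0
    · left; simpa using h0
  · rintro t σ' ⟨-, hF, -, h62, -⟩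
    refine ⟨h62, ?_⟩
    simp [hF.1 50 (by norm_num), h50]
  · rintro t σ' ht ⟨-, hF, h61', h62, h60, hE, hor⟩
    have d5 := (hF.1 5 (by norm_num)).trans h5
    have hbc := (hE.abs_le hb hZ hk (by omega) le_rfl (by omega)).1
    have hbi := (hE.abs_le hb hZ hk (i := c + 1 + t) (by omega) (by omega) (by omega)).1
    simp only [Nat.cast_add, Nat.cast_one] at hbi
    refine .ifE (T := 60 + (121 + 121)) hB (by decide) (fun hpos => ?_) (fun hneg => ?_)
    · simp only [Expr.eval_sub, Expr.eval_const, Expr.eval_mod, Expr.eval_load, eval_work,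
        Expr.eval_reg, d5, h61'] at hpos
      have hzero : σ'.mem (-1 - (c : ℕ)) % Z = 0 := by
        have := Int.emod_nonneg (σ'.mem (-1 - (c : ℕ))) (show Z ≠ 0 by omega)
        omega
      have hall := hor.resolve_left (not_not.2 hzero)
      refine .seq (.set hB (by decide) (by simp [h61']; omega) ?_)
      refine .seq (.put hB (by decide) (by simp [h62]; omega) ?_)
      refine .put hB (by decide) (by simp [h61']; omega) ?_
      simp only [Expr.eval_load, eval_work, Expr.eval_reg, reg_setReg, h61', h62, mem_setReg,
        reg_setMem, Expr.eval_sub, Expr.eval_const]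
      norm_num only [if_true, if_false]
      have hne : (-1 - (c + 1 + t) : ℤ) ≠ -1 - c := by omega
      refine ⟨by simp, by omega, ?_, by simp, by simp [add_assoc],
        by simp [h60], ?_, ?_⟩
      · exact (((hF.set (by norm_num)).put (by omega)).put (by omega)).set (by norm_num)
      · refine hE.swap (i := c + 1 + t) (by omega) (by omega) ?_ ?_ ?_
        · simp
          omega
        · simp
        · intro x hx hx'
          have : (-1 - x : ℤ) ≠ -1 - c := by omega
          have : (-1 - x : ℤ) ≠ -1 - (c + 1 + t) := by omega
          simp [*]
      · by_cases h0 : σ'.mem (-1 - (c + 1 + t)) % Z = 0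
        · right
          intro i hi hi'
          simp only [mem_setReg, mem_setMem]
          split_ifs with g1 g2
          · rw [zero_sub, Int.emod_eq_zero_of_dvd ((Int.dvd_neg).2 (Int.dvd_of_emod_eq_zero hzero))]
          · exact h0
          · exact hall i hi (by omega)
        · left
          simpa [hne.symm] using h0
    · simp only [Expr.eval_sub, Expr.eval_const, Expr.eval_mod, Expr.eval_load, eval_work,
        Expr.eval_reg, d5, h61'] at hneg
      refine (Run.skip ?_).mono (by norm_num) fun _ h => h
      refine ⟨h62, by omega, hF.set (by norm_num), by simp [h61'], by simp [add_assoc],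
        by simp [h60], by simpa using hE, ?_⟩
      left
      simp only [mem_setReg]
      omega
  · rintro σ' ⟨-, h1, h2, -, h3⟩
    exact ⟨h1, h2, h3⟩

theorem run_reduceProg {O : List ℤ → ℤ} {B : ℕ} (hB : 10 ^ 6 ≤ B) {σ : State} {Z : ℤ} {c l : ℕ}
    {q : ℤ} {w R D : ℕ → ℤ}
    (h5 : σ.reg 5 = Z) (h50 : σ.reg 50 = (c + 1 + l : ℕ)) (h61 : σ.reg 61 = c)
    (h60 : σ.reg 60 = q) (h63 : σ.reg 63 = D c) (h64 : σ.reg 64 = R c)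
    (hw : ∀ i : ℕ, σ.mem (-1 - i) = w i) (hR : ∀ i, R i = (w i + Z / 2) / Z)
    (hD : ∀ i, D i = w i - Z * R i)
    (hb : ∀ i, c < i → i < c + 1 + l → |R i| ≤ B ∧ |D i| ≤ B ∧
      |(D c * R i - D i * R c) / q| ≤ B) :
    Run O B reduceProg σ (l * 362 + 121) fun σ' =>
      Frame 60 σ σ' ∧ σ'.reg 61 = c ∧ σ'.reg 63 = D c ∧
      ∀ i, c < i → i < c + 1 + l → σ'.mem (-1 - (i : ℕ)) = (D c * R i - D i * R c) / q := by
  apply Run.of_bounded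
  intro hσ
  have hkB : ((c + 1 + l : ℕ) : ℤ) ≤ B := by
    have := (le_abs_self _).trans (hσ.1 50 (by norm_num)); rwa [h50] at this
  push_cast at hkB
  refine .forE hB (by decide) (c + 1) l (60 + (60 + 121))
    (fun t σ' => t ≤ l ∧ Frame 60 σ σ' ∧ σ'.reg 61 = c ∧ σ'.reg 62 = c + 1 + t ∧
      σ'.reg 60 = q ∧ σ'.reg 63 = D c ∧ σ'.reg 64 = R c ∧
      (∀ i, c < i → i < c + 1 + t →
        σ'.mem (-1 - (i : ℕ)) = (D c * R i - D i * R c) / q) ∧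
      ∀ i, c + 1 + t ≤ i → σ'.mem (-1 - (i : ℕ)) = w i)
    (by simp [h61]) (by rw [abs_le]; omega) (by rw [abs_le]; omega) ?_ ?_ ?_ ?_
  · refine ⟨by omega, (Frame.refl _ _).set (by norm_num), by simp [h61], by simp,
      by simp [h60], by simp [h63], by simp [h64], by omega, by simp [hw]⟩
  · rintro t σ' ⟨-, hF, -, h62, -⟩
    exact ⟨h62, by simp [hF.1 50 (by norm_num), h50]⟩
  · rintro t σ' ht ⟨-, hF, h61', h62, h60, h63, h64, hold, hnext⟩
    have f5 := (hF.1 5 (by norm_num)).trans h5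
    have hm : σ'.mem (-1 - (c + 1 + t)) = w (c + 1 + t) := by
      simpa using hnext (c + 1 + t) le_rfl
    obtain ⟨hi1, hi2, hi3⟩ := hb (c + 1 + t) (by omega) (by omega)
    have e67 : (digitTail (.load (work (.reg 62))) (.reg 5)).eval σ' = R (c + 1 + t) := by
      simp [f5, h62, hm, hR]
    have e66 : (Expr.load (work (.reg 62)) - .reg 5 * .reg 67).eval
        (σ'.setReg 67 (R (c + 1 + t))) = D (c + 1 + t) := by
      simp [f5, h62, hm, hD]
    refine .seq (.set hB (by decide) (by rw [e67]; exact hi1) ?_)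
    rw [e67]
    refine .seq (.set hB (by decide) (by rw [e66]; exact hi2) ?_)
    rw [e66]
    refine .put hB (by decide) ?_ ?_
    · simpa [h60, h63, h64] using hi3
    · refine ⟨by simp [h62], by omega, ?_, by simp [h61'], by simp [add_assoc],
        by simp [h60], by simp [h63], by simp [h64], ?_, ?_⟩
      · refine (((hF.set (by norm_num)).set (by norm_num)).put ?_).set (by norm_num)
        simp [h62]; omega
      · intro i hi hi'
        simp only [mem_setReg, mem_setMem, eval_work, Expr.eval_reg, reg_setReg, h62,
          Expr.eval_div, Expr.eval_sub, Expr.eval_mul, h60, h63, h64]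
        norm_num only [if_true, if_false]
        by_cases h : i = c + 1 + t
        · subst h; simp
        · rw [if_neg (by omega)]; exact hold i hi (by omega)
      · intro i hi
        simp only [mem_setReg, mem_setMem, eval_work, Expr.eval_reg, reg_setReg, h62]
        norm_num only [if_true, if_false]
        rw [if_neg (by omega)]; exact hnext i (by omega)
  · rintro σ' ⟨-, h1, h2, -, -, h3, -, h4, -⟩
    exact ⟨h1, h2, h3, h4⟩

theorem run_detProg {O : List ℤ → ℤ} {B : ℕ} (hB : 10 ^ 6 ≤ B) {σ : State} {Z b : ℤ} {k N : ℕ}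
    {A₀ : ℕ → ℕ → ℤ} (h5 : σ.reg 5 = Z) (h50 : σ.reg 50 = k) (hb : 1 ≤ b)
    (hZ : 2 * (k * b) ^ k < Z) (hk : k ≤ N) (hN : 1 ≤ N) (hBZ : Z ^ N ≤ B)
    (hA : ∀ i < k, ∀ j, |A₀ i j| ≤ b) (hw : ∀ i < k, σ.mem (-1 - (i : ℕ)) = pack Z N (A₀ i)) :
    Run O B detProg σ (2000 * (k + 1) ^ 2) fun σ' =>
      Frame 60 σ σ' ∧ σ'.reg 60 = lead A₀ k := by
  apply Run.of_bounded
  intro hσ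
  have hZ1 := one_le_of_digit_bound hb hZ
  have hZB : Z ≤ B := le_trans (by simpa using pow_le_pow_right₀ hZ1 hN) hBZ
  have hkB : (k : ℤ) ≤ B := by simpa [h50] using hσ.1 50 (by norm_num)
  have hB' : (10 : ℤ) ^ 6 ≤ B := by exact_mod_cast hB
  have main : Run O B detProg σ (60 + (k * ((k * 484 + 121 + (60 + (60 +
      (k * 362 + 121 + 60)))) + 121) + 121)) fun σ' =>
      Frame 60 σ σ' ∧ σ'.reg 60 = lead A₀ k := by
    refine .seq (.set hB (by decide) (by simp; omega) ?_)
    refine .forE hB (by decide) 0 k _ (fun c σ' => c ≤ k ∧ Frame 60 σ σ' ∧ σ'.reg 61 = c ∧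
      ElimState Z k N b A₀ c (σ'.reg 60) fun i => σ'.mem (-1 - (i : ℕ))) rfl (by simp)
      (by simpa using hkB) ?_ ?_ ?_ ?_
    · refine ⟨by omega, ((Frame.refl _ _).set le_rfl).set (by norm_num), by simp, ?_⟩
      simpa using ElimState.init (w := fun i => σ.mem (-1 - (i : ℕ))) hA hw
    · rintro c σ' ⟨_, hF, h61, -⟩
      simp [h61, hF.1 50 (by norm_num), h50]
    · rintro c σ₁ hc ⟨-, hF₁, h61, hE₁⟩
      have c5 := (hF₁.1 5 (by norm_num)).trans h5
      have c50 := (hF₁.1 50 (by norm_num)).trans h50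
      obtain ⟨l, rfl⟩ : ∃ l, k = c + 1 + l := ⟨k - (c + 1), by omega⟩
      refine .seq ((run_pivotProg hB c5 c50 h61 hb hZ hk hBZ hE₁).mono (by gcongr; omega) ?_)
      rintro σ₂ ⟨hF₂, h61₂, h60₂, hE₂, hor₂⟩
      have d5 := (hF₂.1 5 (by norm_num)).trans c5
      have d50 := (hF₂.1 50 (by norm_num)).trans c50
      obtain ⟨hb1, hb2, hb3⟩ := hE₂.abs_le hb hZ hk (by omega) le_rfl (by omega)
      set R : ℕ → ℤ := fun i => (σ₂.mem (-1 - (i : ℕ)) + Z / 2) / Z with hR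
      set D : ℕ → ℤ := fun i => σ₂.mem (-1 - (i : ℕ)) - Z * R i with hD
      have e64 : (digitTail (.load (work (.reg 61))) (.reg 5)).eval σ₂ = R c := by
        simp [d5, h61₂, hR]
      have e63 : (Expr.load (work (.reg 61)) - .reg 5 * .reg 64).eval (σ₂.setReg 64 (R c)) =
          D c := by
        simp [d5, h61₂, hD]
      refine .seq (.set hB (by decide) (by rw [e64]; exact hb2.trans hBZ) ?_)
      rw [e64]
      refine .seq (.set hB (by decide) (by rw [e63]; exact hb3.trans hZB) ?_)
      rw [e63]
      have hF₃ : Frame 60 σ ((σ₂.setReg 64 (R c)).setReg 63 (D c)) :=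
        ((hF₁.trans hF₂).set (by norm_num)).set (by norm_num)
      have hstep : ∀ w' : ℕ → ℤ, (∀ i, c < i → i < c + 1 + l →
          w' i = (D c * R i - D i * R c) / σ₁.reg 60) →
          ElimState Z (c + 1 + l) N b A₀ (c + 1) (D c) w' := fun w' hw' =>
        hE₂.step hb hZ hk (by omega) hor₂ (fun _ => rfl) (fun _ => rfl) hw'
      have hnew : ∀ i, c < i → i < c + 1 + l → |(D c * R i - D i * R c) / σ₁.reg 60| ≤ Z ^ N :=
        fun i hi hi' => ((hstep _ fun _ _ _ => rfl).abs_le hb hZ hk (i := i) (by omega)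
          (by omega) (by omega)).1
      refine .seq ((run_reduceProg (R := R) (D := D) (q := σ₁.reg 60) (c := c) (l := l) hB
        (by simpa using d5) (by simpa using d50) (by simpa using h61₂) (by simpa using h60₂)
        (by simp) (by simp) (w := fun i => σ₂.mem (-1 - (i : ℕ))) (by simp) (fun _ => rfl)
        (fun _ => rfl) fun i hi hi' => ?_).mono (by gcongr; omega) ?_)
      · obtain ⟨-, g2, g3⟩ := hE₂.abs_le hb hZ hk (i := i) (by omega) (by omega) (by omega)
        exact ⟨g2.trans hBZ, g3.trans hZB, (hnew i hi hi').trans hBZ⟩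
      rintro σ₄ ⟨hF₄, h61₄, h63₄, hm₄⟩
      refine .set hB (by decide) (by simpa [h63₄] using hb3.trans hZB) ?_
      refine ⟨by simp [h61₄], by omega, ?_, by simp, ?_⟩
      · exact ((hF₃.trans hF₄).set (by norm_num)).set (by norm_num)
      · simpa [h63₄] using hstep _ hm₄
    · rintro σ' ⟨_, hF, -, hE⟩
      exact ⟨hF, hE.eq_lead⟩
  refine main.mono ?_ fun _ h => h
  nlinarith

/-! ### Cofactors of leading blocks -/

/-- The determinant of the leading block of size `k`, with row `r` replaced by the unit vector of
index `c`: the entry at `(c, r)` of the adjugate. -/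
def cof {R : Type*} [CommRing R] (A : ℕ → ℕ → R) (k r c : ℕ) : R :=
  (Matrix.of fun x y : Fin k => if x.val = r then if y.val = c then 1 else 0 else A x y).det

section

variable {R S : Type*} [CommRing R] [CommRing S]

theorem map_cof (φ : R →+* S) (A : ℕ → ℕ → R) (k r c : ℕ) :
    φ (cof A k r c) = cof (fun i j => φ (A i j)) k r c := by
  rw [cof, RingHom.map_det, cof]
  congr 1
  ext x y
  simp only [RingHom.mapMatrix_apply, Matrix.map_apply, Matrix.of_apply]
  split_ifs <;> simp

theorem cof_congr {A A' : ℕ → ℕ → R} {k : ℕ} (h : ∀ i < k, ∀ j < k, A i j = A' i j) (r c : ℕ) :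
    cof A k r c = cof A' k r c := by
  unfold cof
  congr 1
  ext x y
  simp only [Matrix.of_apply, h x x.2 y y.2]

theorem adjugate_eq_cof {k : ℕ} (B : Matrix (Fin k) (Fin k) R) (A : ℕ → ℕ → R)
    (h : ∀ i j, B i j = A i j) (c r : Fin k) : B.adjugate c r = cof A k r c := by
  rw [Matrix.adjugate_apply, cof]
  congr 1
  ext x y
  by_cases hx : x = r
  · subst hx
    simp [Matrix.updateRow_self, Pi.single_apply, Fin.ext_iff]
  · have : x.val ≠ r := fun h => hx (Fin.ext h)
    simp [Matrix.updateRow_ne hx, this, h]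

theorem det_of_last_row {k : ℕ} (M : Matrix (Fin (k + 1)) (Fin (k + 1)) R)
    (h : ∀ y, M (Fin.last k) y = if y = Fin.last k then 1 else 0) :
    M.det = (M.submatrix Fin.castSucc Fin.castSucc).det := by
  rw [Matrix.det_succ_row M (Fin.last k), Finset.sum_eq_single (Fin.last k)]
  · have : (-1 : R) ^ (k + k) = 1 := by rw [← two_mul, pow_mul]; simp
    simp [h, Fin.succAbove_last, this]
  · intro y _ hy; simp [h, hy]
  · simp

/-- The dependence of the cofactors in the last row on the entry to the left of the last diagonal
entry. -/
theorem cof_add_subdiag {A A' : ℕ → ℕ → R} {i r : ℕ} (hr : r ≤ i) (y : R)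
    (h : ∀ a b, A a b = A' a b + if a = i + 1 ∧ b = i then y else 0) :
    cof A (i + 2) r (i + 1) = cof A' (i + 2) r (i + 1) - y * cof A (i + 1) r i := by
  let last : Fin (i + 2) := Fin.last (i + 1)
  let r' : Fin (i + 2) := ⟨r, by omega⟩
  have hrl : r' ≠ last := by simp [r', last, Fin.ext_iff]; omega
  let M' : Matrix (Fin (i + 2)) (Fin (i + 2)) R :=
    Matrix.of fun x y => if x.val = r then if y.val = i + 1 then 1 else 0 else A' x y
  let e : Fin (i + 2) → R := fun y => if y.val = i then 1 else 0
  have h1 : (Matrix.of fun x y : Fin (i + 2) => if x.val = r then if y.val = i + 1 then 1 else 0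
      else A x y) = M'.updateRow last (M' last + y • e) := by
    ext a b
    by_cases ha : a = last
    · subst ha
      have : i + 1 ≠ r := by omega
      simp [M', last, h, e, this]
    · have ha' : a.val ≠ i + 1 := fun h => ha (Fin.ext h)
      simp [Matrix.updateRow_ne ha, M', h, ha']
  have h2 : (M'.updateRow last e).det = -cof A (i + 1) r i := by
    have h3 := Matrix.det_permute (Equiv.swap r' last) (M'.updateRow last e)
    rw [Equiv.Perm.sign_swap hrl] at h3
    have h4 : ((M'.updateRow last e).submatrix (Equiv.swap r' last) id).det =
        cof A (i + 1) r i := by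
      rw [det_of_last_row, cof]
      · congr 1
        ext a b
        simp only [Matrix.submatrix_apply, id, Matrix.of_apply]
        by_cases ha : a.val = r
        · have : a.castSucc = r' := Fin.ext ha
          simp [this, ha, e]
        · have g1 : a.castSucc ≠ r' := fun h => ha (by simpa [r'] using congrArg Fin.val h)
          have g2 : a.castSucc ≠ last := (Fin.castSucc_lt_last a).ne
          rw [Equiv.swap_apply_of_ne_of_ne g1 g2, Matrix.updateRow_ne g2]
          have : a.val ≠ i + 1 := by omega
          simp [M', ha, h, this]
      · intro b
        have : (Fin.last (i + 1) : Fin (i + 2)) = last := rfl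
        simp only [Matrix.submatrix_apply, this, Equiv.swap_apply_right, id,
          Matrix.updateRow_ne hrl]
        simp [M', r', last, Fin.ext_iff]
    rw [h4] at h3
    rw [h3]; simp
  have h3 : cof A' (i + 2) r (i + 1) = M'.det := rfl
  rw [cof, h1, Matrix.det_updateRow_add, Matrix.updateRow_eq_self, Matrix.det_updateRow_smul, h2, h3]
  ring

end

/-! ### Resultants -/

/-- The polynomials have no common complex root. -/
def NoCommonRoot (f g : ℤ[X]) : Prop := ∀ z : ℂ, aeval z f ≠ 0 ∨ aeval z g ≠ 0

/-- The resultant of two polynomials, both regarded as having the larger of their degrees. -/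
noncomputable def res (f g : ℤ[X]) : ℤ :=
  f.resultant g (max f.natDegree g.natDegree) (max f.natDegree g.natDegree)

theorem noCommonRoot_iff (f g : ℤ[X]) :
    NoCommonRoot f g ↔ IsCoprime (f.map (Int.castRingHom ℚ)) (g.map (Int.castRingHom ℚ)) := by
  rw [Polynomial.isCoprime_iff_aeval_ne_zero_of_isAlgClosed ℚ ℂ]
  have h : ∀ (z : ℂ) (f : ℤ[X]), aeval z (f.map (Int.castRingHom ℚ)) = aeval z f := fun z f => by
    rw [aeval_def, aeval_def, eval₂_map]
    congr 1
  simp only [h, NoCommonRoot]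

theorem res_ne_zero_iff {f g : ℤ[X]} (h : g ≠ 0) : res f g ≠ 0 ↔ NoCommonRoot f g := by
  have hinj : Function.Injective (Int.castRingHom ℚ) := Int.cast_injective
  rw [noCommonRoot_iff]
  set F := f.map (Int.castRingHom ℚ) with hF
  set G := g.map (Int.castRingHom ℚ) with hG
  have hG0 : G ≠ 0 := (Polynomial.map_ne_zero_iff hinj).2 h
  have hcast : ((res f g : ℤ) : ℚ) =
      F.resultant G (max F.natDegree G.natDegree) (max F.natDegree G.natDegree) := by
    rw [hF, hG, resultant_map_map, natDegree_map_eq_of_injective hinj,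
      natDegree_map_eq_of_injective hinj]; rfl
  have h0 : res f g ≠ 0 ↔ ((res f g : ℤ) : ℚ) ≠ 0 := by simp
  rw [h0, hcast]
  have hiff : F.resultant G ≠ 0 ↔ IsCoprime F G := by
    rw [Ne, resultant_eq_zero_iff]; simp [hG0]
  rw [← hiff]
  rcases le_total F.natDegree G.natDegree with hle | hle
  · rw [max_eq_right hle]
    obtain ⟨k, hk⟩ := Nat.exists_eq_add_of_le hle
    have := resultant_add_left_deg F G F.natDegree G.natDegree k le_rfl
    rw [← hk] at this
    rw [this]
    simp [hG0]
  · rw [max_eq_left hle]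
    obtain ⟨k, hk⟩ := Nat.exists_eq_add_of_le hle
    have := resultant_add_right_deg F G F.natDegree G.natDegree k le_rfl
    rw [← hk] at this
    rw [this]
    by_cases hF0 : F = 0
    · have : G.natDegree = 0 := by
        have : F.natDegree = 0 := by simp [hF0]
        omega
      have hk0 : k = 0 := by
        have : F.natDegree = 0 := by simp [hF0]
        omega
      simp [hk0]
    · simp [hF0]

theorem sylvester_apply (f g : ℤ[X]) (d : ℕ) (i j : Fin (d + d)) : sylvester f g d d i j =
    if j.val < d then if j.val ≤ i.val ∧ i.val ≤ j.val + d then g.coeff (i.val - j.val) else 0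
    else if j.val - d ≤ i.val ∧ i.val ≤ j.val then f.coeff (i.val - (j.val - d)) else 0 := by
  refine Fin.addCases (fun j => ?_) (fun j => ?_) j
  · simp [sylvester]
  · simp only [sylvester, Matrix.of_apply, Fin.addCases_right, Fin.val_natAdd, Set.mem_Icc]
    simp only [add_comm d j.val, show ¬ (j.val + d < d) by omega, if_false, Nat.add_sub_cancel]

theorem det_coeffMatrix (f g : ℤ[X]) : (coeffMatrix f g).det = res f g := by
  have key : ∀ (d : ℕ) (M : Matrix (Fin (2 * d)) (Fin (2 * d)) ℤ),
      (∀ r s, M r s = if s.val < d then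
        if s.val ≤ r.val ∧ r.val ≤ d + s.val then f.coeff (d + s.val - r.val) else 0
        else if s.val - d ≤ r.val ∧ r.val ≤ s.val then g.coeff (s.val - r.val) else 0) →
      M.det = (sylvester f g d d).det := by
    intro d M hM
    rw [← Matrix.det_submatrix_equiv_self ((finCongr (two_mul d).symm).trans Fin.revPerm)]
    congr 1
    ext i j
    rw [sylvester_apply, Matrix.submatrix_apply, hM]
    simp only [Equiv.trans_apply, finCongr_apply, Fin.revPerm_apply, Fin.val_rev, Fin.val_cast]
    have hi := i.2
    have hj := j.2
    split_ifs <;> first | rfl | omega | (congr 1; omega)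
  exact key _ _ fun r s => rfl

/-! ### The matrix of linear polynomials -/

/-- The constant coefficients of the matrix with linear polynomial entries: `p` on the diagonal and
in the first column, and `Y i` in row `i` to the left of the diagonal. -/
def famConst (p : ℤ) (Y : ℕ → ℤ) (i j : ℕ) : ℤ :=
  (if i = j then p else 0) +
    if i = 0 then 0 else (if j = 0 then p else 0) + if j + 1 = i then Y i else 0

/-- The matrix with linear polynomial entries whose linear coefficients are `N`. -/
noncomputable def fam (N : ℕ → ℕ → ℤ) (p : ℤ) (Y : ℕ → ℤ) (i j : ℕ) : ℤ[X] :=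
  X * C (N i j) + C (famConst p Y i j)

/-- The entry in the last row and column `r` of the adjugate of the leading block that ends in
row `i`. -/
noncomputable def fcof (N : ℕ → ℕ → ℤ) (p : ℤ) (Y : ℕ → ℤ) (i r : ℕ) : ℤ[X] :=
  cof (fam N p Y) (i + 1) r i

section

variable (N : ℕ → ℕ → ℤ) (p : ℤ) (Y : ℕ → ℤ)

theorem famConst_update (i a b : ℕ) : famConst p Y a b =
    famConst p (Function.update Y (i + 1) 0) a b + if a = i + 1 ∧ b = i then Y (i + 1) else 0 := by
  by_cases ha : a = i + 1
  · subst ha; by_cases hb : b = i <;> simp [famConst, hb]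
  · simp [famConst, ha]

theorem fcof_succ {i r : ℕ} (hr : r ≤ i) : fcof N p Y (i + 1) r =
    fcof N p (Function.update Y (i + 1) 0) (i + 1) r - C (Y (i + 1)) * fcof N p Y i r := by
  refine cof_add_subdiag hr _ fun a b => ?_
  rw [fam, famConst_update p Y i, fam]
  split_ifs <;> simp
  ring

theorem fcof_congr {Y' : ℕ → ℤ} {i : ℕ} (h : ∀ k, 1 ≤ k → k ≤ i → Y k = Y' k) (r : ℕ) :
    fcof N p Y i r = fcof N p Y' i r := by
  refine cof_congr (fun a ha b hb => ?_) r i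
  have : famConst p Y a b = famConst p Y' a b := by
    unfold famConst
    rcases Nat.eq_zero_or_pos a with rfl | h0
    · simp
    · rw [h a h0 (by omega)]
  rw [fam, fam, this]

theorem eval_zero_fcof (i r : ℕ) : (fcof N p Y i r).eval 0 = cof (famConst p Y) (i + 1) r i := by
  have := map_cof (Polynomial.evalRingHom (0 : ℤ)) (fam N p Y) (i + 1) r i
  rw [coe_evalRingHom] at this
  rw [fcof, this]
  simp [fam]

theorem eval_zero_fcof_one_one : (fcof N p Y 1 1).eval 0 = p := by
  rw [eval_zero_fcof, cof, Matrix.det_fin_two]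
  simp [famConst]

theorem cof_famConst_one {i : ℕ} (h : Y (i + 2) = 0) :
    cof (famConst p Y) (i + 3) 1 (i + 2) = 0 := by
  rw [cof, ← Matrix.exists_vecMul_eq_zero_iff]
  refine ⟨fun x => if x.val = 0 then -1 else if x.val = 1 then -p else if x.val = i + 2 then 1
    else 0, fun h0 => ?_, ?_⟩
  · have := congrFun h0 0
    simp at this
  · funext y
    rw [Matrix.vecMul, dotProduct, Fin.sum_univ_succ, Fin.sum_univ_succ, Fin.sum_univ_castSucc,
      Finset.sum_eq_zero]
    · have hy := y.2
      simp only [Fin.val_zero, Fin.val_succ, Fin.val_last, Matrix.of_apply, famConst]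
      by_cases h1 : y.val = 0
      · simp [h1]
      · by_cases h2 : y.val = i + 2
        · simp [h2]
        · by_cases h3 : y.val = i + 1
          · simp [h3, h]
          · have e1 : ¬ (i + 2 = y.val) := fun h => h2 h.symm
            have e2 : ¬ (0 = y.val) := fun h => h1 h.symm
            simp [h1, h2, h3, e1, e2]
    · intro x _
      have := x.2
      simp only [Fin.val_succ, Fin.val_castSucc]
      rw [if_neg (by omega), if_neg (by omega), if_neg (by omega), zero_mul]

theorem eval_zero_fcof_one_succ (i : ℕ) : (fcof N p Y (i + 2) 1).eval 0 =
    -(Y (i + 2) * (fcof N p Y (i + 1) 1).eval 0) := by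
  rw [fcof_succ N p Y (by omega), eval_sub, eval_zero_fcof, cof_famConst_one]
  · simp
  · simp

theorem cof_famConst_zero (hp : p ≠ 0) {i : ℕ} (h : Y (i + 2) = 0) :
    cof (famConst p Y) (i + 3) 0 (i + 2) ≠ 0 := by
  rw [cof, Ne, ← Matrix.exists_mulVec_eq_zero_iff]
  rintro ⟨v, hv, h0⟩
  apply hv
  have hrow : ∀ x : Fin (i + 3), ∑ y : Fin (i + 3), (if x.val = 0 then if y.val = i + 2 then (1 : ℤ) else 0
      else famConst p Y x y) * v y = 0 := fun x => congrFun h0 x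
  have hlast : v (Fin.last (i + 2)) = 0 := by
    have := hrow 0
    rw [Finset.sum_eq_single (Fin.last (i + 2))] at this
    · simpa using this
    · intro y _ hy
      have : y.val ≠ i + 2 := fun h => hy (Fin.ext h)
      simp [this]
    · simp
  have hsum : ∀ x : Fin (i + 3), x.val ≠ 0 → p * v x + p * v 0 +
      Y x * v ⟨x.val - 1, by omega⟩ = 0 := by
    intro x hx
    have := hrow x
    simp only [if_neg hx, famConst, add_mul, Finset.sum_add_distrib, ite_mul, zero_mul] at this
    rw [Finset.sum_eq_single x, Finset.sum_eq_single (0 : Fin (i + 3)),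
      Finset.sum_eq_single (⟨x.val - 1, by omega⟩ : Fin (i + 3))] at this
    · rw [if_pos rfl, if_pos (by simp), if_pos (by simp; omega)] at this
      linarith
    · intro y _ hy
      rw [if_neg]
      intro h
      apply hy
      ext
      simp; omega
    · simp
    · intro y _ hy
      rw [if_neg]
      intro h
      exact hy (Fin.ext h)
    · simp
    · intro y _ hy
      rw [if_neg]
      intro h
      exact hy (Fin.ext h.symm)
    · simp
  have hzero : v 0 = 0 := by
    have := hsum (Fin.last (i + 2)) (by simp)
    simp only [Fin.val_last, h, hlast] at this
    simpa [hp] using this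
  have hall : ∀ (k : ℕ) (hk : k < i + 3), v ⟨k, hk⟩ = 0 := by
    intro k
    induction k with
    | zero => intro _; exact hzero
    | succ k ih =>
      intro hk
      have := hsum ⟨k + 1, hk⟩ (by simp)
      simp only [hzero, Nat.add_sub_cancel, ih (by omega)] at this
      simpa [hp] using this
  funext x
  exact hall x x.2

/-- Multiplication by `X` turns the cofactor into a determinant of the form that Mathlib's
expansion of `det (X • A + B)` covers. -/
theorem X_mul_fcof {i r : ℕ} (hr : r ≤ i) : X * fcof N p Y i r =
    ((X : ℤ[X]) • (Matrix.of fun x y : Fin (i + 1) =>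
        if x.val = r then if y.val = i then 1 else 0 else N x y).map C +
      (Matrix.of fun x y : Fin (i + 1) =>
        if x.val = r then 0 else famConst p Y x y).map C).det := by
  have h := Matrix.det_mul_column (fun x : Fin (i + 1) => if x.val = r then (X : ℤ[X]) else 1)
    (Matrix.of fun x y : Fin (i + 1) =>
      if x.val = r then if y.val = i then 1 else 0 else fam N p Y x y)
  have hprod : ∏ x : Fin (i + 1), (if x.val = r then (X : ℤ[X]) else 1) = X := by
    rw [Finset.prod_eq_single ⟨r, by omega⟩]
    · simp
    · intro b _ hb
      rw [if_neg fun h => hb (Fin.ext h)]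
    · simp
  rw [hprod] at h
  rw [fcof, cof, ← h]
  congr 1
  ext x y : 2
  simp only [Matrix.of_apply, Matrix.add_apply, Matrix.smul_apply, Matrix.map_apply, smul_eq_mul]
  split_ifs <;> simp [fam]

theorem natDegree_fcof_le {i r : ℕ} (hr : r ≤ i) : (fcof N p Y i r).natDegree ≤ i := by
  have h := natDegree_det_X_add_C_le (Matrix.of fun x y : Fin (i + 1) =>
        if x.val = r then if y.val = i then 1 else 0 else N x y)
      (Matrix.of fun x y : Fin (i + 1) => if x.val = r then 0 else famConst p Y x y)
  rw [← X_mul_fcof N p Y hr, Fintype.card_fin] at h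
  by_cases h0 : fcof N p Y i r = 0
  · simp [h0]
  · rw [natDegree_X_mul h0] at h
    omega

theorem coeff_fcof {i r : ℕ} (hr : r ≤ i) : (fcof N p Y i r).coeff i = cof N (i + 1) r i := by
  have h := coeff_det_X_add_C_card (Matrix.of fun x y : Fin (i + 1) =>
        if x.val = r then if y.val = i then 1 else 0 else N x y)
      (Matrix.of fun x y : Fin (i + 1) => if x.val = r then 0 else famConst p Y x y)
  rw [← X_mul_fcof N p Y hr, Fintype.card_fin, coeff_X_mul] at h
  rw [h, cof]

end

/-! ### The exponents found in the loop -/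

/-- If the resultant of `A₀ - y B₀` and `A₁ - y B₁` vanishes, these have a common root, which is a
root of `A₀ B₁ - A₁ B₀`. As `B₀` and `B₁` have no common root, it determines `y`. -/
theorem exists_res_ne_zero {A₀ A₁ B₀ B₁ : ℤ[X]} (hB : NoCommonRoot B₀ B₁) {D : ℕ}
    (hΔ : A₀ * B₁ - A₁ * B₀ ≠ 0) (hD : (A₀ * B₁ - A₁ * B₀).natDegree ≤ D) (y : ℕ → ℤ)
    (hy : Function.Injective y) (hne : ∀ j, A₁ - C (y j) * B₁ ≠ 0) :
    ∃ j, 1 ≤ j ∧ j ≤ D + 1 ∧ res (A₀ - C (y j) * B₀) (A₁ - C (y j) * B₁) ≠ 0 := by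
  by_contra! hcon
  have hroot : ∀ j, 1 ≤ j → j ≤ D + 1 → ∃ z : ℂ, aeval z A₀ = y j * aeval z B₀ ∧
      aeval z A₁ = y j * aeval z B₁ := by
    intro j h1 h2
    have := mt (res_ne_zero_iff (hne j)).2 (not_not.2 (hcon j h1 h2))
    simp only [NoCommonRoot, not_forall, not_or, not_not] at this
    obtain ⟨z, hz1, hz2⟩ := this
    refine ⟨z, ?_, ?_⟩
    · simpa [sub_eq_zero] using hz1
    · simpa [sub_eq_zero] using hz2
  choose! z hz0 hz1 using hroot
  have hinj : Function.Injective (algebraMap ℤ ℂ) := by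
    rw [algebraMap_int_eq]; exact Int.cast_injective
  have hcard := Finset.card_le_card_of_injOn (s := Finset.Icc 1 (D + 1))
    (t := ((A₀ * B₁ - A₁ * B₀).aroots ℂ).toFinset) z ?_ ?_
  · have h1 := Multiset.toFinset_card_le ((A₀ * B₁ - A₁ * B₀).aroots ℂ)
    have h2 := card_roots' ((A₀ * B₁ - A₁ * B₀).map (algebraMap ℤ ℂ))
    rw [natDegree_map_eq_of_injective hinj] at h2
    rw [Nat.card_Icc] at hcard
    rw [aroots] at h1 hcard
    omega
  · intro j hj
    obtain ⟨h1, h2⟩ := Finset.mem_Icc.1 hj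
    rw [Finset.mem_coe, Multiset.mem_toFinset, mem_aroots']
    refine ⟨(Polynomial.map_ne_zero_iff hinj).2 hΔ, ?_⟩
    rw [map_sub, map_mul, map_mul, hz0 j h1 h2, hz1 j h1 h2]; ring
  · intro j hj j' hj' hjj
    obtain ⟨h1, h2⟩ := Finset.mem_Icc.1 hj
    obtain ⟨h1', h2'⟩ := Finset.mem_Icc.1 hj'
    by_contra hne
    have hyy : ((y j : ℂ) - y j') ≠ 0 := by
      rw [sub_ne_zero]; exact_mod_cast fun h => hne (hy h)
    have e0 := hz0 j h1 h2
    have e1 := hz1 j h1 h2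
    have e0' := hz0 j' h1' h2'
    have e1' := hz1 j' h1' h2'
    rw [hjj] at e0 e1
    rcases hB (z j') with h | h
    · apply h
      apply (mul_eq_zero.1 (show ((y j : ℂ) - y j') * aeval (z j') B₀ = 0 by
        linear_combination e0' - e0)).resolve_left hyy
    · apply h
      apply (mul_eq_zero.1 (show ((y j : ℂ) - y j') * aeval (z j') B₁ = 0 by
        linear_combination e1' - e1)).resolve_left hyy

/-- At `0` only the entries next to the diagonal contribute to the second cofactor: it is, up to
sign, `p` times the product of `Y 2, …, Y (i + 1)`. -/
theorem eval_zero_fcof_one_ne_zero (N : ℕ → ℕ → ℤ) {p : ℤ} (hp : p ≠ 0) {Y : ℕ → ℤ}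
    {i : ℕ} (hY : ∀ k, 2 ≤ k → k ≤ i + 1 → Y k ≠ 0) : (fcof N p Y (i + 1) 1).eval 0 ≠ 0 := by
  induction i with
  | zero => rw [eval_zero_fcof_one_one]; exact hp
  | succ i ih =>
    rw [eval_zero_fcof_one_succ, neg_ne_zero]
    exact mul_ne_zero (hY _ (by omega) le_rfl) (ih fun k h1 h2 => hY k h1 (by omega))

theorem prime_dvd_of_dvd_eval_zero_fcof_one (N : ℕ → ℕ → ℤ) {p q : ℤ} (hq : Prime q) {J : ℕ → ℕ}
    {i : ℕ} (h : q ∣ (fcof N p (fun k => p ^ J k) (i + 1) 1).eval 0) : q ∣ p := by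
  induction i with
  | zero => rwa [eval_zero_fcof_one_one] at h
  | succ i ih =>
    rw [eval_zero_fcof_one_succ, dvd_neg] at h
    rcases hq.dvd_or_dvd h with h | h
    · exact hq.dvd_of_dvd_pow h
    · exact ih h

/-- The search for the exponent in row `i + 1` succeeds after at most `2 i + 2` attempts. -/
theorem exists_exponent (N : ℕ → ℕ → ℤ) {p : ℤ} (hp : 2 ≤ p) {Y : ℕ → ℤ} {i : ℕ}
    (hY : ∀ k, 1 ≤ k → k ≤ i → Y k ≠ 0)
    (hi : i = 0 ∨ res (fcof N p Y i 0) (fcof N p Y i 1) ≠ 0) :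
    ∃ j, 1 ≤ j ∧ j ≤ 2 * i + 2 ∧ res (fcof N p (Function.update Y (i + 1) (p ^ j)) (i + 1) 0)
      (fcof N p (Function.update Y (i + 1) (p ^ j)) (i + 1) 1) ≠ 0 := by
  have hp0 : p ≠ 0 := by omega
  have hinj : Function.Injective fun j : ℕ => p ^ j := by
    intro a b h
    have : (p.natAbs : ℕ) ^ a = p.natAbs ^ b := by
      rw [← Int.natAbs_pow, ← Int.natAbs_pow]; exact congrArg _ h
    exact Nat.pow_right_injective (by omega) this
  have hfc : ∀ (y : ℤ) (r : ℕ), r ≤ i → fcof N p (Function.update Y (i + 1) y) (i + 1) r =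
      fcof N p (Function.update Y (i + 1) 0) (i + 1) r - C y * fcof N p Y i r := fun y r hr => by
    rw [fcof_succ N p _ hr, Function.update_idem, Function.update_self,
      fcof_congr N p (Function.update Y (i + 1) y) (Y' := Y) (i := i) fun k _ h2 => by
        rw [Function.update_of_ne (by omega)]]
  have hY' : ∀ j k, 2 ≤ k → k ≤ i + 1 → Function.update Y (i + 1) (p ^ j) k ≠ 0 := by
    intro j k h1 h2
    by_cases h : k = i + 1
    · subst h; simp [hp0]
    · rw [Function.update_of_ne h]; exact hY k (by omega) (by omega)
  have hne : ∀ j : ℕ, fcof N p (Function.update Y (i + 1) (p ^ j)) (i + 1) 1 ≠ 0 := by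
    intro j h0
    have := eval_zero_fcof_one_ne_zero N hp0 (hY' j)
    simp [h0] at this
  rcases Nat.eq_zero_or_pos i with rfl | hpos
  · have h1 : ∀ y, fcof N p (Function.update Y (0 + 1) y) (0 + 1) 1 = fam N p Y 0 0 := fun y => by
      rw [fcof, cof, Matrix.det_fin_two]
      simp [fam, famConst]
    have h2 : fcof N p Y 0 0 = 1 := by
      rw [fcof, cof, Matrix.det_fin_one]; simp
    have hdeg : (fam N p Y 0 0).natDegree ≤ 1 := by
      rw [fam, mul_comm]; exact natDegree_linear_le
    have hΔ : fcof N p (Function.update Y (0 + 1) 0) (0 + 1) 0 * 0 - fam N p Y 0 0 * 1 ≠ 0 := by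
      simp only [mul_zero, zero_sub, mul_one, neg_ne_zero]
      rw [← h1 (p ^ 0)]; exact hne 0
    obtain ⟨j, hj1, hj2, hj⟩ := exists_res_ne_zero (B₀ := 1) (B₁ := 0) (fun z => .inl (by simp))
      (D := 1) hΔ (by simpa using hdeg) (fun j => p ^ j) hinj fun j => by
        simp only [mul_zero, sub_zero]
        rw [← h1 (p ^ j)]; exact hne j
    refine ⟨j, hj1, hj2, ?_⟩
    rw [hfc _ 0 le_rfl, h1, h2]
    simpa using hj
  · obtain ⟨l, rfl⟩ : ∃ l, i = l + 1 := ⟨i - 1, by omega⟩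
    set Y₀ := Function.update Y (l + 1 + 1) 0 with hY₀
    have hg : fcof N p Y (l + 1) 1 ≠ 0 := by
      intro h0
      have := eval_zero_fcof_one_ne_zero N hp0 (i := l) fun k h1 h2 => hY k (by omega) h2
      simp [h0] at this
    have hcop : NoCommonRoot (fcof N p Y (l + 1) 0) (fcof N p Y (l + 1) 1) :=
      (res_ne_zero_iff hg).1 (hi.resolve_left (by omega))
    have hΔ : fcof N p Y₀ (l + 1 + 1) 0 * fcof N p Y (l + 1) 1 -
        fcof N p Y₀ (l + 1 + 1) 1 * fcof N p Y (l + 1) 0 ≠ 0 := by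
      intro h0
      have := congrArg (eval 0) h0
      rw [eval_sub, eval_mul, eval_mul, eval_zero] at this
      have e1 : (fcof N p Y₀ (l + 1 + 1) 1).eval 0 = 0 := by
        rw [eval_zero_fcof]; exact cof_famConst_one p Y₀ (by simp [hY₀])
      rw [e1, zero_mul, sub_zero] at this
      rcases mul_eq_zero.1 this with h | h
      · rw [eval_zero_fcof] at h
        exact cof_famConst_zero p Y₀ hp0 (by simp [hY₀]) h
      · exact eval_zero_fcof_one_ne_zero N hp0 (i := l) (fun k h1 h2 => hY k (by omega) h2) h
    have hdeg : (fcof N p Y₀ (l + 1 + 1) 0 * fcof N p Y (l + 1) 1 -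
        fcof N p Y₀ (l + 1 + 1) 1 * fcof N p Y (l + 1) 0).natDegree ≤ 2 * (l + 1) + 1 := by
      refine (natDegree_sub_le _ _).trans (max_le ?_ ?_)
      · refine natDegree_mul_le.trans ?_
        have := natDegree_fcof_le N p Y₀ (i := l + 1 + 1) (r := 0) (by omega)
        have := natDegree_fcof_le N p Y (i := l + 1) (r := 1) (by omega)
        omega
      · refine natDegree_mul_le.trans ?_
        have := natDegree_fcof_le N p Y₀ (i := l + 1 + 1) (r := 1) (by omega)
        have := natDegree_fcof_le N p Y (i := l + 1) (r := 0) (by omega)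
        omega
    obtain ⟨j, hj1, hj2, hj⟩ := exists_res_ne_zero hcop hΔ hdeg (fun j => p ^ j) hinj fun j => by
      rw [← hfc _ 1 (by omega)]
      exact hne j
    refine ⟨j, hj1, hj2, ?_⟩
    rw [hfc _ 0 (by omega), hfc _ 1 (by omega)]
    exact hj

/-! ### The sizes of coefficients -/

/-- The sum of the absolute values of the coefficients. -/
def norm1 (f : ℤ[X]) : ℤ := ∑ i ∈ f.support, |f.coeff i|

theorem norm1_eq_sum {f : ℤ[X]} {s : Finset ℕ} (h : f.support ⊆ s) :
    norm1 f = ∑ i ∈ s, |f.coeff i| :=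
  Finset.sum_subset h fun i _ hi => by simp [notMem_support_iff.1 hi]

theorem norm1_eq_sum_range {f : ℤ[X]} {d : ℕ} (h : f.natDegree ≤ d) :
    norm1 f = ∑ i ∈ Finset.range (d + 1), |f.coeff i| :=
  norm1_eq_sum fun i hi => by
    have := le_natDegree_of_mem_supp i hi
    simp; omega

theorem norm1_nonneg (f : ℤ[X]) : 0 ≤ norm1 f := Finset.sum_nonneg fun _ _ => abs_nonneg _

theorem abs_coeff_le_norm1 (f : ℤ[X]) (k : ℕ) : |f.coeff k| ≤ norm1 f := by
  rw [norm1_eq_sum (Finset.subset_insert k f.support)]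
  exact Finset.single_le_sum (f := fun i => |f.coeff i|) (fun _ _ => abs_nonneg _)
    (Finset.mem_insert_self _ _)

theorem norm1_zero : norm1 0 = 0 := by simp [norm1]

theorem norm1_one : norm1 1 = 1 := by
  rw [norm1_eq_sum_range (d := 0) (by simp)]
  simp

theorem norm1_neg (f : ℤ[X]) : norm1 (-f) = norm1 f := by simp [norm1]

theorem norm1_add_le (f g : ℤ[X]) : norm1 (f + g) ≤ norm1 f + norm1 g := by
  rw [norm1_eq_sum (f := f) (s := f.support ∪ g.support) Finset.subset_union_left,
    norm1_eq_sum (f := g) (s := f.support ∪ g.support) Finset.subset_union_right,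
    norm1_eq_sum (s := f.support ∪ g.support) support_add, ← Finset.sum_add_distrib]
  exact Finset.sum_le_sum fun i _ => by rw [coeff_add]; exact abs_add_le _ _

theorem norm1_sum_le {ι : Type*} (s : Finset ι) (f : ι → ℤ[X]) :
    norm1 (∑ i ∈ s, f i) ≤ ∑ i ∈ s, norm1 (f i) :=
  Finset.le_sum_of_subadditive norm1 norm1_zero.le norm1_add_le s f

theorem norm1_monomial_mul_le (k : ℕ) (a : ℤ) (g : ℤ[X]) :
    norm1 (monomial k a * g) ≤ |a| * norm1 g := by
  rw [norm1_eq_sum (f := monomial k a * g) (s := g.support.image (· + k))]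
  · rw [Finset.sum_image fun x _ y _ h => by simpa using h, norm1, Finset.mul_sum]
    refine Finset.sum_le_sum fun i _ => ?_
    rw [coeff_monomial_mul, abs_mul]
  · intro i hi
    rw [mem_support_iff] at hi
    rw [Finset.mem_image]
    by_cases h : k ≤ i
    · refine ⟨i - k, ?_, by omega⟩
      rw [mem_support_iff]
      intro h0
      obtain ⟨j, rfl⟩ := Nat.exists_eq_add_of_le' h
      rw [coeff_monomial_mul] at hi
      rw [Nat.add_sub_cancel] at h0
      simp [h0] at hi
    · rw [← C_mul_X_pow_eq_monomial, mul_assoc, coeff_C_mul, coeff_X_pow_mul', if_neg h] at hi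
      simp at hi

theorem norm1_mul_le (f g : ℤ[X]) : norm1 (f * g) ≤ norm1 f * norm1 g := by
  conv_lhs => rw [f.as_sum_support, Finset.sum_mul]
  refine (norm1_sum_le _ _).trans ?_
  rw [norm1, Finset.sum_mul]
  exact Finset.sum_le_sum fun i _ => norm1_monomial_mul_le _ _ _

theorem norm1_prod_le {ι : Type*} (s : Finset ι) (f : ι → ℤ[X]) :
    norm1 (∏ i ∈ s, f i) ≤ ∏ i ∈ s, norm1 (f i) := by
  classical
  induction s using Finset.induction_on with
  | empty => simp [norm1_one]
  | insert a s ha ih =>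
    rw [Finset.prod_insert ha, Finset.prod_insert ha]
    exact (norm1_mul_le _ _).trans (mul_le_mul_of_nonneg_left ih (norm1_nonneg _))

theorem norm1_C (a : ℤ) : norm1 (C a) = |a| := by
  rw [norm1_eq_sum_range (d := 0) (by simp)]
  simp

theorem norm1_det_le {k : ℕ} {β : ℤ} (hβ : 1 ≤ β) (M : Matrix (Fin k) (Fin k) ℤ[X])
    (hM : ∀ i j, norm1 (M i j) ≤ β) : norm1 M.det ≤ (k * β) ^ k := by
  rw [Matrix.det_apply]
  have h1 : norm1 (∑ σ : Equiv.Perm (Fin k), Equiv.Perm.sign σ • ∏ i, M (σ i) i) ≤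
      ∑ _σ : Equiv.Perm (Fin k), β ^ k := by
    refine (norm1_sum_le _ _).trans (Finset.sum_le_sum fun σ _ => ?_)
    have h : norm1 (∏ i, M (σ i) i) ≤ β ^ k := by
      refine (norm1_prod_le _ _).trans ?_
      have := Finset.prod_le_prod (s := Finset.univ) (f := fun i => norm1 (M (σ i) i))
        (g := fun _ => β) (fun i _ => norm1_nonneg _) fun i _ => hM _ _
      simpa using this
    rcases Int.units_eq_one_or (Equiv.Perm.sign σ) with hs | hs
    · rw [hs, one_smul]; exact h
    · rw [hs, Units.neg_smul, one_smul, norm1_neg]; exact h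
  refine h1.trans ?_
  rw [Finset.sum_const, Finset.card_univ, Fintype.card_perm, Fintype.card_fin, nsmul_eq_mul,
    mul_pow]
  have : (k.factorial : ℤ) ≤ (k : ℤ) ^ k := by exact_mod_cast Nat.factorial_le_pow k
  gcongr

theorem abs_eval_le {f : ℤ[X]} {d : ℕ} (hd : f.natDegree ≤ d) {x : ℤ} (hx : 1 ≤ |x|) :
    |f.eval x| ≤ norm1 f * |x| ^ d := by
  rw [eval_eq_sum_range' (n := d + 1) (by omega), norm1_eq_sum_range hd, Finset.sum_mul]
  refine (Finset.abs_sum_le_sum_abs _ _).trans (Finset.sum_le_sum fun i hi => ?_)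
  rw [abs_mul, abs_pow]
  have : i ≤ d := by simp at hi; omega
  gcongr

theorem norm1_fam_le (N : ℕ → ℕ → ℤ) (p : ℤ) (Y : ℕ → ℤ) (i j : ℕ) :
    norm1 (fam N p Y i j) ≤ |N i j| + |famConst p Y i j| := by
  refine (norm1_add_le _ _).trans ?_
  rw [norm1_C]
  have : norm1 (X * C (N i j)) ≤ |N i j| := by
    have := norm1_monomial_mul_le 1 1 (C (N i j))
    rw [norm1_C] at this
    simpa [monomial_one_one_eq_X] using this
  omega

theorem abs_famConst_le (p : ℤ) (Y : ℕ → ℤ) (i j : ℕ) :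
    |famConst p Y i j| ≤ 2 * |p| + if i = 0 then 0 else |Y i| := by
  have h1 := abs_nonneg p
  have h2 := abs_nonneg (Y i)
  unfold famConst
  have h3 : |if i = j then p else 0| ≤ |p| := by split_ifs <;> simp
  rcases Nat.eq_zero_or_pos i with rfl | hi
  · simp only [if_true, add_zero]; omega
  · have hi0 : i ≠ 0 := by omega
    simp only [hi0, if_false]
    have h4 : |if j = 0 then p else 0| ≤ |p| := by split_ifs <;> simp
    have h5 : |if j + 1 = i then Y i else 0| ≤ |Y i| := by split_ifs <;> simp
    have h6 := abs_add_le (if i = j then p else 0)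
      ((if j = 0 then p else 0) + if j + 1 = i then Y i else 0)
    have h7 := abs_add_le (if j = 0 then p else 0) (if j + 1 = i then Y i else 0)
    omega

theorem norm1_cof_le {A : ℕ → ℕ → ℤ[X]} {k : ℕ} {β : ℤ} (hβ : 1 ≤ β)
    (hA : ∀ i < k, ∀ j < k, norm1 (A i j) ≤ β) (r c : ℕ) : norm1 (cof A k r c) ≤ (k * β) ^ k := by
  refine norm1_det_le hβ _ fun i j => ?_
  simp only [Matrix.of_apply]
  split_ifs
  · rw [norm1_one]; exact hβ
  · rw [norm1_zero]; omega
  · exact hA i i.2 j j.2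

theorem abs_res_le {f g : ℤ[X]} {β : ℤ} (hβ : 1 ≤ β) {k : ℕ} (hf : norm1 f ≤ β)
    (hg : norm1 g ≤ β) (hfk : 2 * f.natDegree ≤ k) (hgk : 2 * g.natDegree ≤ k) :
    |res f g| ≤ (k * β) ^ k := by
  refine abs_det_le (by omega) hβ _ fun i j => ?_
  rw [sylvester_apply]
  have h1 := fun k => (abs_coeff_le_norm1 f k).trans hf
  have h2 := fun k => (abs_coeff_le_norm1 g k).trans hg
  split_ifs <;> first | exact h1 _ | exact h2 _ | (simp; omega)

/-! ### Cofactors, changes of base and resultants by programs -/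

theorem pack_shift (Z : ℤ) (M : ℕ) (φ : ℕ → ℤ) (u : ℕ) :
    pack Z (u + M) (fun t => if u ≤ t then φ (t - u) else 0) = Z ^ u * pack Z M φ := by
  induction u with
  | zero => simp
  | succ u ih =>
    rw [show u + 1 + M = u + M + 1 by omega, pack_succ, if_neg (by omega), zero_add, pow_succ',
      mul_assoc, ← ih]
    congr 1
    refine pack_congr fun j _ => ?_
    by_cases h : u ≤ j
    · rw [if_pos h, if_pos (by omega)]; congr 1; omega
    · rw [if_neg h, if_neg (by omega)]

theorem pack_eq_of_zero {Z : ℤ} {M M' : ℕ} (h : M ≤ M') {φ : ℕ → ℤ}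
    (h0 : ∀ j, M ≤ j → φ j = 0) : pack Z M' φ = pack Z M φ := by
  refine (Finset.sum_subset (Finset.range_subset_range.2 h) fun j _ hj => ?_).symm
  rw [h0 j (by simpa using hj), zero_mul]

theorem pack_single {Z : ℤ} {N c : ℕ} (h : c < N) :
    pack Z N (fun y => if y = c then 1 else 0) = Z ^ c := by
  simp [pack, h]

theorem eval_eq_pack {f : ℤ[X]} {M : ℕ} (h : f.natDegree < M) (x : ℤ) :
    f.eval x = pack x M f.coeff := eval_eq_sum_range' h x

theorem pow_le_pow_of_le {k n : ℕ} (h : k ≤ n) {b : ℤ} (hb : 1 ≤ b) :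
    ((k : ℤ) * b) ^ k ≤ (n * b) ^ n := by
  rcases Nat.eq_zero_or_pos n with rfl | hn
  · obtain rfl : k = 0 := by omega
    simp
  have h1 : (1 : ℤ) ≤ n * b := by nlinarith [show (1 : ℤ) ≤ n by exact_mod_cast hn]
  have h2 : (k : ℤ) ≤ n := by exact_mod_cast h
  calc ((k : ℤ) * b) ^ k ≤ (n * b) ^ k := by gcongr
    _ ≤ (n * b) ^ n := pow_le_pow_right₀ h1 h

/-- The matrix with row `r` replaced by the unit vector of index `c`. -/
def unitRow (A : ℕ → ℕ → ℤ) (r c : ℕ) : ℕ → ℕ → ℤ :=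
  fun x y => if x = r then if y = c then 1 else 0 else A x y

/-- The determinant of the leading block of size (register `50`) of the matrix whose packed rows
start at the address in register `51`, after row (register `52`) is replaced by register `53`. -/
def cofProg : Program :=
  .seq (forE 54 (.const 0) (.reg 50) (put (work (.reg 54)) (.load (.reg 51 + .reg 54)))) <|
  .seq (put (work (.reg 52)) (.reg 53)) detProg

theorem run_cofProg {O : List ℤ → ℤ} {B : ℕ} (hB : 10 ^ 6 ≤ B) {σ : State} {Z b s v : ℤ}
    {k N r c : ℕ} {A : ℕ → ℕ → ℤ} (h5 : σ.reg 5 = Z) (h50 : σ.reg 50 = k)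
    (h51 : σ.reg 51 = s) (hs : 0 ≤ s) (h52 : σ.reg 52 = r) (hr : r ≤ k) (h53 : σ.reg 53 = v)
    (hv : v = Z ^ c) (hc : c < N) (hb : 1 ≤ b) (hZ : 2 * (k * b) ^ k < Z) (hk : k ≤ N)
    (hBZ : Z ^ N ≤ B) (hA : ∀ i < k, ∀ j, |A i j| ≤ b)
    (hw : ∀ i : ℕ, i < k → σ.mem (s + i) = pack Z N (A i)) :
    Run O B cofProg σ (3000 * (k + 1) ^ 2) fun σ' =>
      Frame 54 σ σ' ∧ σ'.reg 60 = lead (unitRow A r c) k := by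
  apply Run.of_bounded
  intro hσ
  have hkB : (k : ℤ) ≤ B := by simpa [h50] using hσ.1 50 (by norm_num)
  have main : Run O B cofProg σ (k * (121 + 121) + 121 + (121 + 2000 * (k + 1) ^ 2)) fun σ' =>
      Frame 54 σ σ' ∧ σ'.reg 60 = lead (unitRow A r c) k := by
    refine .seq ?_
    refine .forE hB (by decide) 0 k 121 (fun t σ' => t ≤ k ∧ Frame 54 σ σ' ∧ σ'.reg 54 = t ∧
      ∀ i : ℕ, i < t → σ'.mem (-1 - i) = pack Z N (A i)) rfl (by simp) (by simpa using hkB)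
      ?_ ?_ ?_ ?_
    · exact ⟨by omega, (Frame.refl _ _).set le_rfl, by simp, by omega⟩
    · rintro t σ' ⟨_, hF, h54, -⟩
      exact ⟨by simp [h54], by simp [hF.1 50 (by norm_num), h50]⟩
    · rintro t σ' ht ⟨-, hF, h54, hm⟩
      have hval : (Expr.load (.reg 51 + .reg 54)).eval σ' = pack Z N (A t) := by
        simp only [Expr.eval_load, Expr.eval_add, Expr.eval_reg, h54, hF.1 51 (by norm_num), h51]
        rw [hF.2 _ (by omega), hw t ht]
      have hbd : |pack Z N (A t)| ≤ B := by
        rw [← hw t ht]; exact hσ.2 _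
      refine .put hB (by decide) (by rw [hval]; exact hbd) ?_
      rw [hval]
      refine ⟨by simp [h54], by omega, (hF.put (by simp [h54]; omega)).set le_rfl, by simp, ?_⟩
      intro i hi
      simp only [mem_setReg, mem_setMem, eval_work, Expr.eval_reg, h54]
      by_cases h : i = t
      · subst h; simp
      · rw [if_neg (by omega)]; exact hm i (by omega)
    · rintro σ₁ ⟨-, hF₁, -, hm₁⟩
      have c53 : σ₁.reg 53 = v := (hF₁.1 53 (by norm_num)).trans h53
      have c52 : σ₁.reg 52 = r := (hF₁.1 52 (by norm_num)).trans h52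
      refine .seq (.put hB (by decide) ?_ ?_)
      · rw [Expr.eval_reg, c53, ← h53]; exact hσ.1 53 (by norm_num)
      refine (run_detProg (A₀ := unitRow A r c) (N := N) hB (σ := _) (Z := Z) (b := b) (k := k)
        ?_ ?_ hb hZ hk (by omega) hBZ ?_ ?_).mono le_rfl ?_
      · simp [hF₁.1 5 (by norm_num), h5]
      · simp [hF₁.1 50 (by norm_num), h50]
      · intro i hi j
        unfold unitRow
        split_ifs
        · simpa using hb
        · simp; omega
        · exact hA i hi j
      · intro i hi
        simp only [mem_setMem, eval_work, Expr.eval_reg, c52, c53]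
        by_cases h : i = r
        · subst h
          have : unitRow A i c i = fun y => if y = c then 1 else 0 := by
            funext y; simp [unitRow]
          rw [if_pos rfl, this, pack_single hc, hv]
        · have : unitRow A r c i = A i := by
            funext y; simp [unitRow, h]
          rw [if_neg (by omega), hm₁ i hi, this]
      · rintro σ₂ ⟨hF₂, h60⟩
        refine ⟨?_, h60⟩
        refine (hF₁.put ?_).trans (hF₂.mono (by norm_num))
        simp [c52]; omega
  refine main.mono ?_ fun _ h => h
  nlinarith

theorem lead_unitRow (A : ℕ → ℕ → ℤ) (k r c : ℕ) : lead (unitRow A r c) k = cof A k r c := rfl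

theorem lead_unitRow_self (A : ℕ → ℕ → ℤ) (k c : ℕ) : lead (unitRow A k c) k = lead A k := by
  unfold lead
  congr 1
  ext x y
  simp [unitRow, x.2.ne]

/-- The integer in register `40`, with balanced digits in base register `6`, is converted to base
register `42`; the number of digits is in register `41`. The result is in register `43`, and
register `44` holds the index of the last nonzero digit. -/
def repackProg : Program :=
  .seq (set 43 (.const 0)) <| .seq (set 44 (.const 0)) <| .seq (set 46 (.const 1)) <|
  forE 45 (.const 0) (.reg 41) <|
    .seq (set 47 (digitTail (.reg 40) (.reg 6))) <|
    .seq (set 48 (.reg 40 - .reg 6 * .reg 47)) <|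
    .seq (set 43 (.reg 43 + .reg 48 * .reg 46)) <|
    .seq (set 46 (.reg 46 * .reg 42)) <|
    .seq (set 40 (.reg 47)) <|
    ifE (.reg 48 * .reg 48) (set 44 (.reg 45)) skip

theorem run_repackProg {O : List ℤ → ℤ} {B : ℕ} (hB : 10 ^ 6 ≤ B) {σ : State} {x τ : ℤ}
    {f : ℤ[X]} {M : ℕ} (h6 : σ.reg 6 = x) (h40 : σ.reg 40 = f.eval x) (h41 : σ.reg 41 = M)
    (h42 : σ.reg 42 = τ) (hf : f.natDegree < M) (hd : ∀ j, 2 * |f.coeff j| < x)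
    (hx : x ^ M ≤ B) (hτ : ∀ t ≤ M, |τ ^ t| ≤ B)
    (hp : ∀ t ≤ M, |pack τ t f.coeff| ≤ B) :
    Run O B repackProg σ (M * 542 + 301) fun σ' => Frame 40 σ σ' ∧ σ'.reg 41 = M ∧
      σ'.reg 42 = τ ∧ σ'.reg 43 = f.eval τ ∧ σ'.reg 44 = f.natDegree := by
  apply Run.of_bounded
  intro hσ
  have hx1 : 1 ≤ x := by have := hd 0; have := abs_nonneg (f.coeff 0); omega
  have hB' : (10 : ℤ) ^ 6 ≤ B := by exact_mod_cast hB
  have hMB : (M : ℤ) ≤ B := by simpa [h41] using hσ.1 41 (by norm_num)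
  have htail : ∀ t ≤ M, |pack x (M - t) fun s => f.coeff (t + s)| ≤ B := fun t ht => by
    have h1 := two_mul_abs_pack_lt hx1 (N := M - t) fun s _ => hd (t + s)
    have h2 : x ^ (M - t) ≤ x ^ M := pow_le_pow_right₀ hx1 (by omega)
    have := abs_nonneg (pack x (M - t) fun s => f.coeff (t + s))
    omega
  have hxM : x ≤ x ^ M := by simpa using pow_le_pow_right₀ hx1 (show 1 ≤ M by omega)
  have main : ∃ T ≤ M * 542 + 301, Run O B repackProg σ T fun σ' => Frame 40 σ σ' ∧
      σ'.reg 41 = M ∧ σ'.reg 42 = τ ∧ σ'.reg 43 = f.eval τ ∧ σ'.reg 44 = f.natDegree := by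
    refine ⟨60 + (60 + (60 + (M * (421 + 121) + 121))), by omega, ?_⟩
    refine .seq (.set hB (by decide) (by simp) ?_)
    refine .seq (.set hB (by decide) (by simp) ?_)
    refine .seq (.set hB (by decide) (by simp; omega) ?_)
    refine .forE hB (by decide) 0 M 421 (fun t σ' => t ≤ M ∧ Frame 40 σ σ' ∧ σ'.reg 41 = M ∧
      σ'.reg 42 = τ ∧ σ'.reg 45 = t ∧ σ'.reg 46 = τ ^ t ∧ σ'.reg 43 = pack τ t f.coeff ∧
      (σ'.reg 40 = pack x (M - t) fun s => f.coeff (t + s)) ∧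
      ∃ D : ℕ, σ'.reg 44 = D ∧ (D = 0 ∨ f.coeff D ≠ 0) ∧ ∀ s < t, f.coeff s ≠ 0 → s ≤ D)
      rfl (by simp) (by simpa using hMB) ?_ ?_ ?_ ?_
    · refine ⟨by omega, ?_, by simp [h41], by simp [h42], by simp, by simp,
        by simp [pack_zero], ?_, 0, by simp, by simp, by omega⟩
      · exact ((((Frame.refl _ _).set (by norm_num)).set (by norm_num)).set
          (by norm_num)).set (by norm_num)
      · simp [h40, eval_eq_pack hf]
    · rintro t σ' ⟨_, hF, h41', -, h45, -⟩
      exact ⟨by simp [h45], by simp [h41']⟩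
    · rintro t σ' ht ⟨-, hF, g41, g42, g45, g46, g43, g40, D, g44, hD1, hD2⟩
      have g6 := (hF.1 6 (by norm_num)).trans h6
      have hsplit : (pack x (M - t) fun s => f.coeff (t + s)) =
          f.coeff t + x * pack x (M - (t + 1)) fun s => f.coeff (t + 1 + s) := by
        rw [show M - t = M - (t + 1) + 1 by omega, pack_succ]
        simp only [add_zero, add_assoc, add_comm 1]
      have hdt := hd t
      have hT := div_of_two_mul_abs_lt (t := pack x (M - (t + 1)) fun s => f.coeff (t + 1 + s)) hdt
      rw [← hsplit] at hT
      have hdig : (pack x (M - t) fun s => f.coeff (t + s)) -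
          x * (pack x (M - (t + 1)) fun s => f.coeff (t + 1 + s)) = f.coeff t := by
        rw [hsplit]; ring
      have hct : |f.coeff t| ≤ B := by omega
      have hpk : pack τ t f.coeff + f.coeff t * τ ^ t = pack τ (t + 1) f.coeff :=
        (Finset.sum_range_succ _ _).symm
      refine Run.mono (T := 60 + (60 + (60 + (60 + (60 + (60 + 61)))))) ?_ (by norm_num) fun _ h => h
      refine .seq (.set hB (by decide) (by simpa [g40, g6, hT] using htail (t + 1) ht) ?_)
      refine .seq (.set hB (by decide) (by simpa [g40, g6, hT, hdig] using hct) ?_)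
      refine .seq (.set hB (by decide)
        (by simpa [g40, g6, hT, hdig, g43, g46, hpk] using hp (t + 1) ht) ?_)
      refine .seq (.set hB (by decide) (by simpa [g46, g42, ← pow_succ] using hτ (t + 1) ht) ?_)
      refine .seq (.set hB (by decide) (by simpa [g40, g6, hT] using htail (t + 1) ht) ?_)
      have hF' : ∀ {σ'' : State} {z : ℤ} (d : ℕ), 40 ≤ d → Frame 40 σ σ'' →
          Frame 40 σ (σ''.setReg d z) := fun d hd h => h.set hd
      refine .ifE hB (by decide) (fun hpos => ?_) (fun hneg => (Run.skip ?_).mono (by norm_num)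
        fun _ h => h)
      · simp [g40, g6, hT, hdig] at hpos
        refine .set hB (by decide) (by simpa [g45] using le_trans (show (t : ℤ) ≤ M by exact_mod_cast ht.le) hMB) ?_
        refine ⟨by simp [g45], by omega, ?_, by simp [g41], by simp [g42], by simp,
          by simp [g46, g42, pow_succ], by simp [g40, g6, hT, hdig, g43, g46, hpk],
          by simp [g40, g6, hT], t, by simp [g45], .inr (by simpa using hpos), by omega⟩
        iterate 7 refine hF' _ (by norm_num) ?_
        exact hF
      · simp [g40, g6, hT, hdig] at hneg
        have h0 : f.coeff t = 0 := by nlinarith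
        refine ⟨by simp [g45], by omega, ?_, by simp [g41], by simp [g42], by simp,
          by simp [g46, g42, pow_succ], by simp [g40, g6, hT, hdig, g43, g46, hpk],
          by simp [g40, g6, hT], D, by simp [g44], hD1, fun s hs hs' => ?_⟩
        · iterate 6 refine hF' _ (by norm_num) ?_
          exact hF
        · rcases Nat.lt_succ_iff_lt_or_eq.1 hs with h | rfl
          · exact hD2 s h hs'
          · exact absurd h0 hs'
    · rintro σ' ⟨-, hF, g41, g42, -, -, g43, -, D, g44, hD1, hD2⟩
      refine ⟨hF, g41, g42, by rw [g43, eval_eq_pack hf], ?_⟩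
      rw [g44]
      have h1 : D ≤ f.natDegree := by
        rcases hD1 with rfl | h
        · omega
        · exact le_natDegree_of_ne_zero h
      have h2 : f.natDegree ≤ D := by
        by_cases h0 : f = 0
        · simp [h0]
        · exact hD2 _ hf (by simpa using h0)
      exact_mod_cast le_antisymm h1 h2
  obtain ⟨T, hT, h⟩ := main
  exact h.mono hT fun _ h => h

/-! ### The test of a candidate in the loop -/

theorem abs_pack_coeff_le (f : ℤ[X]) {τ : ℤ} (hτ : 1 ≤ |τ|) (t : ℕ) :
    |pack τ t f.coeff| ≤ norm1 f * |τ| ^ t := by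
  calc |pack τ t f.coeff| ≤ ∑ j ∈ Finset.range t, |f.coeff j * τ ^ j| :=
        Finset.abs_sum_le_sum_abs _ _
    _ ≤ ∑ j ∈ Finset.range t, |f.coeff j| * |τ| ^ t := by
        refine Finset.sum_le_sum fun j hj => ?_
        rw [abs_mul, abs_pow]
        exact mul_le_mul_of_nonneg_left (pow_le_pow_right₀ hτ (Finset.mem_range.1 hj).le)
          (abs_nonneg _)
    _ = (∑ j ∈ Finset.range t, |f.coeff j|) * |τ| ^ t := by rw [Finset.sum_mul]
    _ ≤ norm1 f * |τ| ^ t := by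
        gcongr
        rw [norm1_eq_sum (s := f.support ∪ Finset.range t) Finset.subset_union_left]
        exact Finset.sum_le_sum_of_subset_of_nonneg Finset.subset_union_right
          fun _ _ _ => abs_nonneg _

theorem natDegree_fam_le (N : ℕ → ℕ → ℤ) (p : ℤ) (Y : ℕ → ℤ) (i j : ℕ) :
    (fam N p Y i j).natDegree ≤ 1 := by
  unfold fam
  compute_degree

theorem eval_cof_fam (N : ℕ → ℕ → ℤ) (p : ℤ) (Y : ℕ → ℤ) (k r c : ℕ) (x : ℤ) :
    (cof (fam N p Y) k r c).eval x = cof (fun u v => (fam N p Y u v).eval x) k r c :=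
  map_cof (evalRingHom x) _ _ _ _

/-- The relations between the bound `β` for the coefficients of the entries of the polynomial
matrix, the value `x` that encodes polynomials by integers, the base `Z` for packed rows, and the
bound `B` for all integers. -/
structure Sizes (n : ℕ) (β x Z : ℤ) (B : ℕ) : Prop where
  hB : 10 ^ 6 ≤ B
  hn : 2 ≤ n
  hβ : 1 ≤ β
  hx : 2 * (n * β) ^ n < x
  hZ : 2 * (n * (β * x)) ^ n < Z
  hR : 2 * ((2 * n : ℕ) * (n * β) ^ n) ^ (2 * n) < Z
  hZB : Z ^ (2 * n) ≤ B

section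

variable {n : ℕ} {β x Z : ℤ} {B : ℕ}

theorem Sizes.one_le_coeff (h : Sizes n β x Z B) : 1 ≤ (n * β) ^ n := by
  have := h.hn; have := h.hβ
  refine one_le_pow₀ ?_
  have : (1 : ℤ) ≤ n := by omega
  nlinarith

theorem Sizes.one_le_x (h : Sizes n β x Z B) : 1 ≤ x := by
  have := h.one_le_coeff; have := h.hx; omega

theorem Sizes.x_lt (h : Sizes n β x Z B) : 2 * x < Z := by
  have h1 := h.one_le_x; have h2 := h.hβ; have h3 := h.hn
  have h4 : (1 : ℤ) ≤ n := by omega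
  have h5 : x ≤ β * x := by nlinarith
  have h6 : x ≤ n * (β * x) := by nlinarith
  have h7 : n * (β * x) ≤ (n * (β * x)) ^ n := by
    conv_lhs => rw [← pow_one (n * (β * x))]
    exact pow_le_pow_right₀ (by omega) (by omega)
  have := h.hZ
  omega

theorem Sizes.Z_pow_le (h : Sizes n β x Z B) {t : ℕ} (ht : t ≤ 2 * n) : Z ^ t ≤ B :=
  (pow_le_pow_right₀ (by have := h.x_lt; have := h.one_le_x; omega) ht).trans h.hZB

theorem Sizes.norm1_cof_lt (h : Sizes n β x Z B) {A : ℕ → ℕ → ℤ[X]} {k : ℕ} (hk : k ≤ n)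
    (hA : ∀ i < k, ∀ j < n, norm1 (A i j) ≤ β) (r c : ℕ) : norm1 (cof A k r c) ≤ (n * β) ^ n :=
  (norm1_cof_le h.hβ (fun i hi j hj => hA i hi j (by omega)) r c).trans
    (pow_le_pow_of_le hk h.hβ)

end

/-- A cofactor of the polynomial matrix whose rows are packed from register `51` on; it is
evaluated at register `42`. -/
def evalCofProg : Program := .seq cofProg (.seq (set 40 (.reg 60)) repackProg)

theorem evalCof_cost {k n M : ℕ} (hk : k ≤ n) (hM : M ≤ n + 1) (hn : 2 ≤ n) :
    3000 * (k + 1) ^ 2 + (60 + (M * 542 + 301)) ≤ 4000 * (n + 1) ^ 2 := by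
  have h1 : 3000 * (k + 1) ^ 2 ≤ 3000 * (n + 1) ^ 2 := by gcongr
  have h2 : 3 * (n + 1) ≤ (n + 1) ^ 2 := by nlinarith
  omega

theorem run_evalCofProg {O : List ℤ → ℤ} {B : ℕ} {n : ℕ} {β x Z : ℤ} (hS : Sizes n β x Z B)
    {σ : State} {s τ v : ℤ} {k r c M : ℕ} {N : ℕ → ℕ → ℤ} {p : ℤ} {Y : ℕ → ℤ}
    (h5 : σ.reg 5 = Z) (h6 : σ.reg 6 = x) (h50 : σ.reg 50 = k) (h51 : σ.reg 51 = s) (hs : 0 ≤ s)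
    (h52 : σ.reg 52 = r) (hr : r ≤ k) (h53 : σ.reg 53 = v) (hv : v = Z ^ c) (hc : c < n)
    (hk : k ≤ n) (h41 : σ.reg 41 = M) (hM : M ≤ n + 1) (h42 : σ.reg 42 = τ) (hτ1 : 1 ≤ |τ|)
    (hτ : x * |τ| ^ (n + 1) ≤ B) (hdeg : (cof (fam N p Y) k r c).natDegree < M)
    (hfam : ∀ u < k, ∀ v < n, norm1 (fam N p Y u v) ≤ β)
    (hw : ∀ u : ℕ, u < k → σ.mem (s + u) = pack Z n fun v => (fam N p Y u v).eval x) :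
    Run O B evalCofProg σ (4000 * (n + 1) ^ 2) fun σ' => Frame 40 σ σ' ∧ σ'.reg 41 = M ∧
      σ'.reg 42 = τ ∧ σ'.reg 43 = (cof (fam N p Y) k r c).eval τ ∧
      σ'.reg 44 = (cof (fam N p Y) k r c).natDegree := by
  have hB := hS.hB
  have hx1 := hS.one_le_x
  have hxZ := hS.x_lt
  have hβ := hS.hβ
  set f := cof (fam N p Y) k r c with hf
  have hfn : norm1 f ≤ (n * β) ^ n := hS.norm1_cof_lt hk hfam r c
  have hxf := hS.hx
  have hβx : 1 ≤ β * x := by nlinarith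
  have hkn : ((k : ℤ) * (β * x)) ^ k ≤ (n * (β * x)) ^ n := pow_le_pow_of_le hk hβx
  let A : ℕ → ℕ → ℤ := fun u v => if v < n then (fam N p Y u v).eval x else 0
  have hA : f.eval x = lead (unitRow A r c) k := by
    rw [hf, eval_cof_fam, lead_unitRow]
    refine cof_congr (fun i _ j hj => ?_) r c
    simp [A, show j < n by omega]
  have hfB : |f.eval x| ≤ B := by
    have h1 : |f.eval x| ≤ Z := by
      rw [hA]
      refine (abs_det_le (le_refl k) hβx _ fun i j => ?_).trans ?_
      · simp only [Matrix.of_apply, unitRow, A]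
        split_ifs
        · simpa using hβx
        · simp; omega
        · refine (abs_eval_le (natDegree_fam_le N p Y _ _) (by rwa [abs_of_nonneg (by omega)])).trans ?_
          rw [pow_one, abs_of_nonneg (by omega : 0 ≤ x)]
          exact mul_le_mul_of_nonneg_right (hfam _ i.2 _ (by assumption)) (by omega)
        · simp; omega
      · have := hS.hZ; have := pow_nonneg (show 0 ≤ (n : ℤ) * (β * x) by positivity) n
        omega
    have h2 := hS.Z_pow_le (t := 1) (by have := hS.hn; omega)
    rw [pow_one] at h2
    omega
  have main : Run O B evalCofProg σ (3000 * (k + 1) ^ 2 + (60 + (M * 542 + 301))) fun σ' =>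
      Frame 40 σ σ' ∧ σ'.reg 41 = M ∧
      σ'.reg 42 = τ ∧ σ'.reg 43 = f.eval τ ∧ σ'.reg 44 = f.natDegree := by
    refine .seq ((run_cofProg (A := A) (N := n) (b := β * x) hB h5 h50 h51 hs h52 hr h53 hv hc hβx
      ?_ hk (hS.Z_pow_le (by omega)) ?_ ?_).mono le_rfl ?_)
    · have := hS.hZ; omega
    · intro i hi j
      simp only [A]
      split_ifs with hj
      · refine (abs_eval_le (natDegree_fam_le N p Y _ _) (by rwa [abs_of_nonneg (by omega)])).trans ?_
        rw [pow_one, abs_of_nonneg (by omega : 0 ≤ x)]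
        exact mul_le_mul_of_nonneg_right (hfam _ hi _ hj) (by omega)
      · simp; omega
    · intro i hi
      rw [hw i hi]
      exact pack_congr fun j hj => by simp [A, hj]
    · rintro σ₁ ⟨hF₁, h60⟩
      rw [← hA] at h60
      refine .seq (.set hB (by decide) (by simpa [h60] using hfB) ?_)
      refine (run_repackProg (f := f) (x := x) (τ := τ) (M := M) hB ?_ ?_ ?_ ?_ hdeg ?_ ?_ ?_
        ?_).mono le_rfl ?_
      · simp [hF₁.1 6 (by norm_num), h6]
      · simp [h60]
      · simp [hF₁.1 41 (by norm_num), h41]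
      · simp [hF₁.1 42 (by norm_num), h42]
      · intro j
        have := abs_coeff_le_norm1 f j
        omega
      · refine le_trans ?_ (hS.Z_pow_le (t := n + 1) (by have := hS.hn; omega))
        calc x ^ M ≤ x ^ (n + 1) := pow_le_pow_right₀ hx1 hM
          _ ≤ Z ^ (n + 1) := by gcongr; omega
      · intro t ht
        rw [abs_pow]
        refine le_trans ?_ hτ
        have : |τ| ^ t ≤ |τ| ^ (n + 1) := pow_le_pow_right₀ hτ1 (by omega)
        have := pow_pos (show 0 < |τ| by omega) (n + 1)
        nlinarith
      · intro t ht
        refine (abs_pack_coeff_le f hτ1 t).trans (le_trans ?_ hτ)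
        have : |τ| ^ t ≤ |τ| ^ (n + 1) := pow_le_pow_right₀ hτ1 (by omega)
        have : 0 ≤ (n * β) ^ n := by positivity
        gcongr
        omega
      · rintro σ₂ ⟨hF₂, h⟩
        exact ⟨((hF₁.mono (by norm_num)).set (by norm_num)).trans hF₂, h⟩
  have h3 := evalCof_cost hk hM hS.hn
  exact main.mono h3 fun _ h => h

/-- The transposed Sylvester matrix. -/
def sylvesterRows (f g : ℤ[X]) (d x y : ℕ) : ℤ :=
  if x < d then if x ≤ y ∧ y ≤ x + d then g.coeff (y - x) else 0
  else if x - d ≤ y ∧ y ≤ x then f.coeff (y - (x - d)) else 0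

theorem lead_sylvesterRows (f g : ℤ[X]) {d : ℕ} (hd : d = max f.natDegree g.natDegree) :
    lead (sylvesterRows f g d) (2 * d) = res f g := by
  rw [two_mul, res, ← hd, resultant, ← Matrix.det_transpose, lead]
  congr 1
  ext i j
  rw [Matrix.transpose_apply, sylvester_apply]
  rfl

theorem pack_sylvesterRows {f g : ℤ[X]} {d : ℕ} (hf : f.natDegree ≤ d) (hg : g.natDegree ≤ d)
    {N x : ℕ} (hN : 2 * d ≤ N) (hx : x < d) (Z : ℤ) :
    pack Z N (sylvesterRows f g d x) = Z ^ x * g.eval Z ∧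
      pack Z N (sylvesterRows f g d (d + x)) = Z ^ x * f.eval Z := by
  have key : ∀ h : ℤ[X], h.natDegree ≤ d →
      (pack Z N fun y => if x ≤ y then h.coeff (y - x) else 0) = Z ^ x * h.eval Z := by
    intro h hh
    rw [pack_eq_of_zero (M := x + (d + 1)) (by omega), pack_shift, eval_eq_pack (M := d + 1) (by omega)]
    intro j hj
    rw [if_pos (by omega), coeff_eq_zero_of_natDegree_lt (by omega)]
  constructor
  · rw [← key g hg]
    refine pack_congr fun y _ => ?_
    simp only [sylvesterRows, if_pos hx]
    by_cases h1 : x ≤ y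
    · by_cases h2 : y ≤ x + d
      · simp [h1, h2]
      · simp only [h1, h2, and_false, if_false, if_true]
        rw [coeff_eq_zero_of_natDegree_lt (by omega)]
    · simp [h1]
  · rw [← key f hf]
    refine pack_congr fun y _ => ?_
    simp only [sylvesterRows, if_neg (show ¬ d + x < d by omega), Nat.add_sub_cancel_left]
    by_cases h1 : x ≤ y
    · by_cases h2 : y ≤ d + x
      · simp [h1, h2]
      · simp only [h1, h2, and_false, if_false, if_true]
        rw [coeff_eq_zero_of_natDegree_lt (by omega)]
    · simp [h1]

/-- The resultant of the polynomials whose values at register `5` are in registers `30` and `32`;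
register `33` holds the larger of the degrees. -/
def resProg : Program :=
  .seq (set 35 (.const 1)) <|
  .seq (forE 36 (.const 0) (.reg 33)
    (.seq (put (work (.reg 36)) (.reg 35 * .reg 32)) <|
      .seq (put (work (.reg 33 + .reg 36)) (.reg 35 * .reg 30)) <|
      set 35 (.reg 35 * .reg 5))) <|
  .seq (set 50 (.reg 33 + .reg 33)) detProg

theorem Sizes.abs_pow_mul_eval_le {B : ℕ} {n : ℕ} {β x Z : ℤ} (hS : Sizes n β x Z B) {h : ℤ[X]}
    {i : ℕ} (h1 : h.natDegree ≤ i) (h2 : norm1 h ≤ (n * β) ^ n) {t : ℕ}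
    (ht : t + i < 2 * n) : |Z ^ t * h.eval Z| ≤ B := by
  have hZ1 : 1 ≤ Z := by have := hS.x_lt; have := hS.one_le_x; omega
  rw [abs_mul, abs_of_nonneg (a := Z ^ t) (by positivity)]
  have h3 := abs_eval_le h1 (x := Z) (by rwa [abs_of_nonneg (by omega)])
  rw [abs_of_nonneg (a := Z) (by omega)] at h3
  have h4 := hS.hx
  have h5 := hS.x_lt
  have h6 := hS.one_le_x
  calc Z ^ t * |h.eval Z| ≤ Z ^ t * (Z * Z ^ i) := by
        gcongr
        refine h3.trans ?_
        gcongr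
        omega
    _ = Z ^ (t + i + 1) := by ring
    _ ≤ B := hS.Z_pow_le (by omega)

theorem Sizes.two_mul_le {B : ℕ} {n : ℕ} {β x Z : ℤ} (hS : Sizes n β x Z B) : (2 * n : ℤ) ≤ B := by
  have := hS.x_lt; have := hS.one_le_x
  have h1 : (2 * n : ℕ) < 2 ^ (2 * n) := Nat.lt_two_pow_self
  have h2 : (2 : ℤ) ^ (2 * n) ≤ Z ^ (2 * n) := pow_le_pow_left₀ (by norm_num) (by omega) _
  have h3 := hS.hZB
  zify at h1
  omega

theorem run_resProg {O : List ℤ → ℤ} {B : ℕ} {n : ℕ} {β x Z : ℤ} (hS : Sizes n β x Z B)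
    {σ : State} {f g : ℤ[X]} (h5 : σ.reg 5 = Z)
    (e30 : σ.reg 30 = f.eval Z) (e32 : σ.reg 32 = g.eval Z)
    (e33 : σ.reg 33 = (max f.natDegree g.natDegree : ℕ)) (hdn : max f.natDegree g.natDegree < n)
    (hnf : norm1 f ≤ (n * β) ^ n) (hng : norm1 g ≤ (n * β) ^ n) :
    Run O B resProg σ (60 + (max f.natDegree g.natDegree * ((121 + (121 + 60)) + 121) + 121 +
      (60 + 2000 * (2 * max f.natDegree g.natDegree + 1) ^ 2)))
      fun σ' => Frame 30 σ σ' ∧ σ'.reg 60 = res f g := by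
  have hB := hS.hB
  have hn := hS.hn
  have hx1 := hS.one_le_x
  have hxZ := hS.x_lt
  have hZ1 : 1 ≤ Z := by omega
  have hpow : ∀ {t : ℕ}, t ≤ 2 * n → Z ^ t ≤ B := fun ht => hS.Z_pow_le ht
  have h2nB := hS.two_mul_le
  set d := max f.natDegree g.natDegree with hd
  have hvf : ∀ {t : ℕ}, t < n → |Z ^ t * f.eval Z| ≤ B := fun ht =>
    hS.abs_pow_mul_eval_le (le_max_left f.natDegree g.natDegree) hnf (by omega)
  have hvg : ∀ {t : ℕ}, t < n → |Z ^ t * g.eval Z| ≤ B := fun ht =>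
    hS.abs_pow_mul_eval_le (le_max_right f.natDegree g.natDegree) hng (by omega)
  have hF := Frame.refl 30 σ
  refine .seq (.set hB (by decide) (by simp; omega) ?_)
  refine .seq ?_
  refine .forE hB (by decide) 0 d (121 + (121 + 60)) (fun t σ' => t ≤ d ∧ Frame 30 σ σ' ∧
    σ'.reg 30 = f.eval Z ∧ σ'.reg 32 = g.eval Z ∧ σ'.reg 33 = d ∧ σ'.reg 36 = t ∧
    σ'.reg 35 = Z ^ t ∧ ∀ u : ℕ, u < t → σ'.mem (-1 - u) = Z ^ u * g.eval Z ∧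
      σ'.mem (-1 - (d + u : ℕ)) = Z ^ u * f.eval Z) rfl (by simp)
      (by rw [zero_add, Nat.abs_cast]; omega) ?_ ?_ ?_ ?_
  · exact ⟨by omega, (hF.set (by norm_num)).set (by norm_num), by simp [e30], by simp [e32],
      by simp [e33], by simp, by simp, by omega⟩
  · rintro t σ' ⟨-, hF', -, -, g33, g36, -⟩
    exact ⟨by simp [g36], by simp [g33]⟩
  · rintro t σ' ht ⟨-, hF', g30, g32, g33, g36, g35, hm⟩
    have g5 : σ'.reg 5 = Z := (hF'.1 5 (by norm_num)).trans h5
    refine .seq (.put hB (by decide) (by simpa [g35, g32] using hvg (t := t) (by omega)) ?_)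
    refine .seq (.put hB (by decide) (by simpa [g35, g30] using hvf (t := t) (by omega)) ?_)
    refine .set hB (by decide) (by
      simp only [Expr.eval_reg, Expr.eval_mul, reg_setMem, g35, g5, ← pow_succ]
      rw [abs_of_nonneg (by positivity)]
      exact hpow (by omega)) ?_
    refine ⟨by simp [g36], by omega, ?_, by simp [g30], by simp [g32], by simp [g33], by simp,
      by simp [g35, g5, pow_succ], fun u hu => ?_⟩
    · refine (((hF'.put ?_).put ?_).set (by norm_num)).set (by norm_num)
      · simp [g36]; omega
      · simp [g36, g33]; omega
    · simp only [mem_setReg, mem_setMem, eval_work, Expr.eval_reg, Expr.eval_mul, Expr.eval_add,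
        reg_setMem, g36, g35, g33, g32, g30]
      by_cases h : u = t
      · subst h
        refine ⟨?_, ?_⟩
        · rw [if_neg (by omega), if_pos rfl]
        · rw [if_pos (by push_cast; ring)]
      · refine ⟨?_, ?_⟩
        · rw [if_neg (by omega), if_neg (by omega)]
          exact (hm u (by omega)).1
        · rw [if_neg (by omega), if_neg (by omega)]
          exact (hm u (by omega)).2
  · rintro σ' ⟨-, hF', -, -, g33, -, -, hm⟩
    have g5 : σ'.reg 5 = Z := (hF'.1 5 (by norm_num)).trans h5
    refine .seq (.set hB (by decide) (by
      simp only [Expr.eval_reg, Expr.eval_add, g33]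
      rw [abs_of_nonneg (by omega)]; omega) ?_)
    refine (run_detProg (A₀ := sylvesterRows f g d) (N := 2 * n) (b := (n * β) ^ n) (k := 2 * d)
      (Z := Z) hB (by simp [g5]) (by simp [g33]; ring) hS.one_le_coeff ?_ (by omega) (by omega)
      hS.hZB ?_ ?_).mono le_rfl ?_
    · refine lt_of_le_of_lt ?_ hS.hR
      have := pow_le_pow_of_le (show 2 * d ≤ 2 * n by omega) hS.one_le_coeff
      omega
    · intro u _ v
      have h1 : ∀ t, |f.coeff t| ≤ (n * β) ^ n := fun t => (abs_coeff_le_norm1 f t).trans hnf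
      have h2 : ∀ t, |g.coeff t| ≤ (n * β) ^ n := fun t => (abs_coeff_le_norm1 g t).trans hng
      have h3 : |(0 : ℤ)| ≤ (n * β) ^ n := (abs_nonneg _).trans (h1 0) |>.trans' (by simp)
      unfold sylvesterRows
      split_ifs <;> first | exact h1 _ | exact h2 _ | exact h3
    · intro u hu
      by_cases h : u < d
      · rw [(pack_sylvesterRows (le_max_left _ _) (le_max_right _ _) (by omega) h Z).1]
        simpa using (hm u h).1
      · obtain ⟨u', rfl⟩ := Nat.exists_eq_add_of_le (not_lt.1 h)
        rw [(pack_sylvesterRows (le_max_left _ _) (le_max_right _ _) (by omega)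
          (show u' < d by omega) Z).2]
        simpa using (hm u' (by omega)).2
    · rintro σ'' ⟨hF'', h60⟩
      exact ⟨(hF'.set (by norm_num)).trans (hF''.mono (by norm_num)),
        by rw [h60, lead_sylvesterRows f g rfl]⟩

/-- The determinant of the coefficient matrix for the block that ends in the row whose index is in
register `8`; the rows are packed from the address in register `13` on. -/
def testProg : Program :=
  .seq (set 41 (.reg 8 + .const 1)) <| .seq (set 42 (.reg 5)) <|
  .seq (set 50 (.reg 8 + .const 1)) <| .seq (set 51 (.reg 13)) <| .seq (set 52 (.const 0)) <|
  .seq (set 53 (.reg 11)) <| .seq evalCofProg <|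
  .seq (set 30 (.reg 43)) <| .seq (set 31 (.reg 44)) <|
  .seq (set 50 (.reg 8 + .const 1)) <| .seq (set 51 (.reg 13)) <| .seq (set 52 (.const 1)) <|
  .seq (set 53 (.reg 11)) <| .seq evalCofProg <|
  .seq (set 32 (.reg 43)) <| .seq (set 33 (.reg 31)) <|
  .seq (ifE (.reg 44 - .reg 31) (set 33 (.reg 44)) skip) <|
  resProg

theorem test_cost {d i n : ℕ} (hdi : d ≤ i) (hi : i < n) :
    60 + (60 + (60 + (60 + (60 + (60 + (4000 * (n + 1) ^ 2 +
      (60 + (60 + (60 + (60 + (60 + (60 + (4000 * (n + 1) ^ 2 + (60 + (60 + ((60 + 61) + (60 +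
      (d * ((121 + (121 + 60)) + 121) + 121 + (60 + 2000 * (2 * d + 1) ^ 2))))))))))))))))))) ≤
      30000 * (n + 1) ^ 2 := by
  have h1 : (2 * d + 1) ^ 2 ≤ 4 * (n + 1) ^ 2 := by
    have : 2 * d + 1 ≤ 2 * (n + 1) := by omega
    calc (2 * d + 1) ^ 2 ≤ (2 * (n + 1)) ^ 2 := Nat.pow_le_pow_left this 2
      _ = 4 * (n + 1) ^ 2 := by ring
  have h2 : 2 * (n + 1) ≤ (n + 1) ^ 2 := by nlinarith
  generalize (2 * d + 1) ^ 2 = u at *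
  generalize (n + 1) ^ 2 = v at *
  ring_nf
  omega

set_option maxHeartbeats 1000000 in
theorem run_testProg {O : List ℤ → ℤ} {B : ℕ} {n : ℕ} {β x Z : ℤ} (hS : Sizes n β x Z B)
    {σ : State} {s : ℤ} {i : ℕ} {N : ℕ → ℕ → ℤ} {p : ℤ} {Y : ℕ → ℤ}
    (h5 : σ.reg 5 = Z) (h6 : σ.reg 6 = x) (h8 : σ.reg 8 = i) (hi1 : 1 ≤ i) (hi : i < n)
    (h11 : σ.reg 11 = Z ^ i) (h13 : σ.reg 13 = s) (hs : 0 ≤ s)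
    (hfam : ∀ u ≤ i, ∀ v < n, norm1 (fam N p Y u v) ≤ β)
    (hw : ∀ u : ℕ, u ≤ i → σ.mem (s + u) = pack Z n fun v => (fam N p Y u v).eval x) :
    Run O B testProg σ (30000 * (n + 1) ^ 2) fun σ' => Frame 30 σ σ' ∧
      σ'.reg 60 = res (fcof N p Y i 0) (fcof N p Y i 1) := by
  apply Run.of_bounded
  intro hσ
  have hB := hS.hB
  have hn := hS.hn
  have hx1 := hS.one_le_x
  have hxZ := hS.x_lt
  have hZ1 : 1 ≤ Z := by omega
  have hpow : ∀ {t : ℕ}, t ≤ 2 * n → Z ^ t ≤ B := fun ht => hS.Z_pow_le ht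
  have hZB : Z ≤ B := by simpa using hpow (t := 1) (by omega)
  have hZnB : |(Z : ℤ) ^ i| ≤ B := by
    rw [abs_of_nonneg (by positivity)]; exact hpow (by omega)
  have h2nB := hS.two_mul_le
  have hsB : |s| ≤ B := by rw [← h13]; exact hσ.1 13 (by norm_num)
  have hτ : x * |Z| ^ (n + 1) ≤ B := by
    rw [abs_of_nonneg (by omega)]
    calc x * Z ^ (n + 1) ≤ Z * Z ^ (n + 1) := by gcongr; omega
      _ = Z ^ (n + 2) := by ring
      _ ≤ B := hpow (by omega)
  set f := fcof N p Y i 0 with hf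
  set g := fcof N p Y i 1 with hg
  have hdf : f.natDegree ≤ i := natDegree_fcof_le N p Y (by omega)
  have hdg : g.natDegree ≤ i := natDegree_fcof_le N p Y hi1
  have hnf : norm1 f ≤ (n * β) ^ n := hS.norm1_cof_lt (by omega) (fun u hu => hfam u (by omega)) _ _
  have hng : norm1 g ≤ (n * β) ^ n := hS.norm1_cof_lt (by omega) (fun u hu => hfam u (by omega)) _ _
  set d := max f.natDegree g.natDegree with hd
  have hdi : d ≤ i := by omega
  have main : Run O B testProg σ (60 + (60 + (60 + (60 + (60 + (60 + (4000 * (n + 1) ^ 2 +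
      (60 + (60 + (60 + (60 + (60 + (60 + (4000 * (n + 1) ^ 2 + (60 + (60 + ((60 + 61) + (60 +
      (d * ((121 + (121 + 60)) + 121) + 121 + (60 + 2000 * (2 * d + 1) ^ 2))))))))))))))))))))
      fun σ' => Frame 30 σ σ' ∧ σ'.reg 60 = res f g := by
    have hi1B : |(i : ℤ) + 1| ≤ B := by rw [abs_of_nonneg (by omega)]; omega
    refine .seq (.set hB (by decide) (by simpa [h8] using hi1B) ?_)
    refine .seq (.set hB (by decide) (by simpa [h5, abs_of_nonneg (show 0 ≤ Z by omega)] using hZB) ?_)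
    refine .seq (.set hB (by decide) (by simpa [h8] using hi1B) ?_)
    refine .seq (.set hB (by decide) (by simpa [h13] using hsB) ?_)
    refine .seq (.set hB (by decide) (by simp) ?_)
    refine .seq (.set hB (by decide) (by simpa [h11] using hZnB) ?_)
    refine .seq ((run_evalCofProg (s := s) (τ := Z) (v := Z ^ i) (k := i + 1) (r := 0) (c := i)
      (M := i + 1) (N := N) (p := p) (Y := Y) hS (by simp [h5]) (by simp [h6]) (by simp [h8])
      (by simp [h13]) hs (by simp) (by omega) (by simp [h11]) rfl hi (by omega) (by simp [h8])
      (by omega) (by simp [h5]) (by rwa [abs_of_nonneg (by omega)]) hτ (Nat.lt_succ_of_le hdf)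
      (fun u hu => hfam u (by omega)) (fun u hu => by simpa using hw u (by omega))).mono le_rfl ?_)
    rintro σ₁ ⟨hF₁, a41, a42, a43, a44⟩
    have hF₁' : Frame 40 σ σ₁ := by
      refine Frame.trans ?_ hF₁
      exact (((((((Frame.refl _ _).set (by norm_num)).set (by norm_num)).set
        (by norm_num)).set (by norm_num)).set (by norm_num)).set (by norm_num))
    clear hF₁
    have b : ∀ r < 40, σ₁.reg r = σ.reg r := hF₁'.1
    have a43' : σ₁.reg 43 = f.eval Z := a43
    have a44' : σ₁.reg 44 = f.natDegree := a44
    refine .seq (.set hB (by decide) (by simpa [a43'] using hS.abs_pow_mul_eval_le hdf hnf (t := 0) (by omega)) ?_)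
    refine .seq (.set hB (by decide) (by
      simp only [Expr.eval_reg, reg_setReg, a44']
      rw [if_neg (by norm_num), Nat.abs_cast]; omega) ?_)
    refine .seq (.set hB (by decide) (by simpa [b, h8] using hi1B) ?_)
    refine .seq (.set hB (by decide) (by simpa [b, h13] using hsB) ?_)
    refine .seq (.set hB (by decide) (by simp; omega) ?_)
    refine .seq (.set hB (by decide) (by simpa [b, h11] using hZnB) ?_)
    refine .seq ((run_evalCofProg (s := s) (τ := Z) (v := Z ^ i) (k := i + 1) (r := 1) (c := i)
      (M := i + 1) (N := N) (p := p) (Y := Y) hS (by simp [b, h5]) (by simp [b, h6])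
      (by simp [b, h8])
      (by simp [b, h13]) hs (by simp) (by omega) (by simp [b, h11]) rfl hi (by omega)
      (by simpa using a41)
      (by omega) (by simpa using a42) (by rwa [abs_of_nonneg (by omega)]) hτ
      (Nat.lt_succ_of_le hdg)
      (fun u hu => hfam u (by omega)) (fun u hu => by
        simpa [hF₁'.2 (s + u) (by omega)] using hw u (by omega))).mono le_rfl ?_)
    rintro σ₂ ⟨hF₂, c41, c42, c43, c44⟩
    have c43' : σ₂.reg 43 = g.eval Z := c43
    have c44' : σ₂.reg 44 = g.natDegree := c44
    have c30 : σ₂.reg 30 = f.eval Z := by rw [hF₂.1 30 (by norm_num)]; simp [a43']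
    have c31 : σ₂.reg 31 = f.natDegree := by rw [hF₂.1 31 (by norm_num)]; simp [a44']
    have hF₂' : Frame 30 σ σ₂ := by
      refine Frame.trans ?_ (hF₂.mono (by norm_num))
      exact ((((((hF₁'.mono (by norm_num)).set (by norm_num)).set (by norm_num)).set
        (by norm_num)).set (by norm_num)).set (by norm_num)).set (by norm_num)
    clear hF₂ c43 c44
    have c5 : σ₂.reg 5 = Z := (hF₂'.1 5 (by norm_num)).trans h5
    refine .seq (.set hB (by decide) (by simpa [c43'] using hS.abs_pow_mul_eval_le hdg hng (t := 0) (by omega)) ?_)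
    refine .seq (.set hB (by decide) (by
      simp only [Expr.eval_reg, reg_setReg, c31]
      rw [if_neg (by norm_num), Nat.abs_cast]; omega) ?_)
    have rest : ∀ σ₃ : State, Frame 30 σ σ₃ → σ₃.reg 30 = f.eval Z → σ₃.reg 32 = g.eval Z →
        σ₃.reg 33 = d → Run O B resProg σ₃ (60 +
        (d * ((121 + (121 + 60)) + 121) + 121 + (60 + 2000 * (2 * d + 1) ^ 2)))
        fun σ' => Frame 30 σ σ' ∧ σ'.reg 60 = res f g := fun σ₃ hF e30 e32 e33 =>
      (run_resProg hS ((hF.1 5 (by norm_num)).trans h5) e30 e32 e33 (hdi.trans_lt hi) hnf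
        hng).mono le_rfl fun σ' h => ⟨hF.trans h.1, h.2⟩
    refine Run.seq (T := 60 + 61) (.ifE (T := 60) hB (by decide) (fun hpos => ?_) (fun hneg => (Run.skip ?_).mono (by norm_num)
        fun _ h => h))
    · simp [c31, c44'] at hpos
      refine .set hB (by decide) (by
        simp only [Expr.eval_reg, reg_setReg, c44']
        rw [if_neg (by norm_num), if_neg (by norm_num), Nat.abs_cast]; omega) ?_
      refine rest _ (((hF₂'.set (by norm_num)).set (by norm_num)).set (by norm_num)) (by simp [c30])
        (by simp [c43']) ?_
      simp [c44', hd]; omega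
    · simp [c31, c44'] at hneg
      refine rest _ ((hF₂'.set (by norm_num)).set (by norm_num)) (by simp [c30])
        (by simp [c43']) ?_
      simp [c31, hd]; omega
  exact main.mono (test_cost hdi hi) fun _ h => h

/-! ### The least prime that does not divide an integer -/

theorem log_le_four_mul_rpow {x : ℝ} (hx : 0 < x) : Real.log x ≤ 4 * x ^ (1 / 4 : ℝ) := by
  have h := Real.log_le_sub_one_of_pos (Real.rpow_pos_of_pos hx (1 / 4 : ℝ))
  rw [Real.log_rpow hx] at h
  linarith

theorem log_sq_le {x : ℝ} (hx : 1 ≤ x) : Real.log x ^ 2 ≤ 16 * √x := by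
  have h0 : 0 < x := by linarith
  have h1 := log_le_four_mul_rpow h0
  have h2 : (x ^ (1 / 4 : ℝ)) ^ 2 = √x := by
    rw [← Real.rpow_natCast, ← Real.rpow_mul h0.le, Real.sqrt_eq_rpow]; norm_num
  have h3 := Real.log_nonneg hx
  have : 0 < x ^ (1 / 4 : ℝ) := by positivity
  nlinarith

/-- All primes below `P` divide `D`, so that their product is at most `|D|`, and Chebyshev's lower
bound for this product applies. -/
theorem prime_le_of_dvd {D : ℤ} (hD : D ≠ 0) {P : ℕ}
    (hmin : ∀ r : ℕ, r.Prime → r < P → (r : ℤ) ∣ D) :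
    (P : ℝ) ≤ 2 ^ 18 + 1 + 10 * Real.log |(D : ℝ)| := by
  have hD1 : (1 : ℝ) ≤ |(D : ℝ)| := by
    exact_mod_cast Int.one_le_abs hD
  have hlog := Real.log_nonneg hD1
  rcases le_or_gt P (2 ^ 18 + 1) with h | h
  · have : (P : ℝ) ≤ 2 ^ 18 + 1 := by exact_mod_cast h
    linarith
  obtain ⟨x, rfl⟩ : ∃ x, P = x + 1 := ⟨P - 1, by omega⟩
  have hx : 2 ^ 18 ≤ x := by omega
  have hxr : (2 : ℝ) ^ 18 ≤ x := by exact_mod_cast hx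
  clear h hx
  have h1 : (primorial x : ℤ) ∣ D := by
    rw [Int.natCast_dvd]
    unfold primorial
    refine Finset.prod_primes_dvd _ (fun p hp => (Finset.mem_filter.1 hp).2.prime) fun p hp => ?_
    rw [Finset.mem_filter, Finset.mem_range] at hp
    exact Int.natCast_dvd.1 (hmin p hp.2 hp.1)
  have h2 : Real.log (primorial x) ≤ Real.log |(D : ℝ)| := by
    refine Real.log_le_log (by exact_mod_cast primorial_pos x) ?_
    have := Int.le_of_dvd (abs_pos.2 hD) ((dvd_abs _ _).2 h1)
    exact_mod_cast this
  have h3 := Chebyshev.theta_ge x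
  rw [Chebyshev.theta_eq_log_primorial, Nat.floor_natCast] at h3
  have h4 := log_le_four_mul_rpow (x := x) (by linarith)
  set u : ℝ := (x : ℝ) ^ (1 / 4 : ℝ) with hu
  have hu4 : u ^ 4 = x := by
    rw [hu, ← Real.rpow_natCast, ← Real.rpow_mul (by positivity)]; norm_num
  have hu0 : 0 ≤ u := by positivity
  have hsq : √(x : ℝ) = u ^ 2 := by
    rw [← hu4, show u ^ 4 = (u ^ 2) ^ 2 by ring, Real.sqrt_sq (by positivity)]
  have hu20 : 20 ≤ u := by
    by_contra hlt
    have : u ^ 4 ≤ 20 ^ 4 := pow_le_pow_left₀ hu0 (not_le.1 hlt).le 4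
    rw [hu4] at this
    norm_num at hxr this
    linarith
  have h5 : Real.log (x + 1) ≤ 1 + 4 * u := by
    have : Real.log ((x : ℝ) + 1) ≤ Real.log (2 * x) := Real.log_le_log (by linarith) (by linarith)
    rw [Real.log_mul (by norm_num) (by linarith)] at this
    have := Real.log_two_lt_d9
    linarith
  have h6 := Real.log_two_gt_d9
  have h7 : 2 * √(x : ℝ) * Real.log x ≤ 8 * u ^ 3 := by
    rw [hsq]
    have : 0 ≤ u ^ 2 := by positivity
    nlinarith
  have h8 : (20 : ℝ) * u ^ 3 ≤ x := by
    rw [← hu4]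
    have : 0 ≤ u ^ 3 := by positivity
    nlinarith
  have h9 : (400 : ℝ) * u ≤ u ^ 3 := by nlinarith [mul_nonneg hu0 (sub_nonneg.2 hu20)]
  push_cast
  linarith [mul_le_mul_of_nonneg_left h6.le (show (0 : ℝ) ≤ x by positivity)]

/-- There are few proper prime powers, so that their product is only exponential. -/
theorem prod_prime_pow_le {P : ℕ} {T : Finset ℕ}
    (hT : ∀ x ∈ T, x < P ∧ IsPrimePow x ∧ ¬ x.Prime) :
    ((∏ x ∈ T, x : ℕ) : ℝ) ≤ Real.exp (47 * P) := by
  rcases Nat.eq_zero_or_pos P with rfl | hP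
  · obtain rfl : T = ∅ := Finset.eq_empty_of_forall_notMem fun x hx => by
      have := (hT x hx).1; omega
    simp
  have hP1 : (1 : ℝ) ≤ P := by exact_mod_cast hP
  have hlog := Real.log_nonneg hP1
  have h1 : (T.card : ℝ) * Real.log 2 ≤ 2 * √(P : ℝ) * Real.log P := by
    refine le_trans ?_ (Chebyshev.psi_sub_theta_le hP1)
    rw [Chebyshev.psi_sub_theta_eq_sum_not_prime, Nat.floor_natCast]
    calc (T.card : ℝ) * Real.log 2 = ∑ _x ∈ T, Real.log 2 := by simp
      _ ≤ ∑ x ∈ T, ArithmeticFunction.vonMangoldt x := by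
          refine Finset.sum_le_sum fun x hx => ?_
          have hx' := (hT x hx).2.1
          rw [ArithmeticFunction.vonMangoldt_apply, if_pos hx']
          exact Real.log_le_log (by norm_num)
            (by exact_mod_cast (Nat.minFac_prime hx'.ne_one).two_le)
      _ ≤ _ := by
          refine Finset.sum_le_sum_of_subset_of_nonneg (fun x hx => ?_) fun _ _ _ =>
            ArithmeticFunction.vonMangoldt_nonneg
          have := hT x hx
          exact Finset.mem_filter.2 ⟨Finset.mem_Ioc.2 ⟨this.2.1.pos, this.1.le⟩, this.2.2⟩
  have h2 : (∏ x ∈ T, x : ℕ) ≤ P ^ T.card := by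
    rw [← Finset.prod_const]
    exact Finset.prod_le_prod' fun x hx => (hT x hx).1.le
  have h3 : (P : ℝ) ^ T.card = Real.exp (T.card * Real.log P) := by
    rw [mul_comm, Real.exp_mul, Real.exp_log (by linarith), Real.rpow_natCast]
  calc ((∏ x ∈ T, x : ℕ) : ℝ) ≤ (P : ℝ) ^ T.card := by exact_mod_cast h2
    _ ≤ Real.exp (47 * P) := by
        rw [h3]
        refine Real.exp_le_exp.2 ?_
        have h4 := Real.log_two_gt_d9
        have h5 := log_sq_le hP1
        have h6 : √(P : ℝ) * √(P : ℝ) = P := Real.mul_self_sqrt (by linarith)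
        have h7 := Real.sqrt_nonneg (P : ℝ)
        have h8 : (T.card : ℝ) * Real.log P * Real.log 2 ≤ 32 * P := by
          calc (T.card : ℝ) * Real.log P * Real.log 2 = T.card * Real.log 2 * Real.log P := by ring
            _ ≤ 2 * √(P : ℝ) * Real.log P * Real.log P := by gcongr
            _ = 2 * √(P : ℝ) * Real.log P ^ 2 := by ring
            _ ≤ 2 * √(P : ℝ) * (16 * √(P : ℝ)) := by gcongr
            _ = 32 * (√(P : ℝ) * √(P : ℝ)) := by ring
            _ = 32 * P := by rw [h6]
        have h9 : 0 ≤ (T.card : ℝ) * Real.log P := by positivity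
        nlinarith

/-- If all `x < q` divide `R`, but `q` does not divide `R ^ 2`, then `q` is prime. -/
theorem prime_of_not_dvd_sq {q : ℕ} (hq : 2 ≤ q) {R : ℤ}
    (h : ∀ x : ℕ, 2 ≤ x → x < q → (x : ℤ) ∣ R) :
    (¬ IsPrimePow q → (q : ℤ) ∣ R) ∧ (¬ q.Prime → (q : ℤ) ∣ R * R) := by
  have h1 : ¬ IsPrimePow q → (q : ℤ) ∣ R := by
    intro hp
    have hr := Nat.minFac_prime (n := q) (by omega)
    set r := q.minFac
    obtain ⟨k, u, hru, hk⟩ := Nat.exists_eq_pow_mul_and_not_dvd (n := q) (by omega) r hr.ne_one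
    have hk0 : k ≠ 0 := by
      rintro rfl
      rw [pow_zero, one_mul] at hk
      exact hru (hk ▸ Nat.minFac_dvd q)
    have hr2 := hr.two_le
    have hu2 : 2 ≤ u := by
      rcases Nat.lt_or_ge u 2 with h | h
      · interval_cases u
        · simp at hru
        · exact absurd ((isPrimePow_nat_iff q).2 ⟨r, k, hr, by omega, by omega⟩) hp
      · exact h
    have hrk : 2 ≤ r ^ k := hr2.trans (Nat.le_self_pow hk0 r)
    have hc : IsCoprime ((r ^ k : ℕ) : ℤ) (u : ℤ) :=
      Nat.isCoprime_iff_coprime.2 (Nat.Coprime.pow_left k ((Nat.Prime.coprime_iff_not_dvd hr).2 hru))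
    have := hc.mul_dvd (h (r ^ k) hrk (by rw [hk]; nlinarith)) (h u hu2 (by rw [hk]; nlinarith))
    rwa [← Nat.cast_mul, ← hk] at this
  refine ⟨h1, fun hnp => ?_⟩
  by_cases hp : IsPrimePow q
  · obtain ⟨r, k, hr, hk, rfl⟩ := (isPrimePow_nat_iff q).1 hp
    have hk2 : 2 ≤ k := by
      by_contra hlt
      obtain rfl : k = 1 := by omega
      simp [hr] at hnp
    have hd : ((r ^ (k - 1) : ℕ) : ℤ) ∣ R :=
      h _ (hr.two_le.trans (Nat.le_self_pow (by omega) r)) (Nat.pow_lt_pow_right hr.one_lt (by omega))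
    refine dvd_trans ?_ (mul_dvd_mul hd hd)
    rw [← Nat.cast_mul, ← pow_add]
    exact Int.natCast_dvd_natCast.2 (pow_dvd_pow r (by omega))
  · exact (h1 hp).mul_right R

/-- The least prime that does not divide register `38` is put into register `39`. Register `38`
becomes a multiple of all smaller integers, with the same prime divisors. -/
def primeProg : Program :=
  .seq (set 39 (.const 2)) <|
  whileE (.const 1 - (.reg 38 * .reg 38) % .reg 39) <|
    .seq (ifE (.reg 38 % .reg 39) (set 38 (.reg 38 * .reg 39)) skip) <|
    set 39 (.reg 39 + .const 1)

theorem run_primeProg {O : List ℤ → ℤ} {B : ℕ} (hB : 10 ^ 6 ≤ B) {σ : State} {D : ℤ} (hD : D ≠ 0)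
    (h38 : σ.reg 38 = D) {P : ℕ} (hP : IsLeast {q : ℕ | q.Prime ∧ ¬ (q : ℤ) ∣ D} P) (hPB : P ≤ B)
    (hDB : |(D : ℝ)| * Real.exp (47 * P) ≤ B) :
    Run O B primeProg σ (60 + (P * ((60 + 61 + 60) + 61) + 61)) fun σ' =>
      Frame 38 σ σ' ∧ σ'.reg 39 = P := by
  have hP2 := hP.1.1.two_le
  refine .seq (.set hB (by decide) (by simp; omega) ?_)
  refine .whileE hB (by decide) P (60 + 61 + 60) (fun k σ' => Frame 38 σ σ' ∧
    σ'.reg 39 = (k + 2 : ℕ) ∧ k + 2 ≤ P ∧ ∃ T : Finset ℕ, σ'.reg 38 = D * (∏ x ∈ T, x : ℕ) ∧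
    (∀ x ∈ T, x < k + 2 ∧ IsPrimePow x ∧ ¬ x.Prime) ∧
    (∀ x : ℕ, 2 ≤ x → x < k + 2 → (x : ℤ) ∣ σ'.reg 38) ∧
    ∀ r : ℕ, r.Prime → (r : ℤ) ∣ σ'.reg 38 → (r : ℤ) ∣ D) ?_ ?_ ?_
  · refine ⟨(Frame.refl _ _).set (by norm_num), by simp, hP2, ∅, by simp [h38], by simp,
      fun x _ _ => by omega, fun r _ h => by simpa [h38] using h⟩
  · rintro k σ' ⟨hF, h39, hkP, T, h38', hT, hx, hr⟩ hpos
    have hne : k + 2 ≠ P := by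
      intro h
      have h0 : (σ'.reg 38 * σ'.reg 38) % (k + 2 : ℕ) = 0 := by
        have := Int.emod_nonneg (σ'.reg 38 * σ'.reg 38) (show ((k + 2 : ℕ) : ℤ) ≠ 0 by omega)
        simp only [Expr.eval_sub, Expr.eval_const, Expr.eval_mod, Expr.eval_mul, Expr.eval_reg,
          h39] at hpos
        omega
      have h1 := Int.dvd_of_emod_eq_zero h0
      rw [h] at h1
      have h2 := (Nat.prime_iff_prime_int.1 hP.1.1).dvd_or_dvd h1
      rw [or_self] at h2
      exact hP.1.2 (hr P hP.1.1 h2)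
    have hdv : ((k + 2 : ℕ) : ℤ) ∣ σ'.reg 38 * σ'.reg 38 := by
      refine Int.dvd_of_emod_eq_zero ?_
      have := Int.emod_nonneg (σ'.reg 38 * σ'.reg 38) (show ((k + 2 : ℕ) : ℤ) ≠ 0 by omega)
      simp only [Expr.eval_sub, Expr.eval_const, Expr.eval_mod, Expr.eval_mul, Expr.eval_reg,
        h39] at hpos
      omega
    refine ⟨by omega, Run.seq (T := 60 + 61) (T' := 60) ?_⟩
    have h3 : |σ'.reg 39 + 1| ≤ B := by
      rw [h39, abs_of_nonneg (by omega)]; omega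
    refine .ifE hB (by decide) (fun hp => ?_) (fun hn => (Run.skip ?_).mono (by norm_num)
      fun _ h => h)
    · have hnd : ¬ ((k + 2 : ℕ) : ℤ) ∣ σ'.reg 38 := fun h => by
        have := Int.emod_eq_zero_of_dvd h
        simp only [Expr.eval_mod, Expr.eval_reg, h39] at hp
        omega
      have hpp : IsPrimePow (k + 2) := by
        by_contra h
        exact hnd ((prime_of_not_dvd_sq (by omega) hx).1 h)
      have hnp : ¬ (k + 2).Prime := fun h => by
        have := (Nat.prime_iff_prime_int.1 h).dvd_or_dvd hdv
        rw [or_self] at this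
        exact hnd this
      have hmem : k + 2 ∉ T := fun h => by have := (hT _ h).1; omega
      have hT' : ∀ x ∈ insert (k + 2) T, x < k + 1 + 2 ∧ IsPrimePow x ∧ ¬ x.Prime := by
        intro x hx'
        rcases Finset.mem_insert.1 hx' with rfl | h
        · exact ⟨by omega, hpp, hnp⟩
        · have := hT x h; exact ⟨by omega, this.2⟩
      have hnew : σ'.reg 38 * σ'.reg 39 = D * (∏ x ∈ insert (k + 2) T, x : ℕ) := by
        rw [Finset.prod_insert hmem, h38', h39]; push_cast; ring
      have hb : |D * ((∏ x ∈ insert (k + 2) T, x : ℕ) : ℤ)| ≤ B := by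
        have h1 := prod_prime_pow_le (P := P) fun x hx => by
          have := hT' x hx; exact ⟨by omega, this.2⟩
        have h2 : |((D * ((∏ x ∈ insert (k + 2) T, x : ℕ) : ℤ) : ℤ) : ℝ)| ≤ B := by
          refine le_trans ?_ hDB
          rw [Int.cast_mul, abs_mul, Int.cast_natCast, Nat.abs_cast]
          gcongr
        rw [← Int.cast_abs] at h2
        exact_mod_cast h2
      refine .set hB (by decide) (by simpa only [Expr.eval_mul, Expr.eval_reg, hnew] using hb) ?_
      refine .set hB (by decide) (by simpa using h3) ?_
      refine ⟨(hF.set (by norm_num)).set (by norm_num), by simp [h39]; ring, by omega,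
        insert (k + 2) T, by simp [hnew], hT', fun x h2 h4 => ?_, fun r hrp hrd => ?_⟩
      · simp only [reg_setReg, Expr.eval_mul, Expr.eval_reg]
        rw [if_neg (by norm_num), if_pos trivial]
        rcases Nat.lt_succ_iff_lt_or_eq.1 (show x < k + 2 + 1 by omega) with h | rfl
        · exact (hx x h2 h).mul_right _
        · rw [h39]; exact dvd_mul_left _ _
      · simp only [reg_setReg, Expr.eval_mul, Expr.eval_reg] at hrd
        rw [if_neg (by norm_num), if_pos trivial, h39] at hrd
        have hrp' := Nat.prime_iff_prime_int.1 hrp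
        rcases hrp'.dvd_or_dvd hrd with h | h
        · exact hr r hrp h
        · have := hrp'.dvd_or_dvd (h.trans hdv)
          rw [or_self] at this
          exact hr r hrp this
    · have hd : ((k + 2 : ℕ) : ℤ) ∣ σ'.reg 38 := by
        refine Int.dvd_of_emod_eq_zero ?_
        have := Int.emod_nonneg (σ'.reg 38) (show ((k + 2 : ℕ) : ℤ) ≠ 0 by omega)
        simp only [Expr.eval_mod, Expr.eval_reg, h39] at hn
        omega
      refine .set hB (by decide) (by simpa using h3) ?_
      refine ⟨hF.set (by norm_num), by simp [h39]; ring, by omega,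
        T, by simp [h38'], fun x hx => ⟨by have := (hT x hx).1; omega, (hT x hx).2⟩,
        fun x h2 h4 => ?_, by simpa using hr⟩
      simp only [reg_setReg]
      rw [if_neg (by norm_num)]
      rcases Nat.lt_succ_iff_lt_or_eq.1 (show x < k + 2 + 1 by omega) with h | rfl
      · exact hx x h2 h
      · exact hd
  · rintro k σ' ⟨hF, h39, hkP, T, h38', hT, hx, hr⟩ hneg
    refine ⟨hF, ?_⟩
    have hnd : ¬ ((k + 2 : ℕ) : ℤ) ∣ σ'.reg 38 * σ'.reg 38 := fun h => by
      have := Int.emod_eq_zero_of_dvd h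
      simp only [Expr.eval_sub, Expr.eval_const, Expr.eval_mod, Expr.eval_mul, Expr.eval_reg,
        h39] at hneg
      omega
    have hprime : (k + 2).Prime := by
      by_contra h
      exact hnd ((prime_of_not_dvd_sq (by omega) hx).2 h)
    have : P ≤ k + 2 := hP.2 ⟨hprime, fun h => hnd ?_⟩
    · rw [h39]; congr 1; omega
    · rw [h38']
      exact (h.mul_right _).mul_right _

/-! ### The matrices of the reduction -/

/-- The entries of a matrix, indexed by natural numbers. -/
def natMat {n : ℕ} (M : Matrix (Fin n) (Fin n) ℤ) (i j : ℕ) : ℤ :=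
  if h : i < n ∧ j < n then M ⟨i, h.1⟩ ⟨j, h.2⟩ else 0

section

variable {n : ℕ} (hn : 2 ≤ n) (M : Matrix (Fin n) (Fin n) ℤ) (p : ℕ) (J : ℕ → ℕ)

theorem natMat_apply (i j : Fin n) : natMat M i j = M i j := by
  simp [natMat]

/-- The powers of `p` that are added to the left of the diagonal. -/
def powers (t : ℕ) : ℤ := (p : ℤ) ^ J t

/-- The entries of the matrix of linear polynomials at the end of the loop. -/
noncomputable def poly : ℕ → ℕ → ℤ[X] := fam (natMat M.adjugate) p (powers p J)

/-- The entry in the last row and in column `r` of the adjugate of the matrix of linear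
polynomials. -/
noncomputable def lastCof (r : ℕ) : ℤ[X] := fcof (natMat M.adjugate) p (powers p J) (n - 1) r

theorem powers_update (k j : ℕ) :
    powers p (Function.update J k j) = Function.update (powers p J) k ((p : ℤ) ^ j) := by
  funext t
  by_cases h : t = k
  · subst h; simp [powers]
  · simp [powers, h]

theorem loopMatrix_apply {k : ℕ} (hk : k < n) (i j : Fin n) : loopMatrix hn M p J k i j =
    X * C (natMat M.adjugate i j) + C (if i.val ≤ k then famConst p (powers p J) i j
      else if i = j then (p : ℤ) else 0) := by
  induction k with
  | zero =>
    rw [natMat_apply]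
    by_cases h : i.val = 0
    · by_cases h2 : i = j
      · subst h2; simp [loopMatrix, famConst, h]
      · have : ¬ 0 = j.val := fun h' => h2 (Fin.ext (h.trans h'))
        simp [loopMatrix, famConst, h, h2, this]
    · by_cases h2 : i = j
      · subst h2; simp [loopMatrix, h]
      · simp [loopMatrix, h, h2]
  | succ k ih =>
    rw [loopMatrix, dif_pos hk, loopStep, Matrix.add_apply, Matrix.add_apply, ih (by omega)]
    rw [Matrix.single_apply, Matrix.single_apply]
    simp only [fst, Fin.ext_iff, add_tsub_cancel_right]
    rcases lt_trichotomy i.val (k + 1) with h | h | h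
    · simp [show i.val ≤ k by omega, show i.val ≤ k + 1 by omega, show ¬ k + 1 = i.val by omega]
    · simp only [h, show ¬ k + 1 ≤ k by omega, le_refl, if_true, if_false, famConst, powers,
        true_and, Nat.succ_ne_zero, add_left_inj, eq_comm (a := j.val)]
      split_ifs <;> simp <;> ring
    · simp [show ¬ i.val ≤ k by omega, show ¬ i.val ≤ k + 1 by omega,
        show ¬ k + 1 = i.val by omega]

theorem loopMatrix_eq_poly {k : ℕ} (hk : k < n) {i : Fin n} (hi : i.val ≤ k) (j : Fin n) :
    loopMatrix hn M p J k i j = poly M p J i j := by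
  rw [loopMatrix_apply hn M p J hk, if_pos hi]; rfl

theorem loopMatrix_update {k j : ℕ} (hk : k + 1 < n) :
    loopStep hn p j ⟨k + 1, hk⟩ (loopMatrix hn M p J k) =
      loopMatrix hn M p (Function.update J (k + 1) j) (k + 1) := by
  conv_rhs => rw [loopMatrix, dif_pos hk, Function.update_self]
  congr 1
  ext1 u v
  rw [loopMatrix_apply hn M p J (by omega), loopMatrix_apply hn M p _ (by omega)]
  split_ifs with h
  · rw [powers_update, famConst, famConst, Function.update_of_ne (by omega)]
  · rfl
  · rfl

variable {M p J}

theorem testDet_eq {W : Matrix (Fin n) (Fin n) ℤ[X]} {i : Fin n} (hi : 1 ≤ i.val)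
    (hW : ∀ u v : Fin n, u.val ≤ i → W u v = poly M p J u v) :
    testDet W i = res (fcof (natMat M.adjugate) p (powers p J) i 0)
      (fcof (natMat M.adjugate) p (powers p J) i 1) := by
  have h : ∀ u v : Fin (i.val + 1), W.submatrix (Fin.castLE i.isLt) (Fin.castLE i.isLt) u v =
      poly M p J u v := fun u v => hW _ _ (by simp; omega)
  have h1 : ((1 : Fin (i.val + 1)) : ℕ) = 1 := by
    rw [Fin.val_one']; exact Nat.mod_eq_of_lt (by omega)
  rw [testDet, det_coeffMatrix, adjugate_eq_cof _ _ h, adjugate_eq_cof _ _ h, h1]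
  rfl

theorem testDet_loopStep {k j : ℕ} (hk : k + 1 < n) :
    testDet (loopStep hn p j ⟨k + 1, hk⟩ (loopMatrix hn M p J k)) ⟨k + 1, hk⟩ =
      res (fcof (natMat M.adjugate) p (Function.update (powers p J) (k + 1) ((p : ℤ) ^ j)) (k + 1) 0)
        (fcof (natMat M.adjugate) p (Function.update (powers p J) (k + 1) ((p : ℤ) ^ j)) (k + 1) 1) := by
  rw [loopMatrix_update, ← powers_update]
  exact testDet_eq (by simp) fun u v hu => loopMatrix_eq_poly hn M p _ hk hu v

variable (M p J) in
/-- The prime and the exponents are the ones that the reduction finds. -/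
structure LoopData : Prop where
  p_spec : IsLeast {q : ℕ | q.Prime ∧ ¬ (q : ℤ) ∣ M (lst hn) (fst hn) * M.det} p
  J_spec : ∀ k (h : k + 1 < n),
    IsLeast {j : ℕ | 0 < j ∧ testDet (loopStep hn p j ⟨k + 1, h⟩ (loopMatrix hn M p J k))
      ⟨k + 1, h⟩ ≠ 0} (J (k + 1))

theorem update_powers_self (k : ℕ) :
    Function.update (powers p J) k ((p : ℤ) ^ J k) = powers p J := Function.update_eq_self k _

/-- The exponents of the loop exist and are small. -/
theorem exists_exponents (hp : p.Prime) (k : ℕ) : ∃ J : ℕ → ℕ, ∀ i < k,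
    IsLeast {j : ℕ | 0 < j ∧
      res (fcof (natMat M.adjugate) p (Function.update (powers p J) (i + 1) ((p : ℤ) ^ j)) (i + 1) 0)
        (fcof (natMat M.adjugate) p (Function.update (powers p J) (i + 1) ((p : ℤ) ^ j)) (i + 1) 1)
        ≠ 0} (J (i + 1)) := by
  induction k with
  | zero => exact ⟨fun _ => 0, by omega⟩
  | succ k ih =>
    obtain ⟨J, hJ⟩ := ih
    have hex := exists_exponent (natMat M.adjugate) (p := p) (by exact_mod_cast hp.two_le)
      (Y := powers p J) (i := k) (fun k _ _ => pow_ne_zero _ (by exact_mod_cast hp.ne_zero)) (by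
        rcases Nat.eq_zero_or_pos k with h | h
        · exact .inl h
        · right
          have := (hJ (k - 1) (by omega)).1.2
          rw [update_powers_self, Nat.sub_add_cancel h] at this
          exact this)
    classical
    have hex' : ∃ j, 0 < j ∧
        res (fcof (natMat M.adjugate) p (Function.update (powers p J) (k + 1) ((p : ℤ) ^ j)) (k + 1) 0)
        (fcof (natMat M.adjugate) p (Function.update (powers p J) (k + 1) ((p : ℤ) ^ j)) (k + 1) 1)
        ≠ 0 := by
      obtain ⟨j, h1, -, h2⟩ := hex
      exact ⟨j, h1, h2⟩
    refine ⟨Function.update J (k + 1) (Nat.find hex'), fun i hi => ?_⟩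
    rw [powers_update]
    rcases Nat.lt_succ_iff_lt_or_eq.1 hi with h | rfl
    · have hc : ∀ (j : ℕ) (r : ℕ), fcof (natMat M.adjugate) p (Function.update
          (Function.update (powers p J) (k + 1) ((p : ℤ) ^ Nat.find hex')) (i + 1) ((p : ℤ) ^ j))
          (i + 1) r = fcof (natMat M.adjugate) p
          (Function.update (powers p J) (i + 1) ((p : ℤ) ^ j)) (i + 1) r := fun j r => by
        refine fcof_congr _ _ _ (fun t _ ht => ?_) r
        by_cases h' : t = i + 1
        · subst h'; simp
        · rw [Function.update_of_ne h', Function.update_of_ne h', Function.update_of_ne (by omega)]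
      rw [Function.update_of_ne (by omega)]
      simp only [hc]
      exact hJ i h
    · simp only [Function.update_idem, Function.update_self]
      exact ⟨Nat.find_spec hex', fun j hj => Nat.find_min' hex' hj⟩

theorem LoopData.isLeast (h : LoopData hn M p J) {k : ℕ} (hk : k + 1 < n) :
    IsLeast {j : ℕ | 0 < j ∧
      res (fcof (natMat M.adjugate) p (Function.update (powers p J) (k + 1) ((p : ℤ) ^ j)) (k + 1) 0)
        (fcof (natMat M.adjugate) p (Function.update (powers p J) (k + 1) ((p : ℤ) ^ j)) (k + 1) 1)
        ≠ 0} (J (k + 1)) := by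
  have := h.J_spec k hk
  simpa only [testDet_loopStep] using this

theorem LoopData.res_ne_zero (h : LoopData hn M p J) {k : ℕ} (hk : k + 1 < n) :
    res (fcof (natMat M.adjugate) p (powers p J) (k + 1) 0)
      (fcof (natMat M.adjugate) p (powers p J) (k + 1) 1) ≠ 0 := by
  have := (h.isLeast hn hk).1.2
  rwa [update_powers_self] at this

theorem LoopData.exponent_le (h : LoopData hn M p J) {k : ℕ} (hk : k + 1 < n) :
    J (k + 1) ≤ 2 * k + 2 := by
  have hp := h.p_spec.1.1
  obtain ⟨j, h1, h2, h3⟩ := exists_exponent (natMat M.adjugate) (p := p)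
    (by exact_mod_cast hp.two_le)
    (Y := powers p J) (i := k) (fun k _ _ => pow_ne_zero _ (by exact_mod_cast hp.ne_zero)) (by
      rcases Nat.eq_zero_or_pos k with h' | h'
      · exact .inl h'
      · right
        have := h.res_ne_zero hn (k := k - 1) (by omega)
        rwa [Nat.sub_add_cancel h'] at this)
  exact ((h.isLeast hn hk).2 ⟨h1, h3⟩).trans h2

theorem exists_loopData (hM : M.det ≠ 0) (h0 : M (lst hn) (fst hn) ≠ 0) :
    ∃ p J, LoopData hn M p J := by
  classical
  have hex : ∃ q : ℕ, q.Prime ∧ ¬ (q : ℤ) ∣ M (lst hn) (fst hn) * M.det := by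
    obtain ⟨q, h1, h2⟩ := Nat.exists_infinite_primes ((M (lst hn) (fst hn) * M.det).natAbs + 1)
    refine ⟨q, h2, fun hd => ?_⟩
    have := Nat.le_of_dvd (Int.natAbs_pos.2 (mul_ne_zero h0 hM)) (Int.natCast_dvd.1 hd)
    omega
  obtain ⟨J, hJ⟩ := exists_exponents (M := M) (Nat.find_spec hex).1 n
  refine ⟨Nat.find hex, J, ⟨Nat.find_spec hex, fun q hq => Nat.find_min' hex hq⟩, fun k hk => ?_⟩
  simpa only [testDet_loopStep] using hJ k (by omega)

theorem adjugate_map_eval {W : Matrix (Fin n) (Fin n) ℤ[X]} (hW : ∀ u v, W u v = poly M p J u v)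
    (τ : ℤ) (r c : Fin n) :
    (W.map (eval τ)).adjugate c r = (cof (poly M p J) n r c).eval τ := by
  have : (W.map (eval τ)).adjugate = (W.adjugate).map (eval τ) :=
    ((evalRingHom τ).map_adjugate W).symm
  rw [this, Matrix.map_apply, adjugate_eq_cof W (poly M p J) hW]

theorem det_map_eval {W : Matrix (Fin n) (Fin n) ℤ[X]} (hW : ∀ u v, W u v = poly M p J u v)
    (τ : ℤ) (c : ℕ) : (W.map (eval τ)).det = (cof (poly M p J) n n c).eval τ := by
  have : (W.map (eval τ)).det = W.det.eval τ := ((evalRingHom τ).map_det W).symm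
  rw [this, cof]
  congr 2
  ext1 x y
  rw [Matrix.of_apply, if_neg x.2.ne, hW]

theorem adjugate_lst {W : Matrix (Fin n) (Fin n) ℤ[X]} (hW : ∀ u v, W u v = poly M p J u v)
    (τ : ℤ) (r : Fin n) : (W.map (eval τ)).adjugate (lst hn) r = (lastCof M p J r).eval τ := by
  rw [adjugate_map_eval hW, lastCof, fcof, Nat.sub_add_cancel (by omega)]
  rfl

theorem testDet_lst {W : Matrix (Fin n) (Fin n) ℤ[X]} (hW : ∀ u v, W u v = poly M p J u v) :
    testDet W (lst hn) = res (lastCof M p J 0) (lastCof M p J 1) :=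
  testDet_eq (by simp [lst]; omega) fun u v _ => hW u v

/-- Modulo `p`, the matrix of linear polynomials is a multiple of `adj M`. -/
theorem map_castRingHom_zmod (hJ : ∀ t, 1 ≤ t → t < n → 0 < J t)
    {W : Matrix (Fin n) (Fin n) ℤ[X]} (hW : ∀ u v, W u v = poly M p J u v) (τ : ℤ) :
    (W.map (eval τ)).map (Int.castRingHom (ZMod p)) =
      (τ : ZMod p) • (M.map (Int.castRingHom (ZMod p))).adjugate := by
  have h0 : (M.map (Int.castRingHom (ZMod p))).adjugate =
      M.adjugate.map (Int.castRingHom (ZMod p)) := ((Int.castRingHom (ZMod p)).map_adjugate M).symm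
  rw [h0]
  ext u v
  have h1 : eval τ (W u v) = τ * M.adjugate u v + famConst p (powers p J) u v := by
    rw [hW, poly, fam, eval_add, eval_mul, eval_X, eval_C, eval_C, natMat_apply]
  have h2 : ((famConst p (powers p J) u v : ℤ) : ZMod p) = 0 := by
    rw [ZMod.intCast_zmod_eq_zero_iff_dvd]
    have h3 : 1 ≤ u.val → (p : ℤ) ∣ powers p J u := fun h => dvd_pow_self _ (hJ u h u.2).ne'
    unfold famConst
    refine dvd_add ?_ ?_
    · split_ifs <;> simp
    · split_ifs with h4 h5 h6 h6
      · simp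
      · exact dvd_add dvd_rfl (h3 (by omega))
      · simp
      · simpa using h3 (by omega)
      · simp
  simp only [Matrix.map_apply, h1, eq_intCast, Int.cast_add, h2, Int.cast_mul, add_zero,
    Matrix.smul_apply, smul_eq_mul]

/-! ### The substituted value and the Bézout coefficients -/

theorem not_dvd_coprimePart (hp : p.Prime) {c : ℤ} (hc : c ≠ 0) : ¬ (p : ℤ) ∣ coprimePart p c := by
  have : Fact p.Prime := ⟨hp⟩
  unfold coprimePart
  split_ifs with h
  · intro h
    have h1 := (Int.dvd_add_right (dvd_refl (p : ℤ))).1 h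
    exact hp.one_lt.ne' (by exact_mod_cast Int.eq_one_of_dvd_one (by positivity) h1)
  · intro h
    have h1 : (p : ℤ) ^ (padicValInt p c + 1) ∣ c := by
      obtain ⟨d, hd⟩ := padicValInt_dvd (p := p) c
      have hp0 : (p : ℤ) ^ padicValInt p c ≠ 0 := pow_ne_zero _ (by exact_mod_cast hp.ne_zero)
      have h2 : c / (p : ℤ) ^ padicValInt p c = d := Int.ediv_eq_of_eq_mul_right hp0 hd
      rw [h2] at h
      conv_rhs => rw [hd]
      rw [pow_succ]
      exact mul_dvd_mul_left _ h
    rw [padicValInt_dvd_iff] at h1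
    rcases h1 with h1 | h1
    · exact hc h1
    · omega

theorem two_le_abs_coprimePart (hp : p.Prime) {c : ℤ} (hc : c ≠ 0) : 2 ≤ |coprimePart p c| := by
  have : Fact p.Prime := ⟨hp⟩
  unfold coprimePart
  split_ifs with h
  · have := hp.two_le
    rw [abs_of_nonneg (by omega)]; omega
  · obtain ⟨d, hd⟩ := padicValInt_dvd (p := p) c
    have hp0 : (p : ℤ) ^ padicValInt p c ≠ 0 := pow_ne_zero _ (by exact_mod_cast hp.ne_zero)
    have h2 : c / (p : ℤ) ^ padicValInt p c = d := Int.ediv_eq_of_eq_mul_right hp0 hd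
    rw [h2]
    have h3 : c.natAbs = p ^ padicValInt p c * d.natAbs := by
      conv_lhs => rw [hd]
      rw [Int.natAbs_mul, Int.natAbs_pow, Int.natAbs_natCast]
    have h4 : d.natAbs ≠ 0 := by
      intro h; rw [h, mul_zero] at h3; exact hc (Int.natAbs_eq_zero.1 h3)
    have h5 : d.natAbs ≠ 1 := by
      intro h'; rw [h', mul_one] at h3; exact h h3
    rw [Int.abs_eq_natAbs]; omega

theorem abs_coprimePart_le (p : ℕ) (c : ℤ) : |coprimePart p c| ≤ |c| + (p + 1) := by
  unfold coprimePart
  split_ifs with h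
  · rw [abs_of_nonneg (a := (p : ℤ) + 1) (by omega)]
    have := abs_nonneg c; omega
  · have := Int.natAbs_ediv_le_natAbs c ((p : ℤ) ^ padicValInt p c)
    rw [Int.abs_eq_natAbs, Int.abs_eq_natAbs]; omega

theorem dvd_coprimePart {q : ℕ} (hq : q.Prime) (hp : p.Prime) (hqp : q ≠ p) {c : ℤ}
    (h : (q : ℤ) ∣ c) : (q : ℤ) ∣ coprimePart p c := by
  have hnd : ¬ q ∣ p ^ padicValInt p c := fun h' =>
    hqp ((Nat.prime_dvd_prime_iff_eq hq hp).1 (hq.dvd_of_dvd_pow h'))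
  unfold coprimePart
  split_ifs with h'
  · rw [Int.natCast_dvd, h'] at h
    exact absurd h hnd
  · obtain ⟨d, hd⟩ := padicValInt_dvd (p := p) c
    have hp0 : (p : ℤ) ^ padicValInt p c ≠ 0 := pow_ne_zero _ (by exact_mod_cast hp.ne_zero)
    have h2 : c / (p : ℤ) ^ padicValInt p c = d := Int.ediv_eq_of_eq_mul_right hp0 hd
    rw [h2]
    rw [hd] at h
    refine ((Nat.prime_iff_prime_int.1 hq).dvd_or_dvd h).resolve_left fun h3 => hnd ?_
    exact_mod_cast h3

variable {W : Matrix (Fin n) (Fin n) ℤ[X]}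

theorem LoopData.res_lastCof_ne_zero (h : LoopData hn M p J) :
    res (lastCof M p J 0) (lastCof M p J 1) ≠ 0 := by
  have := h.res_ne_zero hn (k := n - 2) (by omega)
  rwa [show n - 2 + 1 = n - 1 by omega] at this

theorem LoopData.not_dvd (h : LoopData hn M p J) :
    ¬ (p : ℤ) ∣ M (lst hn) (fst hn) ∧ ¬ (p : ℤ) ∣ M.det :=
  ⟨fun h' => h.p_spec.1.2 (h'.mul_right _), fun h' => h.p_spec.1.2 (h'.mul_left _)⟩

/-- Modulo `p`, the matrix is `τ` times the adjugate of `M`. -/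
theorem LoopData.det_ne_zero (h : LoopData hn M p J) (hW : ∀ u v, W u v = poly M p J u v) {τ : ℤ}
    (hτ : ¬ (p : ℤ) ∣ τ) : (W.map (eval τ)).det ≠ 0 := by
  have : Fact p.Prime := ⟨h.p_spec.1.1⟩
  intro h0
  have h1 : ((W.map (eval τ)).map (Int.castRingHom (ZMod p))).det = 0 := by
    rw [← RingHom.mapMatrix_apply, ← RingHom.map_det, h0, map_zero]
  rw [map_castRingHom_zmod (fun t h1 h2 => by
    have := (h.isLeast hn (k := t - 1) (by omega)).1.1
    rwa [Nat.sub_add_cancel h1] at this) hW, Matrix.det_smul, Matrix.det_adjugate,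
    ← RingHom.mapMatrix_apply, ← RingHom.map_det, mul_eq_zero] at h1
  rcases h1 with h1 | h1
  · exact hτ ((ZMod.intCast_zmod_eq_zero_iff_dvd _ _).1 (eq_zero_of_pow_eq_zero h1))
  · exact h.not_dvd.2 ((ZMod.intCast_zmod_eq_zero_iff_dvd _ _).1 (eq_zero_of_pow_eq_zero h1))

theorem LoopData.not_dvd_eval_lastCof_zero (h : LoopData hn M p J)
    (hW : ∀ u v, W u v = poly M p J u v) {τ : ℤ}
    (hτ : ¬ (p : ℤ) ∣ τ) : ¬ (p : ℤ) ∣ (lastCof M p J 0).eval τ := by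
  have : Fact p.Prime := ⟨h.p_spec.1.1⟩
  intro h0
  have h1 : ((W.map (eval τ)).map (Int.castRingHom (ZMod p))).adjugate (lst hn) (fst hn) = 0 := by
    rw [← RingHom.mapMatrix_apply, ← RingHom.map_adjugate, RingHom.mapMatrix_apply,
      Matrix.map_apply, adjugate_lst hn hW]
    exact (ZMod.intCast_zmod_eq_zero_iff_dvd _ _).2 h0
  rw [map_castRingHom_zmod (fun t h1 h2 => by
    have := (h.isLeast hn (k := t - 1) (by omega)).1.1
    rwa [Nat.sub_add_cancel h1] at this) hW, Matrix.adjugate_smul,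
    Matrix.adjugate_adjugate _ (by simp; omega), ← RingHom.mapMatrix_apply, ← RingHom.map_det,
    Matrix.smul_apply, Matrix.smul_apply, RingHom.mapMatrix_apply, Matrix.map_apply,
    smul_eq_mul, smul_eq_mul, mul_eq_zero, mul_eq_zero] at h1
  rcases h1 with h1 | h1 | h1
  · exact hτ ((ZMod.intCast_zmod_eq_zero_iff_dvd _ _).1 (eq_zero_of_pow_eq_zero h1))
  · exact h.not_dvd.2 ((ZMod.intCast_zmod_eq_zero_iff_dvd _ _).1 (eq_zero_of_pow_eq_zero h1))
  · exact h.not_dvd.1 ((ZMod.intCast_zmod_eq_zero_iff_dvd _ _).1 h1)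

/-- The first cofactor has degree `n - 1`. -/
theorem coeff_lastCof_zero (hM : M.det ≠ 0) (h0 : M (lst hn) (fst hn) ≠ 0) :
    (lastCof M p J 0).coeff (n - 1) ≠ 0 := by
  rw [lastCof, coeff_fcof _ _ _ (by omega), Nat.sub_add_cancel (by omega)]
  have := adjugate_eq_cof M.adjugate (natMat M.adjugate) (fun i j => (natMat_apply _ i j).symm)
    (lst hn) (fst hn)
  have h2 : cof (natMat M.adjugate) n 0 (n - 1) = M.adjugate.adjugate (lst hn) (fst hn) := this.symm
  rw [h2, Matrix.adjugate_adjugate _ (by simp; omega), Matrix.smul_apply, smul_eq_mul]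
  exact mul_ne_zero (pow_ne_zero _ hM) h0

theorem LoopData.prime_dvd_of_dvd (h : LoopData hn M p J) {q : ℕ} (hq : q.Prime) {τ : ℤ}
    (hqτ : (q : ℤ) ∣ τ) (h1 : (q : ℤ) ∣ (lastCof M p J 1).eval τ) : q = p := by
  have h2 : (q : ℤ) ∣ (lastCof M p J 1).eval 0 := by
    have := (hqτ.trans (by simpa using sub_dvd_eval_sub τ 0 (lastCof M p J 1)))
    exact (dvd_sub_right h1).1 this
  rw [lastCof, show n - 1 = n - 2 + 1 by omega] at h2
  have h3 := prime_dvd_of_dvd_eval_zero_fcof_one _ (Nat.prime_iff_prime_int.1 hq) h2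
  exact (Nat.prime_dvd_prime_iff_eq hq h.p_spec.1.1).1 (by exact_mod_cast h3)

/-- A common prime divisor `q` of the two cofactors is different from `p`, and it divides the
resultant. Hence it divides `τ`, which is impossible since the second cofactor is, up to sign, a
product of powers of `p` modulo `τ`. -/
theorem LoopData.isCoprime (h : LoopData hn M p J) (hM : M.det ≠ 0)
    (hW : ∀ u v, W u v = poly M p J u v) {e : ℕ} (he : e ≠ 0) {τ : ℤ}
    (hτ : τ = coprimePart p (res (lastCof M p J 0) (lastCof M p J 1)) ^ e) :
    IsCoprime ((lastCof M p J 0).eval τ) ((lastCof M p J 1).eval τ) ∧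
      (lastCof M p J 1).eval τ ≠ 0 := by
  have hp := h.p_spec.1.1
  have hr := h.res_lastCof_ne_zero
  set c := coprimePart p (res (lastCof M p J 0) (lastCof M p J 1)) with hc
  have hcp : ¬ (p : ℤ) ∣ c := not_dvd_coprimePart hp hr
  have hτp : ¬ (p : ℤ) ∣ τ := fun hd =>
    hcp ((Nat.prime_iff_prime_int.1 hp).dvd_of_dvd_pow (hτ ▸ hd))
  have h00 : M (lst hn) (fst hn) ≠ 0 := fun h0 => h.not_dvd.1 (by simp [h0])
  constructor
  · rw [Int.isCoprime_iff_gcd_eq_one]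
    by_contra hne
    obtain ⟨q, hq, hqd⟩ := Nat.exists_prime_and_dvd hne
    have hq0 : (q : ℤ) ∣ (lastCof M p J 0).eval τ :=
      (Int.natCast_dvd_natCast.2 hqd).trans (Int.gcd_dvd_left _ _)
    have hq1 : (q : ℤ) ∣ (lastCof M p J 1).eval τ :=
      (Int.natCast_dvd_natCast.2 hqd).trans (Int.gcd_dvd_right _ _)
    have hqp : q ≠ p := by
      rintro rfl
      exact h.not_dvd_eval_lastCof_zero hn hW hτp hq0
    have hdeg : n - 1 ≤ (lastCof M p J 0).natDegree :=
      le_natDegree_of_ne_zero (coeff_lastCof_zero hn hM h00)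
    obtain ⟨u, v, -, -, huv⟩ := exists_mul_add_mul_eq_C_resultant (lastCof M p J 0)
      (lastCof M p J 1) (le_max_left _ (lastCof M p J 1).natDegree)
      (le_max_right (lastCof M p J 0).natDegree _) (by omega)
    have hqr : (q : ℤ) ∣ res (lastCof M p J 0) (lastCof M p J 1) := by
      have := congrArg (eval τ) huv
      rw [eval_add, eval_mul, eval_mul, eval_C] at this
      rw [res, ← this]
      exact dvd_add (hq0.mul_right _) (hq1.mul_right _)
    have hqc : (q : ℤ) ∣ c := dvd_coprimePart hq hp hqp hqr
    exact hqp (h.prime_dvd_of_dvd hn hq (hτ ▸ hqc.trans (dvd_pow_self _ he)) hq1)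
  · intro h0
    have h2 := two_le_abs_coprimePart hp hr
    rw [← hc, Int.abs_eq_natAbs] at h2
    obtain ⟨q, hq, hqd⟩ := Nat.exists_prime_and_dvd (show c.natAbs ≠ 1 by omega)
    have hqc : (q : ℤ) ∣ c := Int.natCast_dvd.2 hqd
    have := h.prime_dvd_of_dvd hn hq (hτ ▸ hqc.trans (dvd_pow_self _ he)) (by rw [h0]; simp)
    exact hcp (this ▸ hqc)

theorem substExponent_ne_zero {a : ℕ} (ha : 0 < a) (h0 : 0 < M (lst hn) (fst hn)) {c : ℤ}
    (hc : 2 ≤ |c|) : substExponent hn a M c ≠ 0 := by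
  unfold substExponent
  refine (Nat.ceil_pos.2 (Real.logb_pos ?_ ?_)).ne'
  · have : (2 : ℝ) ≤ |(c : ℝ)| := by exact_mod_cast hc
    linarith
  · have h1 : (1 : ℝ) ≤ a := by exact_mod_cast ha
    have h2 : (1 : ℝ) ≤ M (lst hn) (fst hn) := by exact_mod_cast h0
    have h3 : (2 : ℝ) ≤ n := by exact_mod_cast hn
    have h4 : (4 : ℝ) ≤ 2 * M (lst hn) (fst hn) * n := by nlinarith
    have h5 : (1 : ℝ) < (2 * M (lst hn) (fst hn) * n) ^ (3 * n) :=
      one_lt_pow₀ (by linarith) (by omega)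
    nlinarith [one_le_pow₀ h1 (n := 2)]

/-- The coefficient `b₁` can be chosen as the balanced representative of the inverse of `f` modulo
`g`, which is the choice with `|b₁|` minimal (`abs_le_of_bezout`). -/
theorem exists_bezout {f g : ℤ} (h : IsCoprime f g) (hg : g ≠ 0) :
    ∃ b₁ b₂ : ℤ, b₁ * f + b₂ * g = 1 ∧ -|g| < 2 * b₁ ∧ 2 * b₁ ≤ |g| := by
  obtain ⟨u, v, huv⟩ := h
  obtain ⟨k, hk1, hk2⟩ : ∃ k : ℤ, -|g| < 2 * (u + k * g) ∧ 2 * (u + k * g) ≤ |g| := by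
    have hg0 := abs_pos.2 hg
    obtain ⟨s, hs⟩ : ∃ s : ℤ, |g| = s * g := by
      rcases abs_choice g with h | h
      · exact ⟨1, by rw [h]; ring⟩
      · exact ⟨-1, by rw [h]; ring⟩
    have e1 := Int.emod_add_mul_ediv u |g|
    have e2 := Int.emod_nonneg u hg0.ne'
    have e3 := Int.emod_lt_of_pos u hg0
    by_cases hlt : 2 * (u % |g|) ≤ |g|
    · refine ⟨-(s * (u / |g|)), ?_⟩
      have : u + -(s * (u / |g|)) * g = u % |g| := by
        rw [show -(s * (u / |g|)) * g = -((s * g) * (u / |g|)) by ring, ← hs]; linarith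
      rw [this]; omega
    · refine ⟨-(s * (u / |g| + 1)), ?_⟩
      have : u + -(s * (u / |g| + 1)) * g = u % |g| - |g| := by
        rw [show -(s * (u / |g| + 1)) * g = -((s * g) * (u / |g| + 1)) by ring, ← hs]; linarith
      rw [this]; omega
  exact ⟨u + k * g, v - k * f, by linarith, hk1, hk2⟩

theorem dvd_sub_of_bezout {f g b₁ b₂ b₁' b₂' : ℤ} (h : b₁ * f + b₂ * g = 1)
    (h' : b₁' * f + b₂' * g = 1) : g ∣ b₁' - b₁ := by
  have hc : IsCoprime g f := ⟨b₂, b₁, by linarith⟩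
  refine hc.dvd_of_dvd_mul_right ⟨b₂ - b₂', by linarith⟩

theorem abs_le_of_bezout {f g b₁ b₂ b₁' b₂' : ℤ} (h : b₁ * f + b₂ * g = 1)
    (h1 : -|g| < 2 * b₁) (h2 : 2 * b₁ ≤ |g|) (h' : b₁' * f + b₂' * g = 1) : |b₁| ≤ |b₁'| := by
  rcases eq_or_ne (b₁' - b₁) 0 with h0 | h0
  · rw [sub_eq_zero.1 h0]
  · have := Int.le_of_dvd (abs_pos.2 h0) ((abs_dvd_abs _ _).2 (dvd_sub_of_bezout h h'))
    grind

theorem eq_of_bezout {f g b₁ b₂ b₁' b₂' : ℤ} (h : b₁ * f + b₂ * g = 1)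
    (h1 : -|g| < 2 * b₁) (h2 : 2 * b₁ ≤ |g|) (h' : b₁' * f + b₂' * g = 1)
    (h1' : -|g| < 2 * b₁') (h2' : 2 * b₁' ≤ |g|) : b₁' = b₁ := by
  by_contra hne
  have := Int.le_of_dvd (abs_pos.2 (sub_ne_zero.2 hne)) ((abs_dvd_abs _ _).2 (dvd_sub_of_bezout h h'))
  grind

end

/-! ### Preparation: parameters, packed rows of the input, and the prime -/

/-- The parameters that the program keeps in fixed registers: besides the input, these are the
numbers `S`, `x`, `Z` that determine the encodings, and the addresses of the packed rows of `M`
(register `12`), of the packed rows of `W` (register `13`) and of the query (register `14`), which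
follow one another in the memory after the input. -/
structure Env (n a b : ℕ) (m S x Z : ℤ) (σ : State) : Prop where
  r0 : σ.reg 0 = n
  r1 : σ.reg 1 = a
  r2 : σ.reg 2 = b
  r3 : σ.reg 3 = m
  r4 : σ.reg 4 = S
  r5 : σ.reg 5 = Z
  r6 : σ.reg 6 = x
  r12 : σ.reg 12 = 3 + n * n
  r13 : σ.reg 13 = 3 + n * n + n
  r14 : σ.reg 14 = 3 + n * n + n + n

section

variable {n a b : ℕ} {m S x Z : ℤ} {σ σ' : State}

theorem Env.frame (h : Env n a b m S x Z σ) {k : ℕ} (hk : 15 ≤ k) (hF : Frame k σ σ') :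
    Env n a b m S x Z σ' := by
  obtain ⟨h0, h1, h2, h3, h4, h5, h6, h12, h13, h14⟩ := h
  constructor <;> rw [hF.1 _ (by omega)] <;> assumption

theorem Env.set (h : Env n a b m S x Z σ) {d : ℕ} (hd : 7 ≤ d ∧ d ≤ 11 ∨ 15 ≤ d) {z : ℤ} :
    Env n a b m S x Z (σ.setReg d z) := by
  obtain ⟨h0, h1, h2, h3, h4, h5, h6, h12, h13, h14⟩ := h
  constructor <;> rw [reg_setReg, if_neg (by omega)] <;> assumption

theorem Env.put (h : Env n a b m S x Z σ) {k z : ℤ} : Env n a b m S x Z (σ.setMem k z) := by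
  obtain ⟨h0, h1, h2, h3, h4, h5, h6, h12, h13, h14⟩ := h
  constructor <;> rw [reg_setMem] <;> assumption

end

/-- The memory cells that hold the input. -/
structure Input {n : ℕ} (a b : ℕ) (M : Matrix (Fin n) (Fin n) ℤ) (σ : State) : Prop where
  m0 : σ.mem 0 = n
  m1 : σ.mem 1 = a
  m2 : σ.mem 2 = b
  entry : ∀ i < n, ∀ j < n, σ.mem (3 + i * n + j) = natMat M i j

theorem input_initialState {n : ℕ} (a b : ℕ) (M : Matrix (Fin n) (Fin n) ℤ) :
    Input a b M (initialState a b M) := by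
  refine ⟨rfl, rfl, rfl, fun i hi j hj => ?_⟩
  have h1 : (3 + (i : ℤ) * n + j - 3).toNat = i * n + j := by
    rw [show 3 + (i : ℤ) * n + j - 3 = ((i * n + j : ℕ) : ℤ) by push_cast; ring, Int.toNat_natCast]
  have h2 : i * n + j < n * n := by nlinarith
  have h3 : (0 : ℤ) ≤ i * n := by positivity
  have h4 : 3 ≤ 3 + (i : ℤ) * n + j ∧ (3 + (i : ℤ) * n + j - 3).toNat < n * n :=
    ⟨by omega, by rw [h1]; exact h2⟩
  have h5 : (finProdFinEquiv (⟨i, hi⟩, ⟨j, hj⟩) : Fin (n * n)) =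
      ⟨(3 + (i : ℤ) * n + j - 3).toNat, h4.2⟩ := by
    ext; simp only [finProdFinEquiv_apply_val, h1]; ring
  simp only [initialState]
  rw [if_neg (by omega), if_neg (by omega), if_neg (by omega), dif_pos h4, ← h5,
    Equiv.symm_apply_apply, natMat, dif_pos ⟨hi, hj⟩]

/-- The numbers that determine the encodings. The base `x` for polynomials has length
`O(n² log (mn))` and the base `Z` for rows has length `O(n³ log (mn))`. -/
structure Scales (n : ℕ) (m S β x Z : ℤ) (B : ℕ) : Prop extends Sizes n β x Z B where
  hm : 1 ≤ m
  hmβ : m ≤ β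
  hS : S = 10000 * m * n
  hxS : x = S ^ (6 * n * n)
  hZx : Z = x ^ (2 * n)

/-- The parameters are read and computed. -/
def initProg : Program :=
  .seq (set 0 (.load (.const 0))) <| .seq (set 1 (.load (.const 1))) <|
  .seq (set 2 (.load (.const 2))) <| .seq (set 12 (.const 3 + .reg 0 * .reg 0)) <|
  .seq (set 13 (.reg 12 + .reg 0)) <| .seq (set 14 (.reg 13 + .reg 0)) <|
  .seq (set 3 (.load (.reg 12 - .reg 0))) <|
  .seq (set 4 (.const 10000 * .reg 3 * .reg 0)) <| .seq (set 6 (.const 1)) <|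
  .seq (forE 8 (.const 0) (.const 6 * .reg 0 * .reg 0) (set 6 (.reg 6 * .reg 4))) <|
  .seq (set 5 (.const 1)) <|
  forE 8 (.const 0) (.const 2 * .reg 0) (set 5 (.reg 5 * .reg 6))

section

variable {n a b : ℕ} {m S β x Z : ℤ} {B : ℕ} {M : Matrix (Fin n) (Fin n) ℤ} {O : List ℤ → ℤ}

theorem Scales.one_le_n (h : Scales n m S β x Z B) : (2 : ℤ) ≤ n := by have := h.hn; omega

theorem Scales.le_S (h : Scales n m S β x Z B) : 20000 ≤ S ∧ 10000 * n ≤ S ∧ 20000 * m ≤ S := by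
  have h1 := h.one_le_n; have h2 := h.hm
  rw [h.hS]
  refine ⟨by nlinarith, by nlinarith, by nlinarith⟩

theorem Scales.S_pow_le (h : Scales n m S β x Z B) {t : ℕ} (ht : t ≤ 24 * n ^ 4) : S ^ t ≤ B := by
  have h1 := h.le_S.1
  refine le_trans (pow_le_pow_right₀ (by omega) ht) (le_trans (le_of_eq ?_) h.hZB)
  rw [h.hZx, h.hxS, ← pow_mul, ← pow_mul]
  congr 1; ring

theorem Scales.addr_le (h : Scales n m S β x Z B) : 6 * (n * n : ℤ) + 3 * n + 100 ≤ B := by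
  have h1 := h.le_S
  have h2 := h.one_le_n
  have h3 := h.S_pow_le (t := 2) (by have := Nat.one_le_pow 4 n (by have := h.hn; omega); omega)
  nlinarith

set_option maxHeartbeats 1000000 in
theorem run_initProg (hS : Scales n m S β x Z B) (hn : 2 ≤ n) {σ : State} (hI : Input a b M σ)
    (hm : natMat M (n - 1) 0 = m) :
    Run O B initProg σ (2000 * (n * n)) fun σ' => Env n a b m S x Z σ' ∧ σ'.mem = σ.mem := by
  apply Run.of_bounded
  intro hσ
  have hB := hS.hB
  have ha := hS.addr_le
  have hn1 := hS.one_le_n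
  have hSS := hS.le_S
  have hx1 := hS.one_le_x
  have hxZ := hS.x_lt
  have hnn : (0 : ℤ) ≤ n * n := by positivity
  have hmem : ∀ k, |σ.mem k| ≤ B := hσ.2
  have hn4 : n ≤ n ^ 4 := Nat.le_self_pow (by norm_num) n
  have hn24 : n ^ 2 ≤ n ^ 4 := Nat.pow_le_pow_right (by omega) (by norm_num)
  have hm' : σ.mem (3 + n * n - n) = m := by
    have := hI.entry (n - 1) (by omega) 0 (by omega)
    rw [hm] at this
    rw [← this]
    congr 1
    push_cast [Nat.cast_sub (show 1 ≤ n by omega)]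
    ring
  have main : Run O B initProg σ (60 + (60 + (60 + (60 + (60 + (60 + (60 + (60 + (60 +
      ((6 * n * n) * (60 + 121) + 121 + (60 + ((2 * n) * (60 + 121) + 121))))))))))))
      fun σ' => Env n a b m S x Z σ' ∧ σ'.mem = σ.mem := by
    refine .seq (.set hB (by decide) (hmem _) ?_)
    refine .seq (.set hB (by decide) (hmem _) ?_)
    refine .seq (.set hB (by decide) (hmem _) ?_)
    refine .seq (.set hB (by decide)
      (by simp [hI.m0]; rw [abs_of_nonneg (by omega)]; omega) ?_)
    refine .seq (.set hB (by decide)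
      (by simp [hI.m0]; rw [abs_of_nonneg (by omega)]; omega) ?_)
    refine .seq (.set hB (by decide)
      (by simp [hI.m0]; rw [abs_of_nonneg (by omega)]; omega) ?_)
    refine .seq (.set hB (by decide) (hmem _) ?_)
    refine .seq (.set hB (by decide) (by
      simp [hI.m0, hm', -abs_mul]
      rw [← hS.hS, abs_of_nonneg (by omega)]
      simpa using hS.S_pow_le (t := 1) (by omega)) ?_)
    refine .seq (.set hB (by decide) (by simp; omega) ?_)
    refine .seq ?_
    refine .forE hB (by decide) 0 (6 * n * n) 60 (fun t σ' => t ≤ 6 * n * n ∧ σ'.mem = σ.mem ∧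
      σ'.reg 0 = n ∧ σ'.reg 1 = a ∧ σ'.reg 2 = b ∧ σ'.reg 3 = m ∧ σ'.reg 4 = S ∧
      σ'.reg 6 = S ^ t ∧ σ'.reg 8 = t ∧ σ'.reg 12 = 3 + n * n ∧ σ'.reg 13 = 3 + n * n + n ∧
      σ'.reg 14 = 3 + n * n + n + n) rfl (by simp)
      (by rw [abs_of_nonneg (by positivity)]; push_cast; linarith) ?_ ?_ ?_ ?_
    · simp [hI.m0, hI.m1, hI.m2, hm', hS.hS]
    · rintro t σ' ⟨-, -, h0, -, -, -, -, -, h8, -⟩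
      exact ⟨by simp [h8], by simp [h0]⟩
    · rintro t σ' ht ⟨-, hM, h0, h1, h2, h3, h4, h6, h8, h12, h13, h14⟩
      refine .set hB (by decide) ?_ ?_
      · simp only [Expr.eval_mul, Expr.eval_reg, h6, h4, ← pow_succ]
        rw [abs_of_nonneg (pow_nonneg (by omega) _)]
        refine hS.S_pow_le ?_
        have : 6 * n * n = 6 * n ^ 2 := by ring
        omega
      · refine ⟨by simp [h8], by omega, ?_⟩
        simp [hM, h0, h1, h2, h3, h4, h6, h12, h13, h14, pow_succ]
    · rintro σ₁ ⟨-, hM, h0, h1, h2, h3, h4, h6, h8, h12, h13, h14⟩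
      rw [← hS.hxS] at h6
      refine .seq (.set hB (by decide) (by simp; omega) ?_)
      refine .forE hB (by decide) 0 (2 * n) 60 (fun t σ' => t ≤ 2 * n ∧ σ'.mem = σ.mem ∧
        σ'.reg 0 = n ∧ σ'.reg 1 = a ∧ σ'.reg 2 = b ∧ σ'.reg 3 = m ∧ σ'.reg 4 = S ∧
        σ'.reg 6 = x ∧ σ'.reg 5 = x ^ t ∧ σ'.reg 8 = t ∧ σ'.reg 12 = 3 + n * n ∧
        σ'.reg 13 = 3 + n * n + n ∧ σ'.reg 14 = 3 + n * n + n + n) rfl (by simp)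
        (by rw [abs_of_nonneg (by positivity)]; push_cast; linarith) ?_ ?_ ?_ ?_
      · simp [hM, h0, h1, h2, h3, h4, h6, h12, h13, h14]
      · rintro t σ' ⟨-, -, h0, -, -, -, -, -, -, h8, -⟩
        exact ⟨by simp [h8], by simp [h0]⟩
      · rintro t σ' ht ⟨-, hM, h0, h1, h2, h3, h4, h6, h5, h8, h12, h13, h14⟩
        refine .set hB (by decide) ?_ ?_
        · simp only [Expr.eval_mul, Expr.eval_reg, h6, h5, ← pow_succ]
          rw [abs_of_nonneg (pow_nonneg (by omega) _)]
          calc x ^ (t + 1) ≤ x ^ (2 * n) := pow_le_pow_right₀ hx1 ht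
            _ = Z ^ 1 := by rw [pow_one, hS.hZx]
            _ ≤ B := hS.Z_pow_le (by omega)
        · refine ⟨by simp [h8], by omega, ?_⟩
          simp [hM, h0, h1, h2, h3, h4, h5, h6, h12, h13, h14, pow_succ]
      · rintro σ₂ ⟨-, hM, h0, h1, h2, h3, h4, h6, h5, h8, h12, h13, h14⟩
        exact ⟨⟨h0, h1, h2, h3, h4, by rw [h5, hS.hZx], h6, h12, h13, h14⟩, hM⟩
  refine main.mono ?_ fun _ h => h
  have : 2 * n ≤ n * n := by nlinarith
  have e : 6 * n * n = 6 * (n * n) := by ring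
  rw [e]
  generalize n * n = u at *
  omega

/-- The rows of the input are packed. -/
def packProg : Program :=
  forE 8 (.const 0) (.reg 0) <|
    .seq (set 11 (.const 1)) <| .seq (set 10 (.const 0)) <|
    .seq (forE 9 (.const 0) (.reg 0)
      (.seq (set 10 (.reg 10 + .load (.const 3 + .reg 8 * .reg 0 + .reg 9) * .reg 11)) <|
        set 11 (.reg 11 * .reg 5))) <|
    put (.reg 12 + .reg 8) (.reg 10)

/-- The rows of a matrix, packed, in consecutive memory cells. -/
def Rows (n : ℕ) (Z s : ℤ) (A : ℕ → ℕ → ℤ) (k : ℕ) (σ : State) : Prop :=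
  ∀ i : ℕ, i < k → σ.mem (s + i) = pack Z n (A i)

theorem pack_add_one (Z : ℤ) (N : ℕ) (f : ℕ → ℤ) :
    pack Z (N + 1) f = pack Z N f + f N * Z ^ N := Finset.sum_range_succ _ _

theorem Sizes.abs_pack_le (hS : Sizes n β x Z B) {t : ℕ} (ht : t ≤ 2 * n) {f : ℕ → ℤ}
    (h : ∀ j < t, 2 * |f j| < Z) : |pack Z t f| ≤ B := by
  have hZ : 1 ≤ Z := by have := hS.x_lt; have := hS.one_le_x; omega
  have h1 := two_mul_abs_pack_lt hZ h
  have h2 := hS.Z_pow_le ht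
  have := abs_nonneg (pack Z t f)
  omega

theorem Sizes.β_lt_x (hS : Sizes n β x Z B) : 2 * β < x := by
  have h1 := hS.hx
  have h2 := hS.hβ
  have h3 := hS.hn
  have h4 : (1 : ℤ) ≤ n := by omega
  have h5 : β ≤ n * β := by nlinarith
  have h6 : n * β ≤ (n * β) ^ n := by
    conv_lhs => rw [← pow_one (n * β)]
    exact pow_le_pow_right₀ (by omega) (by omega)
  omega

theorem run_packProg (hS : Scales n m S β x Z B) {σ : State} (hI : Input a b M σ)
    (hE : Env n a b m S x Z σ) (hM : ∀ i < n, ∀ j < n, |natMat M i j| ≤ m) :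
    Run O B packProg σ (2000 * (n * n)) fun σ' => Env n a b m S x Z σ' ∧
      Rows n Z (3 + n * n) (natMat M) n σ' := by
  have hB := hS.hB
  have ha := hS.addr_le
  have hn1 := hS.one_le_n
  have hn := hS.hn
  have hx1 := hS.one_le_x
  have hxZ := hS.x_lt
  have hnn : (0 : ℤ) ≤ n * n := by positivity
  have hβ := hS.β_lt_x
  have hmβ := hS.hmβ
  have hnB : |(0 : ℤ) + n| ≤ B := by rw [abs_of_nonneg (by omega)]; omega
  have hpk : ∀ i < n, ∀ t ≤ n, |pack Z t (natMat M i)| ≤ B := fun i hi t ht =>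
    hS.abs_pack_le (by omega) fun j hj => by have := hM i hi j (by omega); omega
  have main : Run O B packProg σ (n * ((60 + (60 + (n * ((60 + 60) + 121) + 121 + 121))) + 121) + 121)
      fun σ' => Env n a b m S x Z σ' ∧ Rows n Z (3 + n * n) (natMat M) n σ' := by
    refine .forE hB (by decide) 0 n (60 + (60 + (n * ((60 + 60) + 121) + 121 + 121)))
      (fun t σ' => t ≤ n ∧ Env n a b m S x Z σ' ∧ σ'.reg 8 = t ∧
        (∀ i < n, ∀ j < n, σ'.mem (3 + i * n + j) = natMat M i j) ∧
        Rows n Z (3 + n * n) (natMat M) t σ') rfl (by simp) hnB ?_ ?_ ?_ ?_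
    · exact ⟨by omega, hE.set (by omega), by simp, hI.entry, fun i hi => by omega⟩
    · rintro t σ₁ ⟨-, hE, h8, -⟩
      exact ⟨by simp [h8], by simp [hE.r0]⟩
    · rintro i σ₁ hi ⟨-, hE, h8, hin, hR⟩
      refine .seq (.set hB (by decide) (by simp; omega) ?_)
      refine .seq (.set hB (by decide) (by simp) ?_)
      refine .seq ?_
      refine .forE hB (by decide) 0 n (60 + 60) (fun t σ' => t ≤ n ∧ Env n a b m S x Z σ' ∧
        σ'.mem = σ₁.mem ∧ σ'.reg 8 = i ∧ σ'.reg 9 = t ∧ σ'.reg 10 = pack Z t (natMat M i) ∧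
        σ'.reg 11 = Z ^ t) rfl (by simp) hnB ?_ ?_ ?_ ?_
      · exact ⟨by omega, ((hE.set (by omega)).set (by omega)).set (by omega), by simp, by simp [h8],
          by simp, by simp [pack_zero], by simp⟩
      · rintro t σ₂ ⟨-, hE₂, -, -, h9, -⟩
        exact ⟨by simp [h9], by simp [hE₂.r0]⟩
      · rintro t σ₂ ht ⟨-, hE₂, hM₂, h8', h9, h10, h11⟩
        have hv : (Expr.reg 10 + .load (.const 3 + .reg 8 * .reg 0 + .reg 9) * .reg 11).eval σ₂ =
            pack Z (t + 1) (natMat M i) := by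
          simp only [Expr.eval_add, Expr.eval_reg, Expr.eval_load, Expr.eval_mul, Expr.eval_const,
            h8', h9, h10, h11, hE₂.r0, hM₂, hin i hi t ht, pack_add_one]
        refine Run.seq (T := 60) (T' := 60) (.set hB (by decide)
          (by rw [hv]; exact hpk i hi _ ht) ?_)
        rw [hv]
        refine .set hB (by decide) ?_ ?_
        · simp only [Expr.eval_mul, Expr.eval_reg, reg_setReg, h11, hE₂.r5]
          rw [if_neg (by norm_num), if_neg (by norm_num), ← pow_succ,
            abs_of_nonneg (pow_nonneg (by omega) _)]
          exact hS.Z_pow_le (by omega)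
        · refine ⟨by simp [h9], by omega, ((hE₂.set (by omega)).set (by omega)).set (by omega),
            by simp [hM₂], by simp [h8'], by simp, by simp, by simp [h11, hE₂.r5, pow_succ]⟩
      · rintro σ₂ ⟨-, hE₂, hM₂, h8', h9, h10, h11⟩
        refine .put hB (by decide) (by simpa [h10] using hpk i hi n le_rfl) ?_
        simp only [Expr.eval_add, Expr.eval_reg, hE₂.r12, h8', h10]
        refine ⟨by simp [h8'], by omega, hE₂.put.set (by omega), by simp, fun i' hi' j hj => ?_,
          fun i' hi' => ?_⟩
        · simp only [mem_setReg, mem_setMem, hM₂]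
          have h1 : (i' : ℤ) * n + j < n * n := by
            have : i' * n + j < n * n := by nlinarith
            exact_mod_cast this
          rw [if_neg (by omega), hin i' hi' j hj]
        · simp only [mem_setReg, mem_setMem, hM₂]
          by_cases h : i' = i
          · subst h; simp
          · rw [if_neg (by omega)]; exact hR i' (by omega)
    · rintro σ₁ ⟨-, hE, -, -, hR⟩
      exact ⟨hE, hR⟩
  refine main.mono ?_ fun _ h => h
  ring_nf
  nlinarith

/-- The determinant of the input and the prime, which is put into register `7`. -/
def detPrimeProg : Program :=
  .seq (set 50 (.reg 0)) <| .seq (set 51 (.reg 12)) <| .seq (set 52 (.reg 0)) <|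
  .seq (set 53 (.const 1)) <| .seq cofProg <| .seq (set 38 (.reg 60 * .reg 3)) <|
  .seq primeProg (set 7 (.reg 39))

theorem lead_natMat (M : Matrix (Fin n) (Fin n) ℤ) : lead (natMat M) n = M.det := by
  unfold lead
  congr 1
  ext i j
  simp [natMat]

theorem run_detPrimeProg (hS : Scales n m S β x Z B) {σ : State}
    (hE : Env n a b m S x Z σ) (hM : ∀ i < n, ∀ j < n, |natMat M i j| ≤ m)
    (hR : Rows n Z (3 + n * n) (natMat M) n σ) (hD : M.det ≠ 0) {P : ℕ}
    (hP : IsLeast {q : ℕ | q.Prime ∧ ¬ (q : ℤ) ∣ m * M.det} P) (hPB : P ≤ B)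
    (hDB : |((m * M.det : ℤ) : ℝ)| * Real.exp (47 * P) ≤ B) :
    Run O B detPrimeProg σ (4000 * (n + 1) ^ 2 + 300 * P) fun σ' => Env n a b m S x Z σ' ∧
      Rows n Z (3 + n * n) (natMat M) n σ' ∧ σ'.reg 7 = P := by
  have hB := hS.hB
  have ha := hS.addr_le
  have hn1 := hS.one_le_n
  have hn := hS.hn
  have hx1 := hS.one_le_x
  have hxZ := hS.x_lt
  have hnn : (0 : ℤ) ≤ n * n := by positivity
  have hnB : |(n : ℤ)| ≤ B := by rw [abs_of_nonneg (by omega)]; omega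
  have hm := hS.hm
  have main : Run O B detPrimeProg σ (60 + (60 + (60 + (60 + (3000 * (n + 1) ^ 2 + (60 +
      ((60 + (P * ((60 + 61 + 60) + 61) + 61)) + 60)))))))
      fun σ' => Env n a b m S x Z σ' ∧ Rows n Z (3 + n * n) (natMat M) n σ' ∧ σ'.reg 7 = P := by
    refine .seq (.set hB (by decide) (by simpa [hE.r0] using hnB) ?_)
    refine .seq (.set hB (by decide)
      (by simp [hE.r12]; rw [abs_of_nonneg (by omega)]; omega) ?_)
    refine .seq (.set hB (by decide) (by simpa [hE.r0] using hnB) ?_)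
    refine .seq (.set hB (by decide) (by simp; omega) ?_)
    refine .seq ((run_cofProg (A := fun i j => if j < n then natMat M i j else 0) (N := n) (b := m)
      (s := 3 + n * n) (k := n) (r := n) (c := 0) (Z := Z) (v := 1) hB (by simp [hE.r5]) (by simp [hE.r0])
      (by simp [hE.r12]) (by omega) (by simp [hE.r0]) le_rfl (by simp) (by simp) (by omega) hm ?_
      le_rfl (hS.Z_pow_le (by omega)) ?_ ?_).mono le_rfl ?_)
    · have h1 : ((n : ℤ) * m) ^ n ≤ (n * β) ^ n := by
        have := hS.hmβ
        gcongr
      have := hS.hx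
      omega
    · intro i hi j
      split_ifs with h
      · exact hM i hi j h
      · simp; omega
    · intro i hi
      simp only [mem_setReg]
      rw [hR i hi]
      exact pack_congr fun j hj => by simp [hj]
    · rintro σ₁ ⟨hF, h60⟩
      have hdet : σ₁.reg 60 = M.det := by
        rw [h60, lead_unitRow_self, ← lead_natMat]
        unfold lead
        congr 1
        ext i j
        simp
      have hE₁ : Env n a b m S x Z σ₁ :=
        ((((hE.set (by omega)).set (by omega)).set (by omega)).set (by omega)).frame (by norm_num) hF
      have hv : (Expr.reg 60 * .reg 3).eval σ₁ = m * M.det := by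
        simp only [Expr.eval_mul, Expr.eval_reg, hdet, hE₁.r3, mul_comm]
      refine .seq (.set hB (by decide) ?_ ?_)
      · rw [hv]
        have h1 : |((m * M.det : ℤ) : ℝ)| ≤ B := by
          refine le_trans ?_ hDB
          exact le_mul_of_one_le_right (abs_nonneg _) (Real.one_le_exp (by positivity))
        rw [← Int.cast_abs] at h1
        exact_mod_cast h1
      · rw [hv]
        refine .seq ((run_primeProg hB (D := m * M.det) (mul_ne_zero (by omega) hD) (by simp) hP hPB
          hDB).mono le_rfl ?_)
        rintro σ₂ ⟨hF₂, h39⟩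
        have hE₂ : Env n a b m S x Z σ₂ := (hE₁.set (by omega)).frame (by norm_num) hF₂
        refine .set hB (by decide) (by rw [Expr.eval_reg, h39, Nat.abs_cast]; exact_mod_cast hPB) ?_
        refine ⟨hE₂.set (by omega), fun i hi => ?_, by simp [h39]⟩
        rw [mem_setReg, hF₂.2 _ (by omega), mem_setReg, hF.2 _ (by omega)]
        simpa using hR i hi
  refine main.mono ?_ fun _ h => h
  nlinarith

end

/-! ### The rows of the matrix of linear polynomials -/

theorem pack_add (Z : ℤ) (N : ℕ) (f g : ℕ → ℤ) :
    pack Z N (fun j => f j + g j) = pack Z N f + pack Z N g := by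
  simp [pack, add_mul, Finset.sum_add_distrib]

theorem pack_mul (Z : ℤ) (N : ℕ) (c : ℤ) (f : ℕ → ℤ) :
    pack Z N (fun j => c * f j) = c * pack Z N f := by
  simp [pack, Finset.mul_sum, mul_assoc]

theorem pack_ite_eq {Z : ℤ} {N c : ℕ} (h : c < N) (y : ℤ) :
    pack Z N (fun j => if j = c then y else 0) = y * Z ^ c := by
  simp [pack, h]

theorem natMat_adjugate {n : ℕ} (M : Matrix (Fin n) (Fin n) ℤ) {i j : ℕ} (hi : i < n) (hj : j < n) :
    natMat M.adjugate i j = cof (natMat M) n j i := by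
  rw [natMat, dif_pos ⟨hi, hj⟩, adjugate_eq_cof M (natMat M) fun u v => (natMat_apply M u v).symm]

/-- The program for the rows of `x adj M + p Id`. -/
def rowsProg : Program :=
  .seq (set 16 (.const 1)) <|
  forE 8 (.const 0) (.reg 0) <|
    .seq (set 11 (.const 1)) <| .seq (set 10 (.reg 7 * .reg 16)) <|
    .seq (forE 9 (.const 0) (.reg 0)
      (.seq (set 50 (.reg 0)) <| .seq (set 51 (.reg 12)) <| .seq (set 52 (.reg 9)) <|
        .seq (set 53 (.reg 16)) <| .seq cofProg <|
        .seq (set 10 (.reg 10 + .reg 6 * .reg 60 * .reg 11)) (set 11 (.reg 11 * .reg 5)))) <|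
    .seq (put (.reg 13 + .reg 8) (.reg 10)) (set 16 (.reg 16 * .reg 5))

section

variable {n a b : ℕ} {m S β x Z : ℤ} {B : ℕ} {M : Matrix (Fin n) (Fin n) ℤ} {O : List ℤ → ℤ}

theorem Sizes.two_mul_βx_lt (hS : Sizes n β x Z B) : 2 * (β * x) < Z := by
  have h1 := hS.hZ
  have h2 := hS.hβ
  have h3 := hS.hn
  have h0 := hS.one_le_x
  have h4 : (1 : ℤ) ≤ n := by omega
  have h5 : 1 ≤ β * x := by nlinarith
  have h6 : β * x ≤ n * (β * x) := by nlinarith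
  have h7 : n * (β * x) ≤ (n * (β * x)) ^ n := by
    conv_lhs => rw [← pow_one (n * (β * x))]
    exact pow_le_pow_right₀ (by omega) (by omega)
  omega

theorem rows_cost (n : ℕ) (hn : 2 ≤ n) : 60 + (n * ((60 + (60 + (n * ((60 + (60 + (60 + (60 +
    (3000 * (n + 1) ^ 2 + (60 + 60)))))) + 121) + 121 + (121 + 60)))) + 121) + 121) ≤
    20000 * n ^ 4 := by
  have h1 : (n + 1) ^ 2 ≤ 3 * n ^ 2 := by nlinarith
  have h2 : 4 ≤ n ^ 2 := by nlinarith
  have h3 : 2 * n ≤ n ^ 2 := by nlinarith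
  have h4 : n ^ 4 = n ^ 2 * n ^ 2 := by ring
  calc _ = 181 + n * (543) + n * n * (481 + 3000 * (n + 1) ^ 2) := by ring
    _ ≤ 181 + n * 543 + n * n * (481 + 3000 * (3 * n ^ 2)) := by gcongr
    _ ≤ _ := by rw [h4]; nlinarith

theorem run_rowsProg (hS : Scales n m S β x Z B) {σ : State} {P : ℕ}
    (hE : Env n a b m S x Z σ) (h7 : σ.reg 7 = P) (hM : ∀ i < n, ∀ j < n, |natMat M i j| ≤ m)
    (hR : Rows n Z (3 + n * n) (natMat M) n σ)
    (hN : ∀ i < n, ∀ j < n, |natMat M.adjugate i j| + P ≤ β) :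
    Run O B rowsProg σ (20000 * n ^ 4) fun σ' => Env n a b m S x Z σ' ∧ σ'.reg 7 = P ∧
      Rows n Z (3 + n * n + n)
        (fun i j => x * natMat M.adjugate i j + if i = j then (P : ℤ) else 0) n σ' := by
  have hB := hS.hB
  have ha := hS.addr_le
  have hn1 := hS.one_le_n
  have hn := hS.hn
  have hx1 := hS.one_le_x
  have hxZ := hS.x_lt
  have hnn : (0 : ℤ) ≤ n * n := by positivity
  have hβ := hS.β_lt_x
  have hβx := hS.two_mul_βx_lt
  have hm := hS.hm
  have hZ2 : 2 ≤ Z := by omega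
  have hnB : |(0 : ℤ) + n| ≤ B := by rw [abs_of_nonneg (by omega)]; omega
  have hpowB : ∀ t ≤ 2 * n, |Z ^ t| ≤ B := fun t ht => by
    rw [abs_of_nonneg (pow_nonneg (by omega) _)]; exact hS.Z_pow_le ht
  have hPβ : (P : ℤ) ≤ β := by
    have := hN 0 (by omega) 0 (by omega)
    have := abs_nonneg (natMat M.adjugate 0 0)
    omega
  have hacc : ∀ i < n, ∀ t ≤ n, |P * Z ^ i + x * pack Z t (natMat M.adjugate i)| ≤ B := by
    intro i hi t ht
    have h1 : (P : ℤ) * Z ^ i ≤ Z ^ n := by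
      calc (P : ℤ) * Z ^ i ≤ Z * Z ^ (n - 1) := by gcongr <;> omega
        _ = Z ^ n := by rw [← pow_succ', Nat.sub_add_cancel (by omega)]
    have h2 : 2 * |pack Z t fun j => x * natMat M.adjugate i j| < Z ^ t :=
      two_mul_abs_pack_lt (by omega) fun j hj => by
        have := hN i hi j (by omega)
        rw [abs_mul, abs_of_nonneg (show 0 ≤ x by omega)]
        nlinarith [abs_nonneg (natMat M.adjugate i j)]
    rw [pack_mul] at h2
    have h3 : Z ^ t ≤ Z ^ n := pow_le_pow_right₀ (by omega) ht
    have h4 : 2 * Z ^ n ≤ Z ^ (n + 1) := by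
      rw [pow_succ']; exact mul_le_mul_of_nonneg_right hZ2 (pow_nonneg (by omega) _)
    have h5 := hS.Z_pow_le (t := n + 1) (by omega)
    have h6 : 0 ≤ (P : ℤ) * Z ^ i := mul_nonneg (by omega) (pow_nonneg (by omega) _)
    have h7 := abs_add_le ((P : ℤ) * Z ^ i) (x * pack Z t (natMat M.adjugate i))
    rw [abs_of_nonneg h6] at h7
    omega
  have main : Run O B rowsProg σ (60 + (n * ((60 + (60 + (n * ((60 + (60 + (60 + (60 +
      (3000 * (n + 1) ^ 2 + (60 + 60)))))) + 121) + 121 + (121 + 60)))) + 121) + 121))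
      fun σ' => Env n a b m S x Z σ' ∧ σ'.reg 7 = P ∧ Rows n Z (3 + n * n + n)
        (fun i j => x * natMat M.adjugate i j + if i = j then (P : ℤ) else 0) n σ' := by
    refine .seq (.set hB (by decide) (by simp; omega) ?_)
    refine .forE hB (by decide) 0 n (60 + (60 + (n * ((60 + (60 + (60 + (60 +
      (3000 * (n + 1) ^ 2 + (60 + 60)))))) + 121) + 121 + (121 + 60))))
      (fun t σ' => t ≤ n ∧ Env n a b m S x Z σ' ∧ σ'.reg 7 = P ∧ σ'.reg 8 = t ∧
        σ'.reg 16 = Z ^ t ∧ Rows n Z (3 + n * n) (natMat M) n σ' ∧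
        Rows n Z (3 + n * n + n)
          (fun i j => x * natMat M.adjugate i j + if i = j then (P : ℤ) else 0) t σ')
      rfl (by simp) hnB ?_ ?_ ?_ ?_
    · exact ⟨by omega, (hE.set (by omega)).set (by omega), by simp [h7], by simp, by simp,
        fun i hi => by simpa using hR i hi, fun i hi => by omega⟩
    · rintro t σ₁ ⟨-, hE, -, h8, -⟩
      exact ⟨by simp [h8], by simp [hE.r0]⟩
    · rintro i σ₁ hi ⟨-, hE, h7, h8, h16, hR, hR'⟩
      refine .seq (.set hB (by decide) (by simp; omega) ?_)
      have h10 : (P : ℤ) * Z ^ i = P * Z ^ i + x * pack Z 0 (natMat M.adjugate i) := by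
        simp [pack_zero]
      refine .seq (.set hB (by decide) (by
        simp only [Expr.eval_mul, Expr.eval_reg, reg_setReg, h7, h16]
        rw [if_neg (by norm_num), if_neg (by norm_num), h10]
        exact hacc i hi 0 (by omega)) ?_)
      refine .seq ?_
      refine .forE hB (by decide) 0 n (60 + (60 + (60 + (60 + (3000 * (n + 1) ^ 2 + (60 + 60))))))
        (fun t σ' => t ≤ n ∧ Env n a b m S x Z σ' ∧ σ'.reg 7 = P ∧ σ'.reg 8 = i ∧
        σ'.reg 16 = Z ^ i ∧ Rows n Z (3 + n * n) (natMat M) n σ' ∧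
        Rows n Z (3 + n * n + n)
          (fun i j => x * natMat M.adjugate i j + if i = j then (P : ℤ) else 0) i σ' ∧
        σ'.reg 9 = t ∧ σ'.reg 11 = Z ^ t ∧
        σ'.reg 10 = P * Z ^ i + x * pack Z t (natMat M.adjugate i)) rfl (by simp) hnB ?_ ?_ ?_ ?_
      · exact ⟨by omega, ((hE.set (by omega)).set (by omega)).set (by omega), by simp [h7],
          by simp [h8], by simp [h16], fun i hi => by simpa using hR i hi,
          fun i hi => by simpa using hR' i hi, by simp, by simp,
          by simp [h7, h16, pack_zero]⟩
      · rintro t σ₂ ⟨-, hE, -, -, -, -, -, h9, -⟩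
        exact ⟨by simp [h9], by simp [hE.r0]⟩
      · rintro j σ₂ hj ⟨-, hE, h7, h8, h16, hR, hR', h9, h11, h10⟩
        refine .seq (.set hB (by decide) (by simpa [hE.r0] using hnB) ?_)
        refine .seq (.set hB (by decide)
          (by simp [hE.r12]; rw [abs_of_nonneg (by omega)]; omega) ?_)
        refine .seq (.set hB (by decide)
          (by simp [h9]; omega) ?_)
        refine .seq (.set hB (by decide) (by
          simp only [Expr.eval_reg, reg_setReg, h16]
          simpa using hpowB i (by omega)) ?_)
        refine .seq ((run_cofProg (A := fun i j => if j < n then natMat M i j else 0) (N := n)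
          (b := m) (s := 3 + n * n) (k := n) (r := j) (c := i) (Z := Z) (v := Z ^ i) hB
          (by simp [hE.r5]) (by simp [hE.r0])
          (by simp [hE.r12]) (by omega) (by simp [h9]) (by omega) (by simp [h16]) rfl hi hm ?_
          le_rfl (hS.Z_pow_le (by omega)) ?_ ?_).mono le_rfl ?_)
        · have h1 : ((n : ℤ) * m) ^ n ≤ (n * β) ^ n := by
            have := hS.hmβ
            gcongr
          have := hS.hx
          omega
        · intro i hi j
          split_ifs with h
          · exact hM i hi j h
          · simp; omega
        · intro i hi
          simp only [mem_setReg]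
          rw [hR i hi]
          exact pack_congr fun j hj => by simp [hj]
        · rintro σ₃ ⟨hF, h60⟩
          have hcof : σ₃.reg 60 = natMat M.adjugate i j := by
            rw [h60, natMat_adjugate M hi hj, lead_unitRow]
            exact cof_congr (fun u hu v hv => by simp [hv]) _ _
          have g10 : σ₃.reg 10 = P * Z ^ i + x * pack Z j (natMat M.adjugate i) := by
            rw [hF.1 10 (by norm_num)]; simp [h10]
          have g11 : σ₃.reg 11 = Z ^ j := by
            rw [hF.1 11 (by norm_num)]; simp [h11]
          have hE₃ : Env n a b m S x Z σ₃ :=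
            ((((hE.set (by omega)).set (by omega)).set (by omega)).set (by omega)).frame
              (by norm_num) hF
          have hv : (Expr.reg 10 + .reg 6 * .reg 60 * .reg 11).eval σ₃ =
              P * Z ^ i + x * pack Z (j + 1) (natMat M.adjugate i) := by
            simp only [Expr.eval_add, Expr.eval_mul, Expr.eval_reg, g10, hE₃.r6, hcof, g11,
              pack_add_one]
            ring
          refine Run.seq (T := 60) (T' := 60) (.set hB (by decide)
            (by rw [hv]; exact hacc i hi _ hj) ?_)
          rw [hv]
          refine .set hB (by decide) (by
            simp only [Expr.eval_reg, Expr.eval_mul, reg_setReg, g11, hE₃.r5]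
            simpa [← pow_succ] using hpowB (j + 1) (by omega)) ?_
          refine ⟨?_, by omega, ((hE₃.set (by omega)).set (by omega)).set (by omega), ?_, ?_, ?_,
            fun u hu => ?_, fun u hu => ?_, by simp, by simp [g11, hE₃.r5, pow_succ], by simp⟩
          · simp [hF.1 9 (by norm_num), h9]
          · simp [hF.1 7 (by norm_num), h7]
          · simp [hF.1 8 (by norm_num), h8]
          · simp [hF.1 16 (by norm_num), h16]
          · simp only [mem_setReg]
            rw [hF.2 _ (by omega)]
            simpa using hR u hu
          · simp only [mem_setReg]
            rw [hF.2 _ (by omega)]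
            simpa using hR' u hu
      · rintro σ₂ ⟨-, hE, h7, h8, h16, hR, hR', h9, h11, h10⟩
        refine Run.seq (T := 121) (T' := 60) (.put hB (by decide)
          (by simp only [Expr.eval_reg, h10]; exact hacc i hi n le_rfl) ?_)
        simp only [Expr.eval_add, Expr.eval_reg, hE.r13, h8, h10]
        refine .set hB (by decide) (by
            simp only [Expr.eval_reg, Expr.eval_mul, reg_setMem, h16, hE.r5, ← pow_succ]
            exact hpowB (i + 1) (by omega)) ?_
        refine ⟨by simp [h8], by omega, (hE.put.set (by omega)).set (by omega), by simp [h7],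
          by simp, by simp [h16, hE.r5, pow_succ], fun u hu => ?_, fun u hu => ?_⟩
        · simp only [mem_setReg, mem_setMem]
          rw [if_neg (by omega)]
          exact hR u hu
        · simp only [mem_setReg, mem_setMem]
          by_cases h : u = i
          · subst h
            rw [if_pos rfl, pack_add, pack_mul]
            have h1 : pack Z n (fun j => if u = j then (P : ℤ) else 0) = P * Z ^ u := by
              rw [← pack_ite_eq hi]; exact pack_congr fun j _ => by simp only [eq_comm]
            rw [h1]; ring
          · rw [if_neg (by omega)]
            exact hR' u (by omega)
    · rintro σ₁ ⟨-, hE, h7, -, -, -, hR'⟩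
      exact ⟨hE, h7, hR'⟩
  exact main.mono (rows_cost n hn) fun _ h => h

/-! ### The loop -/

/-- The values at `x` of the entries of the matrix after rows `1, …, k` have been processed. -/
def loopRow (M : Matrix (Fin n) (Fin n) ℤ) (P : ℕ) (J : ℕ → ℕ) (x : ℤ) (k i j : ℕ) : ℤ :=
  x * natMat M.adjugate i j + if i ≤ k then famConst P (powers P J) i j
    else if i = j then (P : ℤ) else 0

/-- The values at `x` of row `k + 1` with the candidate `y`. -/
def candRow (M : Matrix (Fin n) (Fin n) ℤ) (P : ℕ) (x : ℤ) (k : ℕ) (y : ℤ) (j : ℕ) : ℤ :=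
  x * natMat M.adjugate (k + 1) j + famConst P (fun _ => y) (k + 1) j

theorem pack_candRow {P : ℕ} {k : ℕ} (hk : k + 1 < n) (y : ℤ) (J : ℕ → ℕ) :
    pack Z n (candRow M P x k y) = pack Z n (loopRow M P J x k (k + 1)) + P + y * Z ^ k := by
  have h0 := pack_ite_eq (Z := Z) (show 0 < n by omega) (P : ℤ)
  have h1 := pack_ite_eq (Z := Z) (show k < n by omega) y
  rw [pow_zero, mul_one] at h0
  conv_rhs => rw [← h1]; enter [1, 2]; rw [← h0]
  rw [← pack_add, ← pack_add]
  refine pack_congr fun j _ => ?_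
  simp only [candRow, loopRow, famConst, Nat.succ_ne_zero, if_false, add_left_inj,
    show ¬ k + 1 ≤ k by omega]
  ring

theorem eval_fam (N : ℕ → ℕ → ℤ) (p : ℤ) (Y : ℕ → ℤ) (i j : ℕ) :
    (fam N p Y i j).eval x = x * N i j + famConst p Y i j := by
  simp [fam]

/-- The loop over the rows: in each of them, the powers of the prime are tried in turn. -/
def loopProg : Program :=
  .seq (set 16 (.const 1)) <|
  forE 8 (.const 1) (.reg 0) <|
    .seq (set 11 (.reg 16 * .reg 5)) <| .seq (set 17 (.reg 7)) <|
    .seq (put (.reg 13 + .reg 8) (.load (.reg 13 + .reg 8) + .reg 7 + .reg 17 * .reg 16)) <|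
    .seq testProg <|
    .seq (whileE (.const 1 - .reg 60 * .reg 60)
      -- The candidate in register `17` is replaced by its product with the prime.
      (.seq (put (.reg 13 + .reg 8)
          (.load (.reg 13 + .reg 8) + (.reg 17 * .reg 7 - .reg 17) * .reg 16)) <|
        .seq (set 17 (.reg 17 * .reg 7)) testProg)) <|
    set 16 (.reg 11)

theorem loop_cost (n : ℕ) (hn : 2 ≤ n) : 60 + ((n - 1) * ((60 + (60 + (121 +
    (30000 * (n + 1) ^ 2 + ((2 * n) * ((121 + (60 + 30000 * (n + 1) ^ 2)) + 61) + 61 + 60))))) +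
    121) + 121) ≤ 300000 * n ^ 4 := by
  have h1 : 4 * (n + 1) ^ 2 ≤ 9 * n ^ 2 := by nlinarith
  have h2 : 4 ≤ n ^ 2 := by nlinarith
  have h3 : 2 * n ≤ n ^ 2 := by nlinarith
  have h4 : n ^ 4 = n ^ 2 * n ^ 2 := by ring
  have h5 : n - 1 ≤ n := by omega
  calc _ ≤ 60 + (n * ((60 + (60 + (121 + (30000 * (n + 1) ^ 2 +
        ((2 * n) * ((121 + (60 + 30000 * (n + 1) ^ 2)) + 61) + 61 + 60))))) + 121) + 121) := by gcongr
    _ = 181 + 483 * n + 484 * (n * n) + n * (1 + 2 * n) * (7500 * (4 * (n + 1) ^ 2)) := by ring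
    _ ≤ 181 + 483 * n + 484 * (n * n) + n * (1 + 2 * n) * (7500 * (9 * n ^ 2)) := by gcongr
    _ ≤ _ := by
        rw [h4]
        have h6 : 2 * (n * (1 + 2 * n)) ≤ 5 * n ^ 2 := by nlinarith
        nlinarith

set_option maxHeartbeats 2000000 in
theorem run_loopProg (hS : Scales n m S β x Z B) (hn : 2 ≤ n) {σ : State} {P : ℕ} {J : ℕ → ℕ}
    (hL : LoopData hn M P J) (hE : Env n a b m S x Z σ) (h7 : σ.reg 7 = P)
    (hR : Rows n Z (3 + n * n + n)
        (fun i j => x * natMat M.adjugate i j + if i = j then (P : ℤ) else 0) n σ)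
    (hN : ∀ i < n, ∀ j < n, |natMat M.adjugate i j| + (2 * P + P ^ (2 * n)) ≤ β) :
    Run O B loopProg σ (300000 * n ^ 4) fun σ' => Env n a b m S x Z σ' ∧ σ'.reg 7 = P ∧
      σ'.reg 60 = res (lastCof M P J 0) (lastCof M P J 1) ∧ σ'.reg 16 = Z ^ (n - 1) ∧
      Rows n Z (3 + n * n + n) (fun i j => (poly M P J i j).eval x) n σ' := by
  have hB := hS.hB
  have ha := hS.addr_le
  have hn1 := hS.one_le_n
  have hx1 := hS.one_le_x
  have hxZ := hS.x_lt
  have hnn : (0 : ℤ) ≤ n * n := by positivity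
  have hβ := hS.β_lt_x
  have hβx := hS.two_mul_βx_lt
  have hP2 : (2 : ℤ) ≤ P := by exact_mod_cast hL.p_spec.1.1.two_le
  have hZ2 : 2 ≤ Z := by omega
  have hpowB : ∀ t ≤ 2 * n, |Z ^ t| ≤ B := fun t ht => by
    rw [abs_of_nonneg (pow_nonneg (by omega) _)]; exact hS.Z_pow_le ht
  have hPJ : ∀ t ≤ 2 * n, (P : ℤ) ^ t ≤ P ^ (2 * n) := fun t ht =>
    pow_le_pow_right₀ (by omega) ht
  have hPβ : (P : ℤ) ^ (2 * n) ≤ β := by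
    have := hN 0 (by omega) 0 (by omega)
    have := abs_nonneg (natMat M.adjugate 0 0)
    omega
  have hβB : β ≤ B := by
    have := hS.Z_pow_le (t := 1) (by omega)
    rw [pow_one] at this; omega
  have hJ : ∀ k, k + 1 < n → J (k + 1) ≤ 2 * n := fun k hk => by
    have := hL.exponent_le hn hk; omega
  -- the entries of a row with a moderate constant term
  have hentry : ∀ i < n, ∀ j < n, ∀ Y : ℕ → ℤ, (i ≠ 0 → |Y i| ≤ P ^ (2 * n)) →
      |natMat M.adjugate i j| + |famConst P Y i j| ≤ β := by
    intro i hi j hj Y hY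
    have h1 := abs_famConst_le P Y i j
    have h2 := hN i hi j hj
    rw [Nat.abs_cast] at h1
    have h3 : 0 ≤ (P : ℤ) ^ (2 * n) := by positivity
    split_ifs at h1 with h
    · omega
    · have := hY h; omega
  have hcand : ∀ k, k + 1 < n → ∀ y : ℤ, |y| ≤ P ^ (2 * n) → |pack Z n (candRow M P x k y)| ≤ B := by
    intro k hk y hy
    refine hS.abs_pack_le (by omega) fun j hj => ?_
    have h1 := hentry (k + 1) hk j hj (fun _ => y) fun _ => hy
    have h2 := abs_add_le (x * natMat M.adjugate (k + 1) j) (famConst P (fun _ => y) (k + 1) j)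
    rw [abs_mul, abs_of_nonneg (show 0 ≤ x by omega)] at h2
    unfold candRow
    have h3 := abs_nonneg (famConst P (fun _ => y) (k + 1) j)
    nlinarith
  -- the call of the test
  have htest : ∀ k, k + 1 < n → ∀ j ≤ 2 * n, ∀ σ₁ : State, Env n a b m S x Z σ₁ → σ₁.reg 7 = P →
      σ₁.reg 8 = (k + 1 : ℕ) → σ₁.reg 11 = Z ^ (k + 1) → σ₁.reg 16 = Z ^ k →
      σ₁.reg 17 = (P : ℤ) ^ j →
      σ₁.mem (3 + n * n + n + (k + 1 : ℕ)) = pack Z n (candRow M P x k ((P : ℤ) ^ j)) →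
      (∀ i < n, i ≠ k + 1 → σ₁.mem (3 + n * n + n + i) = pack Z n (loopRow M P J x k i)) →
      Run O B testProg σ₁ (30000 * (n + 1) ^ 2) fun σ' => Env n a b m S x Z σ' ∧ σ'.reg 7 = P ∧
        σ'.reg 8 = (k + 1 : ℕ) ∧ σ'.reg 11 = Z ^ (k + 1) ∧ σ'.reg 16 = Z ^ k ∧
        σ'.reg 17 = (P : ℤ) ^ j ∧
        σ'.mem (3 + n * n + n + (k + 1 : ℕ)) = pack Z n (candRow M P x k ((P : ℤ) ^ j)) ∧
        (∀ i < n, i ≠ k + 1 → σ'.mem (3 + n * n + n + i) = pack Z n (loopRow M P J x k i)) ∧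
        σ'.reg 60 = res (fcof (natMat M.adjugate) P
            (Function.update (powers P J) (k + 1) ((P : ℤ) ^ j)) (k + 1) 0)
          (fcof (natMat M.adjugate) P
            (Function.update (powers P J) (k + 1) ((P : ℤ) ^ j)) (k + 1) 1) := by
    intro k hk j hj σ₁ hE h7 h8 h11 h16 h17 hm1 hm2
    refine (run_testProg hS.toSizes (s := 3 + n * n + n) (i := k + 1)
      (N := natMat M.adjugate) (p := P)
      (Y := Function.update (powers P J) (k + 1) ((P : ℤ) ^ j)) hE.r5 hE.r6 h8 (by omega) hk h11
      hE.r13 (by omega) (fun u hu v hv => ?_) (fun u hu => ?_)).mono le_rfl ?_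
    · refine (norm1_fam_le _ _ _ _ _).trans (hentry u (by omega) v hv _ fun h => ?_)
      rw [abs_of_nonneg]
      · by_cases h' : u = k + 1
        · subst h'; rw [Function.update_self]; exact hPJ j hj
        · rw [Function.update_of_ne h', powers]
          refine hPJ _ ?_
          have := hJ (u - 1) (by omega)
          rwa [Nat.sub_add_cancel (by omega)] at this
      · by_cases h' : u = k + 1
        · subst h'; rw [Function.update_self]; positivity
        · rw [Function.update_of_ne h', powers]; positivity
    · simp only [eval_fam]
      by_cases h' : u = k + 1
      · subst h'
        rw [hm1]
        refine pack_congr fun v _ => ?_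
        simp [candRow, famConst]
      · rw [hm2 u (by omega) h']
        refine pack_congr fun v _ => ?_
        simp [loopRow, famConst, show u ≤ k by omega, Function.update_of_ne h']
    · rintro σ' ⟨hF, h60⟩
      refine ⟨hE.frame (by norm_num) hF, (hF.1 7 (by norm_num)).trans h7,
        (hF.1 8 (by norm_num)).trans h8, (hF.1 11 (by norm_num)).trans h11,
        (hF.1 16 (by norm_num)).trans h16, (hF.1 17 (by norm_num)).trans h17,
        (hF.2 _ (by omega)).trans hm1, fun i hi h => (hF.2 _ (by omega)).trans (hm2 i hi h), h60⟩
  have main : Run O B loopProg σ (60 + ((n - 1) * ((60 + (60 + (121 +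
      (30000 * (n + 1) ^ 2 + ((2 * n) * ((121 + (60 + 30000 * (n + 1) ^ 2)) + 61) + 61 + 60))))) +
      121) + 121)) fun σ' => Env n a b m S x Z σ' ∧ σ'.reg 7 = P ∧
      σ'.reg 60 = res (lastCof M P J 0) (lastCof M P J 1) ∧ σ'.reg 16 = Z ^ (n - 1) ∧
      Rows n Z (3 + n * n + n) (fun i j => (poly M P J i j).eval x) n σ' := by
    refine .seq (.set hB (by decide) (by simp; omega) ?_)
    refine .forE hB (by decide) 1 (n - 1) (60 + (60 + (121 +
      (30000 * (n + 1) ^ 2 + ((2 * n) * ((121 + (60 + 30000 * (n + 1) ^ 2)) + 61) + 61 + 60)))))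
      (fun k σ' => k < n ∧ Env n a b m S x Z σ' ∧ σ'.reg 7 = P ∧ σ'.reg 8 = 1 + k ∧
        σ'.reg 16 = Z ^ k ∧ Rows n Z (3 + n * n + n) (loopRow M P J x k) n σ' ∧
        (1 ≤ k → σ'.reg 60 = res (fcof (natMat M.adjugate) P (powers P J) k 0)
          (fcof (natMat M.adjugate) P (powers P J) k 1)))
      rfl (by simp; omega) (by rw [abs_of_nonneg (by omega)]; omega) ?_ ?_ ?_ ?_
    · refine ⟨by omega, (hE.set (by omega)).set (by omega), by simp [h7], by simp, by simp,
        fun i hi => ?_, by omega⟩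
      rw [mem_setReg, mem_setReg, hR i hi]
      refine pack_congr fun j _ => ?_
      by_cases h : i = 0
      · subst h; simp [loopRow, famConst]
      · simp [loopRow, h]
    · rintro k σ₁ ⟨-, hE, -, h8, -⟩
      exact ⟨by simp [h8], by simp [hE.r0]; omega⟩
    · rintro k σ₁ hk ⟨-, hE, h7, h8, h16, hR, -⟩
      have hk' : k + 1 < n := by omega
      have hJk := hJ k hk'
      refine .seq (.set hB (by decide) (by
        simp only [Expr.eval_mul, Expr.eval_reg, h16, hE.r5, ← pow_succ]
        exact hpowB _ (by omega)) ?_)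
      refine .seq (.set hB (by decide) (by
        have := hPJ 1 (by omega)
        rw [pow_one] at this
        simp [h7]; omega) ?_)
      have hval : (Expr.load (.reg 13 + .reg 8) + .reg 7 + .reg 17 * .reg 16).eval
          ((σ₁.setReg 11 ((Expr.reg 16 * .reg 5).eval σ₁)).setReg 17
            ((Expr.reg 7).eval (σ₁.setReg 11 ((Expr.reg 16 * .reg 5).eval σ₁)))) =
          pack Z n (candRow M P x k ((P : ℤ) ^ 1)) := by
        have := hR (k + 1) hk'
        rw [Nat.cast_add, Nat.cast_one, add_comm (k : ℤ)] at this
        rw [pack_candRow hk' _ J]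
        simp [hE.r13, h8, h7, h16, this]
      refine .seq (.put hB (by decide) ?_ ?_)
      · rw [hval]
        refine hcand k hk' _ ?_
        rw [abs_of_nonneg (by positivity)]; exact hPJ 1 (by omega)
      rw [hval]
      refine .seq ((htest k hk' 1 (by omega) _ ?_ ?_ ?_ ?_ ?_ ?_ ?_ ?_).mono le_rfl ?_)
      · exact ((hE.set (by omega)).set (by omega)).put
      · simp [h7]
      · simp [h8]; ring
      · simp [h16, hE.r5, pow_succ]
      · simp [h16]
      · simp [h7]
      · simp [hE.r13, h8, add_comm]
      · intro i hi hne
        simp only [mem_setMem, mem_setReg, Expr.eval_add, Expr.eval_reg, reg_setReg]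
        rw [if_neg, hR i hi]
        simp [hE.r13, h8]
        omega
      rintro σ₂ ⟨hE, h7, h8, h11, h16, h17, hm1, hm2, h60⟩
      refine .seq ?_
      refine .whileE hB (by decide) (2 * n) (121 + (60 + 30000 * (n + 1) ^ 2))
        (fun t σ' => t + 1 ≤ J (k + 1) ∧ Env n a b m S x Z σ' ∧ σ'.reg 7 = P ∧
          σ'.reg 8 = (k + 1 : ℕ) ∧ σ'.reg 11 = Z ^ (k + 1) ∧ σ'.reg 16 = Z ^ k ∧
          σ'.reg 17 = (P : ℤ) ^ (t + 1) ∧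
          σ'.mem (3 + n * n + n + (k + 1 : ℕ)) = pack Z n (candRow M P x k ((P : ℤ) ^ (t + 1))) ∧
          (∀ i < n, i ≠ k + 1 → σ'.mem (3 + n * n + n + i) = pack Z n (loopRow M P J x k i)) ∧
          σ'.reg 60 = res (fcof (natMat M.adjugate) P
              (Function.update (powers P J) (k + 1) ((P : ℤ) ^ (t + 1))) (k + 1) 0)
            (fcof (natMat M.adjugate) P
              (Function.update (powers P J) (k + 1) ((P : ℤ) ^ (t + 1))) (k + 1) 1)) ?_ ?_ ?_
      · exact ⟨(hL.isLeast hn hk').1.1, hE, h7, h8, h11, h16, h17, hm1, hm2, h60⟩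
      · rintro t σ₃ ⟨ht, hE, h7, h8, h11, h16, h17, hm1, hm2, h60⟩ hpos
        have h0 : σ₃.reg 60 = 0 := by
          simp only [Expr.eval_sub, Expr.eval_mul, Expr.eval_reg, Expr.eval_const] at hpos
          by_contra h
          have : 0 < σ₃.reg 60 * σ₃.reg 60 := mul_self_pos.2 h
          omega
        have hlt : t + 1 < J (k + 1) := by
          rcases ht.lt_or_eq with h | h
          · exact h
          · rw [h] at h60
            exact absurd (h60.symm.trans h0) (hL.isLeast hn hk').1.2
        have hyB : (P : ℤ) ^ (t + 2) ≤ P ^ (2 * n) := hPJ _ (by omega)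
        have hval : (Expr.load (.reg 13 + .reg 8) + (.reg 17 * .reg 7 - .reg 17) * .reg 16).eval σ₃ =
            pack Z n (candRow M P x k ((P : ℤ) ^ (t + 2))) := by
          rw [pack_candRow hk' _ J]
          rw [pack_candRow hk' _ J] at hm1
          simp only [Expr.eval_load, Expr.eval_add, Expr.eval_mul, Expr.eval_sub, Expr.eval_reg,
            hE.r13, h8, h7, h16, h17, hm1]
          ring
        refine ⟨by omega, .seq (.put hB (by decide) ?_ ?_)⟩
        · rw [hval]
          refine hcand k hk' _ ?_
          rwa [abs_of_nonneg (by positivity)]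
        rw [hval]
        refine .seq (.set hB (by decide) ?_ ?_)
        · simp only [Expr.eval_mul, Expr.eval_reg, reg_setMem, h17, h7, ← pow_succ]
          rw [abs_of_nonneg (by positivity)]
          exact hyB.trans (hPβ.trans hβB)
        refine (htest k hk' (t + 2) (by omega) _ ?_ ?_ ?_ ?_ ?_ ?_ ?_ ?_).mono le_rfl ?_
        · exact hE.put.set (by omega)
        · simp [h7]
        · simp [h8]
        · simp [h11]
        · simp [h16]
        · simp [h17, h7, pow_succ]
        · simp [hE.r13, h8]
        · intro i hi hne
          simp only [mem_setMem, mem_setReg, Expr.eval_add, Expr.eval_reg]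
          rw [if_neg, hm2 i hi hne]
          simp [hE.r13, h8]
          omega
        · rintro σ' h
          exact ⟨hlt, h⟩
      · rintro t σ₃ ⟨ht, hE, h7, h8, h11, h16, h17, hm1, hm2, h60⟩ hneg
        have h0 : σ₃.reg 60 ≠ 0 := by
          intro h
          simp [h] at hneg
        have heq : t + 1 = J (k + 1) :=
          le_antisymm ht ((hL.isLeast hn hk').2 ⟨by omega, h60 ▸ h0⟩)
        rw [heq] at hm1
        rw [heq, update_powers_self] at h60
        refine .set hB (by decide) (by
          simp only [Expr.eval_reg, h11]; exact hpowB _ (by omega)) ?_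
        refine ⟨by simp [h8]; ring, by omega, (hE.set (by omega)).set (by omega), by simp [h7],
          by simp; ring, by simp [h11], fun i hi => ?_, fun _ => by simp [h60]⟩
        simp only [mem_setReg]
        by_cases h : i = k + 1
        · subst h
          rw [hm1]
          refine pack_congr fun j _ => ?_
          simp [candRow, loopRow, famConst, powers]
        · rw [hm2 i hi h]
          refine pack_congr fun j _ => ?_
          simp only [loopRow]
          by_cases h1 : i ≤ k
          · simp [h1, show i ≤ k + 1 by omega]
          · simp [h1, show ¬ i ≤ k + 1 by omega]
    · rintro σ₁ ⟨-, hE, h7, -, h16, hR, h60⟩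
      refine ⟨hE, h7, h60 (by omega), h16, fun i hi => ?_⟩
      rw [hR i hi]
      refine pack_congr fun j _ => ?_
      simp only [poly, eval_fam, loopRow]
      rw [if_pos (by omega)]
  exact main.mono (loop_cost n hn) fun _ h => h

end

/-! ### The substituted value -/

theorem coprimePart_eq {p : ℕ} (hp : p.Prime) {c d : ℤ} {k : ℕ} (hc : c = (p : ℤ) ^ k * d)
    (hd : ¬ (p : ℤ) ∣ d) : coprimePart p c = if d.natAbs = 1 then (p : ℤ) + 1 else d := by
  have : Fact p.Prime := ⟨hp⟩
  have hp0 : (p : ℤ) ^ k ≠ 0 := pow_ne_zero _ (by exact_mod_cast hp.ne_zero)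
  have hd0 : d ≠ 0 := by rintro rfl; simp at hd
  have hc0 : c ≠ 0 := by rw [hc]; exact mul_ne_zero hp0 hd0
  have hv : padicValInt p c = k := by
    refine le_antisymm ?_ ?_
    · by_contra hlt
      have h1 := (padicValInt_dvd_iff (p := p) (k + 1) c).2 (.inr (by omega))
      rw [hc, pow_succ] at h1
      exact hd ((mul_dvd_mul_iff_left hp0).1 h1)
    · exact ((padicValInt_dvd_iff (p := p) k c).1 ⟨d, hc⟩).resolve_left hc0
  have h1 : c.natAbs = p ^ k * d.natAbs := by
    rw [hc, Int.natAbs_mul, Int.natAbs_pow, Int.natAbs_natCast]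
  have h2 : c / (p : ℤ) ^ k = d := Int.ediv_eq_of_eq_mul_right hp0 hc
  rw [coprimePart, hv, h1, h2]
  congr 1
  rw [Nat.mul_eq_left (pow_pos hp.pos k).ne']

/-- Register `20` becomes register `60`, made coprime to the prime in register `7`. -/
def coprimeProg : Program :=
  .seq (set 20 (.reg 60)) <|
  .seq (whileE (.const 1 - .reg 20 % .reg 7) (set 20 (.reg 20 / .reg 7))) <|
  ifE (.const 2 - .reg 20 * .reg 20) (set 20 (.reg 7 + .const 1)) skip

theorem run_coprimeProg {O : List ℤ → ℤ} {B : ℕ} (hB : 10 ^ 6 ≤ B) {σ : State} {p : ℕ}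
    (hp : p.Prime) {c : ℤ} (hc : c ≠ 0) (h7 : σ.reg 7 = p) (h60 : σ.reg 60 = c)
    (hpB : (p : ℤ) + 1 ≤ B) {N : ℕ} (hN : |c| < 2 ^ N) :
    Run O B coprimeProg σ (121 * N + 300) fun σ' =>
      Frame 20 σ σ' ∧ σ'.reg 20 = coprimePart p c := by
  apply Run.of_bounded
  intro hσ
  have hcB : |c| ≤ B := by rw [← h60]; exact hσ.1 60 (by norm_num)
  have hp2 : (2 : ℤ) ≤ p := by exact_mod_cast hp.two_le
  have main : Run O B coprimeProg σ (60 + ((N * (60 + 61) + 61) + (60 + 61))) fun σ' =>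
      Frame 20 σ σ' ∧ σ'.reg 20 = coprimePart p c := by
    refine .seq (.set hB (by decide) (by simpa [h60] using hcB) ?_)
    refine .seq ?_
    refine .whileE hB (by decide) N 60 (fun k σ' => Frame 20 σ σ' ∧
      c = (p : ℤ) ^ k * σ'.reg 20) ?_ ?_ ?_
    · exact ⟨(Frame.refl _ _).set le_rfl, by simp [h60]⟩
    · rintro k σ' ⟨hF, hk⟩ hpos
      have g7 : σ'.reg 7 = p := (hF.1 7 (by norm_num)).trans h7
      have h1 : σ'.reg 20 % p = 0 := by
        have := Int.emod_nonneg (σ'.reg 20) (show (p : ℤ) ≠ 0 by omega)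
        simp only [Expr.eval_sub, Expr.eval_const, Expr.eval_mod, Expr.eval_reg, g7] at hpos
        omega
      have hd0 : σ'.reg 20 ≠ 0 := by intro h; rw [h, mul_zero] at hk; exact hc hk
      have habs : |c| = (p : ℤ) ^ k * |σ'.reg 20| := by
        conv_lhs => rw [hk]
        rw [abs_mul, abs_of_nonneg (by positivity)]
      have hpk : (1 : ℤ) ≤ (p : ℤ) ^ k := one_le_pow₀ (by omega)
      have hd1 := Int.one_le_abs hd0
      obtain ⟨d, hd⟩ := Int.dvd_of_emod_eq_zero h1
      have hdiv : σ'.reg 20 / p = d := Int.ediv_eq_of_eq_mul_right (by omega) hd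
      refine ⟨?_, .set hB (by decide) ?_ ⟨hF.set le_rfl, ?_⟩⟩
      · by_contra hlt
        have h2 : (2 : ℤ) ^ N ≤ 2 ^ k := pow_le_pow_right₀ (by norm_num) (by omega)
        have h3 : (2 : ℤ) ^ k ≤ (p : ℤ) ^ k := pow_le_pow_left₀ (by norm_num) hp2 k
        nlinarith
      · simp only [Expr.eval_div, Expr.eval_reg, g7, hdiv]
        have h4 : |σ'.reg 20| = p * |d| := by
          rw [hd, abs_mul, abs_of_nonneg (show (0 : ℤ) ≤ p by omega)]
        have := abs_nonneg d
        nlinarith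
      · simp only [Expr.eval_div, Expr.eval_reg, g7, hdiv, reg_setReg, if_true]
        rw [hk, hd]; ring
    · rintro k σ' ⟨hF, hk⟩ hneg
      have g7 : σ'.reg 7 = p := (hF.1 7 (by norm_num)).trans h7
      have hnd : ¬ (p : ℤ) ∣ σ'.reg 20 := by
        intro h
        have := Int.emod_eq_zero_of_dvd h
        simp [g7, this] at hneg
      have hd0 : σ'.reg 20 ≠ 0 := by intro h; rw [h, mul_zero] at hk; exact hc hk
      rw [coprimePart_eq hp hk hnd]
      refine .ifE hB (by decide) (fun hpos => ?_) (fun hle => (Run.skip ?_).mono (by norm_num)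
        fun _ h => h)
      · refine .set hB (by decide) (by
          simp only [Expr.eval_add, Expr.eval_reg, Expr.eval_const, g7]
          rwa [abs_of_nonneg (by omega)]) ⟨hF.set le_rfl, ?_⟩
        simp only [Expr.eval_sub, Expr.eval_const, Expr.eval_mul, Expr.eval_reg] at hpos
        have h1 : (σ'.reg 20).natAbs = 1 := by
          have : (σ'.reg 20).natAbs * (σ'.reg 20).natAbs < 2 := by
            zify; rw [abs_mul_abs_self]; omega
          have h0 : (σ'.reg 20).natAbs ≠ 0 := Int.natAbs_ne_zero.2 hd0
          nlinarith [Nat.pos_of_ne_zero h0]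
        simp [h1, g7]
      · refine ⟨hF, ?_⟩
        simp only [Expr.eval_sub, Expr.eval_const, Expr.eval_mul, Expr.eval_reg] at hle
        rw [if_neg]
        intro h1
        have : σ'.reg 20 * σ'.reg 20 = 1 := by
          rw [← abs_mul_abs_self, Int.abs_eq_natAbs, h1]; rfl
        omega
  exact main.mono (by omega) fun _ h => h

/-- Register `22` becomes the least power of register `20` that is not below
`a ^ 2 (2 m n) ^ (3 n)` in magnitude. -/
def substProg : Program :=
  .seq (set 21 (.reg 1 * .reg 1)) <|
  .seq (forE 9 (.const 0) (.const 3 * .reg 0) (set 21 (.reg 21 * (.const 2 * .reg 3 * .reg 0)))) <|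
  .seq (set 22 (.const 1)) <|
  whileE (.reg 21 * .reg 21 - .reg 22 * .reg 22) (set 22 (.reg 22 * .reg 20))

section

variable {n a b : ℕ} {m S β x Z : ℤ} {B : ℕ} {M : Matrix (Fin n) (Fin n) ℤ} {O : List ℤ → ℤ}

theorem lt_substExponent_iff (hn : 2 ≤ n) (ha : 0 < a) (h0 : 0 < M (lst hn) (fst hn)) {c : ℤ}
    (hc : 2 ≤ |c|) (t : ℕ) : t < substExponent hn a M c ↔
      |c| ^ t < (a : ℤ) ^ 2 * (2 * M (lst hn) (fst hn) * n) ^ (3 * n) := by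
  have hc' : (1 : ℝ) < |(c : ℝ)| := by
    have : (2 : ℝ) ≤ |(c : ℝ)| := by exact_mod_cast hc
    linarith
  have hn0 : (0 : ℝ) < n := by exact_mod_cast (show 0 < n by omega)
  have ha0 : (0 : ℝ) < a := by exact_mod_cast ha
  have hM0 : (0 : ℝ) < M (lst hn) (fst hn) := by exact_mod_cast h0
  rw [substExponent, Nat.lt_ceil, Real.lt_logb_iff_rpow_lt hc' (by positivity), Real.rpow_natCast]
  exact_mod_cast Iff.rfl

theorem run_substProg (hB : 10 ^ 6 ≤ B) (hn : 2 ≤ n) (ha : 0 < a) {σ : State}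
    (hE : Env n a b m S x Z σ) (hm : M (lst hn) (fst hn) = m) (hm0 : 0 < m) {c : ℤ} (hc : 2 ≤ |c|)
    (h20 : σ.reg 20 = c)
    (hcB : (a : ℤ) ^ 2 * (2 * m * n) ^ (3 * n) * |c| ≤ B) (hnB : 3 * (n : ℤ) ≤ B) {N : ℕ}
    (hN : (a : ℤ) ^ 2 * (2 * m * n) ^ (3 * n) ≤ 2 ^ N) :
    Run O B substProg σ (600 * n + 400 + 121 * N) fun σ' => Env n a b m S x Z σ' ∧
      (∀ r, 20 ≤ r → r ≠ 21 → r ≠ 22 → σ'.reg r = σ.reg r) ∧ σ'.reg 7 = σ.reg 7 ∧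
      σ'.reg 16 = σ.reg 16 ∧ σ'.mem = σ.mem ∧ σ'.reg 22 = c ^ substExponent hn a M c := by
  have hn0 : (1 : ℤ) ≤ n := by omega
  have ha0 : (1 : ℤ) ≤ a := by omega
  have hmn : 1 ≤ 2 * m * n := by nlinarith
  set E2 : ℤ := (a : ℤ) ^ 2 * (2 * m * n) ^ (3 * n) with hE2
  have hE1 : 1 ≤ E2 := by
    have h1 : 1 ≤ (2 * m * n) ^ (3 * n) := one_le_pow₀ hmn
    have h2 : 1 ≤ (a : ℤ) ^ 2 := one_le_pow₀ ha0
    nlinarith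
  have hEB : E2 ≤ B := by nlinarith
  have hlt := lt_substExponent_iff (M := M) hn ha (by rw [hm]; exact hm0) hc
  rw [hm, ← hE2] at hlt
  have hpart : ∀ t ≤ 3 * n, |(a : ℤ) ^ 2 * (2 * m * n) ^ t| ≤ (B : ℤ) := fun t ht => by
    rw [abs_of_nonneg (by positivity)]
    refine le_trans ?_ hEB
    have : (2 * m * n) ^ t ≤ (2 * m * n) ^ (3 * n) := pow_le_pow_right₀ hmn ht
    rw [hE2]
    gcongr
  set e := substExponent hn a M c with he
  have main : Run O B substProg σ (60 + ((3 * n) * (60 + 121) + 121 + (60 + (N * (60 + 61) + 61))))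
      fun σ' => Env n a b m S x Z σ' ∧
      (∀ r, 20 ≤ r → r ≠ 21 → r ≠ 22 → σ'.reg r = σ.reg r) ∧ σ'.reg 7 = σ.reg 7 ∧
      σ'.reg 16 = σ.reg 16 ∧ σ'.mem = σ.mem ∧ σ'.reg 22 = c ^ e := by
    refine .seq (.set hB (by decide) (by
      simp only [Expr.eval_mul, Expr.eval_reg, hE.r1]
      simpa [sq] using hpart 0 (by omega)) ?_)
    refine .seq ?_
    refine .forE hB (by decide) 0 (3 * n) 60 (fun t σ' => t ≤ 3 * n ∧ Env n a b m S x Z σ' ∧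
      (∀ r, 20 ≤ r → r ≠ 21 → r ≠ 22 → σ'.reg r = σ.reg r) ∧ σ'.reg 7 = σ.reg 7 ∧
      σ'.reg 16 = σ.reg 16 ∧ σ'.mem = σ.mem ∧ σ'.reg 9 = t ∧
      σ'.reg 21 = (a : ℤ) ^ 2 * (2 * m * n) ^ t) rfl (by simp)
      (by rw [abs_of_nonneg (by positivity)]; push_cast; linarith) ?_ ?_ ?_ ?_
    · refine ⟨by omega, (hE.set (by omega)).set (by omega), fun r h1 h2 h3 => ?_, by simp, by simp,
        by simp, by simp, by simp [hE.r1, sq]⟩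
      simp [h2, show r ≠ 9 by omega]
    · rintro t σ₁ ⟨-, hE, -, -, -, -, h9, -⟩
      exact ⟨by simp [h9], by simp [hE.r0]⟩
    · rintro t σ₁ ht ⟨-, hE, hr, h7, h16, hM, h9, h21⟩
      have hv : (Expr.reg 21 * (.const 2 * .reg 3 * .reg 0)).eval σ₁ =
          (a : ℤ) ^ 2 * (2 * m * n) ^ (t + 1) := by
        simp only [Expr.eval_mul, Expr.eval_reg, Expr.eval_const, h21, hE.r3, hE.r0]
        ring
      refine .set hB (by decide) (by rw [hv]; exact hpart _ ht) ?_
      rw [hv]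
      refine ⟨by simp [h9], by omega, (hE.set (by omega)).set (by omega), fun r h1 h2 h3 => ?_,
        by simp [h7], by simp [h16], by simp [hM], by simp, by simp⟩
      simp [h2, show r ≠ 9 by omega, hr r h1 h2 h3]
    · rintro σ₁ ⟨-, hE, hr, h7, h16, hM, h9, h21⟩
      rw [← hE2] at h21
      refine .seq (.set hB (by decide) (by simp; omega) ?_)
      refine .whileE hB (by decide) N 60 (fun t σ' => t ≤ e ∧ Env n a b m S x Z σ' ∧
        (∀ r, 20 ≤ r → r ≠ 21 → r ≠ 22 → σ'.reg r = σ.reg r) ∧ σ'.reg 7 = σ.reg 7 ∧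
        σ'.reg 16 = σ.reg 16 ∧ σ'.mem = σ.mem ∧ σ'.reg 21 = E2 ∧ σ'.reg 22 = c ^ t) ?_ ?_ ?_
      · refine ⟨by omega, hE.set (by omega), fun r h1 h2 h3 => ?_, by simp [h7], by simp [h16],
          by simp [hM], by simp [h21], by simp⟩
        simp [h3, hr r h1 h2 h3]
      · rintro t σ₂ ⟨ht, hE, hr, h7, h16, hM, h21, h22⟩ hpos
        simp only [Expr.eval_sub, Expr.eval_mul, Expr.eval_reg, h21, h22] at hpos
        have h1 : |c| ^ t < E2 := by
          rw [← abs_pow]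
          have := abs_mul_abs_self (c ^ t)
          have := abs_nonneg (c ^ t)
          nlinarith
        have hte : t < e := (hlt t).2 h1
        refine ⟨?_, .set hB (by decide) ?_ ?_⟩
        · by_contra hle
          have h2 : (2 : ℤ) ^ N ≤ 2 ^ t := pow_le_pow_right₀ (by norm_num) (by omega)
          have h3 : (2 : ℤ) ^ t ≤ |c| ^ t := pow_le_pow_left₀ (by norm_num) hc t
          omega
        · simp only [Expr.eval_mul, Expr.eval_reg, h22, hr 20 le_rfl (by norm_num) (by norm_num),
            h20, abs_mul, abs_pow]
          refine le_trans ?_ hcB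
          gcongr
        · refine ⟨hte, hE.set (by omega), fun r h1 h2 h3 => ?_, by simp [h7], by simp [h16],
            by simp [hM], by simp [h21], ?_⟩
          · simp [h3, hr r h1 h2 h3]
          · simp [h22, hr 20 le_rfl (by norm_num) (by norm_num), h20, pow_succ]
      · rintro t σ₂ ⟨ht, hE, hr, h7, h16, hM, h21, h22⟩ hneg
        simp only [Expr.eval_sub, Expr.eval_mul, Expr.eval_reg, h21, h22] at hneg
        have h1 : ¬ |c| ^ t < E2 := by
          rw [← abs_pow]
          intro h
          have := abs_mul_abs_self (c ^ t)
          have := abs_nonneg (c ^ t)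
          nlinarith
        have hte : t = e := le_antisymm ht (not_lt.1 fun h => h1 ((hlt t).1 h))
        exact ⟨hE, hr, h7, h16, hM, by rw [h22, hte]⟩
  exact main.mono (by omega) fun _ h => h

end

/-! ### Bézout coefficients -/

/-- The extended Euclidean algorithm for registers `24` and `25`; the coefficients are put into
registers `33` and `34`. -/
def bezoutProg : Program :=
  .seq (ifE (.reg 25) (set 26 (.reg 25)) (set 26 (.const 0 - .reg 25))) <|
  .seq (set 27 (.reg 26)) <| .seq (set 28 (.reg 24 % .reg 26)) <| .seq (set 29 (.const 0)) <|
  .seq (set 30 (.const 1 % .reg 26)) <|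
  .seq (whileE (.reg 28)
    (.seq (set 31 (.reg 27 / .reg 28)) <| .seq (set 32 (.reg 27 % .reg 28)) <|
      .seq (set 27 (.reg 28)) <| .seq (set 28 (.reg 32)) <|
      -- The coefficients are reduced modulo `|g|`, which keeps them small.
      .seq (set 32 ((.reg 29 - .reg 31 * .reg 30) % .reg 26)) <|
      .seq (set 29 (.reg 30)) (set 30 (.reg 32)))) <|
  .seq (ifE (.const 2 * .reg 29 - .reg 26) (set 33 (.reg 29 - .reg 26)) (set 33 (.reg 29))) <|
  set 34 ((.const 1 - .reg 33 * .reg 24) / .reg 25)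

set_option maxHeartbeats 1000000 in
theorem run_bezoutProg {O : List ℤ → ℤ} {B : ℕ} (hB : 10 ^ 6 ≤ B) {σ : State} {f g b₁ b₂ : ℤ}
    (h24 : σ.reg 24 = f) (h25 : σ.reg 25 = g) (hg : g ≠ 0) (hb : b₁ * f + b₂ * g = 1)
    (hb1 : -|g| < 2 * b₁) (hb2 : 2 * b₁ ≤ |g|) (hbB : |b₂| ≤ B) {N : ℕ} (hN : |g| * |g| < 2 ^ N) :
    Run O B bezoutProg σ (1000 + 481 * N) fun σ' =>
      Frame 26 σ σ' ∧ σ'.reg 33 = b₁ ∧ σ'.reg 34 = b₂ := by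
  apply Run.of_bounded
  intro hσ
  have hgB : |g| ≤ B := by rw [← h25]; exact hσ.1 25 (by norm_num)
  have hg0 := abs_pos.2 hg
  set G := |g| with hG
  have hB' : (1 : ℤ) ≤ B := by exact_mod_cast le_trans (by norm_num) hB
  have mod_lt : ∀ z : ℤ, |z % G| ≤ B := fun z => by
    rw [abs_of_nonneg (Int.emod_nonneg _ hg0.ne')]
    have := Int.emod_lt_of_pos z hg0
    omega
  obtain ⟨T, hT⟩ : ∃ T, T = 420 := ⟨_, rfl⟩
  obtain ⟨R, hR⟩ : ∃ R, R = 60 + (60 + (60 + (60 + ((N * (T + 61) + 61) + 181)))) := ⟨_, rfl⟩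
  obtain ⟨Q, hQ⟩ : ∃ Q, Q = 60 := ⟨_, rfl⟩
  have main : Run O B bezoutProg σ ((Q + 61) + R)
      fun σ' => Frame 26 σ σ' ∧ σ'.reg 33 = b₁ ∧ σ'.reg 34 = b₂ := by
    have rest : ∀ σ₁, Frame 26 σ σ₁ → σ₁.reg 26 = G → Run O B
        (.seq (set 27 (.reg 26)) <| .seq (set 28 (.reg 24 % .reg 26)) <| .seq (set 29 (.const 0)) <|
        .seq (set 30 (.const 1 % .reg 26)) <|
        .seq (whileE (.reg 28)
          (.seq (set 31 (.reg 27 / .reg 28)) <| .seq (set 32 (.reg 27 % .reg 28)) <|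
            .seq (set 27 (.reg 28)) <| .seq (set 28 (.reg 32)) <|
            .seq (set 32 ((.reg 29 - .reg 31 * .reg 30) % .reg 26)) <|
            .seq (set 29 (.reg 30)) (set 30 (.reg 32)))) <|
        .seq (ifE (.const 2 * .reg 29 - .reg 26) (set 33 (.reg 29 - .reg 26)) (set 33 (.reg 29))) <|
        set 34 ((.const 1 - .reg 33 * .reg 24) / .reg 25)) σ₁ R
        fun σ' => Frame 26 σ σ' ∧ σ'.reg 33 = b₁ ∧ σ'.reg 34 = b₂ := by
      intro σ₁ hF h26
      have g24 : σ₁.reg 24 = f := (hF.1 24 (by norm_num)).trans h24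
      rw [hR]
      refine .seq (.set hB (by decide) (by simpa [h26, abs_of_pos hg0] using hgB) ?_)
      refine .seq (.set hB (by decide) (by simpa [h26] using mod_lt _) ?_)
      refine .seq (.set hB (by decide) (by simp) ?_)
      refine .seq (.set hB (by decide) (by simpa [h26] using mod_lt _) ?_)
      refine .seq ?_
      refine .whileE hB (by decide) N T
        (fun k σ' => Frame 26 σ σ' ∧ σ'.reg 26 = G ∧ 0 ≤ σ'.reg 28 ∧ σ'.reg 28 < σ'.reg 27 ∧
          σ'.reg 27 ≤ G ∧ 2 ^ k * (σ'.reg 27 * σ'.reg 28) ≤ G * G ∧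
          IsCoprime (σ'.reg 27) (σ'.reg 28) ∧ G ∣ σ'.reg 29 * f - σ'.reg 27 ∧
          G ∣ σ'.reg 30 * f - σ'.reg 28 ∧ (0 ≤ σ'.reg 29 ∧ σ'.reg 29 < G) ∧
          (0 ≤ σ'.reg 30 ∧ σ'.reg 30 < G)) ?_ ?_ ?_
      · have e1 := Int.emod_nonneg f hg0.ne'
        have e2 := Int.emod_lt_of_pos f hg0
        have e3 := Int.emod_nonneg 1 hg0.ne'
        have e4 := Int.emod_lt_of_pos 1 hg0
        have hcop : IsCoprime G (f % G) := by
          have : IsCoprime G f := by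
            rw [hG]
            exact (IsCoprime.abs_left_iff g f).2 ⟨b₂, b₁, by linarith⟩
          rw [Int.emod_def]
          have h := this.add_mul_left_right (-(f / G))
          rwa [mul_neg, ← sub_eq_add_neg] at h
        refine ⟨?_, ?_⟩
        · exact (((hF.set (by norm_num)).set (by norm_num)).set (by norm_num)).set (by norm_num)
        · simp only [reg_setReg, Expr.eval_reg, Expr.eval_mod, Expr.eval_const, h26, g24]
          norm_num
          refine ⟨e1, e2, by nlinarith, hcop, ?_, hg0, e3, e4⟩
          have h1 : G ∣ 1 - 1 % G := Int.dvd_self_sub_emod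
          have h2 : G ∣ f - f % G := Int.dvd_self_sub_emod
          have : 1 % G * f - f % G = (f - f % G) - (1 - 1 % G) * f := by ring
          rw [this]
          exact dvd_sub h2 (h1.mul_right f)
      · rintro k σ₂ ⟨hF, h26, hr1, hr2, hr3, hk, hc, hu0, hu1, hu2, hu3⟩ hpos
        rw [Expr.eval_reg] at hpos
        set r0 := σ₂.reg 27
        set r1 := σ₂.reg 28
        set u0 := σ₂.reg 29
        set u1 := σ₂.reg 30
        have e1 := Int.emod_nonneg r0 hpos.ne'
        have e2 := Int.emod_lt_of_pos r0 hpos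
        have e3 := Int.emod_add_mul_ediv r0 r1
        have e4 : 1 ≤ r0 / r1 := by
          rw [Int.le_ediv_iff_mul_le hpos]; omega
        have e5 : r0 / r1 ≤ r0 := Int.ediv_le_self _ (by omega)
        have e6 := Int.emod_nonneg (u0 - r0 / r1 * u1) hg0.ne'
        have e7 := Int.emod_lt_of_pos (u0 - r0 / r1 * u1) hg0
        refine ⟨?_, ?_⟩
        · by_contra hle
          have h1 : (2 : ℤ) ^ N ≤ 2 ^ k := pow_le_pow_right₀ (by norm_num) (by omega)
          have h2 : 1 ≤ r0 * r1 := one_le_mul_of_one_le_of_one_le (by omega) (by omega)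
          have h3 : (0 : ℤ) ≤ 2 ^ k := by positivity
          have h4 := le_mul_of_one_le_right h3 h2
          omega
        have b0 : |r0 / r1| ≤ B := by rw [abs_of_nonneg (by omega)]; omega
        have b1 : |r0 % r1| ≤ B := by rw [abs_of_nonneg (by omega)]; omega
        have b2 : |r1| ≤ B := by rw [abs_of_nonneg (by omega)]; omega
        have b3 : |u1| ≤ B := by rw [abs_of_nonneg (by omega)]; omega
        refine Run.mono (T := 60 + (60 + (60 + (60 + (60 + (60 + 60)))))) ?_ (by omega)
          fun _ h => h
        refine .seq (.set hB (by decide) b0 ?_)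
        refine .seq (.set hB (by decide) (by simpa using b1) ?_)
        refine .seq (.set hB (by decide) (by simpa using b2) ?_)
        refine .seq (.set hB (by decide) (by simpa using b1) ?_)
        refine .seq (.set hB (by decide) (by simpa [h26] using mod_lt _) ?_)
        refine .seq (.set hB (by decide) (by simpa using b3) ?_)
        refine .set hB (by decide) (by simpa [h26] using mod_lt _) ⟨?_, ?_⟩
        · exact (((((((hF.set (by norm_num)).set (by norm_num)).set (by norm_num)).set
            (by norm_num)).set (by norm_num)).set (by norm_num)).set (by norm_num))
        · simp only [reg_setReg, Expr.eval_reg, Expr.eval_mod, Expr.eval_div, Expr.eval_sub,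
            Expr.eval_mul, h26]
          norm_num
          refine ⟨e1, e2, by omega, ?_, ?_, hu1, ?_, hu3, e6, e7⟩
          · have h3 : (0 : ℤ) < 2 ^ k := by positivity
            have h5 : r1 * 1 ≤ r1 * (r0 / r1) := mul_le_mul_of_nonneg_left e4 hr1
            have h6 : 2 * (r0 % r1) ≤ r0 := by omega
            have h4 : 2 * (r1 * (r0 % r1)) ≤ r0 * r1 := by
              calc 2 * (r1 * (r0 % r1)) = 2 * (r0 % r1) * r1 := by ring
                _ ≤ r0 * r1 := by gcongr
            calc (2 : ℤ) ^ (k + 1) * (r1 * (r0 % r1)) = 2 ^ k * (2 * (r1 * (r0 % r1))) := by ring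
              _ ≤ 2 ^ k * (r0 * r1) := by gcongr
              _ ≤ G * G := hk
          · rw [Int.emod_def]
            have h := hc.symm.add_mul_left_right (-(r0 / r1))
            rwa [mul_neg, ← sub_eq_add_neg] at h
          · have h1 : G ∣ (u0 - r0 / r1 * u1) - (u0 - r0 / r1 * u1) % G := Int.dvd_self_sub_emod
            have h2 : (u0 - r0 / r1 * u1) % G * f - r0 % r1 = (u0 * f - r0) -
                (r0 / r1) * (u1 * f - r1) -
                ((u0 - r0 / r1 * u1) - (u0 - r0 / r1 * u1) % G) * f := by
              rw [Int.emod_def r0 r1]; ring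
            rw [h2]
            exact dvd_sub (dvd_sub hu0 (hu1.mul_left _)) (h1.mul_right _)
      · rintro k σ₂ ⟨hF, h26, hr1, hr2, hr3, hk, hc, hu0, hu1, hu2, hu3⟩ hneg
        rw [Expr.eval_reg] at hneg
        have h28 : σ₂.reg 28 = 0 := le_antisymm hneg hr1
        have h27 : σ₂.reg 27 = 1 := by
          rw [h28, isCoprime_zero_right] at hc
          rcases Int.isUnit_iff.1 hc with h | h <;> omega
        rw [h27] at hu0
        have g24 : σ₂.reg 24 = f := (hF.1 24 (by norm_num)).trans h24
        have g25 : σ₂.reg 25 = g := (hF.1 25 (by norm_num)).trans h25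
        have key : ∀ c₁ : ℤ, G ∣ c₁ - σ₂.reg 29 → -G < 2 * c₁ → 2 * c₁ ≤ G → c₁ = b₁ := by
          intro c₁ h1 h2 h3
          have h4 : G ∣ c₁ * f - 1 := by
            have : c₁ * f - 1 = (c₁ - σ₂.reg 29) * f + (σ₂.reg 29 * f - 1) := by ring
            rw [this]
            exact dvd_add (h1.mul_right _) hu0
          obtain ⟨d, hd⟩ := (abs_dvd _ _).1 h4
          exact eq_of_bezout (b₂' := -d) hb hb1 hb2 (by linarith) h2 h3
        have last : ∀ σ₃, Frame 26 σ σ₃ → σ₃.reg 33 = b₁ → Run O B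
            (set 34 ((.const 1 - .reg 33 * .reg 24) / .reg 25)) σ₃ 60
            fun σ' => Frame 26 σ σ' ∧ σ'.reg 33 = b₁ ∧ σ'.reg 34 = b₂ := by
          intro σ₃ hF₃ h33
          have hv : ((Expr.const 1 - .reg 33 * .reg 24) / .reg 25 : Expr).eval σ₃ = b₂ := by
            simp only [Expr.eval_div, Expr.eval_sub, Expr.eval_mul, Expr.eval_const, Expr.eval_reg,
              h33, (hF₃.1 24 (by norm_num)).trans h24, (hF₃.1 25 (by norm_num)).trans h25]
            exact Int.ediv_eq_of_eq_mul_left hg (by linarith)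
          exact .set hB (by decide) (by rwa [hv]) ⟨hF₃.set (by norm_num), by simp [h33], by
            rw [hv]; simp⟩
        refine Run.seq (T := 60 + 61) (T' := 60) (.ifE (T := 60) hB (by decide) (fun hp => ?_)
          fun hp => ?_)
        · simp only [Expr.eval_sub, Expr.eval_mul, Expr.eval_const, Expr.eval_reg, h26] at hp
          refine .set hB (by decide) ?_ (last _ (hF.set (by norm_num)) ?_)
          · simp only [Expr.eval_sub, Expr.eval_reg, h26]
            rw [abs_le]; constructor <;> omega
          · simp only [reg_setReg, if_true, Expr.eval_sub, Expr.eval_reg, h26]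
            exact key _ (by simp) (by omega) (by omega)
        · simp only [Expr.eval_sub, Expr.eval_mul, Expr.eval_const, Expr.eval_reg, h26] at hp
          refine .set hB (by decide) ?_ (last _ (hF.set (by norm_num)) ?_)
          · simp only [Expr.eval_reg]
            rw [abs_le]; constructor <;> omega
          · simp only [reg_setReg, if_true, Expr.eval_reg]
            exact key _ (by simp) (by omega) (by omega)
    refine .seq (.ifE hB (by decide) (fun hp => ?_) fun hp => ?_)
    · rw [Expr.eval_reg, h25] at hp
      rw [hQ]
      refine .set hB (by decide) (by simpa [h25] using hgB) (rest _ ((Frame.refl _ _).set le_rfl) ?_)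
      simp [h25, hG, abs_of_pos hp]
    · rw [Expr.eval_reg, h25] at hp
      rw [hQ]
      refine .set hB (by decide) (by simpa [h25] using hgB) (rest _ ((Frame.refl _ _).set le_rfl) ?_)
      simp [h25, hG, abs_of_nonpos hp]
  refine main.mono ?_ fun _ h => h
  subst hT hQ
  omega

/-! ### The oracle query -/

theorem natDegree_cof_fam_le (N : ℕ → ℕ → ℤ) (p : ℤ) (Y : ℕ → ℤ) (k r c : ℕ) :
    (cof (fam N p Y) k r c).natDegree ≤ k := by
  have h := natDegree_det_X_add_C_le
    (Matrix.of fun x y : Fin k => if x.val = r then 0 else N x y)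
    (Matrix.of fun x y : Fin k => if x.val = r then if y.val = c then 1 else 0
      else famConst p Y x y)
  rw [Fintype.card_fin] at h
  refine le_trans (le_of_eq ?_) h
  unfold cof
  congr 2
  ext1 i j
  simp only [Matrix.of_apply, Matrix.add_apply, Matrix.smul_apply, Matrix.map_apply, smul_eq_mul]
  split_ifs <;> simp [fam]

/-- Register `d` becomes a cofactor of the matrix of linear polynomials, evaluated at
register `22`. -/
def evProg (d : ℕ) (r v : Expr) : Program :=
  .seq (set 52 r) <| .seq (set 53 v) <| .seq (set 50 (.reg 0)) <| .seq (set 51 (.reg 13)) <|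
  .seq (set 41 (.reg 0 + .const 1)) <| .seq (set 42 (.reg 22)) <|
  .seq evalCofProg (set d (.reg 43))

section

variable {n a b : ℕ} {m S β x Z : ℤ} {B : ℕ} {M : Matrix (Fin n) (Fin n) ℤ} {O : List ℤ → ℤ}

theorem run_evProg (hS : Scales n m S β x Z B) {σ : State} {P : ℕ} {J : ℕ → ℕ} {τ : ℤ}
    (hE : Env n a b m S x Z σ) (h22 : σ.reg 22 = τ) (hτ1 : 1 ≤ |τ|)
    (hτ : x * |τ| ^ (n + 1) ≤ B) (hfam : ∀ u < n, ∀ v < n, norm1 (poly M P J u v) ≤ β)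
    (hR : Rows n Z (3 + n * n + n) (fun i j => (poly M P J i j).eval x) n σ)
    {d r c : ℕ} (hd : d < 40) (hr : r ≤ n) (hc : c < n) {er ev : Expr}
    (her : er.Ok) (hev : ev.Ok) (hr1 : er.eval σ = r)
    (hv1 : ev.eval (σ.setReg 52 r) = Z ^ c) :
    Run O B (evProg d er ev) σ (5000 * (n + 1) ^ 2) fun σ' =>
      σ'.reg d = (cof (poly M P J) n r c).eval τ ∧ (∀ i < 40, i ≠ d → σ'.reg i = σ.reg i) ∧
      ∀ k, 0 ≤ k → σ'.mem k = σ.mem k := by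
  apply Run.of_bounded
  intro hσ
  have hB := hS.hB
  have ha := hS.addr_le
  have hn1 := hS.one_le_n
  have hn := hS.hn
  have hx1 := hS.one_le_x
  have hxZ := hS.x_lt
  have hnn : (0 : ℤ) ≤ n * n := by positivity
  have hτB : |τ| ≤ B := by rw [← h22]; exact hσ.1 22 (by norm_num)
  have hF := Frame.refl 40 σ
  have main : Run O B (evProg d er ev) σ
      (60 + (60 + (60 + (60 + (60 + (60 + (4000 * (n + 1) ^ 2 + 60)))))))
      fun σ' => σ'.reg d = (cof (poly M P J) n r c).eval τ ∧
      (∀ i < 40, i ≠ d → σ'.reg i = σ.reg i) ∧ ∀ k, 0 ≤ k → σ'.mem k = σ.mem k := by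
    refine .seq (.set hB ⟨by norm_num, her⟩ (by rw [hr1, Nat.abs_cast]; omega) ?_)
    rw [hr1]
    refine .seq (.set hB ⟨by norm_num, hev⟩ (by
      rw [hv1, abs_of_nonneg (pow_nonneg (by omega) _)]; exact hS.Z_pow_le (by omega)) ?_)
    rw [hv1]
    refine .seq (.set hB (by decide) (by simp [hE.r0]; omega) ?_)
    refine .seq (.set hB (by decide) (by
      simp [hE.r13]; rw [abs_of_nonneg (by omega)]; omega) ?_)
    refine .seq (.set hB (by decide) (by
      simp [hE.r0]; rw [abs_of_nonneg (by omega)]; omega) ?_)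
    refine .seq (.set hB (by decide) (by simpa [h22] using hτB) ?_)
    refine .seq ((run_evalCofProg (s := 3 + n * n + n) (τ := τ) (v := Z ^ c) (k := n) (r := r)
      (c := c) (M := n + 1) (N := natMat M.adjugate) (p := P) (Y := powers P J) hS.toSizes
      (by simp [hE.r5]) (by simp [hE.r6]) (by simp [hE.r0])
      (by simp [hE.r13]) (by omega) (by simp) hr (by simp) rfl hc le_rfl
      (by simp [hE.r0]) le_rfl (by simp [h22]) hτ1 hτ
      (Nat.lt_succ_of_le (natDegree_cof_fam_le _ _ _ _ _ _)) hfam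
      (fun u hu => by simpa [poly] using hR u hu)).mono le_rfl ?_)
    rintro σ₁ ⟨hF₁, -, -, h43, -⟩
    apply Run.of_bounded
    intro hσ₁
    refine .set hB ⟨by omega, by decide⟩ (hσ₁.1 43 (by norm_num)) ⟨?_, fun i hi hid => ?_,
      fun k hk => ?_⟩
    · rw [reg_setReg, if_pos rfl, Expr.eval_reg, h43]; rfl
    · rw [reg_setReg, if_neg hid, hF₁.1 i hi]
      simp [show i ≠ 42 by omega, show i ≠ 41 by omega, show i ≠ 51 by omega,
        show i ≠ 50 by omega, show i ≠ 52 by omega, show i ≠ 53 by omega]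
    · rw [mem_setReg, hF₁.2 k hk]
      simp
  refine main.mono ?_ fun _ h => h
  have : 3 * 3 ≤ (n + 1) * (n + 1) := Nat.mul_le_mul (by omega) (by omega)
  rw [← pow_two (n + 1)] at this
  omega

/-- The number `D' = det M'` is in register `23`; its absolute value is put into register `35` and
its sign into register `36`. -/
def signProg : Program :=
  ifE (.reg 23) (.seq (set 36 (.const 1)) (set 35 (.reg 23)))
    (.seq (set 36 (.const (-1))) (set 35 (.const 0 - .reg 23)))

/-- The part of the query that precedes the numerators of the vector.  Register `37` becomes the
first address after it. -/
def headerProg : Target → Program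
  | .sap => .seq (put (.reg 14) (.reg 1)) <| .seq (put (.reg 14 + .const 1) (.reg 2)) <|
      .seq (put (.reg 14 + .const 2) (.reg 35)) (set 37 (.reg 14 + .const 3))
  | .gda => .seq (put (.reg 14) (.reg 1)) <| .seq (put (.reg 14 + .const 1) (.reg 2)) <|
      .seq (put (.reg 14 + .const 2) (.reg 35 * .reg 2)) <|
      .seq (put (.reg 14 + .const 3) (.const 2 * .reg 1)) <|
      .seq (put (.reg 14 + .const 4) (.reg 35)) (set 37 (.reg 14 + .const 5))

/-- The part of the query that precedes the numerators of the vector; here `d = |det M'|`. -/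
def header (a b d : ℤ) : Target → List ℤ
  | .sap => [a, b, d]
  | .gda => [a, b, d * b, 2 * a, d]

/-- The numerators of the vector with denominator `|det M'|`, from register `37` on.  Register
`38` becomes the length of the query. -/
def numeratorProg : Program :=
  .seq (set 16 (.const 1)) <|
  .seq (forE 8 (.const 0) (.reg 0) <|
    .seq (evProg 24 (.const 0) (.reg 16)) <| .seq (evProg 25 (.const 1) (.reg 16)) <|
    .seq (put (.reg 37 + .reg 8) (.reg 36 * (.reg 33 * .reg 24 + .reg 34 * .reg 25))) <|
    set 16 (.reg 16 * .reg 5)) <|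
  set 38 (.reg 37 - .reg 14 + .reg 0)

theorem run_signProg (hB : 10 ^ 6 ≤ B) {σ : State} {D : ℤ} (hD : D ≠ 0) (h23 : σ.reg 23 = D) :
    Run O B signProg σ 300 fun σ' => σ'.reg 35 = |D| ∧ σ'.reg 36 = D.sign ∧ Frame 35 σ σ' := by
  apply Run.of_bounded
  intro hσ
  have hDB : |D| ≤ B := by rw [← h23]; exact hσ.1 23 (by norm_num)
  have hB' : (1 : ℤ) ≤ B := by exact_mod_cast le_trans (by norm_num) hB
  refine Run.mono (T := (60 + 60) + 61) ?_ (by norm_num) fun _ h => h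
  refine .ifE (T := 60 + 60) hB (by decide) (fun hp => ?_) fun hp => ?_
  · rw [Expr.eval_reg, h23] at hp
    refine Run.seq (T := 60) (T' := 60) (.set hB (by decide) (by simpa using hB') ?_)
    refine .set hB (by decide) (by simpa [h23] using hDB) ⟨?_, ?_, ?_⟩
    · simp [h23, abs_of_pos hp]
    · simp [Int.sign_eq_one_of_pos hp]
    · exact ((Frame.refl _ _).set (by norm_num)).set (by norm_num)
  · rw [Expr.eval_reg, h23] at hp
    refine Run.seq (T := 60) (T' := 60) (.set hB (by decide) (by simpa using hB') ?_)
    refine .set hB (by decide) (by simpa [h23] using hDB) ⟨?_, ?_, ?_⟩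
    · simp [h23, abs_of_nonpos hp]
    · simp [Int.sign_eq_neg_one_of_neg (lt_of_le_of_ne hp hD)]
    · exact ((Frame.refl _ _).set (by norm_num)).set (by norm_num)

/-- The memory from address `k` on begins with the list `l`. -/
def Holds (σ : State) (k : ℤ) (l : List ℤ) : Prop :=
  ∀ i (h : i < l.length), σ.mem (k + i) = l[i]

theorem run_headerProg (hS : Scales n m S β x Z B) {σ : State} (hE : Env n a b m S x Z σ)
    {d : ℤ} (h35 : σ.reg 35 = d) (hd : |d * b| ≤ B) (ha : 2 * (a : ℤ) ≤ B) (t : Target) :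
    Run O B (headerProg t) σ 1000 fun σ' =>
      Holds σ' (3 + n * n + n + n) (header a b d t) ∧
      σ'.reg 37 = 3 + n * n + n + n + (header a b d t).length ∧
      (∀ r < 37, σ'.reg r = σ.reg r) ∧ ∀ k < 3 + (n * n : ℤ) + n + n, σ'.mem k = σ.mem k := by
  apply Run.of_bounded
  intro hσ
  have hB := hS.hB
  have h0 := hS.addr_le
  have hnn : (0 : ℤ) ≤ n * n := by positivity
  have h1 : |(a : ℤ)| ≤ B := by rw [← hE.r1]; exact hσ.1 1 (by norm_num)
  have h2 : |(b : ℤ)| ≤ B := by rw [← hE.r2]; exact hσ.1 2 (by norm_num)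
  have hdB : |d| ≤ B := by rw [← h35]; exact hσ.1 35 (by norm_num)
  have e1 := hE.r1
  have e2 := hE.r2
  have e14 := hE.r14
  cases t with
  | sap =>
    refine Run.mono (T := 121 + (121 + (121 + 60))) ?_ (by norm_num) fun _ h => h
    refine .seq (.put hB (by decide) (by simpa [e1] using h1) ?_)
    refine .seq (.put hB (by decide) (by simpa [e2] using h2) ?_)
    refine .seq (.put hB (by decide) (by simpa [h35] using hdB) ?_)
    refine .set hB (by decide) (by simp [e14]; rw [abs_of_nonneg (by omega)]; omega)
      ⟨fun i hi => ?_, ?_, fun r hr => ?_, fun k hk => ?_⟩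
    · simp only [header, List.length_cons, List.length_nil] at hi
      interval_cases i <;> simp [header, e14, e1, e2, h35]
    · simp [header, e14]
    · simp [show r ≠ 37 by omega]
    · simp only [mem_setReg, mem_setMem, Expr.eval_add, Expr.eval_reg, Expr.eval_const, e14,
        reg_setMem]
      rw [if_neg (by omega), if_neg (by omega), if_neg (by omega)]
  | gda =>
    refine Run.mono (T := 121 + (121 + (121 + (121 + (121 + 60))))) ?_ (by norm_num) fun _ h => h
    refine .seq (.put hB (by decide) (by simpa [e1] using h1) ?_)
    refine .seq (.put hB (by decide) (by simpa [e2] using h2) ?_)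
    refine .seq (.put hB (by decide) (by simpa [h35, e2, -abs_mul] using hd) ?_)
    refine .seq (.put hB (by decide) (by simpa [e1] using ha) ?_)
    refine .seq (.put hB (by decide) (by simpa [h35] using hdB) ?_)
    refine .set hB (by decide) (by simp [e14]; rw [abs_of_nonneg (by omega)]; omega)
      ⟨fun i hi => ?_, ?_, fun r hr => ?_, fun k hk => ?_⟩
    · simp only [header, List.length_cons, List.length_nil] at hi
      interval_cases i <;> simp [header, e14, e1, e2, h35]
    · simp [header, e14]
    · simp [show r ≠ 37 by omega]
    · simp only [mem_setReg, mem_setMem, Expr.eval_add, Expr.eval_mul, Expr.eval_reg,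
        Expr.eval_const, e14, reg_setMem]
      rw [if_neg (by omega), if_neg (by omega), if_neg (by omega), if_neg (by omega),
        if_neg (by omega)]

set_option maxHeartbeats 1000000 in
theorem run_numeratorProg (hS : Scales n m S β x Z B) {σ : State} {P : ℕ} {J : ℕ → ℕ} {τ : ℤ}
    (hE : Env n a b m S x Z σ) (h22 : σ.reg 22 = τ) (hτ1 : 1 ≤ |τ|)
    (hτ : x * |τ| ^ (n + 1) ≤ B) (hfam : ∀ u < n, ∀ v < n, norm1 (poly M P J u v) ≤ β)
    (hR : Rows n Z (3 + n * n + n) (fun i j => (poly M P J i j).eval x) n σ)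
    {s b₁ b₂ : ℤ} {h : ℕ} (h36 : σ.reg 36 = s) (h33 : σ.reg 33 = b₁) (h34 : σ.reg 34 = b₂)
    (h37 : σ.reg 37 = 3 + n * n + n + n + h) (hh : h ≤ 5) {y : ℕ → ℤ}
    (hy : ∀ u, y u = s * (b₁ * (cof (poly M P J) n 0 u).eval τ +
      b₂ * (cof (poly M P J) n 1 u).eval τ)) (hyB : ∀ u < n, |y u| ≤ B) :
    Run O B numeratorProg σ (30000 * n ^ 4) fun σ' => Env n a b m S x Z σ' ∧
      (∀ r < 38, 26 ≤ r → σ'.reg r = σ.reg r) ∧ σ'.reg 22 = τ ∧ σ'.reg 38 = (h + n : ℕ) ∧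
      (∀ k < 3 + (n * n : ℤ) + n + n + h, 0 ≤ k → σ'.mem k = σ.mem k) ∧
      ∀ u : ℕ, u < n → σ'.mem (3 + n * n + n + n + h + u) = y u := by
  have hB := hS.hB
  have ha := hS.addr_le
  have hn1 := hS.one_le_n
  have hn := hS.hn
  have hx1 := hS.one_le_x
  have hxZ := hS.x_lt
  have hnn : (0 : ℤ) ≤ n * n := by positivity
  have hnB : |(0 : ℤ) + n| ≤ B := by rw [abs_of_nonneg (by omega)]; omega
  have hZB : ∀ t ≤ 2 * n, |Z ^ t| ≤ B := fun t ht => by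
    rw [abs_of_nonneg (pow_nonneg (by omega) _)]; exact hS.Z_pow_le ht
  obtain ⟨T, hT⟩ : ∃ T, T = 5000 * (n + 1) ^ 2 := ⟨_, rfl⟩
  have main : Run O B numeratorProg σ
      (60 + ((n * ((T + (T + (121 + 60))) + 121) + 121) + 60)) fun σ' => Env n a b m S x Z σ' ∧
      (∀ r < 38, 26 ≤ r → σ'.reg r = σ.reg r) ∧ σ'.reg 22 = τ ∧ σ'.reg 38 = (h + n : ℕ) ∧
      (∀ k < 3 + (n * n : ℤ) + n + n + h, 0 ≤ k → σ'.mem k = σ.mem k) ∧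
      ∀ u : ℕ, u < n → σ'.mem (3 + n * n + n + n + h + u) = y u := by
    refine .seq (.set hB (by decide) (by simp; omega) ?_)
    refine .seq ?_
    refine .forE hB (by decide) 0 n (T + (T + (121 + 60))) (fun t σ' => t ≤ n ∧
      Env n a b m S x Z σ' ∧ σ'.reg 8 = t ∧ σ'.reg 16 = Z ^ t ∧ σ'.reg 22 = τ ∧
      (∀ r < 38, 26 ≤ r → σ'.reg r = σ.reg r) ∧
      (∀ k < 3 + (n * n : ℤ) + n + n + h, 0 ≤ k → σ'.mem k = σ.mem k) ∧
      ∀ u : ℕ, u < t → σ'.mem (3 + n * n + n + n + h + u) = y u) rfl (by simp) hnB ?_ ?_ ?_ ?_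
    · refine ⟨by omega, (hE.set (by omega)).set (by omega), by simp, by simp, by simp [h22],
        fun r h1 h2 => ?_, fun k _ _ => rfl, fun u hu => by omega⟩
      simp [show r ≠ 8 by omega, show r ≠ 16 by omega]
    · rintro t σ₁ ⟨-, hE₁, h8, -⟩
      exact ⟨by simp [h8], by simp [hE₁.r0]⟩
    · rintro t σ₁ ht ⟨-, hE₁, h8, h16, g22, hreg, hmem, hval⟩
      have hR₁ : Rows n Z (3 + n * n + n) (fun i j => (poly M P J i j).eval x) n σ₁ :=
        fun i hi => by rw [hmem _ (by omega) (by omega)]; exact hR i hi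
      refine .seq ((run_evProg hS (r := 0) (c := t) hE₁ g22 hτ1 hτ hfam hR₁ (by norm_num)
        (by omega) ht (by decide) (by decide) rfl (by simp [h16])).mono hT.ge ?_)
      rintro σ₂ ⟨e24, hreg₂, hmem₂⟩
      have hE₂ : Env n a b m S x Z σ₂ := by
        obtain ⟨h0, h1, h2, h3, h4, h5, h6, h12, h13, h14⟩ := hE₁
        constructor <;> rw [hreg₂ _ (by norm_num) (by norm_num)] <;> assumption
      have hR₂ : Rows n Z (3 + n * n + n) (fun i j => (poly M P J i j).eval x) n σ₂ :=
        fun i hi => by rw [hmem₂ _ (by omega)]; exact hR₁ i hi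
      refine .seq ((run_evProg hS (r := 1) (c := t) hE₂
        ((hreg₂ 22 (by norm_num) (by norm_num)).trans g22) hτ1 hτ hfam hR₂ (by norm_num)
        (by omega) ht (by decide) (by decide) rfl
        (by simpa [h16] using hreg₂ 16 (by norm_num) (by norm_num))).mono hT.ge ?_)
      rintro σ₃ ⟨e25, hreg₃, hmem₃⟩
      have hE₃ : Env n a b m S x Z σ₃ := by
        obtain ⟨h0, h1, h2, h3, h4, h5, h6, h12, h13, h14⟩ := hE₂
        constructor <;> rw [hreg₃ _ (by norm_num) (by norm_num)] <;> assumption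
      have hreg' : ∀ r < 40, r ≠ 24 → r ≠ 25 → σ₃.reg r = σ₁.reg r := fun r h1 h2 h3 =>
        (hreg₃ r h1 h3).trans (hreg₂ r h1 h2)
      have e24' : σ₃.reg 24 = (cof (poly M P J) n 0 t).eval τ :=
        (hreg₃ 24 (by norm_num) (by norm_num)).trans e24
      have hv : (Expr.reg 36 * (.reg 33 * .reg 24 + .reg 34 * .reg 25)).eval σ₃ = y t := by
        simp only [Expr.eval_mul, Expr.eval_add, Expr.eval_reg, e24', e25, hy]
        rw [hreg' 36 (by norm_num) (by norm_num) (by norm_num),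
          hreg' 33 (by norm_num) (by norm_num) (by norm_num),
          hreg' 34 (by norm_num) (by norm_num) (by norm_num),
          hreg 36 (by norm_num) (by norm_num), hreg 33 (by norm_num) (by norm_num),
          hreg 34 (by norm_num) (by norm_num), h36, h33, h34]
      have hadr : (Expr.reg 37 + .reg 8).eval σ₃ = 3 + n * n + n + n + h + t := by
        simp only [Expr.eval_add, Expr.eval_reg]
        rw [hreg' 37 (by norm_num) (by norm_num) (by norm_num),
          hreg' 8 (by norm_num) (by norm_num) (by norm_num), hreg 37 (by norm_num) (by norm_num),
          h37, h8]
      have e16 : σ₃.reg 16 = Z ^ t := (hreg' 16 (by norm_num) (by norm_num) (by norm_num)).trans h16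
      refine Run.seq (T := 121) (T' := 60) (.put hB (by decide) (by rw [hv]; exact hyB t ht) ?_)
      rw [hv, hadr]
      refine .set hB (by decide) ?_ ?_
      · simp only [Expr.eval_mul, Expr.eval_reg, reg_setMem, e16, hE₃.r5, ← pow_succ]
        exact hZB _ (by omega)
      · refine ⟨?_, by omega, ((hE₃.put).set (by omega)).set (by omega), by simp, ?_, ?_,
          fun r h1 h2 => ?_, fun k h1 h2 => ?_, fun u hu => ?_⟩
        · simp only [reg_setReg, reg_setMem]
          rw [if_neg (by norm_num), hreg' 8 (by norm_num) (by norm_num) (by norm_num), h8]; omega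
        · simp [e16, hE₃.r5, pow_succ]
        · simp only [reg_setReg, reg_setMem]
          rw [if_neg (by norm_num), if_neg (by norm_num),
            hreg' 22 (by norm_num) (by norm_num) (by norm_num), g22]
        · simp only [reg_setReg, reg_setMem]
          rw [if_neg (by omega), if_neg (by omega), hreg' r (by omega) (by omega) (by omega),
            hreg r h1 h2]
        · simp only [mem_setReg, mem_setMem]
          rw [if_neg (by omega), hmem₃ k h2, hmem₂ k h2, hmem k h1 h2]
        · simp only [mem_setReg, mem_setMem]
          by_cases hut : u = t
          · subst hut; simp
          · rw [if_neg (by omega), hmem₃ _ (by omega), hmem₂ _ (by omega), hval u (by omega)]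
    · rintro σ₁ ⟨-, hE₁, h8, h16, g22, hreg, hmem, hval⟩
      have hv : (Expr.reg 37 - .reg 14 + .reg 0).eval σ₁ = (h + n : ℕ) := by
        simp only [Expr.eval_add, Expr.eval_sub, Expr.eval_reg, hreg 37 (by norm_num) (by norm_num),
          h37, hE₁.r14, hE₁.r0]
        push_cast; ring
      refine .set hB (by decide) (by rw [hv, Nat.abs_cast]; omega) ?_
      rw [hv]
      refine ⟨hE₁.set (by omega), fun r h1 h2 => ?_, by simp [g22], by simp, hmem, hval⟩
      rw [reg_setReg, if_neg (by omega), hreg r h1 h2]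
  refine main.mono ?_ fun _ h => h
  rw [hT]
  have h1 : (n + 1) ^ 2 ≤ 3 * n ^ 2 := by nlinarith
  have h2 : n * (n + 1) ^ 2 ≤ n * (3 * n ^ 2) := Nat.mul_le_mul le_rfl h1
  have h3 : n ^ 3 * 2 ≤ n ^ 3 * n := Nat.mul_le_mul le_rfl hn
  have h4 : n * 4 ≤ n * n ^ 2 := Nat.mul_le_mul le_rfl (by nlinarith)
  have e : n * ((5000 * (n + 1) ^ 2 + (5000 * (n + 1) ^ 2 + (121 + 60))) + 121) =
    10000 * (n * (n + 1) ^ 2) + 302 * n := by ring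
  have e2 : n ^ 4 = n ^ 3 * n := by ring
  have e3 : n * (3 * n ^ 2) = 3 * n ^ 3 := by ring
  have e4 : n * n ^ 2 = n ^ 3 := by ring
  rw [e, e2]
  omega

theorem Holds.append {σ : State} {k : ℤ} {l l' : List ℤ} (h : Holds σ k l)
    (h' : Holds σ (k + l.length) l') : Holds σ k (l ++ l') := by
  intro i hi
  rw [List.length_append] at hi
  rcases lt_or_ge i l.length with hl | hl
  · rw [List.getElem_append_left hl, h i hl]
  · rw [List.getElem_append_right hl, ← h' (i - l.length) (by omega)]
    congr 1
    push_cast [hl]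
    ring

theorem Holds.block_eq {σ s : State} (hs : s.mem = σ.mem) {k : ℤ} {l : List ℤ} (h : Holds σ k l) :
    s.block k l.length = l := by
  refine List.ext_getElem (by simp [State.block]) fun i h1 h2 => ?_
  rw [← h i h2]
  simp [State.block, hs, ← List.map_eq_flatMap]

end

/-! ### The output -/

/-- The residue of `t` modulo `d` in the interval `(-d/2, d/2]`. -/
def balanced (d t : ℤ) : ℤ := if d < 2 * (t % d) then t % d - d else t % d

theorem two_mul_abs_balanced_le {d : ℤ} (hd : 0 < d) (t : ℤ) : 2 * |balanced d t| ≤ d := by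
  have h1 := Int.emod_nonneg t hd.ne'
  have h2 := Int.emod_lt_of_pos t hd
  unfold balanced
  split_ifs with h
  · rw [abs_of_nonpos (by omega)]; omega
  · rw [abs_of_nonneg h1]; omega

theorem dvd_sub_balanced (d t : ℤ) : d ∣ t - balanced d t := by
  have h : d ∣ t - t % d := Int.dvd_self_sub_emod
  unfold balanced
  split_ifs
  · rw [show t - (t % d - d) = (t - t % d) + d by ring]
    exact dvd_add h (dvd_refl d)
  · exact h

theorem balanced_div_eq {d : ℤ} (hd : 0 < d) (t : ℤ) :
    (t / d : ℚ) - ⌈(t / d : ℚ) - 1 / 2⌉ = balanced d t / d := by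
  have hd' : (0 : ℚ) < d := by exact_mod_cast hd
  obtain ⟨k, hk⟩ := dvd_sub_balanced d t
  have h1 := two_mul_abs_balanced_le hd t
  have h2 : -d < 2 * balanced d t := by
    have h3 := Int.emod_nonneg t hd.ne'
    unfold balanced
    split_ifs with h <;> omega
  have h3 : 2 * balanced d t ≤ d := by have := le_abs_self (balanced d t); omega
  have e : (t : ℚ) = balanced d t + d * k := by
    have : t = balanced d t + d * k := by linarith
    exact_mod_cast this
  have e1 : (t / d : ℚ) = balanced d t / d + k := by rw [e]; field_simp
  have hc : ⌈(t / d : ℚ) - 1 / 2⌉ = k := by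
    rw [Int.ceil_eq_iff, e1]
    have h2' : -(d : ℚ) < 2 * balanced d t := by exact_mod_cast h2
    have h3' : 2 * (balanced d t : ℚ) ≤ d := by exact_mod_cast h3
    constructor
    · have : -(1 / 2 : ℚ) < balanced d t / d := by rw [lt_div_iff₀ hd']; linarith
      linarith
    · have : (balanced d t / d : ℚ) ≤ 1 / 2 := by rw [div_le_iff₀ hd']; linarith
      linarith
  rw [hc, e1]; ring

/-- The numerators `y` of the vector are replaced by the balanced residues of `q y`. -/
def residueProg : Program :=
  forE 8 (.const 0) (.reg 0) <|
    .seq (set 17 (.reg 40 * .load (.reg 37 + .reg 8) % .reg 35)) <|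
    .seq (ifE (.const 2 * .reg 17 - .reg 35) (set 17 (.reg 17 - .reg 35)) skip) <|
    put (.reg 37 + .reg 8) (.reg 17)

/-- The product of the matrix `M'` with the vector of residues, divided by `|det M'|`.  The entries
of `M'` are recovered from the packed rows. -/
def productProg : Program :=
  forE 8 (.const 0) (.reg 0) <|
    .seq (set 17 (.load (.reg 13 + .reg 8))) <| .seq (set 18 (.const 0)) <|
    .seq (forE 9 (.const 0) (.reg 0)
      (.seq (set 19 (digitTail (.reg 17) (.reg 5))) <|
        .seq (set 10 (.reg 17 - .reg 5 * .reg 19)) <|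
        .seq (set 11 (digitTail (.reg 10) (.reg 6))) <|
        .seq (set 18 (.reg 18 +
          (.reg 10 + (.reg 22 - .reg 6) * .reg 11) * .load (.reg 37 + .reg 9))) <|
        set 17 (.reg 19))) <|
    put (.reg 8) (.reg 18 / .reg 35)

section

variable {n a b : ℕ} {m S β x Z : ℤ} {B : ℕ} {M : Matrix (Fin n) (Fin n) ℤ} {O : List ℤ → ℤ}

set_option maxHeartbeats 1000000 in
theorem run_residueProg (hS : Scales n m S β x Z B) {σ : State} (hE : Env n a b m S x Z σ)
    {s q d : ℤ} {y : ℕ → ℤ} (h37 : σ.reg 37 = s) (h35 : σ.reg 35 = d) (h40 : σ.reg 40 = q)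
    (hd : 0 < d) (hy : ∀ u : ℕ, u < n → σ.mem (s + u) = y u) :
    Run O B residueProg σ (1000 * n ^ 4) fun σ' => Env n a b m S x Z σ' ∧
      (∀ r < 40, 20 ≤ r → σ'.reg r = σ.reg r) ∧ (∀ k < s, σ'.mem k = σ.mem k) ∧
      ∀ u : ℕ, u < n → σ'.mem (s + u) = balanced d (q * y u) := by
  apply Run.of_bounded
  intro hσ
  have hB := hS.hB
  have ha := hS.addr_le
  have hn1 := hS.one_le_n
  have hn := hS.hn
  have hnn : (0 : ℤ) ≤ n * n := by positivity
  have hnB : |(0 : ℤ) + n| ≤ B := by rw [abs_of_nonneg (by omega)]; omega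
  have hdB : d ≤ B := by rw [← h35]; exact (le_abs_self _).trans (hσ.1 35 (by norm_num))
  have main : Run O B residueProg σ (n * ((60 + ((60 + 61) + 121)) + 121) + 121) fun σ' =>
      Env n a b m S x Z σ' ∧
      (∀ r < 40, 20 ≤ r → σ'.reg r = σ.reg r) ∧ (∀ k < s, σ'.mem k = σ.mem k) ∧
      ∀ u : ℕ, u < n → σ'.mem (s + u) = balanced d (q * y u) := by
    refine .forE hB (by decide) 0 n (60 + ((60 + 61) + 121)) (fun t σ' => t ≤ n ∧
      Env n a b m S x Z σ' ∧ σ'.reg 8 = t ∧ σ'.reg 40 = q ∧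
      (∀ r < 40, 20 ≤ r → σ'.reg r = σ.reg r) ∧ (∀ k < s, σ'.mem k = σ.mem k) ∧
      (∀ u : ℕ, u < t → σ'.mem (s + u) = balanced d (q * y u)) ∧
      ∀ u : ℕ, u < n → t ≤ u → σ'.mem (s + u) = y u) rfl (by simp) hnB ?_ ?_ ?_ ?_
    · refine ⟨by omega, hE.set (by omega), by simp, by simp [h40], fun r h1 h2 => ?_,
        fun k _ => rfl, fun u hu => by omega, fun u hu _ => hy u hu⟩
      simp [show r ≠ 8 by omega]
    · rintro t σ₁ ⟨-, hE₁, h8, -⟩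
      exact ⟨by simp [h8], by simp [hE₁.r0]⟩
    · rintro t σ₁ ht ⟨-, hE₁, h8, g40, hreg, hmem, hval, hval'⟩
      have g35 : σ₁.reg 35 = d := (hreg 35 (by norm_num) (by norm_num)).trans h35
      have g37 : σ₁.reg 37 = s := (hreg 37 (by norm_num) (by norm_num)).trans h37
      have e1 := Int.emod_nonneg (q * y t) hd.ne'
      have e2 := Int.emod_lt_of_pos (q * y t) hd
      have hv : (Expr.reg 40 * .load (.reg 37 + .reg 8) % .reg 35).eval σ₁ = q * y t % d := by
        simp only [Expr.eval_mul, Expr.eval_mod, Expr.eval_load, Expr.eval_add, Expr.eval_reg, g40,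
          g37, h8, g35, hval' t ht le_rfl]
      have last : ∀ σ₂, Env n a b m S x Z σ₂ → (∀ r < 41, r ≠ 17 → σ₂.reg r = σ₁.reg r) →
          σ₂.mem = σ₁.mem → σ₂.reg 17 = balanced d (q * y t) → Run O B
          (put (.reg 37 + .reg 8) (.reg 17)) σ₂ 121 fun σ'' => σ''.reg 8 = 0 + t ∧ (t + 1 ≤ n ∧
            Env n a b m S x Z (σ''.setReg 8 (0 + t + 1)) ∧
            (σ''.setReg 8 (0 + t + 1)).reg 8 = (t + 1 : ℕ) ∧
            (σ''.setReg 8 (0 + t + 1)).reg 40 = q ∧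
            (∀ r < 40, 20 ≤ r → (σ''.setReg 8 (0 + t + 1)).reg r = σ.reg r) ∧
            (∀ k < s, (σ''.setReg 8 (0 + t + 1)).mem k = σ.mem k) ∧
            (∀ u : ℕ, u < t + 1 →
              (σ''.setReg 8 (0 + t + 1)).mem (s + u) = balanced d (q * y u)) ∧
            ∀ u : ℕ, u < n → t + 1 ≤ u → (σ''.setReg 8 (0 + t + 1)).mem (s + u) = y u) := by
        intro σ₂ hE₂ hr₂ hm₂ h17
        have h3 := two_mul_abs_balanced_le hd (q * y t)
        have h4 := abs_nonneg (balanced d (q * y t))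
        have e37 : σ₂.reg 37 = s := (hr₂ 37 (by norm_num) (by norm_num)).trans g37
        have e8 : σ₂.reg 8 = t := (hr₂ 8 (by norm_num) (by norm_num)).trans h8
        refine .put hB (by decide) (by rw [Expr.eval_reg, h17]; omega) ?_
        simp only [Expr.eval_add, Expr.eval_reg, e37, e8, h17]
        refine ⟨by simp [e8], by omega, hE₂.put.set (by omega), by simp, ?_, fun r h1 h2 => ?_,
          fun k hk => ?_, fun u hu => ?_, fun u hu hu' => ?_⟩
        · simp [hr₂ 40 (by norm_num) (by norm_num), g40]
        · rw [reg_setReg, if_neg (by omega), reg_setMem, hr₂ r (by omega) (by omega), hreg r h1 h2]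
        · rw [mem_setReg, mem_setMem, if_neg (by omega), hm₂, hmem k hk]
        · rw [mem_setReg, mem_setMem, hm₂]
          by_cases hut : u = t
          · subst hut; simp
          · rw [if_neg (by omega), hval u (by omega)]
        · rw [mem_setReg, mem_setMem, if_neg (by omega), hm₂, hval' u hu (by omega)]
      refine .seq (.set hB (by decide) (by rw [hv, abs_of_nonneg e1]; omega) ?_)
      rw [hv]
      refine Run.seq (T := 60 + 61) (T' := 121) (.ifE (T := 60) hB (by decide) (fun hp => ?_)
        fun hp => (Run.skip ?_).mono (by norm_num) fun _ h => h)
      · simp [g35] at hp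
        refine .set hB (by decide) ?_ (last _ ((hE₁.set (by omega)).set (by omega))
          (fun r h1 h2 => by simp [h2]) rfl ?_)
        · simp [g35]; rw [abs_of_nonpos (by omega)]; omega
        · simp [g35, balanced, hp]
      · simp [g35] at hp
        refine last _ (hE₁.set (by omega)) (fun r h1 h2 => by simp [h2]) rfl ?_
        simp [balanced, hp.not_gt]
    · rintro σ₁ ⟨-, hE₁, -, -, hreg, hmem, hval, -⟩
      exact ⟨hE₁, hreg, hmem, hval⟩
  refine main.mono ?_ fun _ h => h
  have h3 : n ≤ n ^ 4 := Nat.le_self_pow (by norm_num) n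
  omega

theorem fam_digits {N : ℕ → ℕ → ℤ} {p : ℤ} {Y : ℕ → ℤ} {i j : ℕ} (hx : 2 * β < x)
    (h : norm1 (fam N p Y i j) ≤ β) (τ : ℤ) :
    ((fam N p Y i j).eval x + x / 2) / x = N i j ∧
    (fam N p Y i j).eval x + (τ - x) * N i j = (fam N p Y i j).eval τ := by
  have h1 : |famConst p Y i j| ≤ β := by
    refine le_trans (le_of_eq ?_) ((abs_coeff_le_norm1 _ 0).trans h)
    simp [fam]
  constructor
  · rw [eval_fam, add_comm (x * _)]
    exact div_of_two_mul_abs_lt (by omega)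
  · rw [eval_fam, eval_fam]; ring

set_option maxHeartbeats 1000000 in
theorem run_productProg (hS : Scales n m S β x Z B) {σ : State} {P : ℕ} {J : ℕ → ℕ} {τ F : ℤ}
    (hE : Env n a b m S x Z σ) (h22 : σ.reg 22 = τ)
    (hfam : ∀ u < n, ∀ v < n, norm1 (poly M P J u v) ≤ β)
    (hR : Rows n Z (3 + n * n + n) (fun i j => (poly M P J i j).eval x) n σ)
    {s d : ℤ} {z : ℕ → ℤ} (h37 : σ.reg 37 = s) (hs : n ≤ s) (h35 : σ.reg 35 = d)
    (hz : ∀ u : ℕ, u < n → σ.mem (s + u) = z u)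
    (hF : ∀ u < n, ∀ v < n, |(poly M P J u v).eval τ * z v| ≤ F) (hFB : n * F ≤ B) :
    Run O B productProg σ (1000 * n ^ 4) fun σ' => ∀ i : ℕ, i < n →
      σ'.mem i = (∑ j ∈ Finset.range n, (poly M P J i j).eval τ * z j) / d := by
  have hB := hS.hB
  have ha := hS.addr_le
  have hn1 := hS.one_le_n
  have hn := hS.hn
  have hx1 := hS.one_le_x
  have hxZ := hS.x_lt
  have hβ := hS.β_lt_x
  have hβx := hS.two_mul_βx_lt
  have hnn : (0 : ℤ) ≤ n * n := by positivity
  have hnB : |(0 : ℤ) + n| ≤ B := by rw [abs_of_nonneg (by omega)]; omega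
  have hZB := hS.Z_pow_le (t := 1) (by omega)
  rw [pow_one] at hZB
  have hF0 : 0 ≤ F := (abs_nonneg _).trans (hF 0 (by omega) 0 (by omega))
  have hev : ∀ i < n, ∀ j < n, 2 * |(poly M P J i j).eval x| < Z := fun i hi j hj => by
    have h1 := abs_eval_le (natDegree_fam_le (natMat M.adjugate) P (powers P J) i j) (x := x)
      (by rwa [abs_of_nonneg (by omega)])
    rw [pow_one, abs_of_nonneg (by omega : 0 ≤ x)] at h1
    have h2 := mul_le_mul_of_nonneg_right (hfam i hi j hj) (by omega : 0 ≤ x)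
    have h3 : |(poly M P J i j).eval x| ≤ norm1 (poly M P J i j) * x := h1
    omega
  have hpk : ∀ i < n, ∀ t ≤ n, |pack Z (n - t) fun v => (poly M P J i (t + v)).eval x| ≤ B :=
    fun i hi t ht => hS.abs_pack_le (by omega) fun j hj => hev i hi _ (by omega)
  have hsum : ∀ i < n, ∀ t ≤ n, |∑ j ∈ Finset.range t, (poly M P J i j).eval τ * z j| ≤ B :=
    fun i hi t ht => by
      refine (Finset.abs_sum_le_sum_abs _ _).trans ((Finset.sum_le_card_nsmul _ _ F ?_).trans ?_)
      · intro j hj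
        exact hF i hi j (by simp at hj; omega)
      · rw [Finset.card_range, nsmul_eq_mul]
        refine le_trans ?_ hFB
        gcongr
  have main : Run O B productProg σ (n * ((60 + (60 + ((n * ((60 + (60 + (60 + (60 + 60)))) +
      121) + 121) + 121))) + 121) + 121) fun σ' => ∀ i : ℕ, i < n →
      σ'.mem i = (∑ j ∈ Finset.range n, (poly M P J i j).eval τ * z j) / d := by
    refine .forE hB (by decide) 0 n (60 + (60 + ((n * ((60 + (60 + (60 + (60 + 60)))) +
      121) + 121) + 121))) (fun t σ' => t ≤ n ∧
      Env n a b m S x Z σ' ∧ σ'.reg 8 = t ∧ σ'.reg 22 = τ ∧ σ'.reg 35 = d ∧ σ'.reg 37 = s ∧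
      (∀ k : ℤ, n ≤ k → σ'.mem k = σ.mem k) ∧ ∀ i : ℕ, i < t →
      σ'.mem i = (∑ j ∈ Finset.range n, (poly M P J i j).eval τ * z j) / d) rfl (by simp) hnB
      ?_ ?_ ?_ ?_
    · exact ⟨by omega, hE.set (by omega), by simp, by simp [h22], by simp [h35], by simp [h37],
        fun k _ => rfl, fun u hu => by omega⟩
    · rintro t σ₁ ⟨-, hE₁, h8, -⟩
      exact ⟨by simp [h8], by simp [hE₁.r0]⟩
    · rintro i σ₁ hi ⟨-, hE₁, h8, g22, g35, g37, hmem, hval⟩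
      have hrow : (Expr.load (.reg 13 + .reg 8)).eval σ₁ =
          pack Z n fun v => (poly M P J i v).eval x := by
        simp only [Expr.eval_load, Expr.eval_add, Expr.eval_reg, hE₁.r13, h8]
        rw [hmem _ (by omega)]; exact hR i hi
      refine .seq (.set hB (by decide) (by rw [hrow]; simpa using hpk i hi 0 (by omega)) ?_)
      rw [hrow]
      refine .seq (.set hB (by decide) (by simp) ?_)
      refine .seq ?_
      refine .forE hB (by decide) 0 n (60 + (60 + (60 + (60 + 60)))) (fun t σ' => t ≤ n ∧
        Env n a b m S x Z σ' ∧ σ'.mem = σ₁.mem ∧ σ'.reg 8 = i ∧ σ'.reg 9 = t ∧ σ'.reg 22 = τ ∧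
        σ'.reg 35 = d ∧ σ'.reg 37 = s ∧
        σ'.reg 17 = (pack Z (n - t) fun v => (poly M P J i (t + v)).eval x) ∧
        σ'.reg 18 = ∑ j ∈ Finset.range t, (poly M P J i j).eval τ * z j) rfl (by simp) hnB
        ?_ ?_ ?_ ?_
      · exact ⟨by omega, ((hE₁.set (by omega)).set (by omega)).set (by omega), by simp, by simp [h8],
          by simp, by simp [g22], by simp [g35], by simp [g37], by simp, by simp⟩
      · rintro t σ₂ ⟨-, hE₂, -, -, h9, -⟩
        exact ⟨by simp [h9], by simp [hE₂.r0]⟩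
      · rintro t σ₂ ht ⟨-, hE₂, hm₂, k8, k9, k22, k35, k37, k17, k18⟩
        have hsplit : (pack Z (n - t) fun v => (poly M P J i (t + v)).eval x) =
            (poly M P J i t).eval x +
              Z * pack Z (n - (t + 1)) fun v => (poly M P J i (t + 1 + v)).eval x := by
          rw [show n - t = n - (t + 1) + 1 by omega, pack_succ]
          simp only [add_zero, add_assoc, add_comm 1]
        have h2 := hev i hi t ht
        have v19 : (digitTail (.reg 17) (.reg 5)).eval σ₂ =
            pack Z (n - (t + 1)) fun v => (poly M P J i (t + 1 + v)).eval x := by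
          rw [eval_digitTail, Expr.eval_reg, Expr.eval_reg, k17, hE₂.r5, hsplit]
          exact div_of_two_mul_abs_lt h2
        obtain ⟨f1, f2⟩ := fam_digits hβ (hfam i hi t ht) τ
        change ((poly M P J i t).eval x + x / 2) / x = _ at f1
        change (poly M P J i t).eval x + _ = (poly M P J i t).eval τ at f2
        refine .seq (.set hB (by decide) (by rw [v19]; exact hpk i hi _ (by omega)) ?_)
        rw [v19]
        have v10 : (Expr.reg 17 - .reg 5 * .reg 19).eval (σ₂.setReg 19
            (pack Z (n - (t + 1)) fun v => (poly M P J i (t + 1 + v)).eval x)) =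
            (poly M P J i t).eval x := by
          simp [k17, hE₂.r5, hsplit]
        refine .seq (.set hB (by decide) (by
          rw [v10]; have := abs_nonneg ((poly M P J i t).eval x); omega) ?_)
        rw [v10]
        have hN : |natMat M.adjugate i t| ≤ B := by
          have h3 := (abs_coeff_le_norm1 (poly M P J i t) 1).trans (hfam i hi t ht)
          have h4 : (poly M P J i t).coeff 1 = natMat M.adjugate i t := by
            rw [poly, fam, coeff_add, mul_comm, coeff_C_mul, coeff_X_one,
              coeff_C_of_ne_zero one_ne_zero, mul_one, add_zero]
          rw [h4] at h3
          omega
        refine .seq (.set hB (by decide) (by simp [hE₂.r6, f1]; exact hN) ?_)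
        have v18 : (poly M P J i t).eval x + (τ - x) * natMat M.adjugate i t =
            (poly M P J i t).eval τ := f2
        refine .seq (.set hB (by decide) (by
          simp [hE₂.r6, f1, k18, k22, k37, k9, hm₂, hmem _ (by omega : (n : ℤ) ≤ s + t), hz t ht,
            v18]
          rw [← Finset.sum_range_succ]; exact hsum i hi _ ht) ?_)
        refine .set hB (by decide) (by simpa using hpk i hi _ ht) ⟨by simp [k9], by omega,
          ((((((hE₂.set (by omega)).set (by omega)).set (by omega)).set (by omega)).set
            (by omega)).set (by omega)), by simp [hm₂], by simp [k8], by simp, by simp [k22],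
          by simp [k35], by simp [k37], by simp, ?_⟩
        simp [hE₂.r6, f1, k18, k22, k37, k9, hm₂, hmem _ (by omega : (n : ℤ) ≤ s + t), hz t ht,
            v18, Finset.sum_range_succ]
      · rintro σ₂ ⟨-, hE₂, hm₂, k8, k9, k22, k35, k37, k17, k18⟩
        have hv : (Expr.reg 18 / .reg 35).eval σ₂ =
            (∑ j ∈ Finset.range n, (poly M P J i j).eval τ * z j) / d := by
          simp [k18, k35]
        refine .put hB (by decide) ?_ ?_
        · rw [hv]
          refine le_trans ?_ (hsum i hi n le_rfl)
          have := Int.natAbs_ediv_le_natAbs (∑ j ∈ Finset.range n, (poly M P J i j).eval τ * z j) d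
          rw [Int.abs_eq_natAbs, Int.abs_eq_natAbs]; exact_mod_cast this
        · rw [hv, Expr.eval_reg, k8]
          refine ⟨by simp [k8], by omega, hE₂.put.set (by omega), by simp, by simp [k22],
            by simp [k35], by simp [k37], fun k hk => ?_, fun u hu => ?_⟩
          · rw [mem_setReg, mem_setMem, if_neg (by omega), hm₂, hmem k hk]
          · rw [mem_setReg, mem_setMem, hm₂]
            by_cases hut : u = i
            · subst hut; simp
            · rw [if_neg (by omega), hval u (by omega)]
    · rintro σ₁ ⟨-, -, -, -, -, -, -, hval⟩
      exact hval
  refine main.mono ?_ fun _ h => h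
  have h3 : n * n ≤ n ^ 4 := by
    rw [← pow_two]; exact Nat.pow_le_pow_right (by omega) (by norm_num)
  have h4 : n * 2 ≤ n * n := Nat.mul_le_mul le_rfl hn
  have e : n * ((60 + (60 + ((n * ((60 + (60 + (60 + (60 + 60)))) + 121) + 121) + 121))) + 121) =
    421 * (n * n) + 483 * n := by ring
  rw [e]
  omega

end

/-! ### The query and the output in terms of integers -/

section

variable {n : ℕ} {A : Matrix (Fin n) (Fin n) ℤ}

/-- The numerators of `A⁻¹ v` with respect to the denominator `|det A|`. -/
def numerator (A : Matrix (Fin n) (Fin n) ℤ) (v : Fin n → ℤ) (i : Fin n) : ℤ :=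
  A.det.sign * A.adjugate.mulVec v i

theorem inv_mulVec_eq (hA : A.det ≠ 0) (v : Fin n → ℤ) (i : Fin n) :
    (A.map (Int.cast : ℤ → ℚ))⁻¹.mulVec (fun i => (v i : ℚ)) i =
      numerator A v i / (|A.det| : ℤ) := by
  have hA' : (A.det : ℚ) ≠ 0 := by exact_mod_cast hA
  have h1 : (A.map (Int.cast : ℤ → ℚ)).det = A.det := (Int.cast_det A).symm
  have h2 : (A.map (Int.cast : ℤ → ℚ)).adjugate = A.adjugate.map (Int.cast : ℤ → ℚ) :=
    ((Int.castRingHom ℚ).map_adjugate A).symm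
  have h3 : (A.adjugate.map (Int.cast : ℤ → ℚ)).mulVec (fun i => (v i : ℚ)) i =
      (A.adjugate.mulVec v i : ℤ) := by
    simp [Matrix.mulVec, dotProduct]
  rw [Matrix.inv_def, h1, h2, Matrix.smul_mulVec, Pi.smul_apply, h3, Ring.inverse_eq_inv',
    smul_eq_mul, numerator]
  have h4 : A.det.sign * |A.det| = A.det := Int.sign_mul_abs A.det
  have h5 : A.det.sign * A.det.sign = 1 := by
    rcases lt_or_gt_of_ne hA with h | h
    · rw [Int.sign_eq_neg_one_of_neg h]; rfl
    · rw [Int.sign_eq_one_of_pos h]; rfl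
  have h4' : (A.det : ℚ) = A.det.sign * (|A.det| : ℤ) := by exact_mod_cast h4.symm
  have h5' : (A.det.sign : ℚ) * A.det.sign = 1 := by exact_mod_cast h5
  have h6 : ((|A.det| : ℤ) : ℚ) ≠ 0 := by exact_mod_cast abs_ne_zero.2 hA
  have h7 : (A.det.sign : ℚ) ≠ 0 := left_ne_zero_of_mul_eq_one h5'
  rw [h4', eq_div_iff h6]
  push_cast at *
  field_simp
  linear_combination (-(A.adjugate.mulVec v i : ℚ)) * h5'

theorem mulVec_numerator (v : Fin n → ℤ) (i : Fin n) :
    A.mulVec (numerator A v) i = |A.det| * v i := by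
  have h : numerator A v = A.det.sign • A.adjugate.mulVec v := rfl
  rw [h, Matrix.mulVec_smul, Matrix.mulVec_mulVec, Matrix.mul_adjugate, Matrix.smul_mulVec,
    Matrix.one_mulVec, Pi.smul_apply, Pi.smul_apply, smul_eq_mul, smul_eq_mul, ← mul_assoc]
  rw [← Int.sign_mul_self_eq_abs]

theorem balanced_emod_mul (d q y : ℤ) : balanced d (q % d * y) = balanced d (q * y) := by
  have : q % d * y % d = q * y % d := (Int.mod_modEq q d).mul_right y
  rw [balanced, balanced, this]

/-- The output is computed exactly from the balanced residues. -/
theorem output_eq (hA : A.det ≠ 0) (v : Fin n → ℤ) (q : ℤ) (i : Fin n) :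
    (((∑ j, A i j * balanced |A.det| (q * numerator A v j)) / |A.det| : ℤ) : ℚ) =
      (A.map (Int.cast : ℤ → ℚ)).mulVec
        (fracPart ((q : ℚ) • (A.map (Int.cast : ℤ → ℚ))⁻¹.mulVec fun i => (v i : ℚ))) i := by
  have hd : 0 < |A.det| := abs_pos.2 hA
  have hdvd : |A.det| ∣ ∑ j, A i j * balanced |A.det| (q * numerator A v j) := by
    have h1 : |A.det| ∣ ∑ j, A i j * (q * numerator A v j -
        balanced |A.det| (q * numerator A v j)) :=
      Finset.dvd_sum fun j _ => (dvd_sub_balanced _ _).mul_left _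
    have h2 : ∑ j, A i j * (q * numerator A v j) = |A.det| * (q * v i) := by
      rw [mul_left_comm, ← mulVec_numerator, Matrix.mulVec, dotProduct, Finset.mul_sum]
      exact Finset.sum_congr rfl fun j _ => by ring
    simp only [mul_sub, Finset.sum_sub_distrib, h2] at h1
    exact (dvd_sub_right (dvd_mul_right _ _)).1 h1
  rw [Int.cast_div hdvd (by exact_mod_cast hd.ne')]
  rw [Matrix.mulVec, dotProduct, Int.cast_sum, Finset.sum_div]
  refine Finset.sum_congr rfl fun j _ => ?_
  have h : ((q : ℚ) • (A.map (Int.cast : ℤ → ℚ))⁻¹.mulVec fun i => (v i : ℚ)) j =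
      ((q * numerator A v j : ℤ) : ℚ) / (|A.det| : ℤ) := by
    rw [Pi.smul_apply, inv_mulVec_eq hA, smul_eq_mul]; push_cast; ring
  rw [fracPart, h, balanced_div_eq hd, Matrix.map_apply]
  push_cast; ring

end

section

variable {n : ℕ} {hn : 2 ≤ n} {a b : ℕ} {M : Matrix (Fin n) (Fin n) ℤ}

theorem Execution.x_apply (E : Execution hn a b M) (i : Fin n) :
    E.x i = numerator E.M' E.bVec i / (|E.M'.det| : ℤ) := inv_mulVec_eq E.M'_det _ i

theorem Execution.isQuery (E : Execution hn a b M) (ha : 0 < a) (hb : 0 < b) (p : ℝ≥0∞)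
    (t : Target) :
    E.IsQuery p (header a b |E.M'.det| t ++ List.ofFn (numerator E.M' E.bVec)) t := by
  have hd : 0 < |E.M'.det| := abs_pos.2 E.M'_det
  cases t with
  | sap =>
    exact ⟨a, b, |E.M'.det|, _, rfl, by exact_mod_cast hb, hd, by push_cast; rfl, E.x_apply⟩
  | gda =>
    refine ⟨a, b, |E.M'.det| * b, 2 * a, |E.M'.det|, _, rfl, by exact_mod_cast hb, by positivity,
      hd, ?_, ?_, E.x_apply⟩
    · rw [Execution.gdaGap]; push_cast; rfl
    · have hb' : (b : ℝ) ≠ 0 := by positivity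
      have ha' : (a : ℝ) ≠ 0 := by positivity
      rw [Execution.gdaBound]; push_cast; field_simp

theorem Execution.abs_reply_le (E : Execution hn a b M) (ha : 0 < a) (hb : 0 < b) {p : ℝ≥0∞}
    {t : Target} {q : ℤ} (h : E.IsReply p q t) : |q| ≤ |E.M'.det| := by
  cases t with
  | sap => exact h.2
  | gda =>
    obtain ⟨⟨h1, h2⟩, -⟩ := h
    have hb' : (b : ℝ) ≠ 0 := by positivity
    have ha' : (a : ℝ) ≠ 0 := by positivity
    have hdim : dimFactor n p ≠ 0 := by
      have : (0 : ℝ) < n := by exact_mod_cast (by omega : 0 < n)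
      exact (Real.rpow_pos_of_pos this _).ne'
    have h3 : E.gdaGap p * E.gdaBound p = |(E.M'.det : ℝ)| / 2 := by
      rw [Execution.gdaGap, Execution.gdaBound]; field_simp
    rw [h3] at h2
    have h4 : (q : ℝ) ≤ |(E.M'.det : ℝ)| := by have := abs_nonneg (E.M'.det : ℝ); linarith
    rw [abs_of_nonneg (by omega)]
    exact_mod_cast h4

theorem Execution.numerator_eq (E : Execution hn a b M) (i : Fin n) :
    numerator E.M' E.bVec i = E.M'.det.sign *
      (E.b₁ * E.M'.adjugate i (fst hn) + E.b₂ * E.M'.adjugate i (snd hn)) := by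
  have hne : fst hn ≠ snd hn := by simp [fst, snd]
  rw [numerator, Matrix.mulVec, dotProduct]
  congr 1
  rw [Finset.sum_eq_add (fst hn) (snd hn) hne]
  · simp [Execution.bVec, hne.symm, mul_comm]
  · rintro j - ⟨h1, h2⟩
    simp [Execution.bVec, h1, h2]
  · simp
  · simp

end

/-! ### The whole program -/

/-- The part of the program that precedes the call. -/
def beforeCall (t : Target) : Program :=
  .seq initProg <| .seq packProg <| .seq detPrimeProg <| .seq rowsProg <| .seq loopProg <|
  .seq coprimeProg <| .seq substProg <| .seq (evProg 23 (.reg 0) (.const 1)) <|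
  .seq (evProg 24 (.const 0) (.reg 16)) <| .seq (evProg 25 (.const 1) (.reg 16)) <|
  .seq bezoutProg <| .seq signProg <| .seq (headerProg t) numeratorProg

/-- The part of the program that follows the call. -/
def afterCall : Program := .seq residueProg productProg

/-- The program for the reduction.  The reply of the oracle is reduced modulo `|det M'|` at once,
because nothing bounds its length in advance. -/
def reduction (t : Target) : Program :=
  .seq (beforeCall t) <| .seq (.call 100 14 38) <| .seq (.arith .mod 40 100 35) afterCall

section

variable {n : ℕ} (hn : 2 ≤ n) (a : ℕ) (M : Matrix (Fin n) (Fin n) ℤ) (P : ℕ) (J : ℕ → ℕ)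

/-- The base `c` of the power that is substituted for the variable. -/
noncomputable def base : ℤ := coprimePart P (res (lastCof M P J 0) (lastCof M P J 1))

/-- The power `c ^ e` that is substituted for the variable. -/
noncomputable def point : ℤ := base M P J ^ substExponent hn a M (base M P J)

/-- The bounds that keep all the numbers that occur in the computation below `B`. -/
structure Budget {n : ℕ} (hn : 2 ≤ n) (a : ℕ) (M : Matrix (Fin n) (Fin n) ℤ) (P : ℕ) (J : ℕ → ℕ)
    (b : ℕ) (m S β x Z : ℤ) (B : ℕ) : Prop extends Scales n m S β x Z B where
  prime_le : (P : ℤ) + 1 ≤ B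
  exp_le : |((m * M.det : ℤ) : ℝ)| * Real.exp (47 * P) ≤ B
  entry_le : ∀ i < n, ∀ j < n, |natMat M.adjugate i j| + (2 * P + P ^ (2 * n)) ≤ β
  res_le : |res (lastCof M P J 0) (lastCof M P J 1)| ≤ B
  base_le : (a : ℤ) ^ 2 * (2 * m * n) ^ (3 * n) * |base M P J| ≤ B
  point_le : 4 * n * (x * |point hn a M P J| ^ (n + 1)) ^ 3 * a ≤ B
  b_le : b ≤ a
  b_pos : 0 < b
  m_eq : M (lst hn) (fst hn) = m
  le_m : ∀ i j, |M i j| ≤ m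

end

section

variable {n : ℕ} {hn : 2 ≤ n} {a b : ℕ} {M : Matrix (Fin n) (Fin n) ℤ} {P : ℕ} {J : ℕ → ℕ}
  {m S β x Z : ℤ} {B : ℕ}

theorem LoopData.norm1_poly_le (hL : LoopData hn M P J)
    (hN : ∀ i < n, ∀ j < n, |natMat M.adjugate i j| + (2 * P + P ^ (2 * n)) ≤ β) :
    ∀ u < n, ∀ v < n, norm1 (poly M P J u v) ≤ β := by
  intro u hu v hv
  have hP := hL.p_spec.1.1.one_lt
  refine le_trans ?_ (hN u hu v hv)
  refine (norm1_fam_le _ _ _ _ _).trans ?_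
  have h1 := abs_famConst_le P (powers P J) u v
  rw [Nat.abs_cast] at h1
  have h2 : (if u = 0 then 0 else |powers P J u|) ≤ (P : ℤ) ^ (2 * n) := by
    split_ifs with h
    · positivity
    · obtain ⟨k, rfl⟩ := Nat.exists_eq_succ_of_ne_zero h
      have h3 := hL.exponent_le hn (k := k) hu
      rw [powers, abs_of_nonneg (by positivity)]
      exact pow_le_pow_right₀ (by omega) (by rw [Nat.succ_eq_add_one]; omega)
  omega

theorem LoopData.base_spec (hL : LoopData hn M P J) :
    2 ≤ |base M P J| ∧ ¬ (P : ℤ) ∣ base M P J :=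
  ⟨two_le_abs_coprimePart hL.p_spec.1.1 (hL.res_lastCof_ne_zero hn),
    not_dvd_coprimePart hL.p_spec.1.1 (hL.res_lastCof_ne_zero hn)⟩

theorem LoopData.one_le_abs_point (hL : LoopData hn M P J) : 1 ≤ |point hn a M P J| := by
  rw [point, abs_pow]
  exact one_le_pow₀ (by have := hL.base_spec.1; omega)

/-- A bound for the cofactors of `M'`, among them its determinant. -/
theorem Budget.abs_cof_le (h : Budget hn a M P J b m S β x Z B) (hL : LoopData hn M P J) {r c : ℕ} :
    |(cof (poly M P J) n r c).eval (point hn a M P J)| ≤ x * |point hn a M P J| ^ (n + 1) := by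
  have h1 := hL.one_le_abs_point (a := a)
  have h2 := abs_eval_le (natDegree_cof_fam_le (natMat M.adjugate) P (powers P J) n r c) h1
  refine h2.trans ?_
  have h3 : norm1 (cof (poly M P J) n r c) ≤ x := by
    have h4 := h.norm1_cof_lt le_rfl (hL.norm1_poly_le h.entry_le) r c
    have h5 := h.hx
    have := norm1_nonneg (cof (poly M P J) n r c)
    omega
  have h4 : |point hn a M P J| ^ n ≤ |point hn a M P J| ^ (n + 1) :=
    pow_le_pow_right₀ h1 (by omega)
  have := h.one_le_x
  exact mul_le_mul h3 h4 (by positivity) (by omega)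

theorem Budget.abs_entry_le (h : Budget hn a M P J b m S β x Z B) (hL : LoopData hn M P J) {i j : ℕ}
    (hi : i < n) (hj : j < n) :
    |(poly M P J i j).eval (point hn a M P J)| ≤ x * |point hn a M P J| ^ (n + 1) := by
  have h1 := hL.one_le_abs_point (a := a)
  refine (abs_eval_le (natDegree_fam_le (natMat M.adjugate) P (powers P J) i j) h1).trans ?_
  have h3 : norm1 (poly M P J i j) ≤ x := by
    have h4 := hL.norm1_poly_le h.entry_le i hi j hj
    have h5 := h.β_lt_x
    have := h.hβ
    omega
  have h4 : |point hn a M P J| ^ 1 ≤ |point hn a M P J| ^ (n + 1) :=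
    pow_le_pow_right₀ h1 (by omega)
  have := h.one_le_x
  exact mul_le_mul h3 h4 (by positivity) (by omega)

/-- The bounds in terms of `F`, which bounds the entries and the cofactors of `M'`. -/
theorem Budget.bounds (h : Budget hn a M P J b m S β x Z B) (hL : LoopData hn M P J) :
    ∃ F : ℤ, F = x * |point hn a M P J| ^ (n + 1) ∧ 1 ≤ F ∧ F ≤ B ∧ F * F + 1 ≤ B ∧
      3 * F ^ 3 ≤ B ∧ F * b ≤ B ∧ 2 * (a : ℤ) ≤ B ∧ n * (F * F) ≤ B := by
  refine ⟨_, rfl, ?_⟩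
  have hp := h.point_le
  have h1 := one_le_pow₀ (hL.one_le_abs_point (a := a)) (n := n + 1)
  have h2 := h.one_le_x
  have ha : (1 : ℤ) ≤ a := by have := h.b_le; have := h.b_pos; omega
  have hb : (b : ℤ) ≤ a := by exact_mod_cast h.b_le
  have hn1 := h.one_le_n
  have hF : 1 ≤ x * |point hn a M P J| ^ (n + 1) := by nlinarith
  generalize x * |point hn a M P J| ^ (n + 1) = F at *
  have e1 : 1 ≤ F * F := by nlinarith
  have e2 : F ≤ F * F := by nlinarith
  have e3 : F * F ≤ F ^ 3 := by rw [pow_succ, pow_two]; nlinarith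
  have e4 : F ^ 3 ≤ F ^ 3 * a := le_mul_of_one_le_right (by positivity) ha
  have e5 : n * F ^ 3 ≤ n * (F ^ 3 * a) := by gcongr
  have e6 : 2 * F ^ 3 ≤ n * F ^ 3 := by gcongr
  have e7 : 4 * (n * (F ^ 3 * a)) ≤ B := by linarith
  have e8 : n * (F * F) ≤ n * F ^ 3 := by gcongr
  have e9 : F * b ≤ F ^ 3 * a := by
    have : F ≤ F ^ 3 := by omega
    gcongr
  have e10 : (1 : ℤ) * a ≤ F ^ 3 * a := by
    have : 1 ≤ F ^ 3 := by omega
    gcongr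
  have e11 : 1 * (F ^ 3 * a) ≤ n * (F ^ 3 * a) := by
    have : (1 : ℤ) ≤ n := by omega
    gcongr
  refine ⟨hF, ?_, ?_, ?_, ?_, ?_, ?_⟩ <;> omega

/-- The numbers `det M'`, `(adj M')_{n,1}` and `(adj M')_{n,2}`, and the coefficients `b₁`, `b₂`. -/
structure BezoutData (hn : 2 ≤ n) (a : ℕ) (M : Matrix (Fin n) (Fin n) ℤ) (P : ℕ) (J : ℕ → ℕ)
    (D f g b₁ b₂ : ℤ) : Prop where
  D_eq : D = (cof (poly M P J) n n 0).eval (point hn a M P J)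
  f_eq : f = (cof (poly M P J) n 0 (n - 1)).eval (point hn a M P J)
  g_eq : g = (cof (poly M P J) n 1 (n - 1)).eval (point hn a M P J)
  D_ne : D ≠ 0
  g_ne : g ≠ 0
  bezout : b₁ * f + b₂ * g = 1
  lt_b₁ : -|g| < 2 * b₁
  b₁_le : 2 * b₁ ≤ |g|

theorem BezoutData.abs_le {D f g b₁ b₂ F : ℤ} (hb : BezoutData hn a M P J D f g b₁ b₂)
    (hF : 1 ≤ F) (hf : |f| ≤ F) (hg : |g| ≤ F) : |b₁| ≤ F ∧ |b₂| ≤ F * F + 1 := by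
  have h1 := hb.lt_b₁
  have h2 := hb.b₁_le
  have h3 : |b₁| ≤ F := by rw [_root_.abs_le]; constructor <;> omega
  refine ⟨h3, ?_⟩
  have h4 : b₂ * g = 1 - b₁ * f := by linarith [hb.bezout]
  have h5 : |b₂| * |g| ≤ 1 + |b₁| * |f| := by
    rw [← abs_mul, h4, ← abs_mul]
    exact (abs_sub _ _).trans (by simp)
  have h6 : |b₁| * |f| ≤ F * F := mul_le_mul h3 hf (abs_nonneg _) (by omega)
  have h7 : |b₂| * 1 ≤ |b₂| * |g| :=
    mul_le_mul_of_nonneg_left (Int.one_le_abs hb.g_ne) (abs_nonneg _)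
  omega

theorem beforeCall_cost_le (hn : 2 ≤ n) (N : ℕ) : 2000 * (n * n) + (2000 * (n * n) +
    ((4000 * (n + 1) ^ 2 + 300 * P) + (20000 * n ^ 4 + (300000 * n ^ 4 + ((121 * N + 300) +
    ((600 * n + 400 + 121 * N) + (5000 * (n + 1) ^ 2 + (5000 * (n + 1) ^ 2 +
    (5000 * (n + 1) ^ 2 + ((1000 + 481 * N) + (300 + (1000 + 30000 * n ^ 4)))))))))))) ≤
    400000 * n ^ 4 + 300 * P + 800 * N := by
  have h1 : (n + 1) ^ 2 ≤ 3 * (n * n) := by nlinarith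
  have h2 : 2 * 2 ≤ n * n := Nat.mul_le_mul hn hn
  have h3 : 4 * (n * n) ≤ n ^ 4 := by
    calc 4 * (n * n) ≤ (n * n) * (n * n) := Nat.mul_le_mul h2 le_rfl
      _ = n ^ 4 := by ring
  have h4 : n * 2 ≤ n * n := Nat.mul_le_mul le_rfl hn
  generalize (n + 1) ^ 2 = u at *
  generalize n * n = v at *
  generalize n ^ 4 = w at *
  linarith

end

section

variable {n : ℕ} {hn : 2 ≤ n} {a b : ℕ} {M : Matrix (Fin n) (Fin n) ℤ} {P : ℕ} {J : ℕ → ℕ}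
  {m S β x Z : ℤ} {B : ℕ}

/-- The numerators of the vector `M'⁻¹ (b₁, b₂, 0, …, 0)` with denominator `|det M'|`. -/
noncomputable def queryVec (hn : 2 ≤ n) (a : ℕ) (M : Matrix (Fin n) (Fin n) ℤ) (P : ℕ) (J : ℕ → ℕ)
    (D b₁ b₂ : ℤ) (u : ℕ) : ℤ :=
  D.sign * (b₁ * (cof (poly M P J) n 0 u).eval (point hn a M P J) +
    b₂ * (cof (poly M P J) n 1 u).eval (point hn a M P J))

/-- The state before the call. -/
structure Ready (hn : 2 ≤ n) (a b : ℕ) (M : Matrix (Fin n) (Fin n) ℤ) (P : ℕ) (J : ℕ → ℕ)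
    (m S x Z D b₁ b₂ : ℤ) (t : Target) (σ : State) : Prop where
  env : Env n a b m S x Z σ
  r22 : σ.reg 22 = point hn a M P J
  r35 : σ.reg 35 = |D|
  r37 : σ.reg 37 = 3 + n * n + n + n + (header a b |D| t).length
  r38 : σ.reg 38 = ((header a b |D| t).length + n : ℕ)
  rows : Rows n Z (3 + n * n + n) (fun i j => (poly M P J i j).eval x) n σ
  query : Holds σ (3 + n * n + n + n)
    (header a b |D| t ++ List.ofFn fun u : Fin n => queryVec hn a M P J D b₁ b₂ u)

theorem Rows.congr {σ σ' : State} {s : ℤ} {A : ℕ → ℕ → ℤ} {k : ℕ} (h : Rows n Z s A k σ)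
    (hσ : ∀ i : ℕ, i < k → σ'.mem (s + i) = σ.mem (s + i)) : Rows n Z s A k σ' :=
  fun i hi => (hσ i hi).trans (h i hi)

theorem Env.congr {σ σ' : State} (h : Env n a b m S x Z σ) (hσ : ∀ r < 15, σ'.reg r = σ.reg r) :
    Env n a b m S x Z σ' := by
  obtain ⟨h0, h1, h2, h3, h4, h5, h6, h12, h13, h14⟩ := h
  constructor <;> rw [hσ _ (by norm_num)] <;> assumption

theorem abs_sign_mul_le {D : ℤ} (hD : D ≠ 0) (z : ℤ) : |D.sign * z| = |z| := by
  rw [abs_mul, Int.abs_sign_of_ne_zero hD, one_mul]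

theorem length_header (a b d : ℤ) (t : Target) : (header a b d t).length ≤ 5 := by
  cases t <;> simp [header]

/-- The last stage before the call: the query is written. -/
theorem run_writeQuery {O : List ℤ → ℤ} (h : Budget hn a M P J b m S β x Z B)
    (hL : LoopData hn M P J) {D f g b₁ b₂ : ℤ} (hb : BezoutData hn a M P J D f g b₁ b₂)
    (t : Target) {σ : State} (hE : Env n a b m S x Z σ) (h22 : σ.reg 22 = point hn a M P J)
    (h23 : σ.reg 23 = D) (h33 : σ.reg 33 = b₁) (h34 : σ.reg 34 = b₂)
    (hR : Rows n Z (3 + n * n + n) (fun i j => (poly M P J i j).eval x) n σ) :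
    Run O B (.seq signProg <| .seq (headerProg t) numeratorProg) σ
      (300 + (1000 + 30000 * n ^ 4)) (Ready hn a b M P J m S x Z D b₁ b₂ t) := by
  obtain ⟨F, hF, hF1, -, -, hF3, hFb, haB, -⟩ := h.bounds hL
  have hτ : x * |point hn a M P J| ^ (n + 1) ≤ B := by
    obtain ⟨F', hF', -, hFB, -⟩ := h.bounds hL
    rw [← hF']; exact hFB
  have hcof : ∀ r c, |(cof (poly M P J) n r c).eval (point hn a M P J)| ≤ F := fun r c => by
    rw [hF]; exact h.abs_cof_le hL
  have hDF : |D| ≤ F := by rw [hb.D_eq]; exact hcof _ _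
  have hbF := hb.abs_le hF1 (by rw [hb.f_eq]; exact hcof _ _) (by rw [hb.g_eq]; exact hcof _ _)
  have hnn : (0 : ℤ) ≤ n * n := by positivity
  have hB := h.hB
  refine .seq ((run_signProg hB hb.D_ne h23).mono le_rfl ?_)
  rintro σ₁ ⟨e35, e36, hF₁⟩
  have hE₁ := hE.frame (by norm_num) hF₁
  refine .seq ((run_headerProg h.toScales hE₁ e35 (d := |D|) ?_ haB t).mono le_rfl ?_)
  · rw [abs_mul, abs_abs, Nat.abs_cast]
    refine le_trans ?_ hFb
    gcongr
  rintro σ₂ ⟨hH, g37, hreg₂, hmem₂⟩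
  have hreg : ∀ r < 35, σ₂.reg r = σ.reg r := fun r hr =>
    (hreg₂ r (by omega)).trans (hF₁.1 r hr)
  have hR₂ : Rows n Z (3 + n * n + n) (fun i j => (poly M P J i j).eval x) n σ₂ :=
    hR.congr fun i hi => by rw [hmem₂ _ (by omega), hF₁.2 _ (by omega)]
  refine (run_numeratorProg h.toScales (hE₁.congr fun r hr => hreg₂ r (by omega))
    ((hreg 22 (by norm_num)).trans h22) hL.one_le_abs_point hτ (hL.norm1_poly_le h.entry_le) hR₂
    ((hreg₂ 36 (by norm_num)).trans e36) ((hreg 33 (by norm_num)).trans h33)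
    ((hreg 34 (by norm_num)).trans h34) g37 (length_header _ _ _ _)
    (y := queryVec hn a M P J D b₁ b₂) (fun u => rfl) (fun u hu => ?_)).mono le_rfl ?_
  · rw [queryVec, abs_sign_mul_le hb.D_ne]
    refine le_trans ?_ hF3
    refine (abs_add_le _ _).trans ?_
    rw [abs_mul, abs_mul]
    have h1 : |b₁| * |(cof (poly M P J) n 0 u).eval (point hn a M P J)| ≤ F * F :=
      mul_le_mul hbF.1 (hcof _ _) (abs_nonneg _) (by omega)
    have h2 : |b₂| * |(cof (poly M P J) n 1 u).eval (point hn a M P J)| ≤ (F * F + 1) * F :=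
      mul_le_mul hbF.2 (hcof _ _) (abs_nonneg _) (by positivity)
    have h3 : F ≤ F * F := by nlinarith
    have h4 : F * F ≤ F ^ 3 := by rw [pow_succ, pow_two]; nlinarith
    have h5 : (F * F + 1) * F = F ^ 3 + F := by ring
    omega
  · rintro σ₃ ⟨hE₃, hreg₃, g22, g38, hmem₃, hval⟩
    refine ⟨hE₃, g22, ?_, ?_, g38, hR₂.congr fun i hi => hmem₃ _ (by omega) (by omega), ?_⟩
    · rw [hreg₃ 35 (by norm_num) (by norm_num), hreg₂ 35 (by norm_num), e35]
    · rw [hreg₃ 37 (by norm_num) (by norm_num), g37]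
    · refine Holds.append (fun i hi => ?_) fun i hi => ?_
      · rw [hmem₃ _ (by omega) (by omega), hH i hi]
      · simp only [List.length_ofFn] at hi
        rw [hval i hi, List.getElem_ofFn]

set_option maxHeartbeats 1000000 in
theorem run_beforeCall {O : List ℤ → ℤ} (h : Budget hn a M P J b m S β x Z B)
    (hM : M.det ≠ 0) (hL : LoopData hn M P J) {D f g b₁ b₂ : ℤ}
    (hb : BezoutData hn a M P J D f g b₁ b₂) (t : Target) :
    Run O B (beforeCall t) (initialState a b M) (400000 * n ^ 4 + 300 * P + 800 * B.size)
      (Ready hn a b M P J m S x Z D b₁ b₂ t) := by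
  obtain ⟨F, hF, hF1, hFB, hF2, hF3, hFb, haB, -⟩ := h.bounds hL
  have hτ : x * |point hn a M P J| ^ (n + 1) ≤ B := by rw [← hF]; exact hFB
  have hcof : ∀ r c, |(cof (poly M P J) n r c).eval (point hn a M P J)| ≤ F := fun r c => by
    rw [hF]; exact h.abs_cof_le hL
  have hgF : |g| ≤ F := by rw [hb.g_eq]; exact hcof _ _
  have hbF := hb.abs_le hF1 (by rw [hb.f_eq]; exact hcof _ _) hgF
  have hnn : (0 : ℤ) ≤ n * n := by positivity
  have hB := h.hB
  have hS := h.toScales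
  have hsize : (B : ℤ) < 2 ^ B.size := by exact_mod_cast Nat.lt_size_self B
  have hP := hL.p_spec.1.1
  have hnat : natMat M (n - 1) 0 = m := by
    rw [← h.m_eq]; exact natMat_apply M (lst hn) (fst hn)
  have hMm : ∀ i < n, ∀ j < n, |natMat M i j| ≤ m := fun i hi j hj => by
    have := h.le_m ⟨i, hi⟩ ⟨j, hj⟩
    rwa [← natMat_apply M ⟨i, hi⟩ ⟨j, hj⟩] at this
  have ha : 0 < a := lt_of_lt_of_le h.b_pos h.b_le
  have hm0 : 0 < m := by have := h.hm; omega
  have hfam := hL.norm1_poly_le h.entry_le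
  have hbase := hL.base_spec.1
  have hpoint := hL.one_le_abs_point (a := a)
  refine Run.mono ?_ (beforeCall_cost_le hn B.size) fun _ h => h
  refine .seq ((run_initProg hS hn (input_initialState a b M) hnat).mono le_rfl ?_)
  rintro σ₁ ⟨hE₁, hmem₁⟩
  have hI₁ : Input a b M σ₁ := by
    obtain ⟨h0, h1, h2, h3⟩ := input_initialState a b M
    exact ⟨by rw [hmem₁, h0], by rw [hmem₁, h1], by rw [hmem₁, h2], fun i hi j hj => by
      rw [hmem₁, h3 i hi j hj]⟩
  refine .seq ((run_packProg hS hI₁ hE₁ hMm).mono le_rfl ?_)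
  rintro σ₂ ⟨hE₂, hR₂⟩
  refine .seq ((run_detPrimeProg hS hE₂ hMm hR₂ hM (by rw [← h.m_eq]; exact hL.p_spec)
    (by have := h.prime_le; omega) h.exp_le).mono le_rfl ?_)
  rintro σ₃ ⟨hE₃, hR₃, h7⟩
  refine .seq ((run_rowsProg hS hE₃ h7 hMm hR₃ fun i hi j hj => ?_).mono le_rfl ?_)
  · have := h.entry_le i hi j hj
    have : (0 : ℤ) ≤ (P : ℤ) ^ (2 * n) := by positivity
    omega
  rintro σ₄ ⟨hE₄, h7, hR₄⟩
  refine .seq ((run_loopProg hS hn hL hE₄ h7 hR₄ h.entry_le).mono le_rfl ?_)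
  rintro σ₅ ⟨hE₅, h7, h60, h16, hR₅⟩
  refine .seq ((run_coprimeProg hB hP (hL.res_lastCof_ne_zero hn) h7 h60 h.prime_le
    (h.res_le.trans_lt hsize)).mono le_rfl ?_)
  rintro σ₆ ⟨hF₆, h20⟩
  have hE₆ := hE₅.frame (by norm_num) hF₆
  have ha' := hS.addr_le
  refine .seq ((run_substProg hB hn ha hE₆ h.m_eq hm0 hbase h20 h.base_le
    (by omega) (N := B.size) ?_).mono le_rfl ?_)
  · refine le_trans ?_ (h.base_le.trans hsize.le)
    exact le_mul_of_one_le_right (by positivity) (by omega)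
  rintro σ₇ ⟨hE₇, -, -, g16, hmem₇, h22⟩
  have hR₇ : Rows n Z (3 + n * n + n) (fun i j => (poly M P J i j).eval x) n σ₇ :=
    hR₅.congr fun i hi => by rw [hmem₇, hF₆.2 _ (by omega)]
  rw [hF₆.1 16 (by norm_num), h16] at g16
  change σ₇.reg 22 = point hn a M P J at h22
  refine .seq ((run_evProg hS (r := n) (c := 0) (er := .reg 0) hE₇ h22 hpoint hτ hfam hR₇ (by norm_num)
    le_rfl (by omega) (by decide) (by decide) hE₇.r0 (by simp)).mono le_rfl ?_)
  rintro σ₈ ⟨i23, hreg₈, hmem₈⟩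
  have hE₈ := hE₇.congr fun r hr => hreg₈ r (by omega) (by omega)
  have hR₈ := hR₇.congr fun i hi => hmem₈ _ (by omega)
  have i22 := (hreg₈ 22 (by norm_num) (by norm_num)).trans h22
  have i16 := (hreg₈ 16 (by norm_num) (by norm_num)).trans g16
  refine .seq ((run_evProg hS (r := 0) (c := n - 1) hE₈ i22 hpoint hτ hfam hR₈ (by norm_num)
    (by omega) (by omega) (by decide) (by decide) rfl (by simp [i16])).mono le_rfl ?_)
  rintro σ₉ ⟨j24, hreg₉, hmem₉⟩
  have hE₉ := hE₈.congr fun r hr => hreg₉ r (by omega) (by omega)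
  have hR₉ := hR₈.congr fun i hi => hmem₉ _ (by omega)
  have j22 := (hreg₉ 22 (by norm_num) (by norm_num)).trans i22
  have j16 := (hreg₉ 16 (by norm_num) (by norm_num)).trans i16
  have j23 := (hreg₉ 23 (by norm_num) (by norm_num)).trans i23
  refine .seq ((run_evProg hS (r := 1) (c := n - 1) hE₉ j22 hpoint hτ hfam hR₉ (by norm_num)
    (by omega) (by omega) (by decide) (by decide) rfl (by simp [j16])).mono le_rfl ?_)
  rintro τ₁ ⟨k25, hreg₁₀, hmem₁₀⟩
  have hE₁₀ := hE₉.congr fun r hr => hreg₁₀ r (by omega) (by omega)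
  have hR₁₀ := hR₉.congr fun i hi => hmem₁₀ _ (by omega)
  have k22 := (hreg₁₀ 22 (by norm_num) (by norm_num)).trans j22
  have k23 := (hreg₁₀ 23 (by norm_num) (by norm_num)).trans j23
  have k24 := (hreg₁₀ 24 (by norm_num) (by norm_num)).trans j24
  rw [← hb.f_eq] at k24
  rw [← hb.g_eq] at k25
  rw [← hb.D_eq] at k23
  refine .seq ((run_bezoutProg hB k24 k25 hb.g_ne hb.bezout hb.lt_b₁ hb.b₁_le
    (hbF.2.trans hF2) (N := B.size) ?_).mono le_rfl ?_)
  · have : |g| * |g| ≤ F * F := mul_le_mul hgF hgF (abs_nonneg _) (by omega)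
    omega
  rintro τ₂ ⟨hF₁₁, l33, l34⟩
  exact run_writeQuery h hL hb t (hE₁₀.frame (by norm_num) hF₁₁)
    ((hF₁₁.1 22 (by norm_num)).trans k22) ((hF₁₁.1 23 (by norm_num)).trans k23) l33 l34
    (hR₁₀.congr fun i hi => hF₁₁.2 _ (by omega))

end

section

variable {n : ℕ} {hn : 2 ≤ n} {a b : ℕ} {M : Matrix (Fin n) (Fin n) ℤ} {P : ℕ} {J : ℕ → ℕ}
  {m S β x Z : ℤ} {B : ℕ}

theorem Budget.bounded_initialState (h : Budget hn a M P J b m S β x Z B)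
    (hL : LoopData hn M P J) : Bounded B (initialState a b M) := by
  obtain ⟨F, -, -, -, -, -, -, haB, -⟩ := h.bounds hL
  have h1 := h.addr_le
  have h2 := h.b_le
  have hnn : (0 : ℤ) ≤ n * n := by positivity
  have h3 : m ≤ B := by
    have := h.hmβ
    have := h.β_lt_x
    have := h.x_lt
    have := h.Z_pow_le (t := 1) (by omega)
    rw [pow_one] at this
    have := h.one_le_x
    omega
  refine ⟨fun r _ => by simp [initialState], fun k => ?_⟩
  simp only [initialState]
  split_ifs
  · rw [Nat.abs_cast]; omega
  · rw [Nat.abs_cast]; omega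
  · rw [Nat.abs_cast]; omega
  · exact (h.le_m _ _).trans h3
  · simp

theorem run_afterCall {O : List ℤ → ℤ} (h : Budget hn a M P J b m S β x Z B)
    (hL : LoopData hn M P J) {D f g b₁ b₂ q : ℤ} (hb : BezoutData hn a M P J D f g b₁ b₂)
    {t : Target} {σ : State} (hσ : Ready hn a b M P J m S x Z D b₁ b₂ t σ) :
    Run O B afterCall (σ.setReg 40 q) (1000 * n ^ 4 + 1000 * n ^ 4) fun σ' => ∀ i : ℕ, i < n →
      σ'.mem i = (∑ j ∈ Finset.range n, (poly M P J i j).eval (point hn a M P J) *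
        balanced |D| (q * queryVec hn a M P J D b₁ b₂ j)) / |D| := by
  obtain ⟨F, hF, hF1, -, -, -, -, -, hFF⟩ := h.bounds hL
  have hd := abs_pos.2 hb.D_ne
  have hDF : |D| ≤ F := by rw [hb.D_eq, hF]; exact h.abs_cof_le hL
  have hnn : (0 : ℤ) ≤ n * n := by positivity
  obtain ⟨hE, h22, h35, h37, h38, hR, hq⟩ := hσ
  set l := (header a b |D| t).length with hl
  refine .seq ((run_residueProg h.toScales (s := 3 + n * n + n + n + l) (d := |D|) (q := q)
    (y := queryVec hn a M P J D b₁ b₂) (hE.set (by omega)) (by simpa using h37)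
    (by simpa using h35) (by simp) hd fun u hu => ?_).mono le_rfl ?_)
  · have h1 := hq (l + u) (by rw [List.length_append, List.length_ofFn]; omega)
    rw [List.getElem_append_right (by omega), List.getElem_ofFn] at h1
    simp only [← hl, Nat.add_sub_cancel_left] at h1
    rw [mem_setReg, ← h1]
    congr 1
    push_cast; ring
  rintro σ₁ ⟨hE₁, hreg, hmem, hval⟩
  refine run_productProg h.toScales (F := F * F) (s := 3 + n * n + n + n + l)
    (τ := point hn a M P J) (M := M) (P := P) (J := J)
    (z := fun j => balanced |D| (q * queryVec hn a M P J D b₁ b₂ j)) hE₁ ?_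
    (hL.norm1_poly_le h.entry_le) (hR.congr fun i hi => by rw [hmem _ (by omega)]; rfl) ?_
    (by omega) ?_ hval (fun u hu v hv => ?_) hFF
  · rw [hreg 22 (by norm_num) (by norm_num)]; simpa using h22
  · rw [hreg 37 (by norm_num) (by norm_num)]; simpa using h37
  · rw [hreg 35 (by norm_num) (by norm_num)]; simpa using h35
  · rw [abs_mul]
    have h1 : |(poly M P J u v).eval (point hn a M P J)| ≤ F := by
      rw [hF]; exact h.abs_entry_le hL hu hv
    have h2 := two_mul_abs_balanced_le hd (q * queryVec hn a M P J D b₁ b₂ v)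
    have h3 := abs_nonneg (balanced |D| (q * queryVec hn a M P J D b₁ b₂ v))
    exact mul_le_mul h1 (by omega) h3 (by omega)

/-- The execution of the whole program. -/
theorem exec_reduction (O : List ℤ → ℤ) (h : Budget hn a M P J b m S β x Z B)
    (hM : M.det ≠ 0) (hL : LoopData hn M P J) {D f g b₁ b₂ : ℤ}
    (hb : BezoutData hn a M P J D f g b₁ b₂) (t : Target) {w : List ℤ}
    (hw : w = header a b |D| t ++ List.ofFn fun u : Fin n => queryVec hn a M P J D b₁ b₂ u) :
    ∃ T ≤ 403000 * n ^ 4 + 300 * P + 800 * B.size, ∃ s,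
      Exec O (B ^ 8).size (reduction t) (initialState a b M) T [w] s ∧
      ∀ i : ℕ, i < n → s.mem i = (∑ j ∈ Finset.range n,
        (poly M P J i j).eval (point hn a M P J) *
          balanced |D| (O w * queryVec hn a M P J D b₁ b₂ j)) / |D| := by
  obtain ⟨F, hF, hF1, hFB, -⟩ := h.bounds hL
  have hd := abs_pos.2 hb.D_ne
  have hDF : |D| ≤ F := by rw [hb.D_eq, hF]; exact h.abs_cof_le hL
  obtain ⟨T₁, hT₁, s₁, σ₁, hx₁, hs₁, hB₁, hR⟩ := run_beforeCall (O := O) h hM hL hb t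
    (h.bounded_initialState hL) (initialState a b M) ⟨rfl, fun _ _ => rfl⟩
  have hblock : s₁.block (s₁.reg 14) (s₁.reg 38) = w := by
    have h1 : s₁.reg 38 = w.length := by
      rw [hs₁.2 38 (by norm_num), hR.r38, hw, List.length_append, List.length_ofFn]
    rw [h1, hs₁.2 14 (by norm_num), hR.env.r14]
    refine Holds.block_eq hs₁.1 ?_
    rw [hw]; exact hR.query
  set q := O w % |D| with hq
  have hq0 : 0 ≤ q := Int.emod_nonneg _ hd.ne'
  have hq1 : q < |D| := Int.emod_lt_of_pos _ hd
  have hqB : |q| ≤ B := by rw [abs_of_nonneg hq0]; omega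
  have hval : ArithOp.mod.eval ((s₁.setReg 100 (O w)).reg 100) ((s₁.setReg 100 (O w)).reg 35) = q := by
    rw [reg_setReg, reg_setReg, if_pos rfl, if_neg (by norm_num), hs₁.2 35 (by norm_num), hR.r35]
    rfl
  have hagree : Agree ((s₁.setReg 100 (O w)).setReg 40 q) (σ₁.setReg 40 q) := by
    refine ⟨by simpa using hs₁.1, fun r hr => ?_⟩
    simp only [reg_setReg]
    by_cases h40 : r = 40
    · simp [h40]
    · rw [if_neg h40, if_neg h40, if_neg (by omega), hs₁.2 r hr]
  have hbd : Bounded B (σ₁.setReg 40 q) := by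
    refine ⟨fun r hr => ?_, hB₁.2⟩
    rw [reg_setReg]
    split_ifs
    · exact hqB
    · exact hB₁.1 r hr
  obtain ⟨T₂, hT₂, s₂, σ₂, hx₂, hs₂, -, hout⟩ := run_afterCall (O := O) (q := q) h hL hb hR hbd _ hagree
  have hcall := Exec.call (O := O) (L := (B ^ 8).size) 100 14 38 s₁
  rw [hblock] at hcall
  have hmod := Exec.arith (O := O) (L := (B ^ 8).size) .mod 40 100 35 (s₁.setReg 100 (O w)) (by
    rw [hval]
    refine bitLength_le_of_abs_le (hqB.trans ?_)
    have hB1 : 1 ≤ B := le_trans (by norm_num) h.hB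
    exact_mod_cast Nat.le_self_pow (by norm_num) B)
  rw [hval] at hmod
  have h1 : 1 ≤ n ^ 4 := Nat.one_le_pow _ _ (by omega)
  refine ⟨T₁ + (1 + (1 + T₂)), by omega, s₂, by simpa [reduction] using hx₁.seq (hcall.seq (hmod.seq hx₂)), ?_⟩
  intro i hi
  rw [hs₂.1, hout i hi]
  simp only [hq, balanced_emod_mul]

end

/-! ### Sizes -/

section

variable {n : ℕ} {S : ℤ}

/-- The scales `β = S ^ (4 n + 1)`, `x = S ^ (6 n²)` and `Z = x ^ (2 n)` leave enough room between
the digits. -/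
theorem sizes_of_pow (hn : 2 ≤ n) (hS : 20000 ≤ S) (hSn : 10000 * n ≤ S) {β x Z : ℤ} {B : ℕ}
    (hβ : β = S ^ (4 * n + 1)) (hx : x = S ^ (6 * n * n)) (hZ : Z = x ^ (2 * n))
    (hB : Z ^ (2 * n) ≤ B) : Sizes n β x Z B := by
  have hS1 : 1 < S := by omega
  have hn1 : (2 : ℤ) ≤ n := by exact_mod_cast hn
  have hβ0 : 1 ≤ β := by rw [hβ]; exact one_le_pow₀ hS1.le
  have hx0 : 1 ≤ x := by rw [hx]; exact one_le_pow₀ hS1.le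
  have hZ' : Z = S ^ (12 * n ^ 3) := by rw [hZ, hx, ← pow_mul]; congr 1; ring
  have two_mul_pow_le : ∀ (k : ℕ) (y : ℤ), 1 ≤ k → 0 ≤ y → 2 * y ^ k ≤ (2 * y) ^ k := by
    intro k y hk hy
    rw [mul_pow]
    have : (2 : ℤ) ^ 1 ≤ 2 ^ k := pow_le_pow_right₀ (by norm_num) hk
    rw [pow_one] at this
    exact mul_le_mul_of_nonneg_right this (by positivity)
  have h3 : 4 * n ≤ n * n * n := by nlinarith
  have hnβ : 2 * (n * β) ≤ S ^ (4 * n + 2) := by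
    rw [pow_succ S (4 * n + 1), ← hβ, mul_comm (β : ℤ)]
    nlinarith
  have hnβn : 2 * (n * β) ^ n ≤ S ^ (4 * n ^ 2 + 2 * n) := by
    refine (two_mul_pow_le n _ (by omega) (by positivity)).trans ?_
    rw [show 4 * n ^ 2 + 2 * n = (4 * n + 2) * n by ring, pow_mul]
    exact pow_le_pow_left₀ (by positivity) hnβ n
  refine ⟨?_, hn, hβ0, ?_, ?_, ?_, hB⟩
  · have h1 : S ^ 2 ≤ Z ^ (2 * n) := by
      rw [hZ', ← pow_mul]
      refine pow_le_pow_right₀ hS1.le ?_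
      have : 1 ≤ n ^ 3 * n := Nat.mul_pos (by positivity) (by omega)
      have e : 12 * n ^ 3 * (2 * n) = 24 * (n ^ 3 * n) := by ring
      omega
    have h2 : (10 : ℤ) ^ 6 ≤ B := by nlinarith
    exact_mod_cast h2
  · refine hnβn.trans_lt ?_
    rw [hx]
    refine pow_lt_pow_right₀ hS1 ?_
    nlinarith
  · refine (two_mul_pow_le n _ (by omega) (by positivity)).trans_lt ?_
    have h1 : (2 * (n * (β * x))) ^ n ≤ (S ^ (4 * n + 2 + 6 * n * n)) ^ n := by
      refine pow_le_pow_left₀ (by positivity) ?_ n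
      rw [pow_add, ← hx]
      calc 2 * (n * (β * x)) = 2 * (n * β) * x := by ring
        _ ≤ S ^ (4 * n + 2) * x := by gcongr
    refine h1.trans_lt ?_
    rw [← pow_mul, hZ']
    refine pow_lt_pow_right₀ hS1 ?_
    nlinarith
  · refine (two_mul_pow_le (2 * n) _ (by omega) (by positivity)).trans_lt ?_
    have h1 : (2 * ((2 * n : ℕ) * (n * β) ^ n)) ^ (2 * n) ≤
        (S * S ^ (4 * n ^ 2 + 2 * n)) ^ (2 * n) := by
      refine pow_le_pow_left₀ (by positivity) ?_ _
      push_cast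
      calc 2 * (2 * (n : ℤ) * (n * β) ^ n) = (2 * n) * (2 * (n * β) ^ n) := by ring
        _ ≤ S * S ^ (4 * n ^ 2 + 2 * n) := by
          refine mul_le_mul (by omega) hnβn (by positivity) (by omega)
    refine h1.trans_lt ?_
    rw [← pow_succ', ← pow_mul, hZ']
    refine pow_lt_pow_right₀ hS1 ?_
    nlinarith

end

section

variable {n : ℕ} {hn : 2 ≤ n} {a b : ℕ} {M : Matrix (Fin n) (Fin n) ℤ} {P : ℕ} {J : ℕ → ℕ}
  {m S β x Z : ℤ} {B : ℕ}

theorem abs_natMat_le (hm : 1 ≤ m) (hM : ∀ i j, |M i j| ≤ m) (i j : ℕ) : |natMat M i j| ≤ m := by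
  unfold natMat
  split_ifs
  · exact hM _ _
  · simp; omega

theorem abs_natMat_adjugate_le (hm : 1 ≤ m) (hM : ∀ i j, |M i j| ≤ m) {i j : ℕ} (hi : i < n)
    (hj : j < n) : |natMat M.adjugate i j| ≤ (n * m) ^ n := by
  rw [natMat_adjugate M hi hj]
  refine abs_det_le le_rfl hm _ fun u v => ?_
  rw [Matrix.of_apply]
  split_ifs
  · simpa using hm
  · simp; omega
  · exact abs_natMat_le hm hM _ _

theorem LoopData.prime_le_log (hL : LoopData hn M P J) (hM : M.det ≠ 0)
    (hm : M (lst hn) (fst hn) = m) (hm1 : 1 ≤ m) :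
    (P : ℝ) ≤ 2 ^ 18 + 1 + 10 * Real.log |((m * M.det : ℤ) : ℝ)| := by
  refine prime_le_of_dvd (mul_ne_zero (by omega) hM) fun r hr hrP => ?_
  by_contra h
  have := hL.p_spec.2 ⟨hr, by rwa [hm]⟩
  omega

/-- The number whose least prime nondivisor is sought. -/
theorem abs_mul_det_le (hn : 2 ≤ n) (hm : 1 ≤ m) (hM : ∀ i j, |M i j| ≤ m) :
    |m * M.det| ≤ (n * m) ^ (n + 1) := by
  have h1 := abs_det_le le_rfl hm M hM
  have hn1 : (1 : ℤ) ≤ n := by omega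
  rw [abs_mul, abs_of_nonneg (by omega : 0 ≤ m), pow_succ']
  exact mul_le_mul (by nlinarith) h1 (abs_nonneg _) (by positivity)

/-- The number `S` is chosen so large that this holds although the bound for the prime has a large
additive constant. -/
theorem LoopData.prime_lt_sq (hL : LoopData hn M P J) (hM : M.det ≠ 0)
    (hm : M (lst hn) (fst hn) = m) (hm1 : 1 ≤ m) (hle : ∀ i j, |M i j| ≤ m)
    (hS : S = 10000 * m * n) : (P : ℤ) + 1 ≤ S ^ 2 := by
  have h1 := hL.prime_le_log hM hm hm1
  have h2 := abs_mul_det_le hn hm1 hle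
  have hn1 : (2 : ℝ) ≤ n := by exact_mod_cast hn
  have hm1' : (1 : ℝ) ≤ m := by exact_mod_cast hm1
  have h3 : |((m * M.det : ℤ) : ℝ)| ≤ ((n : ℝ) * m) ^ (n + 1) := by
    rw [← Int.cast_abs]; exact_mod_cast h2
  have h0 : 0 < |((m * M.det : ℤ) : ℝ)| :=
    abs_pos.2 (by exact_mod_cast mul_ne_zero (by omega : m ≠ 0) hM)
  have h4 := Real.log_le_log h0 h3
  rw [Real.log_pow] at h4
  have hnm : 0 < (n : ℝ) * m := by positivity
  have h5 := Real.log_le_sub_one_of_pos hnm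
  have h6 : ((n + 1 : ℕ) : ℝ) * Real.log (n * m) ≤ ((n + 1 : ℕ) : ℝ) * (n * m) := by
    gcongr; linarith
  have h7 : (P : ℝ) + 1 ≤ ((10000 * m * n : ℤ) : ℝ) ^ 2 := by
    generalize Real.log |((m * M.det : ℤ) : ℝ)| = l at h1 h4
    push_cast at h4 h6 ⊢
    have h8 : (n + 1 : ℝ) * (n * m) ≤ (2 * n) * (n * m) := by gcongr; linarith
    have h9 : (n : ℝ) * n * m * 1 ≤ n * n * m * m := by gcongr
    have h10 : (2 : ℝ) * 2 * 1 * 1 ≤ n * n * m * m := by gcongr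
    have e : (10000 * (m : ℝ) * n) ^ 2 = 100000000 * (n * n * m * m) := by ring
    have e2 : (2 * n : ℝ) * (n * m) = 2 * (n * n * m * 1) := by ring
    rw [e]
    linarith
  rw [hS]
  exact_mod_cast h7

theorem LoopData.entry_le (hL : LoopData hn M P J) (hM : M.det ≠ 0)
    (hm : M (lst hn) (fst hn) = m) (hm1 : 1 ≤ m) (hle : ∀ i j, |M i j| ≤ m)
    (hS : S = 10000 * m * n) {i j : ℕ} (hi : i < n) (hj : j < n) :
    |natMat M.adjugate i j| + (2 * P + P ^ (2 * n)) ≤ S ^ (4 * n + 1) := by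
  have hn1 : (2 : ℤ) ≤ n := by exact_mod_cast hn
  have h1 := abs_natMat_adjugate_le hm1 hle hi hj
  have h2 := hL.prime_lt_sq hM hm hm1 hle hS
  have hnm : n * m ≤ S := by rw [hS]; nlinarith
  have hS4 : 4 ≤ S := by rw [hS]; nlinarith
  have h3' : ((n : ℤ) * m) ^ n ≤ S ^ n := pow_le_pow_left₀ (by positivity) hnm n
  have h3 : ((n : ℤ) * m) ^ n ≤ S ^ (4 * n) :=
    h3'.trans (pow_le_pow_right₀ (by omega) (by omega))
  have h4 : S ^ 2 ≤ S ^ (4 * n) := pow_le_pow_right₀ (by omega) (by omega)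
  have h5 : (P : ℤ) ^ (2 * n) ≤ S ^ (4 * n) := by
    have hPS : (P : ℤ) ≤ S ^ 2 := by omega
    calc (P : ℤ) ^ (2 * n) ≤ (S ^ 2) ^ (2 * n) := pow_le_pow_left₀ (by positivity) hPS _
      _ = S ^ (4 * n) := by rw [← pow_mul]; congr 1; ring
  have h6 : 4 * S ^ (4 * n) ≤ S ^ (4 * n + 1) := by
    rw [pow_succ, mul_comm]; gcongr
  omega

theorem Scales.abs_res_lt (hS : Scales n m S β x Z B) (hn : 2 ≤ n)
    (hfam : ∀ u < n, ∀ v < n, norm1 (poly M P J u v) ≤ β) :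
    2 * |res (lastCof M P J 0) (lastCof M P J 1)| < Z := by
  have h1 : ∀ r, norm1 (lastCof M P J r) ≤ (n * β) ^ n := fun r =>
    hS.norm1_cof_lt (by omega) (fun i hi j hj => hfam i (by omega) j hj) r (n - 1)
  have h2 : ∀ r ≤ n - 1, 2 * (lastCof M P J r).natDegree ≤ 2 * n := fun r hr => by
    have := natDegree_fcof_le (natMat M.adjugate) P (powers P J) hr
    rw [lastCof]; omega
  have h3 : (1 : ℤ) ≤ (n * β) ^ n := by
    have := hS.hβ
    have : (1 : ℤ) ≤ n := by omega
    exact one_le_pow₀ (by nlinarith)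
  have h4 := abs_res_le h3 (h1 0) (h1 1) (h2 0 (by omega)) (h2 1 (by omega))
  have h5 := hS.hR
  omega

theorem abs_point_le (hn : 2 ≤ n) (ha : 0 < a) (hL : LoopData hn M P J)
    (hm : M (lst hn) (fst hn) = m) (hm1 : 1 ≤ m) :
    |point hn a M P J| ≤ (a : ℤ) ^ 2 * (2 * m * n) ^ (3 * n) * |base M P J| := by
  have hb := hL.base_spec.1
  have h1 : 1 ≤ (a : ℤ) ^ 2 * (2 * m * n) ^ (3 * n) := by
    have h2 : 1 ≤ (a : ℤ) ^ 2 := one_le_pow₀ (by omega)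
    have h3 : 1 ≤ (2 * m * n) ^ (3 * n) := one_le_pow₀ (by
      have : (1 : ℤ) ≤ n := by omega
      nlinarith)
    nlinarith
  rw [point, abs_pow]
  rcases Nat.eq_zero_or_pos (substExponent hn a M (base M P J)) with h | h
  · rw [h, pow_zero]; nlinarith
  · have h2 := (lt_substExponent_iff (M := M) hn ha (by omega) hb
      (substExponent hn a M (base M P J) - 1)).1 (by omega)
    rw [hm] at h2
    rw [← Nat.sub_add_cancel h, pow_succ]
    exact mul_le_mul_of_nonneg_right h2.le (by omega)

end

section

variable {n : ℕ} {hn : 2 ≤ n} {a b : ℕ} {M : Matrix (Fin n) (Fin n) ℤ} {P : ℕ} {J : ℕ → ℕ}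
  {m S β x Z : ℤ} {B : ℕ}

/-- The product of `D` and the proper prime powers below `p` is bounded by a fixed power of `G`. -/
theorem mul_exp_le {D G p : ℝ} {C : ℕ} (hD : 1 ≤ D) (hDG : D ≤ G) (hG : 3 ≤ G)
    (hp : p ≤ C + 10 * Real.log D) : D * Real.exp (47 * p) ≤ G ^ (47 * C + 471) := by
  have h1 : Real.exp (47 * p) ≤ Real.exp 1 ^ (47 * C) * D ^ 470 := by
    have h2 : Real.exp 1 ^ (47 * C) = Real.exp (47 * C) := by
      rw [← Real.exp_nat_mul]; push_cast; rw [mul_one]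
    have h3 : D ^ 470 = Real.exp (470 * Real.log D) := by
      conv_lhs => rw [← Real.exp_log (by linarith : 0 < D)]
      rw [← Real.exp_nat_mul]; norm_num
    rw [h2, h3, ← Real.exp_add]
    exact Real.exp_le_exp.2 (by linarith)
  have h4 : Real.exp 1 ^ (47 * C) ≤ G ^ (47 * C) :=
    pow_le_pow_left₀ (Real.exp_pos 1).le (by linarith [Real.exp_one_lt_d9]) _
  have h5 : D ^ 470 ≤ G ^ 470 := pow_le_pow_left₀ (by linarith) hDG _
  have h6 : (0 : ℝ) < G := by linarith
  calc D * Real.exp (47 * p) ≤ G * (G ^ (47 * C) * G ^ 470) := by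
        refine mul_le_mul hDG (h1.trans ?_) (Real.exp_pos _).le h6.le
        exact mul_le_mul h4 h5 (by positivity) (by positivity)
    _ = G ^ (47 * C + 471) := by rw [← pow_add, ← pow_succ']

theorem mul_pow_cube_le {G x p c : ℤ} (hnG : 4 * n ≤ G) (hx : 0 ≤ x)
    (hxG : x ≤ G) (hp : 0 ≤ p) (hpG : p ≤ G ^ 3) (hcG : c ≤ G) :
    4 * n * (x * p ^ (n + 1)) ^ 3 * c ≤ G ^ (9 * n + 14) := by
  have hG : 0 ≤ G := hx.trans hxG
  have h1 : x * p ^ (n + 1) ≤ G ^ (3 * n + 4) := by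
    calc x * p ^ (n + 1) ≤ G * (G ^ 3) ^ (n + 1) :=
          mul_le_mul hxG (pow_le_pow_left₀ hp hpG _) (by positivity) hG
      _ = G ^ (3 * n + 4) := by rw [← pow_mul, ← pow_succ']; rfl
  calc 4 * n * (x * p ^ (n + 1)) ^ 3 * c ≤ 4 * n * (x * p ^ (n + 1)) ^ 3 * G := by gcongr
    _ ≤ G * (G ^ (3 * n + 4)) ^ 3 * G := by gcongr
    _ = G ^ (9 * n + 14) := by rw [← pow_mul, ← pow_succ', ← pow_succ]; congr 1; ring

set_option maxHeartbeats 1000000 in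
/-- A bound `B` of length `O(n⁴ log (mn))` for the numbers of the computation. The factor `κ` of the
exponent has to absorb the constants in `mul_exp_le`; it is a variable to keep it from being
unfolded. -/
theorem exists_budget (hL : LoopData hn M P J) (hM : M.det ≠ 0) (hm : M (lst hn) (fst hn) = m)
    (hm1 : 1 ≤ m) (hle : ∀ i j, |M i j| ≤ m) (hb : 0 < b) (hba : b ≤ a) {κ : ℕ} (hκ : κ = 10 ^ 7) :
    ∃ (S β x Z : ℤ) (B : ℕ), Budget hn a M P J b m S β x Z B ∧
      (B : ℤ) = ((10000 * m * n) ^ (12 * n ^ 3) * a) ^ (κ * n) := by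
  have hn1 : (2 : ℤ) ≤ n := by exact_mod_cast hn
  obtain ⟨S, hS⟩ : ∃ S : ℤ, S = 10000 * m * n := ⟨_, rfl⟩
  obtain ⟨β, hβ⟩ : ∃ β : ℤ, β = S ^ (4 * n + 1) := ⟨_, rfl⟩
  obtain ⟨x, hx⟩ : ∃ x : ℤ, x = S ^ (6 * n * n) := ⟨_, rfl⟩
  obtain ⟨Z, hZ⟩ : ∃ Z : ℤ, Z = x ^ (2 * n) := ⟨_, rfl⟩
  have hZ' : Z = S ^ (12 * n ^ 3) := by rw [hZ, hx, ← pow_mul]; congr 1; ring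
  obtain ⟨G, hG⟩ : ∃ G : ℤ, G = Z * a := ⟨_, rfl⟩
  have ha1 : (1 : ℤ) ≤ a := by omega
  have hm0 : 0 ≤ m := by omega
  have hS0 : 20000 ≤ S := by rw [hS]; nlinarith
  have hSn : 10000 * n ≤ S := by rw [hS]; nlinarith
  have hSm : 20000 * m ≤ S := by rw [hS]; nlinarith
  have hS1 : 1 ≤ S := by omega
  have hSZ : ∀ t ≤ 12 * n ^ 3, S ^ t ≤ Z := fun t ht => by
    rw [hZ']; exact pow_le_pow_right₀ hS1 ht
  have h8 : 8 ≤ n ^ 3 := Nat.pow_le_pow_left hn 3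
  have hn2 : n ≤ n ^ 3 := Nat.le_self_pow (by norm_num) n
  have hn3 : 3 * n ≤ 12 * n ^ 3 := by omega
  have hSZ1 : S ≤ Z := by simpa using hSZ 1 (by omega)
  have hZ1 : 1 ≤ Z := by omega
  have hZG : Z ≤ G := by rw [hG]; exact le_mul_of_one_le_right (by omega) ha1
  have haG : (a : ℤ) ≤ G := by rw [hG]; exact le_mul_of_one_le_left (by omega) hZ1
  have hG1 : 1 ≤ G := by omega
  obtain ⟨B, hB⟩ : ∃ B : ℕ, (B : ℤ) = G ^ (κ * n) :=
    ⟨(G ^ (κ * n)).toNat, Int.toNat_of_nonneg (by positivity)⟩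
  have hκn : 20000000 ≤ κ * n := by rw [hκ]; omega
  have hGB : ∀ t ≤ κ * n, G ^ t ≤ B := fun t ht => by rw [hB]; exact pow_le_pow_right₀ hG1 ht
  have ha2 : (0 : ℤ) ≤ (a : ℤ) ^ 2 := by positivity
  have hκ2 : 16 * n ≤ κ * n := Nat.mul_le_mul (by rw [hκ]; norm_num) le_rfl
  have hSizes : Sizes n β x Z B := by
    refine sizes_of_pow hn hS0 hSn hβ hx hZ ?_
    exact (pow_le_pow_left₀ (by omega) hZG _).trans (hGB _ (by omega))
  have hmβ : m ≤ β := by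
    have : S ^ 1 ≤ β := by rw [hβ]; exact pow_le_pow_right₀ hS1 (by omega)
    rw [pow_one] at this
    omega
  have hScales : Scales n m S β x Z B := ⟨hSizes, hm1, hmβ, hS, hx, hZ⟩
  have hentry : ∀ i < n, ∀ j < n, |natMat M.adjugate i j| + (2 * P + P ^ (2 * n)) ≤ β :=
    fun i hi j hj => by rw [hβ]; exact hL.entry_le hM hm hm1 hle hS hi hj
  have hP := hL.prime_lt_sq hM hm hm1 hle hS
  have hres := hScales.abs_res_lt hn (hL.norm1_poly_le hentry)
  have hS3 : 2 * S ^ 2 ≤ Z := by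
    have := hSZ 3 (by omega)
    nlinarith
  have hbase : |base M P J| ≤ G := by
    have := abs_coprimePart_le P (res (lastCof M P J 0) (lastCof M P J 1))
    rw [base]; omega
  have hE : (a : ℤ) ^ 2 * (2 * m * n) ^ (3 * n) ≤ G ^ 2 := by
    have h1 : (2 * m * n) ^ (3 * n) ≤ Z := by
      refine le_trans (pow_le_pow_left₀ (mul_nonneg (by omega) (by omega)) ?_ _) (hSZ (3 * n) hn3)
      rw [hS]; nlinarith
    have h2 : Z ≤ Z ^ 2 := by nlinarith
    rw [hG, mul_pow Z, mul_comm]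
    exact mul_le_mul_of_nonneg_right (h1.trans h2) ha2
  have hbaseE : (a : ℤ) ^ 2 * (2 * m * n) ^ (3 * n) * |base M P J| ≤ G ^ 3 := by
    rw [pow_succ G 2]
    exact mul_le_mul hE hbase (abs_nonneg _) (pow_nonneg (by omega) _)
  have hpoint := (abs_point_le hn (by omega) hL hm hm1).trans hbaseE
  have hxG : x ≤ G := by have := hSizes.x_lt; have := hSizes.one_le_x; omega
  have hx1 := hSizes.one_le_x
  refine ⟨S, β, x, Z, B, ⟨hScales, ?_, ?_, hentry, ?_, hbaseE.trans (hGB _ (by omega)), ?_, hba, hb,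
    hm, hle⟩, ?_⟩
  · have h1 := hGB 1 (by omega)
    rw [pow_one] at h1
    omega
  · have h1 : |m * M.det| ≤ G := by
      refine (abs_mul_det_le hn hm1 hle).trans (le_trans ?_ ((hSZ (n + 1) (by omega)).trans hZG))
      refine pow_le_pow_left₀ (by positivity) ?_ _
      rw [hS]; nlinarith
    obtain ⟨C, hC⟩ : ∃ C : ℕ, C = 2 ^ 18 + 1 := ⟨_, rfl⟩
    have h2 := hL.prime_le_log hM hm hm1
    have h3 : |((m * M.det : ℤ) : ℝ)| ≤ (G : ℝ) := by rw [← Int.cast_abs]; exact_mod_cast h1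
    have h4 : (1 : ℝ) ≤ |((m * M.det : ℤ) : ℝ)| := by
      rw [← Int.cast_abs]
      exact_mod_cast Int.one_le_abs (mul_ne_zero (by omega : m ≠ 0) hM)
    have h5 : (3 : ℝ) ≤ G := by exact_mod_cast (by omega : (3 : ℤ) ≤ G)
    have h6 : (P : ℝ) ≤ C + 10 * Real.log |((m * M.det : ℤ) : ℝ)| := by
      have hC' : (C : ℝ) = 2 ^ 18 + 1 := by rw [hC]; norm_num
      rw [hC']; exact h2
    refine (mul_exp_le h4 h3 h5 h6).trans ?_
    -- `47 (2 ^ 18 + 1) + 471` is below `20000000`, which is at most `κ n`.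
    have h7 := hGB (47 * C + 471) (by rw [hC]; omega)
    exact_mod_cast h7
  · have h1 := hGB 1 (by omega)
    rw [pow_one] at h1
    have := abs_nonneg (res (lastCof M P J 0) (lastCof M P J 1))
    omega
  · exact (mul_pow_cube_le (by omega) (by omega) hxG (abs_nonneg _) hpoint haG).trans
      (hGB _ (by omega))
  · rw [hB, hG, hZ', hS]

end

/-! ### Lengths -/

theorem size_le_log {B : ℕ} (hB : 1 ≤ B) : (B.size : ℝ) ≤ 2 * Real.log B + 1 := by
  have hpos : 0 < B.size := Nat.size_pos.2 hB
  have h1 : 2 ^ (B.size - 1) ≤ B := Nat.lt_size.1 (by omega)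
  have h2 : ((2 : ℝ) ^ (B.size - 1)) ≤ B := by exact_mod_cast h1
  have h3 := Real.log_le_log (by positivity) h2
  rw [Real.log_pow] at h3
  have h4 := Real.log_two_gt_d9
  have h5 : ((B.size - 1 : ℕ) : ℝ) = B.size - 1 := by
    rw [Nat.cast_sub hpos]; simp
  rw [h5] at h3
  have h6 : (0 : ℝ) ≤ B.size - 1 := by rw [← h5]; positivity
  nlinarith

/-- The logarithm of the base of the encodings, in terms of the measure `m` of the input. -/
theorem log_scale_le {n a : ℕ} (hn : 2 ≤ n) (ha : 0 < a) {m : ℤ} (hm : 1 ≤ m) {μ : ℝ}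
    (hmμ : (m : ℝ) ≤ μ) (haμ : (a : ℝ) ^ (1 / (n : ℝ) ^ 3) ≤ μ) :
    1 / 2 ≤ Real.log (μ * n) ∧ Real.log a ≤ (n : ℝ) ^ 3 * Real.log (μ * n) ∧
      Real.log (10000 * m * n) ≤ 15 * Real.log (μ * n) := by
  have hn1 : (2 : ℝ) ≤ n := by exact_mod_cast hn
  have hm1 : (1 : ℝ) ≤ m := by exact_mod_cast hm
  have ha1 : (1 : ℝ) ≤ a := by exact_mod_cast ha
  have hμ1 : 1 ≤ μ := hm1.trans hmμ
  have h2 : (2 : ℝ) ≤ μ * n := by nlinarith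
  have h3 := Real.log_le_log (by norm_num) h2
  have h4 := Real.log_two_gt_d9
  refine ⟨by linarith, ?_, ?_⟩
  · have h5 : Real.log ((a : ℝ) ^ (1 / (n : ℝ) ^ 3)) ≤ Real.log (μ * n) := by
      refine Real.log_le_log (Real.rpow_pos_of_pos (by linarith) _) (haμ.trans ?_)
      nlinarith
    rw [Real.log_rpow (by linarith)] at h5
    have h6 : (0 : ℝ) < (n : ℝ) ^ 3 := by positivity
    calc Real.log a = (n : ℝ) ^ 3 * (1 / (n : ℝ) ^ 3 * Real.log a) := by field_simp
      _ ≤ (n : ℝ) ^ 3 * Real.log (μ * n) := by gcongr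
  · have h7 : Real.log 10000 ≤ 14 * Real.log 2 := by
      have : (10000 : ℝ) ≤ 2 ^ 14 := by norm_num
      have h8 := Real.log_le_log (by norm_num) this
      rw [Real.log_pow] at h8
      exact_mod_cast h8
    have h9 : Real.log (m * n) ≤ Real.log (μ * n) :=
      Real.log_le_log (by positivity) (by gcongr)
    have h10 : Real.log (10000 * m * n) = Real.log 10000 + Real.log (m * n) := by
      rw [← Real.log_mul (by norm_num) (by positivity), mul_assoc]
    rw [h10]; linarith

/-- The bounds for the time and the length, in terms of the measure `μ` of the input. The integers
that are computed have absolute value at most `B ^ 8`, as `B` bounds the variables, and expressions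
have degree at most `8` in them. -/
theorem cost_bounds {n a : ℕ} (hn : 2 ≤ n) (ha : 0 < a) {m : ℤ} (hm : 1 ≤ m) {μ : ℝ}
    (hmμ : (m : ℝ) ≤ μ) (haμ : (a : ℝ) ^ (1 / (n : ℝ) ^ 3) ≤ μ) {κ B : ℕ} (hκ : κ = 10 ^ 7)
    (hB1 : 1 ≤ B)
    (hB : (B : ℤ) = ((10000 * m * n) ^ (12 * n ^ 3) * a) ^ (κ * n)) {P : ℕ} {D : ℝ} (hD : 0 < D)
    (hP : (P : ℝ) ≤ 2 ^ 18 + 1 + 10 * Real.log D) (hD' : D ≤ ((n : ℝ) * m) ^ (n + 1)) {T : ℕ}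
    (hT : T ≤ 403000 * n ^ 4 + 300 * P + 800 * B.size) :
    (T : ℝ) ≤ 10 ^ 13 * ((n : ℝ) ^ 4 * Real.log (μ * n)) ∧
      (((B ^ 8).size : ℕ) : ℝ) ≤ 10 ^ 13 * ((n : ℝ) ^ 4 * Real.log (μ * n)) := by
  obtain ⟨h1, h2, h3⟩ := log_scale_le hn ha hm hmμ haμ
  have hn1 : (2 : ℝ) ≤ n := by exact_mod_cast hn
  have hm1 : (1 : ℝ) ≤ m := by exact_mod_cast hm
  have ha1 : (1 : ℝ) ≤ a := by exact_mod_cast ha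
  have hB' : (B : ℝ) = ((10000 * m * n) ^ (12 * n ^ 3) * a) ^ (κ * n) := by exact_mod_cast hB
  have hκ' : (κ : ℝ) = 10 ^ 7 := by rw [hκ]; norm_num
  have h4 : Real.log B = 10 ^ 7 * n * (12 * (n : ℝ) ^ 3 * Real.log (10000 * m * n) + Real.log a) := by
    rw [hB', Real.log_pow, Real.log_mul (by positivity) (by positivity), Real.log_pow]
    push_cast
    rw [hκ']
  have hlogD : Real.log D ≤ (n : ℝ) ^ 4 * (15 * Real.log (μ * n)) := by
    refine (Real.log_le_log hD hD').trans ?_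
    rw [Real.log_pow]
    have hnm : 0 < (n : ℝ) * m := by positivity
    have h5 : Real.log (n * m) ≤ 15 * Real.log (μ * n) :=
      (Real.log_le_log hnm (by linarith)).trans h3
    have h6 : ((n + 1 : ℕ) : ℝ) ≤ (n : ℝ) ^ 4 := by
      have : n + 1 ≤ n ^ 4 := by
        have : 2 ^ 3 ≤ n ^ 3 := Nat.pow_le_pow_left hn 3
        calc n + 1 ≤ 2 ^ 3 * n := by omega
          _ ≤ n ^ 3 * n := Nat.mul_le_mul_right _ this
          _ = n ^ 4 := by ring
      exact_mod_cast this
    exact mul_le_mul h6 h5 (Real.log_nonneg (by nlinarith)) (by positivity)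
  have h16 : (16 : ℝ) ≤ (n : ℝ) ^ 4 := by
    have : 2 ^ 4 ≤ n ^ 4 := Nat.pow_le_pow_left hn 4
    exact_mod_cast this
  have hlogB : Real.log B ≤ 10 ^ 7 * (181 * ((n : ℝ) ^ 4 * Real.log (μ * n))) := by
    rw [h4]
    have h5 : 12 * (n : ℝ) ^ 3 * Real.log (10000 * m * n) + Real.log a ≤
        181 * ((n : ℝ) ^ 3 * Real.log (μ * n)) := by
      have : 12 * (n : ℝ) ^ 3 * Real.log (10000 * m * n) ≤
        12 * (n : ℝ) ^ 3 * (15 * Real.log (μ * n)) := by gcongr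
      linarith
    calc 10 ^ 7 * (n : ℝ) * (12 * (n : ℝ) ^ 3 * Real.log (10000 * m * n) + Real.log a)
        ≤ 10 ^ 7 * (n : ℝ) * (181 * ((n : ℝ) ^ 3 * Real.log (μ * n))) := by gcongr
      _ = 10 ^ 7 * (181 * ((n : ℝ) ^ 4 * Real.log (μ * n))) := by ring
  have hs := size_le_log hB1
  have hs8 := size_le_log (Nat.one_le_pow 8 B hB1)
  rw [Nat.cast_pow, Real.log_pow] at hs8
  have hT' : (T : ℝ) ≤ 403000 * (n : ℝ) ^ 4 + 300 * P + 800 * B.size := by exact_mod_cast hT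
  have h7 : (n : ℝ) ^ 4 * (1 / 2) ≤ (n : ℝ) ^ 4 * Real.log (μ * n) := by gcongr
  rw [mul_left_comm] at hlogD
  generalize (n : ℝ) ^ 4 * Real.log (μ * n) = l at *
  push_cast at hs8
  constructor <;> linarith

/-! ### The execution of the reduction -/

section

variable {n : ℕ} {hn : 2 ≤ n} {a b : ℕ} {M : Matrix (Fin n) (Fin n) ℤ} {P : ℕ} {J : ℕ → ℕ}
  {m S β x Z : ℤ} {B : ℕ}

theorem exists_execution (b : ℕ) (hL : LoopData hn M P J) (hM : M.det ≠ 0) (ha : 0 < a)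
    (h0 : 0 < M (lst hn) (fst hn)) : ∃ E : Execution hn a b M, E.p = P ∧
      (∀ u v : Fin n, E.W u v = poly M P J u v) ∧ cValue hn E.p E.W = base M P J ∧
      E.M' = E.W.map (eval (point hn a M P J)) ∧
      BezoutData hn a M P J E.M'.det (E.M'.adjugate (lst hn) (fst hn))
        (E.M'.adjugate (lst hn) (snd hn)) E.b₁ E.b₂ := by
  have hW : ∀ u v : Fin n, loopMatrix hn M P J (n - 1) u v = poly M P J u v := fun u v =>
    loopMatrix_eq_poly hn M P J (by omega) (by omega) v
  generalize hWdef : loopMatrix hn M P J (n - 1) = W at hW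
  have hc : cValue hn P W = base M P J := by rw [cValue, testDet_lst hn hW]; rfl
  have he := substExponent_ne_zero hn ha h0 (hL.base_spec (hn := hn)).1
  have hpt : ¬ (P : ℤ) ∣ point hn a M P J := fun h => hL.base_spec.2
    ((Nat.prime_iff_prime_int.1 hL.p_spec.1.1).dvd_of_dvd_pow h)
  obtain ⟨hcop, hg⟩ := hL.isCoprime hn hM hW he (τ := point hn a M P J) rfl
  have hdet := hL.det_ne_zero hn hW hpt
  obtain ⟨b₁, b₂, h1, h2, h3⟩ := exists_bezout hcop hg
  have hf := adjugate_lst hn hW (point hn a M P J) (fst hn)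
  have hg' := adjugate_lst hn hW (point hn a M P J) (snd hn)
  change _ = (lastCof M P J 0).eval _ at hf
  change _ = (lastCof M P J 1).eval _ at hg'
  refine ⟨⟨P, hL.p_spec, J, hL.J_spec, W, hWdef.symm, W.map (eval (point hn a M P J)),
    by rw [substMatrix, hc]; rfl, hdet, b₁, b₂, by rw [hf, hg', h1], fun b₁' b₂' h => by
      rw [hf, hg'] at h
      exact abs_le_of_bezout h1 h2 h3 h⟩, rfl, hW, hc, rfl, ?_⟩
  have hlast : ∀ r, lastCof M P J r = cof (poly M P J) n r (n - 1) := fun r => by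
    rw [lastCof, fcof, Nat.sub_add_cancel (by omega)]; rfl
  dsimp only
  exact ⟨det_map_eval hW _ 0, by rw [hf, hlast], by rw [hg', hlast], hdet, by rwa [hg'],
    by rw [hf, hg', h1], by rwa [hg'], by rwa [hg']⟩

theorem Budget.integersBounded (h : Budget hn a M P J b m S β x Z B) (hL : LoopData hn M P J)
    {E : Execution hn a b M} (hp : E.p = P) (hW : ∀ u v : Fin n, E.W u v = poly M P J u v)
    (hc : cValue hn E.p E.W = base M P J) (hM' : E.M' = E.W.map (eval (point hn a M P J)))
    (hb : BezoutData hn a M P J E.M'.det (E.M'.adjugate (lst hn) (fst hn))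
        (E.M'.adjugate (lst hn) (snd hn)) E.b₁ E.b₂) :
    |E.M'.det| ≤ B ∧ E.IntegersBounded B.size := by
  obtain ⟨F, hF, hF1, hFB, hF2, -⟩ := h.bounds hL
  have hcof : ∀ r c, |(cof (poly M P J) n r c).eval (point hn a M P J)| ≤ F := fun r c => by
    rw [hF]; exact h.abs_cof_le hL
  have hD : |E.M'.det| ≤ F := by rw [hb.D_eq]; exact hcof _ _
  have hbF := hb.abs_le hF1 (by rw [hb.f_eq]; exact hcof _ _) (by rw [hb.g_eq]; exact hcof _ _)
  have hx1 := h.one_le_x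
  have ha := lt_of_lt_of_le h.b_pos h.b_le
  have hbase : |base M P J| ≤ B := by
    refine le_trans ?_ h.base_le
    have h1 : (1 : ℤ) ≤ (a : ℤ) ^ 2 := one_le_pow₀ (by omega)
    have h2 : (1 : ℤ) ≤ (2 * m * n) ^ (3 * n) := one_le_pow₀ (by
      have := h.hm
      have := h.one_le_n
      nlinarith)
    exact le_mul_of_one_le_left (abs_nonneg _) (one_le_mul_of_one_le_of_one_le h1 h2)
  have hpoint : |point hn a M P J| ≤ F := by
    have key : ∀ y : ℤ, 1 ≤ y → y ≤ x * y ^ (n + 1) := fun y hy => by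
      have h2 : y ^ 1 ≤ y ^ (n + 1) := pow_le_pow_right₀ hy (by omega)
      rw [pow_one] at h2
      exact h2.trans (le_mul_of_one_le_left (by positivity) hx1)
    rw [hF]
    exact key _ (hL.one_le_abs_point (a := a))
  have hpB : |(E.p : ℤ)| ≤ B := by
    rw [hp, Nat.abs_cast]
    have := h.prime_le
    omega
  have hWB : ∀ i j k, |(E.W i j).coeff k| ≤ B := fun i j k => by
    rw [hW]
    have h1 := (abs_coeff_le_norm1 (poly M P J i j) k).trans
      (hL.norm1_poly_le h.entry_le i i.2 j j.2)
    have h2 := h.β_lt_x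
    have h3 := h.x_lt
    have h4 := h.Z_pow_le (t := 1) (by omega)
    have h5 := h.hβ
    rw [pow_one] at h4
    omega
  have htest : |testDet E.W (lst hn)| ≤ B := by rw [testDet_lst hn hW]; exact h.res_le
  have hM'B : ∀ i j, |E.M' i j| ≤ B := fun i j => by
    rw [hM', Matrix.map_apply, hW]
    refine (h.abs_entry_le hL i.2 j.2).trans ?_
    rw [← hF]; exact hFB
  refine ⟨hD.trans hFB, bitLength_le_of_abs_le hpB, fun i j k => bitLength_le_of_abs_le (hWB i j k),
    bitLength_le_of_abs_le htest, bitLength_le_of_abs_le (by rw [hc]; exact hbase),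
    bitLength_le_of_abs_le (by rw [hc]; exact hpoint.trans hFB),
    fun i j => bitLength_le_of_abs_le (hM'B i j), bitLength_le_of_abs_le (hbF.1.trans hFB),
    bitLength_le_of_abs_le (hbF.2.trans hF2), bitLength_le_of_abs_le (hD.trans hFB)⟩

theorem one_le_entry (hM : M.det ≠ 0) (hle : ∀ i j, |M i j| ≤ M (lst hn) (fst hn)) :
    1 ≤ M (lst hn) (fst hn) := by
  by_contra h
  refine hM ?_
  have h0 : M = 0 := by
    ext i j
    have := hle i j
    have := abs_nonneg (M i j)
    exact abs_eq_zero.1 (by omega)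
  have : Nonempty (Fin n) := ⟨fst hn⟩
  rw [h0, Matrix.det_zero]

end

end LatticeReduction

open LatticeReduction in
theorem theorem2 (t : LatticeReduction.Target) :
    ∃ (P : LatticeReduction.Program) (K : ℝ),
      ∀ (p : ℝ≥0∞), p = 1 ∨ p = 2 ∨ p = ∞ →
      ∀ (n : ℕ) (hn : 2 ≤ n) (a b : ℕ), 0 < b → b ≤ a →
      ∀ (M : Matrix (Fin n) (Fin n) ℤ), M.det ≠ 0 →
        (∀ i j, |M i j| ≤ M (LatticeReduction.lst hn) (LatticeReduction.fst hn)) →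
      ∀ (m : ℝ),
        m = max ((a : ℝ) ^ (1 / (n : ℝ) ^ 3))
          (M (LatticeReduction.lst hn) (LatticeReduction.fst hn) : ℝ) →
      ∀ (O : List ℤ → ℤ),
        ∃ (E : LatticeReduction.Execution hn a b M) (T L : ℕ) (w : List ℤ)
          (s : LatticeReduction.State),
          LatticeReduction.Exec O L P (LatticeReduction.initialState a b M) T [w] s ∧
          E.IsQuery p w t ∧
          (∀ i : Fin n, (s.mem i.val : ℚ) = E.output (O w) i) ∧
          (T : ℝ) ≤ K * ((n : ℝ) ^ 4 * Real.log (m * n)) ∧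
          (L : ℝ) ≤ K * ((n : ℝ) ^ 4 * Real.log (m * n)) ∧
          E.IntegersBounded L ∧
          (E.IsReply p (O w) t → LatticeReduction.bitLength (O w) ≤ L) := by
  refine ⟨reduction t, 10 ^ 13, fun p _ n hn a b hb hba M hM hle μ hμ O => ?_⟩
  have hm1 := one_le_entry hM hle
  have ha : 0 < a := by omega
  obtain ⟨P, J, hL⟩ := exists_loopData hn hM (by omega)
  obtain ⟨E, hp, hW, hc, hM', hbz⟩ := exists_execution b hL hM ha (by omega)
  obtain ⟨κ, hκ⟩ : ∃ κ, κ = 10 ^ 7 := ⟨_, rfl⟩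
  obtain ⟨S, β, x, Z, B, hbud, hB⟩ := exists_budget hL hM rfl hm1 hle hb hba hκ
  have hB1 : 1 ≤ B := le_trans (by norm_num) hbud.hB
  have hcofs : ∀ i r : Fin n, E.M'.adjugate i r =
      (cof (poly M P J) n r i).eval (point hn a M P J) := fun i r => by
    rw [hM', adjugate_map_eval hW]
  have hvec : ∀ i : Fin n, numerator E.M' E.bVec i =
      queryVec hn a M P J E.M'.det E.b₁ E.b₂ i := fun i => by
    rw [E.numerator_eq, queryVec, hcofs, hcofs]; rfl
  obtain ⟨T, hT, s, hx, hs⟩ := exec_reduction O hbud hM hL hbz t rfl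
  have hlist : (List.ofFn fun u : Fin n => queryVec hn a M P J E.M'.det E.b₁ E.b₂ u) =
      List.ofFn (numerator E.M' E.bVec) := by
    congr 1; funext u; exact (hvec u).symm
  rw [hlist] at hx hs
  have hD0 : 0 < |((M (lst hn) (fst hn) * M.det : ℤ) : ℝ)| :=
    abs_pos.2 (by exact_mod_cast mul_ne_zero (by omega) hM)
  have hcost := cost_bounds hn ha hm1 (μ := μ) (hμ ▸ le_max_right _ _) (hμ ▸ le_max_left _ _) hκ hB1
    hB hD0 (hL.prime_le_log hM rfl hm1) (by
      rw [← Int.cast_abs]; exact_mod_cast abs_mul_det_le hn hm1 hle) hT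
  obtain ⟨hDB, hint⟩ := hbud.integersBounded hL hp hW hc hM' hbz
  have hsize : B.size ≤ (B ^ 8).size := Nat.size_le_size (Nat.le_self_pow (by norm_num) B)
  refine ⟨E, T, (B ^ 8).size, _, s, hx, E.isQuery ha hb p t, fun i => ?_, hcost.1, hcost.2, ?_,
    fun h => (bitLength_le_of_abs_le ((E.abs_reply_le ha hb h).trans hDB)).trans hsize⟩
  · rw [hs i i.2, Execution.output, Execution.x, ← output_eq E.M'_det, Finset.sum_range]
    congr 3
    funext j
    rw [hvec, hM', Matrix.map_apply, hW]
  · obtain ⟨h1, h2, h3, h4, h5, h6, h7, h8, h9⟩ := hint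
    exact ⟨h1.trans hsize, fun i j k => (h2 i j k).trans hsize, h3.trans hsize, h4.trans hsize,
      h5.trans hsize, fun i j => (h6 i j).trans hsize, h7.trans hsize, h8.trans hsize,
      h9.trans hsize⟩
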